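/- Let $\mathbf D$ be a small $\infty$-category (a quasicategory) which admits colimits of countable filtered systems, i.e. of functors $I\to\mathbf D$ where $I$ is a countable filtered $\infty$-category. Write $[B,C]=\pi_0\operatorname{Map}_{\mathbf D}(B,C)$ for the morphism sets of the homotopy category $\mathrm{ho}\,\mathbf D$. *Compactly assembled.* Let $\operatorname{Ind}^{\aleph_1}(\mathbf D)$ be the closure of the image of the Yoneda embedding $y$ in $\operatorname{Ind}(\mathbf D)$ under countable filtered colimits, let $y:\mathbf D\to\operatorname{Ind}^{\aleph_1}(\mathbf D)$ be the resulting functor, and let the realization $|-|:\operatorname{Ind}^{\aleph_1}(\mathbf D)\to\mathbf D$ be its left adjoint. An object $A$ of $\mathbf D$ admits a shape if the functor $\operatorname{Map}_{\mathbf D}(A,|-|)$ on $\operatorname{Ind}^{\aleph_1}(\mathbf D)$ is corepresentable. $\mathbf D$ is compactly assembled if every object of $\mathbf D$ admits a shape. *Shape topology.* A morphism $f:A\to B$ of $\mathrm{ho}\,\mathbf D$ is weakly compact if for every countable filtered system $(Z_i)_{i\in I}$ in $\mathbf D$ and every $b:B\to\operatorname{colim}_i Z_i$ there are an object $k$ of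 $I$ and a morphism $a:A\to Z_k$ such that $b\circ f$ is the composition of $a$ with the canonical map $Z_k\to\operatorname{colim}_iZ_i$. The shape topology on $[B,C]$ is the coarsest topology such that the precomposition map $[B,C]\to[A,C]$ is continuous for every weakly compact $A\to B$, where $[A,C]$ carries the discrete topology. Let $\overline{[B,C]}$ denote the Hausdorff quotient of $[B,C]$ with the shape topology. Composition descends to these quotients, so that we have a category $\bar{\mathbf D}$ with the same objects as $\mathbf D$ and the morphism spaces $\operatorname{Hom}_{\bar{\mathbf D}}(B,C)=\overline{[B,C]}$, and a canonical functor $\overline{\mathrm{ho}}:\mathbf D\to\mathrm{ho}\,\mathbf D\to\bar{\mathbf D}$. **Proposition.** If $\mathbf D$ is stable and compactly assembled, then $\overline{\mathrm{ho}}:\mathbf D\to\bar{\mathbf D}$ is conservative: a morphism $f:B\to C$ of $\mathbf D$ whose image in $\bar{\mathbf D}$ is an isomorphism is an equivalence. -/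

import Mathlib

open CategoryTheory MonoidalCategory Simplicial Opposite SSet

universe u

namespace InfCat

/-! ### Homotopy categories, functor complexes, fibres, comma objects -/

/-- The homotopy category `ho(X)` of a simplicial set. Its objects are the vertices of `X`; if `X`
is a quasicategory, the morphisms from `x` to `y` are the homotopy classes `[x, y]` of edges. -/
abbrev Ho (X : SSet.{u}) : Type u := ((truncation 2).obj X).HomotopyCategory

/-- A vertex, seen as an object of the homotopy category. -/
abbrev Ho.mk {X : SSet.{u}} (x : X _⦋0⦌) : Ho X := Truncated.HomotopyCategory.mk x

/-- The class of an edge in the homotopy category. -/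
abbrev Ho.homMk {X : SSet.{u}} {x y : X _⦋0⦌} (e : X.Edge x y) : Ho.mk x ⟶ Ho.mk y :=
  Truncated.HomotopyCategory.homMk e.toTruncated

/-- A morphism of a quasicategory is an equivalence if its class in the homotopy category is
an isomorphism. -/
def IsEquivalence {X : SSet.{u}} {x y : X _⦋0⦌} (e : X.Edge x y) : Prop := IsIso (Ho.homMk e)

/-- The simplicial set `Fun(K, X)`. -/
noncomputable abbrev Fun (K X : SSet.{u}) : SSet.{u} := (ihom K).obj X

/-- A map `K ⟶ X`, seen as a vertex of `Fun(K, X)`. -/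
noncomputable def vertex {K X : SSet.{u}} (p : K ⟶ X) : (Fun K X) _⦋0⦌ :=
  unitHomEquiv _ (MonoidalClosed.curry' p)

/-- Evaluation at a vertex `Fun(K, X) ⟶ X`. -/
noncomputable def evalAt {K : SSet.{u}} (k : K _⦋0⦌) (X : SSet.{u}) : Fun K X ⟶ X :=
  CartesianMonoidalCategory.lift (SSet.const k) (𝟙 _) ≫ (ihom.ev K).app X

/-- The diagonal `X ⟶ Fun(K, X)`. -/
noncomputable def constFun (K X : SSet.{u}) : X ⟶ Fun K X :=
  MonoidalClosed.curry (SemiCartesianMonoidalCategory.snd K X)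

/-- Restriction `Fun(L, X) ⟶ Fun(K, X)` along a map `K ⟶ L`. -/
noncomputable def restrict {K L : SSet.{u}} (i : K ⟶ L) (X : SSet.{u}) : Fun L X ⟶ Fun K X :=
  (MonoidalClosed.pre i).app X

/-- The vertex `0` of `Δ[1]`. -/
abbrev v0 : (Δ[1] : SSet.{u}) _⦋0⦌ := stdSimplex.obj₀Equiv.symm 0

/-- The vertex `1` of `Δ[1]`. -/
abbrev v1 : (Δ[1] : SSet.{u}) _⦋0⦌ := stdSimplex.obj₀Equiv.symm 1

lemma map_const_self (X : SSet.{u}) (x : X _⦋0⦌) :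
    X.map (SimplexCategory.const ⦋0⦌ ⦋0⦌ 0).op x = x := by
  have h : SimplexCategory.const ⦋0⦌ ⦋0⦌ 0 = 𝟙 _ := Subsingleton.elim _ _
  rw [h]
  exact Functor.map_id_apply X _ x

lemma evalAt_vertex {K X : SSet.{u}} (p : K ⟶ X) (k : K _⦋0⦌) :
    (evalAt k X).app _ (vertex p) = p.app _ k := by
  have h : MonoidalClosed.curry' p ≫ evalAt k X =
      CartesianMonoidalCategory.lift (SSet.const k) (𝟙 _) ≫ (ρ_ K).hom ≫ p := by
    rw [← MonoidalClosed.whiskerLeft_curry'_ihom_ev_app]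
    rfl
  refine (congrArg (fun g ↦ unitHomEquiv X g) h).trans ?_
  change p.app _ (K.map (SimplexCategory.const _ _ _).op k) = p.app _ k
  congr 1
  exact map_const_self K k

lemma curry_app {K L X : SSet.{u}} (h : K ⊗ L ⟶ X) (l : L _⦋0⦌) :
    (MonoidalClosed.curry h).app _ l =
      vertex (CartesianMonoidalCategory.lift (𝟙 K) (SSet.const l) ≫ h) := by
  have h' : (unitHomEquiv L).symm l ≫ MonoidalClosed.curry h =
      MonoidalClosed.curry' (CartesianMonoidalCategory.lift (𝟙 K) (SSet.const l) ≫ h) := by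
    rw [← MonoidalClosed.curry_natural_left]
    rfl
  refine Eq.trans ?_ (congrArg (fun g ↦ unitHomEquiv _ g) h')
  change _ = (MonoidalClosed.curry h).app _ (unitHomEquiv L ((unitHomEquiv L).symm l))
  rw [Equiv.apply_symm_apply]

lemma constFun_app (K : SSet.{u}) {X : SSet.{u}} (x : X _⦋0⦌) :
    (constFun K X).app _ x = vertex (SSet.const x) :=
  curry_app _ x

lemma restrict_vertex {K L X : SSet.{u}} (i : K ⟶ L) (p : L ⟶ X) :
    (restrict i X).app _ (vertex p) = vertex (i ≫ p) := by
  have h : MonoidalClosed.curry' p ≫ restrict i X = MonoidalClosed.curry' (i ≫ p) := by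
    simp only [MonoidalClosed.curry', restrict, MonoidalClosed.curry_pre_app]
    rfl
  exact congrArg (fun g ↦ unitHomEquiv _ g) h

lemma evalAt_map {K X Y : SSet.{u}} (k : K _⦋0⦌) (f : X ⟶ Y) {n : SimplexCategoryᵒᵖ}
    (e : (Fun K X).obj n) :
    (evalAt k Y).app n (((ihom K).map f).app n e) = f.app n ((evalAt k X).app n e) := by
  have h : (ihom K).map f ≫ evalAt k Y = evalAt k X ≫ f := by
    dsimp only [evalAt]
    rw [Category.assoc, ← ihom.ev_naturality]
    rfl
  exact congrArg (fun g : Fun K X ⟶ Y ↦ g.app n e) h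

/-- The fibre of a map of simplicial sets over a vertex. -/
def fiber {X Y : SSet.{u}} (f : X ⟶ Y) (y : Y _⦋0⦌) : X.Subcomplex :=
  (Subcomplex.ofSimplex y).preimage f

/-- The comma object `{x} ×_B Fun(Δ[1], B) ×_B A` of a vertex `x` of `B` and a map `G : A ⟶ B`.
Its vertices are the pairs of a vertex `a` of `A` and an edge `x ⟶ G a` of `B`. If `B` is a
quasicategory, its projection to `A` is the left fibration which is classified by the functor
`a ↦ Map_B(x, G a)`. -/
noncomputable def comma {A B : SSet.{u}} (G : A ⟶ B) (x : B _⦋0⦌) :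
    (A ⊗ Fun Δ[1] B).Subcomplex where
  obj n := {z | (evalAt v0 B).app n z.2 ∈ (Subcomplex.ofSimplex x).obj n ∧
    (evalAt v1 B).app n z.2 = G.app n z.1}
  map := by
    rintro m n f ⟨a, e⟩ ⟨h₀, h₁⟩
    dsimp at h₀ h₁
    refine ⟨?_, ?_⟩
    · change (evalAt v0 B).app n ((Fun Δ[1] B).map f e) ∈ _
      rw [NatTrans.naturality_apply]
      exact (Subcomplex.ofSimplex x).map f h₀
    · change (evalAt v1 B).app n ((Fun Δ[1] B).map f e) = G.app n (A.map f a)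
      rw [NatTrans.naturality_apply, NatTrans.naturality_apply, h₁]

/-- The map of comma objects induced by a map of the source of `G`. -/
noncomputable def commaMap {A' A B : SSet.{u}} (f : A' ⟶ A) (G : A ⟶ B) (x : B _⦋0⦌) :
    (comma (f ≫ G) x : SSet.{u}) ⟶ comma G x :=
  Subcomplex.lift ((comma (f ≫ G) x).ι ≫ f ▷ Fun Δ[1] B) (by
    rintro n _ ⟨⟨⟨a, e⟩, h₀, h₁⟩, rfl⟩
    exact ⟨h₀, h₁⟩)

/-- The map of comma objects induced by postcomposition with a map `y : B ⟶ C`. -/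
noncomputable def commaPost {A B C : SSet.{u}} (G : A ⟶ B) (y : B ⟶ C) (x : B _⦋0⦌) :
    (comma G x : SSet.{u}) ⟶ comma (G ≫ y) (y.app _ x) :=
  Subcomplex.lift ((comma G x).ι ≫ A ◁ (ihom Δ[1]).map y) (by
    rintro n _ ⟨⟨⟨a, e⟩, h₀, h₁⟩, rfl⟩
    dsimp at h₀ h₁
    refine ⟨?_, ?_⟩
    · change (evalAt v0 C).app n (((ihom Δ[1]).map y).app n e) ∈ _
      rw [evalAt_map]
      obtain ⟨f, hf⟩ := (Subcomplex.mem_ofSimplex_obj_iff _ _).1 h₀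
      refine (Subcomplex.mem_ofSimplex_obj_iff _ _).2 ⟨f, ?_⟩
      rw [← NatTrans.naturality_apply, hf]
    · change (evalAt v1 C).app n (((ihom Δ[1]).map y).app n e) = y.app n (G.app n a)
      rw [evalAt_map, h₁])

/-- The mapping anima `Map_X(x, y)` of a quasicategory. -/
noncomputable abbrev Map (X : SSet.{u}) (x y : X _⦋0⦌) : SSet.{u} :=
  comma (SSet.const y : Δ[0] ⟶ X) x

/-- A map of simplicial sets is a weak homotopy equivalence if restriction along it induces
bijections of sets of homotopy classes of maps to all Kan complexes. -/
def IsWeakHomotopyEquiv {X Y : SSet.{u}} (f : X ⟶ Y) : Prop :=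
  ∀ (Z : SSet.{u}) [KanComplex Z], Function.Bijective (mapπ₀ (restrict f Z))

/-! ### Initial and terminal vertices, colimits -/

/-- A vertex `v` of a quasicategory is initial if every map `∂Δ[n] ⟶ X`, `n ≥ 1`, with value `v`
at the vertex `0` extends to `Δ[n]`. -/
def IsInitialVertex {X : SSet.{u}} (v : X _⦋0⦌) : Prop :=
  ∀ (n : ℕ) (f : (∂Δ[n + 1] : SSet.{u}) ⟶ X),
    (∀ w : (∂Δ[n + 1] : SSet.{u}) _⦋0⦌, w.1 = stdSimplex.obj₀Equiv.symm 0 → f.app _ w = v) →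
    ∃ g : Δ[n + 1] ⟶ X, ∂Δ[n + 1].ι ≫ g = f

/-- A vertex `v` of a quasicategory is terminal if every map `∂Δ[n] ⟶ X`, `n ≥ 1`, with value `v`
at the vertex `n` extends to `Δ[n]`. -/
def IsTerminalVertex {X : SSet.{u}} (v : X _⦋0⦌) : Prop :=
  ∀ (n : ℕ) (f : (∂Δ[n + 1] : SSet.{u}) ⟶ X),
    (∀ w : (∂Δ[n + 1] : SSet.{u}) _⦋0⦌,
      w.1 = stdSimplex.obj₀Equiv.symm (Fin.last (n + 1)) → f.app _ w = v) →
    ∃ g : Δ[n + 1] ⟶ X, ∂Δ[n + 1].ι ≫ g = f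

/-- A cocone on `p : K ⟶ X`: a natural transformation from `p` to a constant diagram. -/
structure Cocone {K X : SSet.{u}} (p : K ⟶ X) where
  /-- The tip of the cocone. -/
  pt : X _⦋0⦌
  /-- The natural transformation from `p` to the constant diagram. -/
  hom : K ⊗ Δ[1] ⟶ X
  ι₀_hom : ι₀ ≫ hom = p
  ι₁_hom : ι₁ ≫ hom = SSet.const pt

namespace Cocone

variable {K X : SSet.{u}} {p : K ⟶ X} (c : Cocone p)

/-- The structure map `p k ⟶ c.pt` of a cocone. -/
noncomputable def leg (k : K _⦋0⦌) : X.Edge (p.app _ k) c.pt :=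
  Edge.mk (c.hom.app _ (K.σ 0 k, stdSimplex.objEquiv.symm (𝟙 ⦋1⦌)))
    (by
      refine Eq.trans ?_ (congrArg (fun g : K ⟶ X ↦ g.app _ k) c.ι₀_hom)
      refine (NatTrans.naturality_apply c.hom (SimplexCategory.δ (n := 0) 1).op _).symm.trans ?_
      change c.hom.app _ _ = c.hom.app _ _
      congr 1
      refine Prod.ext (SSet.δ_comp_σ_succ_apply (S := K) 0 k) ?_
      exact stdSimplex.obj₀Equiv.injective rfl)
    (by
      refine Eq.trans ?_ ((congrArg (fun g : K ⟶ X ↦ g.app _ k) c.ι₁_hom).trans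
        (map_const_self X c.pt))
      refine (NatTrans.naturality_apply c.hom (SimplexCategory.δ (n := 0) 0).op _).symm.trans ?_
      change c.hom.app _ _ = c.hom.app _ _
      congr 1
      refine Prod.ext (SSet.δ_comp_σ_self_apply (S := K) 0 k) ?_
      exact stdSimplex.obj₀Equiv.injective rfl)

/-- A cocone, seen as a vertex of the comma object of `p` and the diagonal `X ⟶ Fun(K, X)`. -/
noncomputable def toComma : (comma (constFun K X) (vertex p) : SSet.{u}) _⦋0⦌ :=
  ⟨(c.pt, vertex (MonoidalClosed.curry c.hom)), by
    refine ⟨?_, ?_⟩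
    · change (evalAt v0 _).app _ (vertex (MonoidalClosed.curry c.hom)) ∈ _
      rw [evalAt_vertex, curry_app]
      change vertex (ι₀ ≫ c.hom) ∈ _
      rw [c.ι₀_hom]
      exact Subcomplex.mem_ofSimplex_obj _
    · change (evalAt v1 _).app _ (vertex (MonoidalClosed.curry c.hom)) = (constFun K X).app _ c.pt
      rw [evalAt_vertex, curry_app, constFun_app]
      change vertex (ι₁ ≫ c.hom) = _
      rw [c.ι₁_hom]⟩

/-- A cocone is a colimit cocone if it is initial among the cocones on `p`. -/
def IsColimit : Prop := IsInitialVertex c.toComma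

end Cocone

/-- A countable filtered `∞`-category: a quasicategory with countably many simplices
in which every finite diagram has a cocone. -/
structure IsCountableFiltered (I : SSet.{u}) : Prop where
  quasicategory : Quasicategory I
  countable (n : SimplexCategoryᵒᵖ) : Countable (I.obj n)
  nonempty_cocone (L : SSet.{u}) [L.Finite] (f : L ⟶ I) : Nonempty (Cocone f)

/-- `X` admits colimits of all countable filtered systems. -/
def HasCountableFilteredColimits (X : SSet.{u}) : Prop :=
  ∀ (I : SSet.{u}) (_ : IsCountableFiltered I) (p : I ⟶ X), ∃ c : Cocone p, c.IsColimit

/-! ### Stability -/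

/-- The square `Δ[1] × Δ[1]`. -/
noncomputable abbrev Square : SSet.{u} := Δ[1] ⊗ Δ[1]

/-- The span `(0,1) ← (0,0) → (1,0)` in the square. -/
noncomputable def span : (Square.{u}).Subcomplex :=
  (Subcomplex.ofSimplex v0).unionProd (Subcomplex.ofSimplex v0)

/-- The cospan `(0,1) → (1,1) ← (1,0)` in the square. -/
noncomputable def cospan : (Square.{u}).Subcomplex :=
  (Subcomplex.ofSimplex v1).unionProd (Subcomplex.ofSimplex v1)

/-- A map `L ⟶ X`, seen as a vertex of the simplicial set of all extensions to `L` of its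
restriction to a subcomplex `K` of `L`. -/
noncomputable def extVertex {L X : SSet.{u}} (K : L.Subcomplex) (σ : L ⟶ X) :
    (fiber (restrict K.ι X) (vertex (K.ι ≫ σ)) : SSet.{u}) _⦋0⦌ :=
  ⟨vertex σ, by
    change (restrict K.ι X).app _ (vertex σ) ∈ (Subcomplex.ofSimplex (vertex (K.ι ≫ σ))).obj _
    rw [restrict_vertex]
    exact Subcomplex.mem_ofSimplex_obj _⟩

/-- A square is a pushout square if it is initial among the extensions of the underlying span. -/
def IsPushout {X : SSet.{u}} (σ : Square ⟶ X) : Prop := IsInitialVertex (extVertex span σ)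

/-- A square is a pullback square if it is terminal among the extensions of the underlying
cospan. -/
def IsPullback {X : SSet.{u}} (σ : Square ⟶ X) : Prop := IsTerminalVertex (extVertex cospan σ)

/-- A quasicategory is stable if it is pointed, has pushouts and pullbacks, and the pushout
squares in it are exactly the pullback squares. -/
structure IsStable (X : SSet.{u}) : Prop where
  exists_zero : ∃ z : X _⦋0⦌, IsInitialVertex z ∧ IsTerminalVertex z
  exists_pushout (p : (span : SSet.{u}) ⟶ X) : ∃ σ : Square ⟶ X, span.ι ≫ σ = p ∧ IsPushout σ
  exists_pullback (p : (cospan : SSet.{u}) ⟶ X) :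
    ∃ σ : Square ⟶ X, cospan.ι ≫ σ = p ∧ IsPullback σ
  isPushout_iff (σ : Square ⟶ X) : IsPushout σ ↔ IsPullback σ

/-! ### Compactly assembled `∞`-categories -/

/-- An object `a` is compact (for countable filtered systems) if, for every countable filtered
system `p : I ⟶ X` with colimit cocone `c`, the map `colim_i Map(a, p i) → Map(a, c.pt)` is an
equivalence. The left fibration over `I × Δ[1]` classified by `Map(a, c.hom -)` has total space
`comma c.hom a`, which is weakly equivalent to its restriction `I × Map(a, c.pt)` to `I × {1}` and
hence to `Map(a, c.pt)` since `I` is weakly contractible, and its restriction to `I × {0}` has the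
weak homotopy type of `colim_i Map(a, p i)`. -/
def IsCompactObject {X : SSet.{u}} (a : X _⦋0⦌) : Prop :=
  ∀ (I : SSet.{u}) (_ : IsCountableFiltered I) (p : I ⟶ X) (c : Cocone p), c.IsColimit →
    IsWeakHomotopyEquiv (commaMap ι₀ c.hom a)

/-- A functor is fully faithful if it induces equivalences of mapping anima. -/
def IsFullyFaithful {X Y : SSet.{u}} (F : X ⟶ Y) : Prop :=
  ∀ x x' : X _⦋0⦌, IsWeakHomotopyEquiv (commaPost (SSet.const x' : Δ[0] ⟶ X) F x)

/-- `y : X ⟶ C` exhibits `C` as `Ind^{ℵ₁}(X)`, the closure of the representables in `Ind(X)` under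
countable filtered colimits. This determines `C` up to equivalence under `X`: it says
that `C` admits countable filtered colimits, that `y` is fully faithful with compact values, and
that every object of `C` is the colimit of a countable filtered system of objects of `X`. -/
structure IsCountableIndCompletion {X C : SSet.{u}} (y : X ⟶ C) : Prop where
  quasicategory : Quasicategory C
  hasColimits : HasCountableFilteredColimits C
  fullyFaithful : IsFullyFaithful y
  compact (x : X _⦋0⦌) : IsCompactObject (y.app _ x)
  exists_system (Z : C _⦋0⦌) : ∃ (I : SSet.{u}) (_ : IsCountableFiltered I) (p : I ⟶ X)
    (c : Cocone (p ≫ y)), c.IsColimit ∧ c.pt = Z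

/-- The component at a vertex of a natural transformation `h : B × Δ[1] ⟶ B` from the identity
to `F ≫ G`, as a vertex of the comma object of `b` and `G`. -/
noncomputable def unitComponent {A B : SSet.{u}} {F : B ⟶ A} {G : A ⟶ B} (h : B ⊗ Δ[1] ⟶ B)
    (h₀ : ι₀ ≫ h = 𝟙 B) (h₁ : ι₁ ≫ h = F ≫ G) (b : B _⦋0⦌) : (comma G b : SSet.{u}) _⦋0⦌ :=
  ⟨(F.app _ b, vertex (CartesianMonoidalCategory.lift (SSet.const b) (𝟙 _) ≫ h)), by
    have key (i : (Δ[1] : SSet.{u}) _⦋0⦌) :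
        (CartesianMonoidalCategory.lift (SSet.const b) (𝟙 _) ≫ h).app _ i =
          (CartesianMonoidalCategory.lift (𝟙 B) (SSet.const i) ≫ h).app _ b := by
      change h.app _ (B.map (SimplexCategory.const _ _ _).op b, i) =
        h.app _ (b, (Δ[1] : SSet.{u}).map (SimplexCategory.const _ _ _).op i)
      congr 1
      exact Prod.ext (map_const_self B b)
        (map_const_self (Δ[1] : SSet.{u}) i).symm
    refine ⟨?_, ?_⟩
    · change (evalAt v0 B).app _ (vertex _) ∈ _
      rw [evalAt_vertex, key]
      change (ι₀ ≫ h).app _ b ∈ _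
      rw [h₀]
      exact Subcomplex.mem_ofSimplex_obj _
    · change (evalAt v1 B).app _ (vertex _) = (F ≫ G).app _ b
      rw [evalAt_vertex, key]
      change (ι₁ ≫ h).app _ b = _
      rw [h₁]⟩

/-- `F` is left adjoint to `G`: there is a unit transformation `h : id ⟶ F ≫ G` such that
for every `b` the edge `b ⟶ G (F b)` is a universal arrow from `b` to `G`, i.e. it
induces equivalences `Map_A(F b, a) ≃ Map_B(b, G a)`. -/
def IsLeftAdjoint {A B : SSet.{u}} (F : B ⟶ A) (G : A ⟶ B) : Prop :=
  ∃ (h : B ⊗ Δ[1] ⟶ B) (h₀ : ι₀ ≫ h = 𝟙 B) (h₁ : ι₁ ≫ h = F ≫ G),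
    ∀ b : B _⦋0⦌, IsInitialVertex (unitComponent h h₀ h₁ b)

/-- For a realization functor `R = |-| : Ind^{ℵ₁}(X) ⟶ X`, the object `a` of `X` admits a shape:
the functor `Map_X(a, |-|)` is corepresentable, by an object `S` and a map `a ⟶ |S|`. -/
def AdmitsShape {C X : SSet.{u}} (R : C ⟶ X) (a : X _⦋0⦌) : Prop :=
  ∃ s : (comma R a : SSet.{u}) _⦋0⦌, IsInitialVertex s

/-- `X` is compactly assembled: it admits countable filtered colimits, and every object
of `X` admits a shape, where the realization `R` is the left adjoint of `y : X ⟶ Ind^{ℵ₁}(X)`. -/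
def IsCompactlyAssembled (X : SSet.{u}) : Prop :=
  HasCountableFilteredColimits X ∧
    ∃ (C : SSet.{u}) (y : X ⟶ C) (R : C ⟶ X),
      IsCountableIndCompletion y ∧ IsLeftAdjoint R y ∧ ∀ a : X _⦋0⦌, AdmitsShape R a

/-! ### The shape topology and the category of Hausdorff quotients -/

/-- A map `f : A ⟶ B` is weakly compact if for every countable filtered system with colimit `c`
and every map `b : B ⟶ c` the composition `f ≫ b` factors over some member of the system. -/
def IsWeaklyCompact {X : SSet.{u}} {A B : Ho X} (f : A ⟶ B) : Prop :=
  ∀ (I : SSet.{u}) (_ : IsCountableFiltered I) (p : I ⟶ X) (c : Cocone p), c.IsColimit →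
    ∀ b : B ⟶ Ho.mk c.pt, ∃ (i : I _⦋0⦌) (a : A ⟶ Ho.mk (p.app _ i)),
      a ≫ Ho.homMk (c.leg i) = f ≫ b

lemma IsWeaklyCompact.comp_right {X : SSet.{u}} {A B C : Ho X} {f : A ⟶ B}
    (hf : IsWeaklyCompact f) (g : B ⟶ C) : IsWeaklyCompact (f ≫ g) := by
  intro I hI p c hc b
  obtain ⟨i, a, ha⟩ := hf I hI p c hc (g ≫ b)
  exact ⟨i, a, by simpa using ha⟩

/-- The shape topology on `[B, C]`: the coarsest topology for which `[B, C] → [A, C]` is continuous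
for all weakly compact `A ⟶ B`, where `[A, C]` is discrete. -/
@[reducible] def shapeTopology {X : SSet.{u}} (B C : Ho X) : TopologicalSpace (B ⟶ C) :=
  ⨅ (A : Ho X) (f : A ⟶ B) (_ : IsWeaklyCompact f),
    TopologicalSpace.induced (fun g : B ⟶ C ↦ f ≫ g) ⊥

/-- The Hausdorff quotient of `[B, C]` with the shape topology. -/
def HausdorffHom {X : SSet.{u}} (B C : Ho X) : Type u :=
  @T2Quotient (B ⟶ C) (shapeTopology B C)

instance {X : SSet.{u}} (B C : Ho X) : TopologicalSpace (HausdorffHom B C) :=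
  @T2Quotient.instTopologicalSpace (B ⟶ C) (shapeTopology B C)

/-- The class of a morphism in the Hausdorff quotient. -/
def HausdorffHom.mk {X : SSet.{u}} {B C : Ho X} (g : B ⟶ C) : HausdorffHom B C :=
  @T2Quotient.mk (B ⟶ C) (shapeTopology B C) g

lemma HausdorffHom.mk_surjective {X : SSet.{u}} {B C : Ho X} :
    Function.Surjective (HausdorffHom.mk (B := B) (C := C)) :=
  @T2Quotient.surjective_mk (B ⟶ C) (shapeTopology B C)

/-- Two morphisms agree in the Hausdorff quotient iff they agree on all weakly compact maps. -/
lemma HausdorffHom.mk_eq_mk_iff {X : SSet.{u}} {B C : Ho X} (g g' : B ⟶ C) :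
    HausdorffHom.mk g = HausdorffHom.mk g' ↔
      ∀ (A : Ho X) (f : A ⟶ B), IsWeaklyCompact f → f ≫ g = f ≫ g' := by
  let := shapeTopology B C
  constructor
  · intro h A f hf
    let : TopologicalSpace (A ⟶ C) := ⊥
    have : DiscreteTopology (A ⟶ C) := ⟨rfl⟩
    have hc : Continuous (fun g : B ⟶ C ↦ f ≫ g) := by
      rw [continuous_iff_le_induced]
      exact iInf_le_of_le A (iInf_le_of_le f (iInf_le_of_le hf le_rfl))
    exact T2Quotient.compatible hc _ _ (Quotient.exact h)
  · intro h
    have hi : Inseparable g g' := by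
      rw [Inseparable, nhds_iInf, nhds_iInf]
      refine iInf_congr fun A ↦ ?_
      rw [nhds_iInf, nhds_iInf]
      refine iInf_congr fun f ↦ ?_
      rw [nhds_iInf, nhds_iInf]
      refine iInf_congr fun hf ↦ ?_
      rw [@nhds_induced _ _ ⊥, @nhds_induced _ _ ⊥, h A f hf]
    exact (hi.map (T2Quotient.continuous_mk (B ⟶ C))).eq

/-- The composition of Hausdorff quotients. -/
def HausdorffHom.comp {X : SSet.{u}} {A B C : Ho X} :
    HausdorffHom A B → HausdorffHom B C → HausdorffHom A C :=
  Quotient.lift₂ (s₁ := @t2Setoid _ (shapeTopology A B)) (s₂ := @t2Setoid _ (shapeTopology B C))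
    (fun f g ↦ HausdorffHom.mk (f ≫ g)) (by
      intro f g f' g' hf hg
      replace hf := (HausdorffHom.mk_eq_mk_iff f f').1 (Quotient.sound hf)
      replace hg := (HausdorffHom.mk_eq_mk_iff g g').1 (Quotient.sound hg)
      rw [HausdorffHom.mk_eq_mk_iff]
      intro W w hw
      rw [← Category.assoc, hg W _ (hw.comp_right f), Category.assoc, ← Category.assoc,
        hf W w hw, Category.assoc])

/-- The category `X̄`: it has the objects of `ho(X)`, and its morphism spaces are the Hausdorff
quotients of the morphism sets of `ho(X)` with the shape topology. -/
structure HausdorffCat (X : SSet.{u}) where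
  /-- The underlying object of the homotopy category. -/
  obj : Ho X

instance (X : SSet.{u}) : Category.{u} (HausdorffCat X) where
  Hom B C := HausdorffHom B.obj C.obj
  id B := HausdorffHom.mk (𝟙 B.obj)
  comp := HausdorffHom.comp
  id_comp f := by
    obtain ⟨f, rfl⟩ := HausdorffHom.mk_surjective f
    exact congrArg HausdorffHom.mk (Category.id_comp f)
  comp_id f := by
    obtain ⟨f, rfl⟩ := HausdorffHom.mk_surjective f
    exact congrArg HausdorffHom.mk (Category.comp_id f)
  assoc f g h := by
    obtain ⟨f, rfl⟩ := HausdorffHom.mk_surjective f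
    obtain ⟨g, rfl⟩ := HausdorffHom.mk_surjective g
    obtain ⟨h, rfl⟩ := HausdorffHom.mk_surjective h
    exact congrArg HausdorffHom.mk (Category.assoc f g h)

instance {X : SSet.{u}} (B C : HausdorffCat X) : TopologicalSpace (B ⟶ C) :=
  instTopologicalSpaceHausdorffHom B.obj C.obj

/-- The functor `ho(X) ⥤ X̄`. -/
def toHausdorffCat (X : SSet.{u}) : Ho X ⥤ HausdorffCat X where
  obj B := ⟨B⟩
  map f := HausdorffHom.mk f
  map_id _ := rfl
  map_comp _ _ := rfl

end InfCat

namespace InfCat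

/-! ### Arrows of homotopy categories -/

/-! By `HausdorffHom.mk_eq_mk_iff`, two maps agree in $\bar{\mathbf D}$ iff they agree after
precomposition with all weakly compact maps. An inverse of `f : B ⟶ C` in $\bar{\mathbf D}$ is thus
a map `g` with `w ≫ f ≫ g = w` and `w ≫ g ≫ f = w` for all weakly compact `w`. Such a quasi-inverse
has to be turned into an inverse.

Stability. Let $B\to C\to Q\to\Sigma B$ be the cofibre sequence of `f` and `w : A ⟶ Q` weakly
compact. The composite $A\to Q\to\Sigma B$ is the suspension of a map $x:\Omega A\to B$, which is
weakly compact (`IsStable.isWeaklyCompact_of_suspension`). Since `x ≫ f = 0`, also `x = x ≫ f ≫ g =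
0`, so that `w` lifts to `v : A ⟶ C` (`IsStable.exists_lift_of_isWeaklyCompact`). The lift need not
be weakly compact, but `u ≫ v` is for weakly compact `u`. Hence `u ≫ v = (u ≫ v) ≫ g ≫ f`, and this
vanishes in $Q$: every composite of two weakly compact maps ending at $Q$ is null. If this forces
$Q=0$, then `f` has a section `r`. As `f` is in turn a quasi-inverse of `r`, the same argument for
`r` shows that `f` is invertible (`IsStable.isIso_of_isIso_hausdorff`).

Compact assembly. It remains to see that an object $Q$ with this vanishing property is zero
(`IsCompactlyAssembled.isZero_of_isNull`). Its shape is $x=\operatorname{colim}_i y(P_i)$, and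
$Q\cong|x|$ because $y$ is fully faithful (`IsShape.isIso`). A map from a representable to a shape
realizes to a weakly compact map (`IsShape.isWeaklyCompact`). Shapes can be chosen coherently along
a system (`exists_shape_colimit`), whence each $y(P_i)\to x$ factors over the shape of some $P_k$.
Its realization is then a composite of two weakly compact maps, so it is null. The universal
property of shapes and the compactness of representables upgrade this: each $P_i$ has a null
transition map to some $P_m$ (`exists_null_system`).

A countable filtered system with such transition maps has colimit zero
(`Cocone.IsHoColimit.isZero_pt`). This is not a pointwise statement, since the colimit cocone has to
factor over the constant system zero as a coherent transformation. Among the arrows to the tip, an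
arrow from a zero object is initial, and the transition maps factor over such arrows. On a finite
piece of the index category every cocone in the index category induces the same homotopy class of
transformations to this arrow. The classes on an exhausting sequence of finite pieces are compatible
and are represented by one transformation (`exists_transformation_to_const`); this uses
countability.

Technique. Everything is reduced to morphism sets of homotopy categories of functor complexes. The
central notion is `IsLoc`, a vertex which is initial or terminal relative to a map. Universal
arrows, pushouts and pullbacks have this property (`isLoc_of_isInitialVertex_comma`,
`isLoc_of_extVertex`), which is deduced from explicit inner anodyne extensions in the nerve of the
poset `Thick`. It yields bijections of morphism sets (`push_bijective_of_isLoc`) and lifts along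
monomorphisms (`exists_lift_of_isLoc`). -/

lemma exists_triangle {X : SSet.{u}} [Quasicategory X] {s t : X _⦋1⦌} (h : X.δ 0 s = X.δ 1 t) :
    ∃ r : X _⦋2⦌, X.δ 2 r = s ∧ X.δ 0 r = t := by
  have sq : stdSimplex.δ 0 ≫ yonedaEquiv.symm s = stdSimplex.δ 1 ≫ yonedaEquiv.symm t := by
    apply yonedaEquiv.injective
    rw [stdSimplex.yonedaEquiv_δ_comp, stdSimplex.yonedaEquiv_δ_comp]
    simpa using h
  obtain ⟨σ, hσ⟩ := Quasicategory.hornFilling (S := X) (n := 2) (i := 1) (by decide) (by decide)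
    (horn₂₁.isPushout.desc _ _ sq)
  refine ⟨yonedaEquiv σ, ?_, ?_⟩
  · rw [← stdSimplex.yonedaEquiv_δ_comp, ← horn.ι_ι (1 : Fin 3) 2 (by simp), Category.assoc, ← hσ,
      horn₂₁.isPushout.inl_desc]
    simp
  · rw [← stdSimplex.yonedaEquiv_δ_comp, ← horn.ι_ι (1 : Fin 3) 0 (by simp), Category.assoc, ← hσ,
      horn₂₁.isPushout.inr_desc]
    simp

lemma exists_tetrahedron₁ {X : SSet.{u}} [Quasicategory X] {f₀ f₂ f₃ : X _⦋2⦌}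
    (h₁₂ : X.δ 2 f₀ = X.δ 0 f₃) (h₁₃ : X.δ 1 f₀ = X.δ 0 f₂) (h₂₃ : X.δ 2 f₂ = X.δ 2 f₃) :
    ∃ r : X _⦋3⦌, X.δ 0 r = f₀ ∧ X.δ 2 r = f₂ ∧ X.δ 3 r = f₃ := by
  have key (i j : Fin 3) (a b : X _⦋2⦌) (h : X.δ i a = X.δ j b) :
      stdSimplex.δ i ≫ yonedaEquiv.symm a = stdSimplex.δ j ≫ yonedaEquiv.symm b := by
    apply yonedaEquiv.injective
    rw [stdSimplex.yonedaEquiv_δ_comp, stdSimplex.yonedaEquiv_δ_comp]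
    simpa using h
  obtain ⟨φ, h0, h2, h3⟩ := horn₃₁.exists_desc (yonedaEquiv.symm f₀) (yonedaEquiv.symm f₂)
    (yonedaEquiv.symm f₃) (key _ _ _ _ h₁₂) (key _ _ _ _ h₁₃) (key _ _ _ _ h₂₃)
  obtain ⟨σ, hσ⟩ := Quasicategory.hornFilling (S := X) (n := 3) (i := 1) (by decide) (by decide) φ
  refine ⟨yonedaEquiv σ, ?_, ?_, ?_⟩
  · rw [← stdSimplex.yonedaEquiv_δ_comp, ← horn.ι_ι (1 : Fin 4) 0 (by simp), Category.assoc, ← hσ,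
      h0]
    simp
  · rw [← stdSimplex.yonedaEquiv_δ_comp, ← horn.ι_ι (1 : Fin 4) 2 (by simp), Category.assoc, ← hσ,
      h2]
    simp
  · rw [← stdSimplex.yonedaEquiv_δ_comp, ← horn.ι_ι (1 : Fin 4) 3 (by simp), Category.assoc, ← hσ,
      h3]
    simp

lemma exists_tetrahedron₂ {X : SSet.{u}} [Quasicategory X] {f₀ f₁ f₃ : X _⦋2⦌}
    (h₀₂ : X.δ 2 f₁ = X.δ 1 f₃) (h₁₂ : X.δ 2 f₀ = X.δ 0 f₃) (h₂₃ : X.δ 0 f₀ = X.δ 0 f₁) :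
    ∃ r : X _⦋3⦌, X.δ 0 r = f₀ ∧ X.δ 1 r = f₁ ∧ X.δ 3 r = f₃ := by
  have key (i j : Fin 3) (a b : X _⦋2⦌) (h : X.δ i a = X.δ j b) :
      stdSimplex.δ i ≫ yonedaEquiv.symm a = stdSimplex.δ j ≫ yonedaEquiv.symm b := by
    apply yonedaEquiv.injective
    rw [stdSimplex.yonedaEquiv_δ_comp, stdSimplex.yonedaEquiv_δ_comp]
    simpa using h
  obtain ⟨φ, h0, h1, h3⟩ := horn₃₂.exists_desc (yonedaEquiv.symm f₀) (yonedaEquiv.symm f₁)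
    (yonedaEquiv.symm f₃) (key _ _ _ _ h₀₂) (key _ _ _ _ h₁₂) (key _ _ _ _ h₂₃)
  obtain ⟨σ, hσ⟩ := Quasicategory.hornFilling (S := X) (n := 3) (i := 2) (by decide) (by decide) φ
  refine ⟨yonedaEquiv σ, ?_, ?_, ?_⟩
  · rw [← stdSimplex.yonedaEquiv_δ_comp, ← horn.ι_ι (2 : Fin 4) 0 (by simp), Category.assoc, ← hσ,
      h0]
    simp
  · rw [← stdSimplex.yonedaEquiv_δ_comp, ← horn.ι_ι (2 : Fin 4) 1 (by simp), Category.assoc, ← hσ,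
      h1]
    simp
  · rw [← stdSimplex.yonedaEquiv_δ_comp, ← horn.ι_ι (2 : Fin 4) 3 (by simp), Category.assoc, ← hσ,
      h3]
    simp

lemma δδ {X : SSet.{u}} {n : ℕ} (r : X _⦋n + 2⦌) {i j : Fin (n + 2)} (h : i ≤ j) :
    X.δ i (X.δ j.succ r) = X.δ j (X.δ i.castSucc r) :=
  SSet.δ_comp_δ_apply h r

/-- This gives access to the model `HomotopyCategory₂`, in which an equation between edges is always
witnessed by a single triangle. The required fillers come from the inner horns of dimension two and
three. -/
instance quasicategory₂_truncation (X : SSet.{u}) [Quasicategory X] :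
    Truncated.Quasicategory₂ ((truncation 2).obj X) where
  fill21 e₀₁ e₁₂ := by
    let a := Edge.ofTruncated e₀₁
    let b := Edge.ofTruncated e₁₂
    obtain ⟨r, h2, h0⟩ := exists_triangle (s := a.edge) (t := b.edge)
      (a.tgt_eq.trans b.src_eq.symm)
    let c := Edge.mk (X.δ 1 r)
      ((δδ r (i := 1) (j := 1) le_rfl).symm.trans ((congrArg (X.δ 1) h2).trans a.src_eq))
      ((δδ r (i := 0) (j := 0) le_rfl).trans ((congrArg (X.δ 0) h0).trans b.tgt_eq))
    exact ⟨⟨c.toTruncated, (Edge.CompStruct.mk (e₀₁ := a) (e₁₂ := b) (e₀₂ := c) r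
      h2 h0 rfl).toTruncated⟩⟩
  fill31 {x₀ x₁ x₂ x₃ e₀₁ e₁₂ e₂₃ e₀₂ e₁₃ e₀₃} f₃ f₀ f₂ := by
    let g₃ := Edge.CompStruct.ofTruncated (e₀₁ := Edge.ofTruncated e₀₁)
      (e₁₂ := Edge.ofTruncated e₁₂) (e₀₂ := Edge.ofTruncated e₀₂) f₃
    let g₀ := Edge.CompStruct.ofTruncated (e₀₁ := Edge.ofTruncated e₁₂)
      (e₁₂ := Edge.ofTruncated e₂₃) (e₀₂ := Edge.ofTruncated e₁₃) f₀
    let g₂ := Edge.CompStruct.ofTruncated (e₀₁ := Edge.ofTruncated e₀₁)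
      (e₁₂ := Edge.ofTruncated e₁₃) (e₀₂ := Edge.ofTruncated e₀₃) f₂
    obtain ⟨r, h0, h2, h3⟩ := exists_tetrahedron₁ (f₀ := g₀.simplex) (f₂ := g₂.simplex)
      (f₃ := g₃.simplex) (g₀.d₂.trans g₃.d₀.symm) (g₀.d₁.trans g₂.d₀.symm)
      (g₂.d₂.trans g₃.d₂.symm)
    exact ⟨(Edge.CompStruct.mk (e₀₁ := Edge.ofTruncated e₀₂)
      (e₁₂ := Edge.ofTruncated e₂₃) (e₀₂ := Edge.ofTruncated e₀₃) (X.δ 1 r)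
      ((δδ r (i := 1) (j := 2) (by decide)).symm.trans ((congrArg (X.δ 1) h3).trans g₃.d₁))
      ((δδ r (i := 0) (j := 0) le_rfl).trans ((congrArg (X.δ 0) h0).trans g₀.d₀))
      ((δδ r (i := 1) (j := 1) le_rfl).symm.trans
        ((congrArg (X.δ 1) h2).trans g₂.d₁))).toTruncated⟩
  fill32 {x₀ x₁ x₂ x₃ e₀₁ e₁₂ e₂₃ e₀₂ e₁₃ e₀₃} f₃ f₀ f₁ := by
    let g₃ := Edge.CompStruct.ofTruncated (e₀₁ := Edge.ofTruncated e₀₁)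
      (e₁₂ := Edge.ofTruncated e₁₂) (e₀₂ := Edge.ofTruncated e₀₂) f₃
    let g₀ := Edge.CompStruct.ofTruncated (e₀₁ := Edge.ofTruncated e₁₂)
      (e₁₂ := Edge.ofTruncated e₂₃) (e₀₂ := Edge.ofTruncated e₁₃) f₀
    let g₁ := Edge.CompStruct.ofTruncated (e₀₁ := Edge.ofTruncated e₀₂)
      (e₁₂ := Edge.ofTruncated e₂₃) (e₀₂ := Edge.ofTruncated e₀₃) f₁
    obtain ⟨r, h0, h1, h3⟩ := exists_tetrahedron₂ (f₀ := g₀.simplex) (f₁ := g₁.simplex)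
      (f₃ := g₃.simplex) (g₁.d₂.trans g₃.d₁.symm) (g₀.d₂.trans g₃.d₀.symm)
      (g₀.d₀.trans g₁.d₀.symm)
    exact ⟨(Edge.CompStruct.mk (e₀₁ := Edge.ofTruncated e₀₁)
      (e₁₂ := Edge.ofTruncated e₁₃) (e₀₂ := Edge.ofTruncated e₀₃) (X.δ 2 r)
      ((δδ r (i := 2) (j := 2) le_rfl).symm.trans ((congrArg (X.δ 2) h3).trans g₃.d₂))
      ((δδ r (i := 0) (j := 1) (by decide)).trans ((congrArg (X.δ 1) h0).trans g₀.d₁))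
      ((δδ r (i := 1) (j := 1) le_rfl).trans
        ((congrArg (X.δ 1) h1).trans g₁.d₁))).toTruncated⟩

/-- The morphism of the homotopy category given by an edge with prescribed end points. -/
def arr {X : SSet.{u}} (s : X _⦋1⦌) {x y : X _⦋0⦌} (h₀ : X.δ 1 s = x) (h₁ : X.δ 0 s = y) :
    Ho.mk x ⟶ Ho.mk y :=
  Ho.homMk (Edge.mk s h₀ h₁)

lemma arr_id {X : SSet.{u}} (x : X _⦋0⦌) (h₀ h₁) : arr (X.σ 0 x) (x := x) (y := x) h₀ h₁ = 𝟙 _ :=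
  Truncated.HomotopyCategory.homMk_id (V := (truncation 2).obj X) x

/-- The comparison of the two models of the homotopy category. -/
noncomputable def toHo₂ (X : SSet.{u}) [Quasicategory X] :
    Ho X ⥤ Truncated.HomotopyCategory₂ ((truncation 2).obj X) :=
  Truncated.HomotopyCategory.lift (fun x ↦ ⟨x⟩) (fun e ↦ Truncated.HomotopyCategory₂.homMk e)
    (fun x ↦ Truncated.HomotopyCategory₂.homMk_id ⟨x⟩)
    (fun h ↦ h.homotopyCategory₂_fac)

lemma toHo₂_map_homMk {X : SSet.{u}} [Quasicategory X] {x y : X _⦋0⦌} (e : X.Edge x y) :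
    (toHo₂ X).map (Ho.homMk e) = Truncated.HomotopyCategory₂.homMk e.toTruncated :=
  Truncated.HomotopyCategory.lift_map_homMk _ _ _ (fun h ↦ h.homotopyCategory₂_fac) _

/-- A priori morphisms of the homotopy category are words in edges. Filling inner horns closes the
classes of edges under composition, so that they exhaust all morphisms. -/
lemma arr_surjective {X : SSet.{u}} [Quasicategory X] {x y : X _⦋0⦌} (f : Ho.mk x ⟶ Ho.mk y) :
    ∃ (s : X _⦋1⦌) (h₀ : X.δ 1 s = x) (h₁ : X.δ 0 s = y), arr s h₀ h₁ = f := by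
  let W : MorphismProperty (Ho X) := fun a b g ↦ ∃ e : Truncated.Edge a.as.as b.as.as,
    g = Truncated.HomotopyCategory.homMk e
  have : W.IsMultiplicative := {
    id_mem := fun a ↦ ⟨.id _, (Truncated.HomotopyCategory.homMk_id _).symm⟩
    comp_mem := by
      rintro a b c _ _ ⟨e, rfl⟩ ⟨e', rfl⟩
      exact ⟨e.comp e', Truncated.HomotopyCategory.homMk_comp_homMk (e.compStruct e')⟩ }
  have hW : W = ⊤ := Truncated.HomotopyCategory.morphismProperty_eq_top (fun e ↦ ⟨e, rfl⟩)
  obtain ⟨e, he⟩ : W f := hW ▸ trivial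
  exact ⟨(Edge.ofTruncated e).edge, (Edge.ofTruncated e).src_eq, (Edge.ofTruncated e).tgt_eq,
    he.symm⟩

lemma arr_comp {X : SSet.{u}} {a b c : X _⦋1⦌} {x y z : X _⦋0⦌} {ha₀ : X.δ 1 a = x}
    {ha₁ : X.δ 0 a = y} {hb₀ : X.δ 1 b = y} {hb₁ : X.δ 0 b = z} {hc₀ : X.δ 1 c = x}
    {hc₁ : X.δ 0 c = z} (r : X _⦋2⦌) (h₂ : X.δ 2 r = a) (h₀ : X.δ 0 r = b) (h₁ : X.δ 1 r = c) :
    arr a ha₀ ha₁ ≫ arr b hb₀ hb₁ = arr c hc₀ hc₁ :=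
  Truncated.HomotopyCategory.homMk_comp_homMk (Edge.CompStruct.mk (e₀₁ := Edge.mk a ha₀ ha₁)
    (e₁₂ := Edge.mk b hb₀ hb₁) (e₀₂ := Edge.mk c hc₀ hc₁) r h₂ h₀ h₁).toTruncated

/-- The forward direction is read off in `HomotopyCategory₂`. This dictionary between equations and
triangles underlies all arguments about homotopy categories below. -/
lemma arr_comp_iff {X : SSet.{u}} [Quasicategory X] {a b c : X _⦋1⦌} {x y z : X _⦋0⦌}
    {ha₀ : X.δ 1 a = x} {ha₁ : X.δ 0 a = y} {hb₀ : X.δ 1 b = y} {hb₁ : X.δ 0 b = z}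
    {hc₀ : X.δ 1 c = x} {hc₁ : X.δ 0 c = z} :
    arr a ha₀ ha₁ ≫ arr b hb₀ hb₁ = arr c hc₀ hc₁ ↔
      ∃ r : X _⦋2⦌, X.δ 2 r = a ∧ X.δ 0 r = b ∧ X.δ 1 r = c := by
  refine ⟨fun h ↦ ?_, fun ⟨r, h₂, h₀, h₁⟩ ↦ arr_comp r h₂ h₀ h₁⟩
  have h' := congrArg (toHo₂ X).map h
  rw [Functor.map_comp] at h'
  dsimp only [arr] at h'
  rw [toHo₂_map_homMk, toHo₂_map_homMk, toHo₂_map_homMk] at h'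
  obtain ⟨t⟩ := (Truncated.Edge.CompStruct.nonempty_iff
    (f := (Edge.mk a ha₀ ha₁).toTruncated) (g := (Edge.mk b hb₀ hb₁).toTruncated)
    (h := (Edge.mk c hc₀ hc₁).toTruncated)).2 h'
  let t' := Edge.CompStruct.ofTruncated (e₀₁ := Edge.mk a ha₀ ha₁) (e₁₂ := Edge.mk b hb₀ hb₁)
    (e₀₂ := Edge.mk c hc₀ hc₁) t
  exact ⟨t'.simplex, t'.d₂, t'.d₀, t'.d₁⟩

/-- The map of morphism sets of homotopy categories which is induced by a map of simplicial sets,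
with flexible end points. -/
def push {X Y : SSet.{u}} (F : X ⟶ Y) {x x' : X _⦋0⦌} {y y' : Y _⦋0⦌} (h : F.app _ x = y)
    (h' : F.app _ x' = y') (f : Ho.mk x ⟶ Ho.mk x') : Ho.mk y ⟶ Ho.mk y' :=
  eqToHom (by rw [← h]; rfl) ≫
    (Truncated.mapHomotopyCategory ((truncation 2).map F)).map f ≫ eqToHom (by rw [← h']; rfl)

section push

variable {X Y Z : SSet.{u}} (F : X ⟶ Y) {x x' x'' : X _⦋0⦌} {y y' y'' : Y _⦋0⦌}
  (h : F.app _ x = y) (h' : F.app _ x' = y') (h'' : F.app _ x'' = y'')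

lemma push_comp (f : Ho.mk x ⟶ Ho.mk x') (g : Ho.mk x' ⟶ Ho.mk x'') :
    push F h h'' (f ≫ g) = push F h h' f ≫ push F h' h'' g := by
  subst h h' h''
  simp [push]

lemma push_id : push F h h (𝟙 _) = 𝟙 _ := by
  subst h
  simp [push]

lemma app_δ {n : ℕ} (s : X _⦋n + 1⦌) (i : Fin (n + 2)) :
    Y.δ i (F.app _ s) = F.app _ (X.δ i s) :=
  (NatTrans.naturality_apply F _ s).symm

lemma push_arr (s : X _⦋1⦌) (h₀ : X.δ 1 s = x) (h₁ : X.δ 0 s = x') :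
    push F h h' (arr s h₀ h₁) = arr (F.app _ s) (by rw [app_δ, h₀, h]) (by rw [app_δ, h₁, h']) := by
  subst h h'
  refine (Category.id_comp _).trans ((Category.comp_id _).trans ?_)
  exact Truncated.mapHomotopyCategory_homMk _ _

lemma push_push [Quasicategory X] (G : Y ⟶ Z) {z z' : Z _⦋0⦌} (k : G.app _ y = z)
    (k' : G.app _ y' = z') (f : Ho.mk x ⟶ Ho.mk x') :
    push G k k' (push F h h' f) = push (F ≫ G) (by rw [← k, ← h]; rfl) (by rw [← k', ← h']; rfl) f := by
  obtain ⟨s, h₀, h₁, rfl⟩ := arr_surjective f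
  rw [push_arr, push_arr, push_arr]
  rfl

lemma push_congr {F G : X ⟶ Y} (e : F = G) (h : F.app _ x = y) (h' : F.app _ x' = y')
    (k : G.app _ x = y) (k' : G.app _ x' = y') (f : Ho.mk x ⟶ Ho.mk x') :
    push F h h' f = push G k k' f := by
  subst e; rfl

lemma push_refl [Quasicategory X] (f : Ho.mk x ⟶ Ho.mk x') : push (𝟙 X) rfl rfl f = f := by
  obtain ⟨s, h₀, h₁, rfl⟩ := arr_surjective f
  rw [push_arr]
  rfl

end push

end InfCat

namespace InfCat

/-! ### Simplices of functor complexes -/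

open CartesianMonoidalCategory (lift fst snd)

lemma map_ext_app {X Y : SSet.{u}} {f g : X ⟶ Y}
    (h : ∀ (n : ℕ) (x : X _⦋n⦌), f.app _ x = g.app _ x) : f = g := by
  ext ⟨n⟩ x
  induction n using SimplexCategory.rec with
  | _ n => exact h n x

section sx

variable {K L X Y : SSet.{u}}

/-- The simplex of `Fun(K, X)` which corresponds to a map `K ⊗ Δ[n] ⟶ X`. -/
noncomputable def sx {n : ℕ} (H : K ⊗ Δ[n] ⟶ X) : (Fun K X) _⦋n⦌ :=
  yonedaEquiv (MonoidalClosed.curry H)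

lemma sx_surjective {n : ℕ} (s : (Fun K X) _⦋n⦌) : ∃ H : K ⊗ Δ[n] ⟶ X, sx H = s :=
  ⟨MonoidalClosed.uncurry (yonedaEquiv.symm s), by simp [sx]⟩

lemma sx_injective {n : ℕ} {H H' : K ⊗ Δ[n] ⟶ X} (h : sx H = sx H') : H = H' :=
  MonoidalClosed.curry_injective (yonedaEquiv.injective h)

lemma δ_sx {n : ℕ} (H : K ⊗ Δ[n + 1] ⟶ X) (i : Fin (n + 2)) :
    (Fun K X).δ i (sx H) = sx (K ◁ stdSimplex.δ i ≫ H) := by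
  rw [sx, ← stdSimplex.yonedaEquiv_δ_comp, ← MonoidalClosed.curry_natural_left]
  rfl

lemma σ_sx {n : ℕ} (H : K ⊗ Δ[n] ⟶ X) (i : Fin (n + 1)) :
    (Fun K X).σ i (sx H) = sx (K ◁ stdSimplex.σ i ≫ H) := by
  rw [sx, ← stdSimplex.yonedaEquiv_σ_comp, ← MonoidalClosed.curry_natural_left]
  rfl

lemma curry_app_δ₁ (H : K ⊗ Δ[1] ⟶ X) : (Fun K X).δ 1 (sx H) = vertex (ι₀ ≫ H) := by
  rw [sx, ← stdSimplex.yonedaEquiv_δ_comp, stdSimplex.δ_one_eq_const]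
  exact curry_app H v0

lemma curry_app_δ₀ (H : K ⊗ Δ[1] ⟶ X) : (Fun K X).δ 0 (sx H) = vertex (ι₁ ≫ H) := by
  rw [sx, ← stdSimplex.yonedaEquiv_δ_comp, stdSimplex.δ_zero_eq_const]
  exact curry_app H v1

lemma vertex_eq_sx (p : K ⟶ X) : vertex p = sx (fst K Δ[0] ≫ p) := by
  rw [sx]
  refine (curry_app (fst K Δ[0] ≫ p) (stdSimplex.obj₀Equiv.symm 0)).symm.trans ?_
  exact congrArg _ (stdSimplex.obj₀Equiv.injective (Subsingleton.elim (α := Fin 1) _ _))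

lemma vertex_surjective (v : (Fun K X) _⦋0⦌) : ∃ p : K ⟶ X, vertex p = v := by
  obtain ⟨H, rfl⟩ := sx_surjective v
  refine ⟨lift (𝟙 K) (SSet.const (stdSimplex.obj₀Equiv.symm 0)) ≫ H, ?_⟩
  rw [vertex_eq_sx]
  congr 1
  rw [← Category.assoc]
  convert! Category.id_comp H
  ext : 1
  · rfl
  · exact stdSimplex.ext₀

lemma vertex_injective {p q : K ⟶ X} (h : vertex p = vertex q) : p = q := by
  have h' := (unitHomEquiv _).injective h
  rw [← MonoidalClosed.uncurry'_curry' p, h', MonoidalClosed.uncurry'_curry']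

lemma sx_post {n : ℕ} (F : X ⟶ Y) (H : K ⊗ Δ[n] ⟶ X) :
    ((ihom K).map F).app _ (sx H) = sx (H ≫ F) := by
  rw [sx, sx, MonoidalClosed.curry_natural_right]
  rfl

lemma post_vertex (F : X ⟶ Y) (p : K ⟶ X) :
    ((ihom K).map F).app _ (vertex p) = vertex (p ≫ F) := by
  have h : MonoidalClosed.curry' p ≫ (ihom K).map F = MonoidalClosed.curry' (p ≫ F) := by
    simp only [MonoidalClosed.curry', ← MonoidalClosed.curry_natural_right, Category.assoc]
  exact congrArg (fun g ↦ unitHomEquiv _ g) h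

lemma sx_restrict {n : ℕ} (f : L ⟶ K) (H : K ⊗ Δ[n] ⟶ X) :
    (restrict f X).app _ (sx H) = sx (f ▷ _ ≫ H) := by
  rw [sx, sx, restrict, ← MonoidalClosed.curry_pre_app]
  rfl

lemma sx_evalAt {n : ℕ} (k : K _⦋0⦌) (H : K ⊗ Δ[n] ⟶ X) :
    (evalAt k X).app _ (sx H) = yonedaEquiv (lift (SSet.const k) (𝟙 _) ≫ H) := by
  have h : MonoidalClosed.curry H ≫ evalAt k X = lift (SSet.const k) (𝟙 _) ≫ H := by
    have : MonoidalClosed.curry H ≫ lift (SSet.const k) (𝟙 _) =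
        lift (SSet.const k) (𝟙 _) ≫ K ◁ MonoidalClosed.curry H := rfl
    rw [evalAt, ← Category.assoc, this, Category.assoc]
    congr 1
    rw [← MonoidalClosed.uncurry_eq, MonoidalClosed.uncurry_curry]
  rw [← h]
  rfl

lemma constFun_simplex {n : ℕ} (s : X _⦋n⦌) :
    (constFun K X).app _ s = sx (snd K _ ≫ yonedaEquiv.symm s) := by
  have h : yonedaEquiv.symm s ≫ constFun K X = MonoidalClosed.curry (snd K _ ≫ yonedaEquiv.symm s) := by
    rw [constFun, ← MonoidalClosed.curry_natural_left]
    rfl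
  rw [sx, ← h, yonedaEquiv_comp, Equiv.apply_symm_apply]

/-- The class of a natural transformation in the homotopy category of `Fun(K, X)`. -/
noncomputable def cls {p q : K ⟶ X} (H : K ⊗ Δ[1] ⟶ X) (h₀ : ι₀ ≫ H = p) (h₁ : ι₁ ≫ H = q) :
    Ho.mk (vertex p) ⟶ Ho.mk (vertex q) :=
  arr (sx H) (by rw [curry_app_δ₁, h₀]) (by rw [curry_app_δ₀, h₁])

variable [Quasicategory X]

lemma cls_surjective {p q : K ⟶ X} (f : Ho.mk (vertex p) ⟶ Ho.mk (vertex q)) :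
    ∃ (H : K ⊗ Δ[1] ⟶ X) (h₀ : ι₀ ≫ H = p) (h₁ : ι₁ ≫ H = q), cls H h₀ h₁ = f := by
  obtain ⟨s, h₀, h₁, rfl⟩ := arr_surjective f
  obtain ⟨H, rfl⟩ := sx_surjective s
  rw [curry_app_δ₁] at h₀
  rw [curry_app_δ₀] at h₁
  exact ⟨H, vertex_injective h₀, vertex_injective h₁, rfl⟩

lemma cls_comp {p q r : K ⟶ X} {A B C : K ⊗ Δ[1] ⟶ X} {ha₀ : ι₀ ≫ A = p} {ha₁ : ι₁ ≫ A = q}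
    {hb₀ : ι₀ ≫ B = q} {hb₁ : ι₁ ≫ B = r} {hc₀ : ι₀ ≫ C = p} {hc₁ : ι₁ ≫ C = r}
    (S : K ⊗ Δ[2] ⟶ X) (h₂ : K ◁ stdSimplex.δ 2 ≫ S = A) (h₀ : K ◁ stdSimplex.δ 0 ≫ S = B)
    (h₁ : K ◁ stdSimplex.δ 1 ≫ S = C) : cls A ha₀ ha₁ ≫ cls B hb₀ hb₁ = cls C hc₀ hc₁ :=
  arr_comp (sx S) (by rw [δ_sx, h₂]) (by rw [δ_sx, h₀]) (by rw [δ_sx, h₁])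

lemma cls_comp_iff {p q r : K ⟶ X} {A B C : K ⊗ Δ[1] ⟶ X} {ha₀ : ι₀ ≫ A = p} {ha₁ : ι₁ ≫ A = q}
    {hb₀ : ι₀ ≫ B = q} {hb₁ : ι₁ ≫ B = r} {hc₀ : ι₀ ≫ C = p} {hc₁ : ι₁ ≫ C = r} :
    cls A ha₀ ha₁ ≫ cls B hb₀ hb₁ = cls C hc₀ hc₁ ↔ ∃ S : K ⊗ Δ[2] ⟶ X,
      K ◁ stdSimplex.δ 2 ≫ S = A ∧ K ◁ stdSimplex.δ 0 ≫ S = B ∧ K ◁ stdSimplex.δ 1 ≫ S = C := by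
  refine ⟨fun h ↦ ?_, fun ⟨S, h₂, h₀, h₁⟩ ↦ cls_comp S h₂ h₀ h₁⟩
  obtain ⟨r, h₂, h₀, h₁⟩ := arr_comp_iff.1 h
  obtain ⟨S, rfl⟩ := sx_surjective r
  rw [δ_sx] at h₂ h₀ h₁
  exact ⟨S, sx_injective h₂, sx_injective h₀, sx_injective h₁⟩

omit [Quasicategory X] in
lemma cls_fst (p : K ⟶ X) (h₀ h₁) : cls (fst K Δ[1] ≫ p) (p := p) (q := p) h₀ h₁ = 𝟙 _ := by
  have h : sx (fst K Δ[1] ≫ p) = (Fun K X).σ 0 (vertex p) := by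
    rw [vertex_eq_sx, σ_sx]
    rfl
  dsimp only [cls]
  simp only [h]
  exact arr_id _ _ _

omit [Quasicategory X] in
lemma push_post_cls (F : X ⟶ Y) {p q : K ⟶ X} (H : K ⊗ Δ[1] ⟶ X) (h₀ : ι₀ ≫ H = p)
    (h₁ : ι₁ ≫ H = q) {p' q' : K ⟶ Y} (hp : p ≫ F = p') (hq : q ≫ F = q')
    (e e') : push ((ihom K).map F) (y := vertex p') (y' := vertex q') e e' (cls H h₀ h₁) =
      cls (H ≫ F) (by rw [← hp, ← h₀]; rfl) (by rw [← hq, ← h₁]; rfl) := by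
  rw [cls, push_arr]
  simp only [sx_post]
  rfl

omit [Quasicategory X] in
lemma push_restrict_cls (f : L ⟶ K) {p q : K ⟶ X} (H : K ⊗ Δ[1] ⟶ X) (h₀ : ι₀ ≫ H = p)
    (h₁ : ι₁ ≫ H = q) {p' q' : L ⟶ X} (hp : f ≫ p = p') (hq : f ≫ q = q')
    (e e') : push (restrict f X) (y := vertex p') (y' := vertex q') e e' (cls H h₀ h₁) =
      cls (f ▷ _ ≫ H) (by rw [← hp, ← h₀]; rfl) (by rw [← hq, ← h₁]; rfl) := by
  rw [cls, push_arr]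
  simp only [sx_restrict]
  rfl

omit [Quasicategory X] in
lemma push_constFun_arr {x y : X _⦋0⦌} (s : X _⦋1⦌) (h₀ : X.δ 1 s = x) (h₁ : X.δ 0 s = y) {p q : K ⟶ X}
    (e : (constFun K X).app _ x = vertex p) (e' : (constFun K X).app _ y = vertex q) :
    push (constFun K X) e e' (arr s h₀ h₁) = cls (snd K _ ≫ yonedaEquiv.symm s)
      (vertex_injective (by rw [← e, ← h₀, ← app_δ, constFun_simplex, curry_app_δ₁]))
      (vertex_injective (by rw [← e', ← h₁, ← app_δ, constFun_simplex, curry_app_δ₀])) := by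
  rw [push_arr]
  simp only [constFun_simplex]
  rfl

omit [Quasicategory X] in
lemma push_evalAt_cls (k : K _⦋0⦌) {p q : K ⟶ X} (H : K ⊗ Δ[1] ⟶ X) (h₀ : ι₀ ≫ H = p)
    (h₁ : ι₁ ≫ H = q) {x y : X _⦋0⦌} (e : (evalAt k X).app _ (vertex p) = x)
    (e' : (evalAt k X).app _ (vertex q) = y) :
    push (evalAt k X) e e' (cls H h₀ h₁) = arr (yonedaEquiv (lift (SSet.const k) (𝟙 _) ≫ H))
      (by rw [← e, ← h₀, ← curry_app_δ₁, ← sx_evalAt, app_δ])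
      (by rw [← e', ← h₁, ← curry_app_δ₀, ← sx_evalAt, app_δ]) := by
  rw [cls, push_arr]
  simp only [sx_evalAt]

/-- The two triangles of the square. -/
noncomputable def upperTriangle : (Δ[2] : SSet.{u}) ⟶ Δ[1] ⊗ Δ[1] :=
  lift (stdSimplex.σ 0) (stdSimplex.σ 1)

/-- The two triangles of the square. -/
noncomputable def lowerTriangle : (Δ[2] : SSet.{u}) ⟶ Δ[1] ⊗ Δ[1] :=
  lift (stdSimplex.σ 1) (stdSimplex.σ 0)

omit [Quasicategory X] in
lemma hom_std_ext {m : ℕ} {f g : X ⟶ Δ[m]}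
    (h : ∀ (n : ℕ) (x : X _⦋n⦌) (i : Fin (n + 1)), (f.app _ x : Δ[m] _⦋n⦌) i =
      (g.app _ x : Δ[m] _⦋n⦌) i) : f = g :=
  map_ext_app fun n x ↦ SSet.stdSimplex.ext _ _ (h n x)

lemma δ_one_lowerTriangle : (stdSimplex.δ 1 : (Δ[1] : SSet.{u}) ⟶ _) ≫ lowerTriangle = lift (𝟙 _) (𝟙 _) := by
  ext : 1 <;> refine hom_std_ext fun n x i ↦ ?_
  · change Fin.predAbove 1 (Fin.succAbove 1 (x i)) = x i
    generalize x i = t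
    fin_cases t <;> rfl
  · change Fin.predAbove 0 (Fin.succAbove 1 (x i)) = x i
    generalize x i = t
    fin_cases t <;> rfl

lemma δ_one_upperTriangle : (stdSimplex.δ 1 : (Δ[1] : SSet.{u}) ⟶ _) ≫ upperTriangle = lift (𝟙 _) (𝟙 _) := by
  ext : 1 <;> refine hom_std_ext fun n x i ↦ ?_
  · change Fin.predAbove 0 (Fin.succAbove 1 (x i)) = x i
    generalize x i = t
    fin_cases t <;> rfl
  · change Fin.predAbove 1 (Fin.succAbove 1 (x i)) = x i
    generalize x i = t
    fin_cases t <;> rfl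

lemma δ_two_lowerTriangle : (stdSimplex.δ 2 : (Δ[1] : SSet.{u}) ⟶ _) ≫ lowerTriangle = ι₀ := by
  ext : 1 <;> refine hom_std_ext fun n x i ↦ ?_
  · change Fin.predAbove 1 (Fin.succAbove 2 (x i)) = x i
    generalize x i = t
    fin_cases t <;> rfl
  · change Fin.predAbove 0 (Fin.succAbove 2 (x i)) = 0
    generalize x i = t
    fin_cases t <;> rfl

lemma δ_two_upperTriangle : (stdSimplex.δ 2 : (Δ[1] : SSet.{u}) ⟶ _) ≫ upperTriangle = lift (SSet.const v0) (𝟙 _) := by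
  ext : 1 <;> refine hom_std_ext fun n x i ↦ ?_
  · change Fin.predAbove 0 (Fin.succAbove 2 (x i)) = 0
    generalize x i = t
    fin_cases t <;> rfl
  · change Fin.predAbove 1 (Fin.succAbove 2 (x i)) = x i
    generalize x i = t
    fin_cases t <;> rfl

lemma δ_zero_lowerTriangle : (stdSimplex.δ 0 : (Δ[1] : SSet.{u}) ⟶ _) ≫ lowerTriangle = lift (SSet.const v1) (𝟙 _) := by
  ext : 1 <;> refine hom_std_ext fun n x i ↦ ?_
  · change Fin.predAbove 1 (Fin.succAbove 0 (x i)) = 1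
    generalize x i = t
    fin_cases t <;> rfl
  · change Fin.predAbove 0 (Fin.succAbove 0 (x i)) = x i
    generalize x i = t
    fin_cases t <;> rfl

lemma δ_zero_upperTriangle : (stdSimplex.δ 0 : (Δ[1] : SSet.{u}) ⟶ _) ≫ upperTriangle = ι₁ := by
  ext : 1 <;> refine hom_std_ext fun n x i ↦ ?_
  · change Fin.predAbove 0 (Fin.succAbove 0 (x i)) = x i
    generalize x i = t
    fin_cases t <;> rfl
  · change Fin.predAbove 1 (Fin.succAbove 0 (x i)) = 1
    generalize x i = t
    fin_cases t <;> rfl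

/-- A square `K ⊗ (Δ[1] ⊗ Δ[1]) ⟶ X` gives a commutative square in the homotopy category. -/
lemma square_comm (S : K ⊗ (Δ[1] ⊗ Δ[1]) ⟶ X) {p₀₀ p₀₁ p₁₀ p₁₁ : K ⟶ X} {A B C D : K ⊗ Δ[1] ⟶ X}
    (hA : K ◁ ι₀ ≫ S = A) (hB : K ◁ ι₁ ≫ S = B)
    (hC : K ◁ lift (SSet.const v0) (𝟙 _) ≫ S = C) (hD : K ◁ lift (SSet.const v1) (𝟙 _) ≫ S = D)
    (a₀ : ι₀ ≫ A = p₀₀) (a₁ : ι₁ ≫ A = p₁₀) (b₀ : ι₀ ≫ B = p₀₁) (b₁ : ι₁ ≫ B = p₁₁)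
    (c₀ : ι₀ ≫ C = p₀₀) (c₁ : ι₁ ≫ C = p₀₁) (d₀ : ι₀ ≫ D = p₁₀) (d₁ : ι₁ ≫ D = p₁₁) :
    cls A a₀ a₁ ≫ cls D d₀ d₁ = cls C c₀ c₁ ≫ cls B b₀ b₁ := by
  have k₀ : (ι₀ : K ⟶ _) ≫ K ◁ lift (𝟙 Δ[1]) (𝟙 _) = ι₀ ≫ K ◁ ι₀ := by
    refine map_ext_app fun n x ↦ Prod.ext rfl (Prod.ext rfl rfl)
  have k₁ : (ι₁ : K ⟶ _) ≫ K ◁ lift (𝟙 Δ[1]) (𝟙 _) = ι₁ ≫ K ◁ ι₁ := by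
    refine map_ext_app fun n x ↦ Prod.ext rfl (Prod.ext rfl rfl)
  have d₀' : ι₀ ≫ (K ◁ lift (𝟙 _) (𝟙 _) ≫ S) = p₀₀ := by
    rw [← a₀, ← hA, ← Category.assoc, k₀, Category.assoc]
  have d₁' : ι₁ ≫ (K ◁ lift (𝟙 _) (𝟙 _) ≫ S) = p₁₁ := by
    rw [← b₁, ← hB, ← Category.assoc, k₁, Category.assoc]
  -- Both composites are the class of the diagonal of the square, as witnessed by its two triangles.
  rw [cls_comp (C := K ◁ lift (𝟙 _) (𝟙 _) ≫ S) (hc₀ := d₀') (hc₁ := d₁')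
      (K ◁ lowerTriangle ≫ S), cls_comp (C := K ◁ lift (𝟙 _) (𝟙 _) ≫ S) (hc₀ := d₀') (hc₁ := d₁')
      (K ◁ upperTriangle ≫ S)]
  all_goals rw [← Category.assoc, ← whiskerLeft_comp]
  · rw [δ_two_upperTriangle, hC]
  · rw [δ_zero_upperTriangle, hB]
  · rw [δ_one_upperTriangle]
  · rw [δ_two_lowerTriangle, hA]
  · rw [δ_zero_lowerTriangle, hD]
  · rw [δ_one_lowerTriangle]

end sx

end InfCat

namespace InfCat

/-! ### Inner anodyne inclusions of nerves of posets, obtained by toggling an element of each chain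
-/

section Toggle

variable {P : Type u} [PartialOrder P]

/-- A hereditary condition on subsets. -/
def IsHereditary (S : Set P → Prop) : Prop := ∀ σ ρ : Set P, σ ⊆ ρ → S ρ → S σ

/-- The subcomplex of the nerve of `P` of the simplices whose vertices satisfy a hereditary
condition. -/
def chains (S : Set P → Prop) (hS : IsHereditary S) :
    (nerve P).Subcomplex where
  obj n := {s | S (Set.range s.obj)}
  map f s h := hS _ _ (by rintro _ ⟨i, rfl⟩; exact ⟨_, rfl⟩) h

lemma mem_chains {S : Set P → Prop} {hS : IsHereditary S} {n : SimplexCategoryᵒᵖ}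
    (s : (nerve P).obj n) : s ∈ (chains S hS).obj n ↔ S (Set.range s.obj) := Iff.rfl

lemma exists_strictMono_range (n : ℕ) (σ : Set P) (hσ : σ.ncard = n + 1) (hc : IsChain (· ≤ ·) σ) :
    ∃ s : (nerve P) _⦋n⦌, StrictMono s.obj ∧ Set.range s.obj = σ := by
  classical
  have hf : σ.Finite := Set.finite_of_ncard_ne_zero (by lia)
  have : Fintype σ := hf.fintype
  let : LinearOrder σ := hc.linearOrder
  have hcard : Fintype.card σ = n + 1 := by
    rw [← Nat.card_eq_fintype_card]; exact hσ
  let e := Fintype.orderIsoFinOfCardEq σ hcard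
  refine ⟨Monotone.functor (f := fun i ↦ (e i : P)) (fun i j h ↦ e.monotone h), ?_, ?_⟩
  · intro i j h
    exact e.strictMono h
  · ext x
    constructor
    · rintro ⟨i, rfl⟩
      exact (e i).2
    · intro h
      exact ⟨e.symm ⟨x, h⟩, congrArg Subtype.val (e.apply_symm_apply ⟨x, h⟩)⟩

lemma range_δ {n : ℕ} (s : (nerve P) _⦋n + 1⦌) (hs : Function.Injective s.obj) (i : Fin (n + 2)) :
    Set.range ((nerve P).δ i s).obj = Set.range s.obj \ {s.obj i} := by
  ext x
  constructor
  · rintro ⟨j, rfl⟩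
    exact ⟨⟨_, rfl⟩, fun h ↦ Fin.succAbove_ne i j (hs h)⟩
  · rintro ⟨⟨j, rfl⟩, h⟩
    have hj : j ≠ i := fun h' ↦ h (by subst h'; rfl)
    obtain ⟨k, rfl⟩ := Fin.exists_succAbove_eq hj
    exact ⟨k, rfl⟩

lemma nerve_eq_of_range {n : ℕ} {s s' : (nerve P) _⦋n⦌} (hs : StrictMono s.obj)
    (hs' : StrictMono s'.obj) (h : Set.range s.obj = Set.range s'.obj) : s = s' := by
  have := (StrictMono.range_inj (β := Fin (n + 1)) hs hs').1 h
  exact nerve.ext_of_isThin this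

lemma ncard_range {n : ℕ} (s : (nerve P) _⦋n⦌) (hs : StrictMono s.obj) :
    (Set.range s.obj).ncard = n + 1 := by
  rw [← Set.image_univ, Set.ncard_image_of_injective _ hs.injective]
  refine (Set.ncard_univ (Fin (n + 1))).trans ?_
  simp

/-- The finite nonempty chains of `P` in `S'` and not in `S`. -/
structure IsFree (S S' : Set P → Prop) (σ : Set P) : Prop where
  mem : S' σ
  finite : σ.Finite
  nonempty : σ.Nonempty
  isChain : IsChain (· ≤ ·) σ
  notMem : ¬ S σ

lemma isFree_range {S S' : Set P → Prop} {n : ℕ} (s : (nerve P) _⦋n⦌)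
    (h : ¬ S (Set.range s.obj)) (h' : S' (Set.range s.obj)) : IsFree S S' (Set.range s.obj) where
  mem := h'
  finite := Set.finite_range (ι := Fin (n + 1)) _
  nonempty := ⟨_, (0 : Fin (n + 1)), rfl⟩
  isChain := by
    rintro _ ⟨i, rfl⟩ _ ⟨j, rfl⟩ _
    exact (le_total (α := Fin (n + 1)) i j).imp (fun h ↦ s.monotone h) (fun h ↦ s.monotone h)
  notMem := h

/-- A rule which adds an element to or removes an element from each finite nonempty
chain of `P` in a hereditary family `S'` and outside of a hereditary family `S`. -/
structure Toggle (S S' : Set P → Prop) where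
  hereditary : IsHereditary S
  hereditary' : IsHereditary S'
  /-- the element to be toggled -/
  elt : Set P → P
  rank : Set P → ℕ
  isChain_insert σ : IsFree S S' σ → IsChain (· ≤ ·) (insert (elt σ) σ)
  mem_insert σ : IsFree S S' σ → S' (insert (elt σ) σ)
  elt_insert σ : IsFree S S' σ → elt (insert (elt σ) σ) = elt σ
  notMem_diff σ : IsFree S S' σ → elt σ ∈ σ → ¬ S (σ \ {elt σ})
  elt_diff σ : IsFree S S' σ → elt σ ∈ σ → elt (σ \ {elt σ}) = elt σ
  -- Together with `exists_gt` this makes the toggled element an interior vertex, so that the horns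
  -- to be filled are inner.
  exists_lt σ : IsFree S S' σ → elt σ ∈ σ → ∃ x ∈ σ, x < elt σ
  exists_gt σ : IsFree S S' σ → elt σ ∈ σ → ∃ x ∈ σ, elt σ < x
  -- If another face of `σ` also has to be attached as the missing face of a horn, it has to be
  -- attached earlier; the rank excludes infinite regress.
  rank_lt σ x : IsFree S S' σ → elt σ ∈ σ → x ∈ σ → x ≠ elt σ → ¬ S (σ \ {x}) →
    elt (σ \ {x}) ∉ σ \ {x} → rank (σ \ {x}) < rank (σ \ {elt σ})

namespace Toggle

variable {S S' : Set P → Prop} (t : Toggle S S')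

/-- The simplices which contain the element to be toggled. -/
structure Big where
  dim : ℕ
  simplex : (nerve P) _⦋dim + 1⦌
  strictMono : StrictMono simplex.obj
  notMem : ¬ S (Set.range simplex.obj)
  mem' : S' (Set.range simplex.obj)
  index : Fin (dim + 2)
  index_eq : simplex.obj index = t.elt (Set.range simplex.obj)

variable {t}

namespace Big

lemma isFree (b : t.Big) : IsFree S S' (Set.range b.simplex.obj) :=
  isFree_range _ b.notMem b.mem'

lemma mem (b : t.Big) : t.elt (Set.range b.simplex.obj) ∈ Set.range b.simplex.obj :=
  ⟨b.index, b.index_eq⟩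

lemma range_face (b : t.Big) : Set.range ((nerve P).δ b.index b.simplex).obj =
    Set.range b.simplex.obj \ {t.elt (Set.range b.simplex.obj)} := by
  rw [range_δ _ b.strictMono.injective, b.index_eq]

lemma ext_of_range {b b' : t.Big} (h : Set.range b.simplex.obj = Set.range b'.simplex.obj) :
    b = b' := by
  have h' := ncard_range _ b.strictMono
  rw [h, ncard_range _ b'.strictMono] at h'
  obtain ⟨n, s, hs, _, _, i, hi⟩ := b
  obtain ⟨n', s', hs', _, _, i', hi'⟩ := b'
  obtain rfl : n = n' := by dsimp at h'; lia
  obtain rfl := nerve_eq_of_range hs hs' h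
  obtain rfl : i = i' := hs.injective (hi.trans hi'.symm)
  rfl

lemma insert_face (b : t.Big) : insert (t.elt (Set.range ((nerve P).δ b.index b.simplex).obj))
    (Set.range ((nerve P).δ b.index b.simplex).obj) = Set.range b.simplex.obj := by
  rw [range_face, t.elt_diff _ b.isFree b.mem, Set.insert_sdiff_singleton,
    Set.insert_eq_of_mem b.mem]

lemma notMem_face (b : t.Big) : ¬ S (Set.range ((nerve P).δ b.index b.simplex).obj) := by
  rw [range_face]
  exact t.notMem_diff _ b.isFree b.mem

lemma elt_face_notMem (b : t.Big) : t.elt (Set.range ((nerve P).δ b.index b.simplex).obj) ∉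
    Set.range ((nerve P).δ b.index b.simplex).obj := by
  rw [range_face, t.elt_diff _ b.isFree b.mem]
  exact fun h ↦ h.2 rfl

end Big

lemma exists_big (n : ℕ) (σ : Set P) (hσ : IsFree S S' σ) (h : t.elt σ ∈ σ) :
    ∃ b : t.Big, Set.range b.simplex.obj = σ := by
  obtain ⟨x, hx, hx'⟩ := t.exists_lt σ hσ h
  have : 1 < σ.ncard := (Set.one_lt_ncard hσ.finite).2 ⟨x, hx, _, h, hx'.ne⟩
  obtain ⟨m, hm⟩ : ∃ m, σ.ncard = m + 1 + 1 := ⟨σ.ncard - 2, by lia⟩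
  obtain ⟨s, hs, hs'⟩ := exists_strictMono_range _ σ hm hσ.isChain
  obtain ⟨i, hi⟩ : t.elt σ ∈ Set.range s.obj := by rwa [hs']
  exact ⟨⟨m, s, hs, by rw [hs']; exact hσ.notMem, by rw [hs']; exact hσ.mem, i, by rw [hs']; exact hi⟩, hs'⟩

variable (t)

lemma Big.mem_face (b : t.Big) : S' (Set.range ((nerve P).δ b.index b.simplex).obj) := by
  rw [b.range_face]
  exact t.hereditary' _ _ Set.sdiff_subset b.mem'

/-- The small family, as a subcomplex of the big one. -/
abbrev sub : (chains S' t.hereditary' : SSet).Subcomplex :=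
  (chains S t.hereditary).preimage (chains S' t.hereditary').ι

lemma range_eq_of_sMk_eq {n m : ℕ} {x : (chains S' t.hereditary' : SSet) _⦋n⦌}
    {y : (chains S' t.hereditary' : SSet) _⦋m⦌} (h : SSet.S.mk x = SSet.S.mk y) :
    Set.range x.1.obj = Set.range y.1.obj :=
  congrArg (fun z : SSet.S (chains S' t.hereditary' : SSet) ↦ Set.range z.simplex.1.obj) h

/-- The pairing core of a toggle. -/
noncomputable def pairingCore : t.sub.PairingCore where
  -- A chain which contains its toggled element is paired with the face opposite to this element.
  ι := t.Big
  dim b := b.dim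
  simplex b := ⟨b.simplex, b.mem'⟩
  index b := b.index
  nonDegenerate₁ b := by
    refine (Subcomplex.mem_nonDegenerate_iff _ _).2 ?_
    exact (PartialOrder.mem_nerve_nonDegenerate_iff_strictMono _).2 b.strictMono
  nonDegenerate₂ b := by
    refine (Subcomplex.mem_nonDegenerate_iff _ _).2 ?_
    refine (PartialOrder.mem_nerve_nonDegenerate_iff_injective _).2 ?_
    intro i j h
    exact Fin.succAbove_right_injective
      (b.strictMono.injective h : b.index.succAbove i = b.index.succAbove j)
  notMem₁ b := b.notMem
  notMem₂ b := b.notMem_face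
  injective_type₁' {b b'} h := Big.ext_of_range (t.range_eq_of_sMk_eq h)
  injective_type₂' {b b'} h := Big.ext_of_range (by
    have : Set.range ((nerve P).δ b.index b.simplex).obj =
      Set.range ((nerve P).δ b'.index b'.simplex).obj := t.range_eq_of_sMk_eq h
    rw [← b.insert_face, ← b'.insert_face, this])
  type₁_ne_type₂' b b' h := by
    have : Set.range b.simplex.obj =
      Set.range ((nerve P).δ b'.index b'.simplex).obj := t.range_eq_of_sMk_eq h
    have h' := b'.elt_face_notMem
    rw [← this] at h'
    exact h' b.mem
  surjective' x := by
    obtain ⟨n, ⟨s, hmem⟩, hs, hs', rfl⟩ := x.mk_surjective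
    replace hs := (PartialOrder.mem_nerve_nonDegenerate_iff_strictMono _).1
      ((Subcomplex.mem_nonDegenerate_iff _ _).1 hs)
    have hf : IsFree S S' (Set.range s.obj) := isFree_range s hs' hmem
    have key {m : ℕ} (s' : (chains S' t.hereditary' : SSet) _⦋m⦌) (h : StrictMono s'.1.obj)
        (h' : Set.range s.obj = Set.range s'.1.obj) :
        SSet.S.mk (X := (chains S' t.hereditary' : SSet)) ⟨s, hmem⟩ = SSet.S.mk s' := by
      have h₁ := ncard_range _ hs
      have h₂ := ncard_range _ h
      rw [← h'] at h₂
      have h₃ := h₁.symm.trans h₂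
      obtain rfl : m = n := by lia
      obtain ⟨s', hs''⟩ := s'
      obtain rfl := nerve_eq_of_range hs h h'
      rfl
    by_cases h : t.elt (Set.range s.obj) ∈ Set.range s.obj
    · obtain ⟨b, hb⟩ := exists_big n _ hf h
      exact ⟨b, Or.inl (key _ b.strictMono hb.symm)⟩
    · have hf' : IsFree S S' (insert (t.elt (Set.range s.obj)) (Set.range s.obj)) :=
        { mem := t.mem_insert _ hf
          finite := hf.finite.insert _
          nonempty := by simp
          isChain := t.isChain_insert _ hf
          notMem := fun h ↦ hf.notMem (t.hereditary _ _ (Set.subset_insert _ _) h) }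
      obtain ⟨b, hb⟩ := exists_big (t := t) n _ hf' (by
        rw [t.elt_insert _ hf]; exact Set.mem_insert _ _)
      refine ⟨b, Or.inr (key _ ?_ ?_)⟩
      · intro i j hij
        exact b.strictMono (show b.index.succAbove i < b.index.succAbove j from
          Fin.strictMono_succAbove _ hij)
      · refine Eq.trans ?_ b.range_face.symm
        rw [hb, t.elt_insert _ hf, Set.insert_sdiff_self_of_notMem h]

/-- The rank function of a toggle. -/
noncomputable def rankFunction : t.pairingCore.WeakRankFunction ℕ where
  rank b := t.rank (Set.range ((nerve P).δ b.index b.simplex).obj)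
  lt {b b'} h hd := by
    obtain ⟨hne, hlt⟩ := h
    have hsub : Set.range ((nerve P).δ b.index b.simplex).obj ⊆ Set.range b'.simplex.obj := by
      obtain ⟨f, hf⟩ := SSet.S.le_iff.1 (show SSet.S.mk (X := (chains S' t.hereditary' : SSet)) (dim := b.dim)
        ⟨(nerve P).δ b.index b.simplex, b.mem_face⟩ ≤ SSet.S.mk (X := (chains S' t.hereditary' : SSet)) (dim := b'.dim + 1)
        ⟨b'.simplex, b'.mem'⟩ from hlt.le)
      replace hf := congrArg Subtype.val hf
      dsimp at f hf
      rw [← hf]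
      rintro _ ⟨i, rfl⟩
      exact ⟨_, rfl⟩
    have hb : b.dim = b'.dim := hd
    have hcard : (Set.range ((nerve P).δ b.index b.simplex).obj).ncard = b.dim + 1 := by
      rw [b.range_face, Set.ncard_sdiff_singleton_of_mem b.mem, ncard_range _ b.strictMono]
      lia
    have hcard' := ncard_range _ b'.strictMono
    -- By equality of dimensions the small face of `b` is a face of codimension one of `b'`, so it
    -- omits a single vertex.
    obtain ⟨x, hx⟩ : ∃ x, Set.range b'.simplex.obj \
        Set.range ((nerve P).δ b.index b.simplex).obj = {x} := by
      rw [← Set.ncard_eq_one, Set.ncard_sdiff hsub (b'.isFree.finite.subset hsub), hcard, hcard']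
      lia
    have hx' : Set.range ((nerve P).δ b.index b.simplex).obj = Set.range b'.simplex.obj \ {x} := by
      rw [← hx, Set.sdiff_sdiff_cancel_left hsub]
    have hmem : x ∈ Set.range b'.simplex.obj := by
      have : x ∈ ({x} : Set P) := rfl
      rw [← hx] at this
      exact this.1
    change t.rank (Set.range ((nerve P).δ b.index b.simplex).obj) <
      t.rank (Set.range ((nerve P).δ b'.index b'.simplex).obj)
    have h₁ := b.notMem_face
    have h₂ := b.elt_face_notMem
    rw [b'.range_face]
    rw [hx'] at h₁ h₂ ⊢
    refine t.rank_lt _ x b'.isFree b'.mem hmem ?_ h₁ h₂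
    rintro rfl
    apply hne
    apply Big.ext_of_range
    rw [← b.insert_face, ← b'.insert_face, hx', b'.range_face]

/-- The pairing prescribes the horns along which the missing simplices are attached. The rank
function makes it regular, and no horn is outer because the toggled vertex is neither the first nor
the last one. -/
lemma innerAnodyneExtensions : innerAnodyneExtensions t.sub.ι := by
  have : t.pairingCore.IsRegular := t.rankFunction.isRegular
  have : t.pairingCore.IsInner :=
    { ne_zero b h := by
        obtain ⟨_, ⟨i, rfl⟩, hx'⟩ := t.exists_lt _ b.isFree b.mem
        rw [← b.index_eq] at hx'
        replace h : b.index = 0 := h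
        rw [h] at hx'
        exact absurd (b.strictMono.lt_iff_lt.1 hx') (Fin.not_lt_zero _)
      ne_last b h := by
        obtain ⟨_, ⟨i, rfl⟩, hx'⟩ := t.exists_gt _ b.isFree b.mem
        rw [← b.index_eq] at hx'
        replace h : b.index = Fin.last _ := h
        rw [h] at hx'
        exact absurd (b.strictMono.lt_iff_lt.1 hx') (Fin.le_last (n := b.dim + 1) i).not_gt }
  exact t.pairingCore.pairing.innerAnodyneExtensions

/-- The opposite toggle. -/
noncomputable def dual : Toggle (P := Pᵒᵈ) S S' where
  hereditary := t.hereditary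
  hereditary' := t.hereditary'
  elt := t.elt
  rank := t.rank
  isChain_insert σ h := (t.isChain_insert σ ⟨h.1, h.2, h.3, h.4.symm, h.5⟩).symm
  mem_insert σ h := t.mem_insert σ ⟨h.1, h.2, h.3, h.4.symm, h.5⟩
  elt_insert σ h := t.elt_insert σ ⟨h.1, h.2, h.3, h.4.symm, h.5⟩
  notMem_diff σ h := t.notMem_diff σ ⟨h.1, h.2, h.3, h.4.symm, h.5⟩
  elt_diff σ h := t.elt_diff σ ⟨h.1, h.2, h.3, h.4.symm, h.5⟩
  exists_lt σ h := t.exists_gt σ ⟨h.1, h.2, h.3, h.4.symm, h.5⟩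
  exists_gt σ h := t.exists_lt σ ⟨h.1, h.2, h.3, h.4.symm, h.5⟩
  rank_lt σ x h := t.rank_lt σ x ⟨h.1, h.2, h.3, h.4.symm, h.5⟩

end Toggle

end Toggle

/-! ### Extending and gluing maps defined on subcomplexes -/

/-- Maps to quasicategories extend from the subcomplex `A` to the subcomplex `A'`. -/
def HasExt {X : SSet.{u}} (A A' : X.Subcomplex) : Prop :=
  ∀ (B : SSet.{u}) [Quasicategory B] (f : (A : SSet) ⟶ B), ∃ g : (A' : SSet) ⟶ B,
    ∀ (n : SimplexCategoryᵒᵖ) (x : X.obj n) (hx : x ∈ A.obj n) (hx' : x ∈ A'.obj n),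
      g.app n ⟨x, hx'⟩ = f.app n ⟨x, hx⟩

lemma exists_extension {K L : SSet.{u}} (i : K ⟶ L) (hi : innerAnodyneExtensions i) {B : SSet.{u}}
    [Quasicategory B] (f : K ⟶ B) : ∃ g : L ⟶ B, i ≫ g = f := by
  have := hi (Limits.terminal.from B) (mem_innerFibrations _)
  have sq : CommSq f i (Limits.terminal.from B) (Limits.terminal.from L) := ⟨Subsingleton.elim _ _⟩
  exact ⟨sq.lift, sq.fac_left⟩

lemma Toggle.hasExt {P : Type u} [PartialOrder P] {S S' : Set P → Prop} (t : Toggle S S') :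
    HasExt (chains S t.hereditary) (chains S' t.hereditary') := by
  intro B _ f
  obtain ⟨g, hg⟩ := exists_extension _ t.innerAnodyneExtensions
    (Subcomplex.lift (t.sub.ι ≫ (chains S' t.hereditary').ι) (by
      rintro n _ ⟨⟨x, hx⟩, rfl⟩
      exact hx) ≫ f)
  refine ⟨g, fun n x hx hx' ↦ ?_⟩
  exact congrArg (fun k : (t.sub : SSet) ⟶ B ↦ k.app n ⟨⟨x, hx'⟩, hx⟩) hg

/-- Gluing of maps which are defined on two subcomplexes. -/
lemma exists_glue {X Y : SSet.{u}} {A B : X.Subcomplex} (f : (A : SSet) ⟶ Y) (g : (B : SSet) ⟶ Y)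
    (h : ∀ n x hA hB, f.app n ⟨x, hA⟩ = g.app n ⟨x, hB⟩) :
    ∃ k : ((A ⊔ B : X.Subcomplex) : SSet) ⟶ Y,
      (∀ n x hA, k.app n ⟨x, Or.inl hA⟩ = f.app n ⟨x, hA⟩) ∧
      (∀ n x hB, k.app n ⟨x, Or.inr hB⟩ = g.app n ⟨x, hB⟩) := by
  classical
  let φ (n : SimplexCategoryᵒᵖ) (x : ((A ⊔ B : X.Subcomplex) : SSet).obj n) : Y.obj n :=
    if hA : x.1 ∈ A.obj n then f.app n ⟨x.1, hA⟩ else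
      g.app n ⟨x.1, x.2.resolve_left hA⟩
  have h₁ (n x hA) : φ n ⟨x, Or.inl hA⟩ = f.app n ⟨x, hA⟩ := dif_pos hA
  have h₂ (n x hB) : φ n ⟨x, Or.inr hB⟩ = g.app n ⟨x, hB⟩ := by
    by_cases hA : x ∈ A.obj n
    · exact (dif_pos hA).trans (h n x hA hB)
    · exact dif_neg hA
  refine ⟨{ app := fun n ↦ TypeCat.ofHom (φ n), naturality := ?_ }, h₁, h₂⟩
  intro n m a
  ext ⟨x, hA | hB⟩
  · refine (h₁ m _ (A.map a hA)).trans (Eq.trans ?_ (congrArg (Y.map a) (h₁ n x hA)).symm)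
    exact NatTrans.naturality_apply f a ⟨x, hA⟩
  · refine (h₂ m _ (B.map a hB)).trans (Eq.trans ?_ (congrArg (Y.map a) (h₂ n x hB)).symm)
    exact NatTrans.naturality_apply g a ⟨x, hB⟩

end InfCat

namespace InfCat

/-! ### Toggles determined by the largest element with a given property -/

section Builder

variable {P : Type u} [PartialOrder P]

/-- `b` is the largest element of `σ` which satisfies `C`. -/
structure IsLast (C : P → Prop) (σ : Set P) (b : P) : Prop where
  mem : b ∈ σ
  prop : C b
  le : ∀ z ∈ σ, C z → z ≤ b

lemma IsLast.unique {C : P → Prop} {σ : Set P} {b b' : P} (h : IsLast C σ b) (h' : IsLast C σ b') :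
    b = b' :=
  le_antisymm (h'.le _ h.mem h.prop) (h.le _ h'.mem h'.prop)

lemma exists_isLast {C : P → Prop} {σ : Set P} (hσ : σ.Finite) (hc : IsChain (· ≤ ·) σ)
    (h : ∃ z ∈ σ, C z) : ∃ b, IsLast C σ b := by
  obtain ⟨z, hz, hz'⟩ := h
  obtain ⟨b, hb⟩ := (hσ.subset (Set.sep_subset σ C)).exists_maximal ⟨z, hz, hz'⟩
  refine ⟨b, hb.1.1, hb.1.2, fun w hw hw' ↦ ?_⟩
  obtain h | h := hc.total hw hb.1.1
  · exact h
  · exact hb.2 ⟨hw, hw'⟩ h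

open Classical in
/-- The largest element which satisfies `C`. -/
noncomputable def lastElt [Nonempty P] (C : P → Prop) (σ : Set P) : P :=
  Classical.epsilon (IsLast C σ)

lemma lastElt_eq [Nonempty P] {C : P → Prop} {σ : Set P} {b : P} (h : IsLast C σ b) :
    lastElt C σ = b :=
  (Classical.epsilon_spec (p := IsLast C σ) ⟨b, h⟩).unique h

/-- The toggle of the element `φ b`, where `b` is the largest element which satisfies `C`. -/
noncomputable def toggleOfLast [Nonempty P] {S S' : Set P → Prop} (hS : IsHereditary S)
    (hS' : IsHereditary S') (C : P → Prop) (φ : P → P) (hφ : ∀ b, C b → ¬ C (φ b))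
    (hlt : ∀ b, C b → b < φ b)
    (hC : ∀ σ, IsFree S S' σ → ∃ z ∈ σ, C z)
    (hdiff : ∀ σ b, IsFree S S' σ → IsLast C σ b → ¬ S (σ \ {φ b}))
    (hchain : ∀ σ b, IsFree S S' σ → IsLast C σ b → ∀ z ∈ σ, z ≤ φ b ∨ φ b ≤ z)
    (hins : ∀ σ b, IsFree S S' σ → IsLast C σ b → S' (insert (φ b) σ))
    (hgt : ∀ σ b, IsFree S S' σ → IsLast C σ b → φ b ∈ σ → ∃ x ∈ σ, φ b < x) :
    Toggle S S' :=
  have key (σ : Set P) (hσ : IsFree S S' σ) : IsLast C σ (lastElt C σ) := by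
    obtain ⟨b, hb⟩ := exists_isLast hσ.finite hσ.isChain (hC σ hσ)
    rwa [lastElt_eq hb]
  have kdiff (σ : Set P) (x b : P) (hb : IsLast C σ b) (hx : x ≠ b) : IsLast C (σ \ {x}) b :=
    ⟨⟨hb.mem, hx.symm⟩, hb.prop, fun z hz hz' ↦ hb.le z hz.1 hz'⟩
  { hereditary := hS
    hereditary' := hS'
    elt σ := φ (lastElt C σ)
    -- Toggled elements do not satisfy `C`. Removing another vertex changes the toggled element only
    -- if this vertex is the last one with `C`, which lowers the count.
    rank σ := (σ ∩ {z | C z}).ncard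
    isChain_insert σ hσ := by
      refine hσ.isChain.insert fun z hz _ ↦ ?_
      exact (hchain σ _ hσ (key σ hσ) z hz).symm
    mem_insert σ hσ := hins σ _ hσ (key σ hσ)
    elt_insert σ hσ := by
      have h := key σ hσ
      have : IsLast C (insert (φ (lastElt C σ)) σ) (lastElt C σ) := by
        refine ⟨Set.mem_insert_of_mem _ h.mem, h.prop, ?_⟩
        rintro z (rfl | hz) hz'
        · exact (hφ _ h.prop hz').elim
        · exact h.le z hz hz'
      rw [lastElt_eq this]
    notMem_diff σ hσ _ := hdiff σ _ hσ (key σ hσ)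
    elt_diff σ hσ _ := by
      rw [lastElt_eq (kdiff σ _ _ (key σ hσ) (hlt _ (key σ hσ).prop).ne')]
    exists_lt σ hσ _ := ⟨_, (key σ hσ).mem, hlt _ (key σ hσ).prop⟩
    exists_gt σ hσ h := hgt σ _ hσ (key σ hσ) h
    rank_lt σ x hσ hmem hx hne _ h := by
      have hb := key σ hσ
      obtain rfl : x = lastElt C σ := by
        by_contra hxb
        rw [lastElt_eq (kdiff σ x _ hb hxb)] at h
        exact h ⟨hmem, hne.symm⟩
      apply Set.ncard_lt_ncard _ ((hσ.finite.subset Set.sdiff_subset).inter_of_left _)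
      refine ⟨?_, fun h' ↦ ?_⟩
      · rintro z ⟨hz, hz'⟩
        refine ⟨⟨hz.1, ?_⟩, hz'⟩
        rintro rfl
        exact hφ _ hb.prop hz'
      · exact (h' ⟨⟨hb.mem, (hlt _ hb.prop).ne⟩, hb.prop⟩).1.2 rfl }

end Builder

/-! ### The thickened poset and its two toggles -/

/-- The poset from which lifting properties of spaces of cones are deduced. Its elements
`(k, ε, q)` are organized in two layers, which coincide for `k = ⊥` and for `q = ⊤`. -/
def Thick (N Q : Type u) [LinearOrder N] [OrderBot N] [PartialOrder Q] [OrderTop Q] : Type u :=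
  {z : N × Bool × Q // (z.2.2 = ⊤ → z.2.1 = true) ∧ (z.1 = ⊥ → z.2.2 ≠ ⊤ → z.2.1 = false)}

namespace Thick

variable {N Q : Type u} [LinearOrder N] [OrderBot N] [PartialOrder Q] [OrderTop Q]

instance : PartialOrder (Thick N Q) := inferInstanceAs (PartialOrder (Subtype _))

instance : Nonempty (Thick N Q) := ⟨⟨(⊥, true, ⊤), by simp⟩⟩

def idx (z : Thick N Q) : N := z.1.1
def lay (z : Thick N Q) : Bool := z.1.2.1
def pos (z : Thick N Q) : Q := z.1.2.2

lemma le_iff {z w : Thick N Q} : z ≤ w ↔ z.idx ≤ w.idx ∧ z.lay ≤ w.lay ∧ z.pos ≤ w.pos := Iff.rfl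

lemma ext {z w : Thick N Q} (h₁ : z.idx = w.idx) (h₂ : z.lay = w.lay) (h₃ : z.pos = w.pos) :
    z = w :=
  Subtype.ext (Prod.ext h₁ (Prod.ext h₂ h₃))

lemma lay_of_top {z : Thick N Q} (h : z.pos = ⊤) : z.lay = true := z.2.1 h

lemma lay_of_bot {z : Thick N Q} (h : z.idx = ⊥) (h' : z.pos ≠ ⊤) : z.lay = false := z.2.2 h h'

open Classical in
/-- The collapsed index. -/
noncomputable def col (z : Thick N Q) : N := if z.lay = true then z.idx else ⊥

/-- The condition that the tip does not occur. -/
def NoTip (σ : Set (Thick N Q)) : Prop := ∀ z ∈ σ, z.pos ≠ ⊤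

/-- The condition that some index does not occur. -/
def Proper (σ : Set (Thick N Q)) : Prop := ∃ k, k ∉ idx '' σ

/-- The elements of the lower layer which are not in the upper layer. -/
def Lower (z : Thick N Q) : Prop := z.lay = false ∧ z.idx ≠ ⊥

/-- The elements of the upper layer which are not in the lower layer. -/
def Upper (z : Thick N Q) : Prop := z.lay = true ∧ z.pos ≠ ⊤

-- Three stages of an extension problem. `S₀` consists of the given data: everything away from the
-- tip, and the boundary in the upper layer. `S₁` contains the boundary in both layers and between
-- them, and `S₂` also all of the lower layer.
variable (N Q) in
def S₀ (σ : Set (Thick N Q)) : Prop := NoTip σ ∨ (Proper σ ∧ ∀ z ∈ σ, ¬ Lower z)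
variable (N Q) in
def S₁ (σ : Set (Thick N Q)) : Prop := NoTip σ ∨ Proper σ
variable (N Q) in
def S₂ (σ : Set (Thick N Q)) : Prop := S₁ N Q σ ∨ ∀ z ∈ σ, ¬ Upper z

lemma NoTip.mono : IsHereditary (NoTip (N := N) (Q := Q)) := fun _ _ h h' z hz ↦ h' z (h hz)

lemma Proper.mono : IsHereditary (Proper (N := N) (Q := Q)) := by
  rintro σ ρ h ⟨k, hk⟩
  exact ⟨k, fun h' ↦ hk (Set.image_mono h h')⟩

lemma S₀_mono : IsHereditary (S₀ N Q) := fun _ _ h ↦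
  Or.imp (NoTip.mono _ _ h) (And.imp (Proper.mono _ _ h) (fun h' z hz ↦ h' z (h hz)))

lemma S₁_mono : IsHereditary (S₁ N Q) := fun _ _ h ↦
  Or.imp (NoTip.mono _ _ h) (Proper.mono _ _ h)

lemma S₂_mono : IsHereditary (S₂ N Q) := fun _ _ h ↦
  Or.imp (S₁_mono _ _ h) (fun h' z hz ↦ h' z (h hz))

open Classical in
/-- The element over `z` in the upper layer. -/
noncomputable def up (z : Thick N Q) : Thick N Q :=
  ⟨(z.idx, decide (z.pos = ⊤ ∨ z.idx ≠ ⊥), z.pos), by simp +contextual, by simp +contextual⟩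

open Classical in
/-- The element below `z` in the lower layer. -/
noncomputable def down (z : Thick N Q) : Thick N Q :=
  ⟨(z.idx, decide (z.pos = ⊤), z.pos), by simp, by simp +contextual⟩

lemma lay_up {z : Thick N Q} : z.up.lay = true ↔ (z.pos = ⊤ ∨ z.idx ≠ ⊥) := by
  simp [lay, up]
lemma lay_down {z : Thick N Q} : z.down.lay = true ↔ z.pos = ⊤ := by simp [lay, down]

/-- Adding or removing the element above the last element of the lower layer. -/
noncomputable def toggle₁ : Toggle (S₀ N Q) (S₁ N Q) :=
  have top_mem (σ : Set (Thick N Q)) (h : IsFree (S₀ N Q) (S₁ N Q) σ) :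
      ∃ z ∈ σ, z.pos = ⊤ := by
    by_contra! h'
    exact h.notMem (Or.inl h')
  have proper (σ : Set (Thick N Q)) (h : IsFree (S₀ N Q) (S₁ N Q) σ) : Proper σ :=
    h.mem.resolve_left fun h' ↦ h.notMem (Or.inl h')
  have pos_ne (b : Thick N Q) (hb : Lower b) : b.pos ≠ ⊤ := fun h ↦ by
    have := lay_of_top h
    simp [hb.1] at this
  have up_lay (b : Thick N Q) (hb : Lower b) : b.up.lay = true := lay_up.2 (Or.inr hb.2)
  toggleOfLast S₀_mono S₁_mono Lower up
    (fun b hb h ↦ by simp [up_lay b hb, Lower] at h)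
    (fun b hb ↦ by
      refine lt_of_le_of_ne (le_iff.2 ⟨le_rfl, ?_, le_rfl⟩) (fun h ↦ ?_)
      · rw [up_lay b hb]; exact Bool.le_true _
      · have := up_lay b hb
        rw [← h, hb.1] at this
        exact absurd this (by simp))
    (fun σ h ↦ by
      by_contra! h'
      exact h.notMem (Or.inr ⟨proper σ h, h'⟩))
    (fun σ b h hb h' ↦ by
      obtain h' | h' := h'
      · obtain ⟨z, hz, hz'⟩ := top_mem σ h
        refine h' z ⟨hz, ?_⟩ hz'
        rintro rfl
        exact pos_ne b hb.prop hz'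
      · refine h'.2 b ⟨hb.mem, fun h ↦ ?_⟩ hb.prop
        have := up_lay b hb.prop
        rw [← show b = b.up from h, hb.prop.1] at this
        exact absurd this (by simp))
    -- Elements of the chain beyond `b` belong to the upper layer, because `b` is the last one which
    -- does not; hence they lie above `b.up`.
    (fun σ b h hb z hz ↦ by
      by_cases hz' : z ≤ b
      · exact Or.inl (hz'.trans (le_iff.2 ⟨le_rfl, by
          rw [up_lay b hb.prop]; exact Bool.le_true _, le_rfl⟩))
      · have hbz := (h.isChain.total hz hb.mem).resolve_left hz'
        have hl : z.lay = true := by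
          by_contra hl
          exact hz' (hb.le z hz ⟨by simpa using hl, fun h ↦ hb.prop.2
            (le_bot_iff.1 (h ▸ (le_iff.1 hbz).1))⟩)
        exact Or.inr (le_iff.2 ⟨(le_iff.1 hbz).1, by rw [hl]; exact Bool.le_true _,
          (le_iff.1 hbz).2.2⟩))
    (fun σ b h hb ↦ by
      obtain ⟨k, hk⟩ := proper σ h
      refine Or.inr ⟨k, ?_⟩
      rintro ⟨z, rfl | hz, rfl⟩
      · exact hk ⟨b, hb.mem, rfl⟩
      · exact hk ⟨z, hz, rfl⟩)
    (fun σ b h hb h' ↦ by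
      -- A free chain contains an element over the tip, and this lies strictly above `b.up`.
      obtain ⟨z, hz, hz'⟩ := top_mem σ h
      refine ⟨z, hz, lt_of_le_not_ge ((h.isChain.total h' hz).resolve_right fun h' ↦ ?_)
        fun h' ↦ ?_⟩
      all_goals exact pos_ne b hb.prop (top_le_iff.1 (hz' ▸ (le_iff.1 h').2.2)))

/-- Adding or removing the element below the first element of the upper layer. -/
noncomputable def toggle₂ : Toggle (S₂ N Q) (fun _ ↦ True) :=
  have top_mem (σ : Set (Thick N Q)) (h : ¬ S₂ N Q σ) : ∃ z ∈ σ, z.pos = ⊤ := by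
    by_contra! h'
    exact h (Or.inl (Or.inl h'))
  have full (σ : Set (Thick N Q)) (h : ¬ S₂ N Q σ) (k : N) : ∃ z ∈ σ, z.idx = k := by
    by_contra h'
    exact h (Or.inl (Or.inr ⟨k, h'⟩))
  have down_lay (b : Thick N Q) (hb : Upper b) : b.down.lay = false := by
    simpa using fun h ↦ hb.2 (lay_down.1 h)
  have down_le (b : Thick N Q) (hb : Upper b) : b.down ≤ b :=
    le_iff.2 ⟨le_rfl, by rw [down_lay b hb]; exact Bool.false_le _, le_rfl⟩
  have down_ne (b : Thick N Q) (hb : Upper b) : b.down ≠ b := fun h ↦ by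
    have := down_lay b hb
    rw [h, hb.1] at this
    exact absurd this (by simp)
  -- In the opposite order the first element of the upper layer becomes the last one.
  Toggle.dual <| toggleOfLast (P := (Thick N Q)ᵒᵈ) (S := S₂ N Q) S₂_mono (fun _ _ _ _ ↦ trivial)
    Upper down
    (fun b hb h ↦ by
      have := h.1
      rw [down_lay b hb] at this
      exact absurd this (by simp))
    (fun b hb ↦ lt_of_le_of_ne (α := Thick N Q) (down_le b hb) (down_ne b hb))
    (fun σ h ↦ by
      by_contra! h'
      exact h.notMem (Or.inr h'))
    (fun σ b h hb h' ↦ by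
      obtain (h' | ⟨k, hk⟩) | h' := h'
      · obtain ⟨z, hz, hz'⟩ := top_mem σ h.notMem
        refine h' z ⟨hz, ?_⟩ hz'
        rintro rfl
        exact hb.prop.2 hz'
      · obtain ⟨z, hz, rfl⟩ := full σ h.notMem k
        by_cases hzb : z = down b
        · exact hk ⟨b, ⟨hb.mem, fun h ↦ down_ne b hb.prop h.symm⟩, by rw [hzb]; rfl⟩
        · exact hk ⟨z, ⟨hz, hzb⟩, rfl⟩
      · exact h' b ⟨hb.mem, fun h ↦ down_ne b hb.prop h.symm⟩ hb.prop)
    (fun σ b h hb z hz ↦ by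
      have hc : IsChain (fun x y : Thick N Q ↦ x ≤ y) σ := h.isChain.symm
      change @LE.le (Thick N Q) _ b.down z ∨ @LE.le (Thick N Q) _ z b.down
      by_cases hz' : @LE.le (Thick N Q) _ b z
      · exact Or.inl ((down_le b hb.prop).trans hz')
      · have hbz : @LE.le (Thick N Q) _ z b := (hc.total hb.mem hz).resolve_left hz'
        have hp : z.pos ≠ ⊤ := fun h ↦ hb.prop.2 (top_le_iff.1 (h ▸ (le_iff.1 hbz).2.2))
        have hl : z.lay = false := by
          by_contra hl
          exact hz' (hb.le z hz ⟨by simpa using hl, hp⟩)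
        exact Or.inr (le_iff.2 ⟨(le_iff.1 hbz).1, by rw [hl]; exact Bool.false_le _,
          (le_iff.1 hbz).2.2⟩))
    (fun σ b h hb ↦ trivial)
    (fun σ b h hb h' ↦ by
      have hc : IsChain (fun x y : Thick N Q ↦ x ≤ y) σ := h.isChain.symm
      -- A chain outside of `S₂` meets every index. Its element of index `⊥` lies strictly below
      -- `b.down`, since away from the tip the upper layer has no elements of index `⊥`.
      obtain ⟨z, hz, hz'⟩ := full σ h.notMem ⊥
      have hne : ¬ @LE.le (Thick N Q) _ b.down z := fun h ↦ by
        have := lay_of_bot (le_bot_iff.1 (hz' ▸ (le_iff.1 h).1)) hb.prop.2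
        rw [hb.prop.1] at this
        exact absurd this (by simp)
      exact ⟨z, hz, lt_of_le_not_ge (α := Thick N Q) ((hc.total hz h').resolve_right hne) hne⟩)

end Thick

end InfCat

namespace InfCat

open CartesianMonoidalCategory (lift fst snd)

/-! ### Reduction of relative lifting problems to a fixed fibre -/

/-- The degenerate simplices of a vertex. -/
def cst {X : SSet.{u}} (v : X _⦋0⦌) (n : SimplexCategoryᵒᵖ) : X.obj n :=
  X.map (SimplexCategory.const n.unop ⦋0⦌ 0).op v

lemma app_cst {X Y : SSet.{u}} (f : X ⟶ Y) (v : X _⦋0⦌) (n : SimplexCategoryᵒᵖ) :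
    f.app n (cst v n) = cst (f.app _ v) n :=
  NatTrans.naturality_apply f _ v

lemma HasExt.exists_extension {X : SSet.{u}} {A A' : X.Subcomplex} (h : HasExt A A')
    (hA : A ≤ A') {B : SSet.{u}} [Quasicategory B] (f : (A : SSet) ⟶ B) :
    ∃ g : (A' : SSet) ⟶ B, ∀ n x (hx : x ∈ A.obj n), g.app n ⟨x, hA n hx⟩ = f.app n ⟨x, hx⟩ := by
  obtain ⟨g, hg⟩ := h B f
  exact ⟨g, fun n x hx ↦ hg n x hx _⟩

/-- A simplicial set with two maps from `L ⊗ Δ` which have a common retraction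
`(l, π)`, see `Thickening.exists_extension`. -/
structure Thickening {L Δ : SSet.{u}} (K : L.Subcomplex) (D : Δ.Subcomplex)
    (tip : L _⦋0⦌) (i₀ : Δ _⦋0⦌) where
  obj : SSet.{u}
  l : obj ⟶ L
  π : obj ⟶ Δ
  -- The index at which the data over `K` are evaluated: it is the actual index on the first copy of
  -- `L ⊗ Δ` and is collapsed to `i₀` on the second one.
  κ : obj ⟶ Δ
  j₁ : L ⊗ Δ ⟶ obj
  j₂ : L ⊗ Δ ⟶ obj
  V : obj.Subcomplex
  Y : obj.Subcomplex
  l_j₁ n x d : l.app n (j₁.app n (x, d)) = x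
  π_j₁ n x d : π.app n (j₁.app n (x, d)) = d
  l_j₂ n x d : l.app n (j₂.app n (x, d)) = x
  π_j₂ n x d : π.app n (j₂.app n (x, d)) = d
  κ_j₁ n x d (_ : x ∈ K.obj n) : κ.app n (j₁.app n (x, d)) = d
  κ_j₂ n x d (_ : x ∈ K.obj n) : κ.app n (j₂.app n (x, d)) = cst i₀ n
  j_tip n d : j₁.app n (cst tip n, d) = j₂.app n (cst tip n, d)
  j_cst n x : j₁.app n (x, cst i₀ n) = j₂.app n (x, cst i₀ n)
  mem_V n z : j₁.app n z ∈ V.obj n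
  mem_Y n z : j₂.app n z ∈ Y.obj n
  j₁_of_mem n z (_ : z ∈ V.obj n) : j₁.app n (l.app n z, π.app n z) = z
  j₂_of_mem n z (_ : z ∈ Y.obj n) : j₂.app n (l.app n z, π.app n z) = z
  hasExt₁ : HasExt (K.preimage l ⊔ (D.preimage π ⊓ V)) (K.preimage l ⊔ D.preimage π)
  hasExt₂ : HasExt ((K.preimage l ⊔ D.preimage π) ⊔ Y) ⊤

namespace Thickening

variable {L Δ : SSet.{u}} {K : L.Subcomplex} {D : Δ.Subcomplex}
    {tip : L _⦋0⦌} {i₀ : Δ _⦋0⦌} (T : Thickening K D tip i₀)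

include T in
-- The family `τ` lives over the varying data `σ`. It is transported along `σ` to a family `τ'` over
-- the constant data at `i₀`, without changing the values at the tip. A filler `Ω` of `τ'` over the
-- constant data is transported back to a filler `τ''` of `τ`. So it suffices to find fillers in a
-- single fibre.
theorem exists_extension {B : SSet.{u}} [Quasicategory B] (σ : (K : SSet) ⊗ Δ ⟶ B)
    (τ : L ⊗ (D : SSet) ⟶ B) (h : K.ι ▷ (D : SSet) ≫ τ = (K : SSet) ◁ D.ι ≫ σ) :
    ∃ τ' : L ⊗ (D : SSet) ⟶ B,
      (∀ n x d, τ'.app n (x.1, d) = σ.app n (x, cst i₀ n)) ∧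
      (∀ n x (hd : cst i₀ n ∈ D.obj n), τ'.app n (x, ⟨_, hd⟩) = τ.app n (x, ⟨_, hd⟩)) ∧
      (∀ n d, τ'.app n (cst tip n, d) = τ.app n (cst tip n, d)) ∧
      ∀ Ω : L ⊗ Δ ⟶ B, L ◁ D.ι ≫ Ω = τ' →
        (∀ n (x : (K : SSet).obj n) d, Ω.app n (x.1, d) = σ.app n (x, cst i₀ n)) →
        ∃ τ'' : L ⊗ Δ ⟶ B, L ◁ D.ι ≫ τ'' = τ ∧ K.ι ▷ Δ ≫ τ'' = σ ∧
          ∀ n d, τ''.app n (cst tip n, d) = Ω.app n (cst tip n, d) := by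
  have h' (n x d) : τ.app n (x.1, d) = σ.app n (x, d.1) :=
    congrArg (fun g : (K : SSet) ⊗ (D : SSet) ⟶ B ↦ g.app n (x, d)) h
  let f₁ : (K.preimage T.l : SSet) ⟶ B :=
    lift (Subcomplex.lift ((K.preimage T.l).ι ≫ T.l) (by
      rintro n _ ⟨⟨x, hx⟩, rfl⟩; exact hx)) ((K.preimage T.l).ι ≫ T.κ) ≫ σ
  let f₂ : ((D.preimage T.π ⊓ T.V : T.obj.Subcomplex) : SSet) ⟶ B :=
    lift ((D.preimage T.π ⊓ T.V).ι ≫ T.l) (Subcomplex.lift ((D.preimage T.π ⊓ T.V).ι ≫ T.π) (by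
      rintro n _ ⟨⟨x, hx⟩, rfl⟩; exact hx.1)) ≫ τ
  have hf₁ n z hz : f₁.app n ⟨z, hz⟩ = σ.app n (⟨T.l.app n z, hz⟩, T.κ.app n z) := rfl
  have hf₂ n z hz : f₂.app n ⟨z, hz⟩ = τ.app n (T.l.app n z, ⟨T.π.app n z, hz.1⟩) := rfl
  obtain ⟨k, hk₁, hk₂⟩ := exists_glue f₁ f₂ (fun n z hA hB ↦ by
    rw [hf₁, hf₂]
    refine Eq.trans ?_ (h' n ⟨T.l.app n z, hA⟩ ⟨T.π.app n z, hB.1⟩).symm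
    congr 2
    have := T.κ_j₁ n (T.l.app n z) (T.π.app n z) hA
    rwa [T.j₁_of_mem n z hB.2] at this)
  -- The given data are `σ` over `K` and `τ` on the boundary of the first copy. The first extension
  -- also produces the boundary of the second copy, which is the transported family.
  obtain ⟨Ψ, hΨ⟩ := T.hasExt₁.exists_extension
    (sup_le le_sup_left (inf_le_left.trans le_sup_right)) k
  have hΨc n {a b : T.obj.obj n} (hab : a = b) (ha) (hb) : Ψ.app n ⟨a, ha⟩ = Ψ.app n ⟨b, hb⟩ :=
    congrArg (fun w ↦ Ψ.app n w) (Subtype.ext hab)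
  have hm₂ (n x) (d : (D : SSet).obj n) :
      T.j₂.app n (x, d.1) ∈ (K.preimage T.l ⊔ D.preimage T.π : T.obj.Subcomplex).obj n := Or.inr
    ((T.π_j₂ n x d.1).symm ▸ d.2 : T.π.app n (T.j₂.app n (x, d.1)) ∈ D.obj n)
  have hm₁ (n x) (d : (D : SSet).obj n) :
      T.j₁.app n (x, d.1) ∈ (D.preimage T.π ⊓ T.V : T.obj.Subcomplex).obj n := 
    ⟨((T.π_j₁ n x d.1).symm ▸ d.2 : T.π.app n (T.j₁.app n (x, d.1)) ∈ D.obj n), T.mem_V n _⟩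
  have hΨK n z (hz : z ∈ (K.preimage T.l).obj n) :
      Ψ.app n ⟨z, Or.inl hz⟩ = σ.app n (⟨T.l.app n z, hz⟩, T.κ.app n z) :=
    (hΨ n z (Or.inl hz)).trans ((hk₁ n z hz).trans (hf₁ n z hz))
  have hΨj₁ n x d : Ψ.app n ⟨T.j₁.app n (x, d.1), Or.inr (hm₁ n x d).1⟩ = τ.app n (x, d) := by
    refine (hΨ n _ (Or.inr (hm₁ n x d))).trans ((hk₂ n _ (hm₁ n x d)).trans ((hf₂ n _ (hm₁ n x d)).trans ?_))
    exact congrArg (fun w ↦ τ.app n w) (Prod.ext (T.l_j₁ n x d.1) (Subtype.ext (T.π_j₁ n x d.1)))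
  let τ' : L ⊗ (D : SSet) ⟶ B :=
    Subcomplex.lift (L ◁ D.ι ≫ T.j₂) (by rintro n _ ⟨⟨x, d⟩, rfl⟩; exact hm₂ n x d) ≫ Ψ
  have hτ' n x d : τ'.app n (x, d) = Ψ.app n ⟨T.j₂.app n (x, d.1), hm₂ n x d⟩ := rfl
  refine ⟨τ', ?_, ?_, ?_, ?_⟩
  · intro n x d
    have hm : T.j₂.app n (x.1, d.1) ∈ (K.preimage T.l).obj n :=
      ((T.l_j₂ n x.1 d.1).symm ▸ x.2 : T.l.app n (T.j₂.app n (x.1, d.1)) ∈ K.obj n)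
    refine (hτ' n x.1 d).trans ((hΨK n _ hm).trans ?_)
    congr 1
    exact Prod.ext (Subtype.ext (T.l_j₂ n x.1 d.1)) (T.κ_j₂ n x.1 d.1 x.2)
  · intro n x hd
    refine (hτ' n x ⟨_, hd⟩).trans (Eq.trans ?_ (hΨj₁ n x ⟨_, hd⟩))
    exact hΨc n (T.j_cst n x).symm _ _
  · intro n d
    refine (hτ' n _ d).trans (Eq.trans ?_ (hΨj₁ n _ d))
    exact hΨc n (T.j_tip n d.1).symm _ _
  · intro Ω hΩ hΩK
    have hΩ' n x (d : (D : SSet).obj n) : Ω.app n (x, d.1) = τ'.app n (x, d) :=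
      congrArg (fun g : L ⊗ (D : SSet) ⟶ B ↦ g.app n (x, d)) hΩ
    -- Now `Ω` is placed on the second copy, and the second extension fills the first one.
    obtain ⟨m, hm₁', hm₂'⟩ := exists_glue Ψ (T.Y.ι ≫ lift T.l T.π ≫ Ω) (fun n z hA hB ↦ by
      change _ = Ω.app n (T.l.app n z, T.π.app n z)
      have hz := T.j₂_of_mem n z hB
      obtain hA | hA := hA
      · rw [hΨK n z hA]
        refine Eq.trans ?_ (hΩK n ⟨T.l.app n z, hA⟩ _).symm
        congr 2
        have := T.κ_j₂ n (T.l.app n z) (T.π.app n z) hA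
        rwa [hz] at this
      · refine Eq.trans ?_ (hΩ' n _ ⟨T.π.app n z, hA⟩).symm
        refine Eq.trans ?_ (hτ' n _ ⟨T.π.app n z, hA⟩).symm
        exact hΨc n hz.symm _ _)
    obtain ⟨g, hg⟩ := T.hasExt₂.exists_extension le_top m
    let τ'' : L ⊗ Δ ⟶ B := T.j₁ ≫ Subcomplex.lift (𝟙 _) (by simp) ≫ g
    have hτ'' n z : τ''.app n z = g.app n ⟨T.j₁.app n z, trivial⟩ := rfl
    refine ⟨τ'', ?_, ?_, ?_⟩
    · apply map_ext_app
      rintro n ⟨x, d⟩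
      refine Eq.trans ?_ (hΨj₁ _ x d)
      exact (hg _ _ (Or.inl (Or.inr (hm₁ _ x d).1))).trans (hm₁' _ _ (Or.inr (hm₁ _ x d).1))
    · apply map_ext_app
      rintro n ⟨x, d⟩
      have hm : T.j₁.app _ (x.1, d) ∈ (K.preimage T.l).obj _ :=
        ((T.l_j₁ _ x.1 d).symm ▸ x.2 : T.l.app _ (T.j₁.app _ (x.1, d)) ∈ K.obj _)
      refine (hg _ _ (Or.inl (Or.inl hm))).trans ((hm₁' _ _ (Or.inl hm)).trans
        ((hΨK _ _ hm).trans ?_))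
      congr 1
      exact Prod.ext (Subtype.ext (T.l_j₁ _ x.1 d)) (T.κ_j₁ _ x.1 d x.2)
    · intro n d
      have hmY : T.j₁.app n (cst tip n, d) ∈ T.Y.obj n := by
        rw [T.j_tip]; exact T.mem_Y n _
      refine (hg n _ (Or.inr hmY)).trans ((hm₂' _ _ hmY).trans ?_)
      change Ω.app n (T.l.app n _, T.π.app n _) = _
      exact congrArg (fun w ↦ Ω.app n w) (Prod.ext (T.l_j₁ n _ d) (T.π_j₁ n _ d))

/-- The map of nerves which is induced by a monotone map. -/
def ofMono {P Q : Type u} [PartialOrder P] [PartialOrder Q] (f : P → Q) (hf : Monotone f) :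
    nerve P ⟶ nerve Q := nerveMap hf.functor

def ofMono₂ {P Q R : Type u} [PartialOrder P] [PartialOrder Q] [PartialOrder R] (f : P × Q → R)
    (hf : Monotone f) : nerve P ⊗ nerve Q ⟶ nerve R where
  app n := TypeCat.ofHom fun x ↦ Monotone.functor (f := fun i ↦ f (x.1.obj i, x.2.obj i))
    (fun _ _ h ↦ hf ⟨x.1.monotone h, x.2.monotone h⟩)

/-- Thickenings from posets. -/
def ofPosets {P Q N : Type u} [PartialOrder P] [PartialOrder Q] [PartialOrder N]
    (l : P → Q) (π κ : P → N) (j₁ j₂ : Q × N → P) (hl : Monotone l) (hπ : Monotone π)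
    (hκ : Monotone κ) (hj₁ : Monotone j₁) (hj₂ : Monotone j₂) (V Y : P → Prop) (q₀ : Q) (k₀ : N)
    (l_j₁ : ∀ x, l (j₁ x) = x.1) (π_j₁ : ∀ x, π (j₁ x) = x.2)
    (l_j₂ : ∀ x, l (j₂ x) = x.1) (π_j₂ : ∀ x, π (j₂ x) = x.2)
    (κ_j₁ : ∀ x, x.1 ≠ q₀ → κ (j₁ x) = x.2) (κ_j₂ : ∀ x, x.1 ≠ q₀ → κ (j₂ x) = k₀)
    (j_tip : ∀ k, j₁ (q₀, k) = j₂ (q₀, k)) (j_cst : ∀ q, j₁ (q, k₀) = j₂ (q, k₀))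
    (mem_V : ∀ x, V (j₁ x)) (mem_Y : ∀ x, Y (j₂ x))
    (j₁_V : ∀ z, V z → j₁ (l z, π z) = z) (j₂_Y : ∀ z, Y z → j₂ (l z, π z) = z)
    (t₁ : Toggle (fun σ : Set P ↦ (∀ z ∈ σ, l z ≠ q₀) ∨ ((∃ k, k ∉ π '' σ) ∧ ∀ z ∈ σ, V z))
      (fun σ : Set P ↦ (∀ z ∈ σ, l z ≠ q₀) ∨ (∃ k, k ∉ π '' σ)))
    (t₂ : Toggle (fun σ : Set P ↦ ((∀ z ∈ σ, l z ≠ q₀) ∨ (∃ k, k ∉ π '' σ)) ∨ ∀ z ∈ σ, Y z)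
      (fun _ ↦ True))
    {L Δ : SSet.{u}} {K : L.Subcomplex} {D : Δ.Subcomplex}
    {tip : L _⦋0⦌} {i₀ : Δ _⦋0⦌} (φ : L ≅ nerve Q) (ψ : Δ ≅ nerve N)
    (hK : ∀ n x, x ∈ K.obj n ↔ ∀ i, (φ.hom.app n x).obj i ≠ q₀)
    (hD : ∀ n x, x ∈ D.obj n ↔ ∃ k, ∀ i, (ψ.hom.app n x).obj i ≠ k)
    (htip : (φ.hom.app _ tip).obj 0 = q₀) (hi₀ : (ψ.hom.app _ i₀).obj 0 = k₀) :
    Thickening K D tip i₀ :=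
  have hφ (n z) : φ.hom.app n (φ.inv.app n z) = z :=
    congrArg (fun g : nerve Q ⟶ nerve Q ↦ g.app n z) φ.inv_hom_id
  have hψ (n z) : ψ.hom.app n (ψ.inv.app n z) = z :=
    congrArg (fun g : nerve N ⟶ nerve N ↦ g.app n z) ψ.inv_hom_id
  have hφ' (n z) : φ.inv.app n (φ.hom.app n z) = z :=
    congrArg (fun g : L ⟶ L ↦ g.app n z) φ.hom_inv_id
  have hψ' (n z) : ψ.inv.app n (ψ.hom.app n z) = z :=
    congrArg (fun g : Δ ⟶ Δ ↦ g.app n z) ψ.hom_inv_id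
  have ex {n} {x y : (nerve P).obj n} (h : ∀ i, x.obj i = y.obj i) : x = y :=
    nerve.ext_of_isThin (funext h)
  have exQ {n} {x y : L.obj n} (h : ∀ i, (φ.hom.app n x).obj i = (φ.hom.app n y).obj i) :
      x = y := by
    rw [← hφ' n x, ← hφ' n y]; congr 1; exact nerve.ext_of_isThin (funext h)
  have exN {n} {x y : Δ.obj n} (h : ∀ i, (ψ.hom.app n x).obj i = (ψ.hom.app n y).obj i) :
      x = y := by
    rw [← hψ' n x, ← hψ' n y]; congr 1; exact nerve.ext_of_isThin (funext h)
  have htip' (n i) : (φ.hom.app n (cst tip n)).obj i = q₀ := by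
    rw [app_cst]; exact htip
  have hi₀' (n i) : (ψ.hom.app n (cst i₀ n)).obj i = k₀ := by
    rw [app_cst]; exact hi₀
  have hVs : IsHereditary (fun σ : Set P ↦ ∀ z ∈ σ, V z) := fun _ _ h h' z hz ↦ h' z (h hz)
  have hYs : IsHereditary (fun σ : Set P ↦ ∀ z ∈ σ, Y z) := fun _ _ h h' z hz ↦ h' z (h hz)
  let lm : nerve P ⟶ L := ofMono l hl ≫ φ.inv
  let πm : nerve P ⟶ Δ := ofMono π hπ ≫ ψ.inv
  let j₁m : L ⊗ Δ ⟶ nerve P := (φ.hom ⊗ₘ ψ.hom) ≫ ofMono₂ j₁ hj₁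
  let j₂m : L ⊗ Δ ⟶ nerve P := (φ.hom ⊗ₘ ψ.hom) ≫ ofMono₂ j₂ hj₂
  have hlm (n z i) : (φ.hom.app n (lm.app n z)).obj i = l (z.obj i) :=
    congrArg (fun w : (nerve Q).obj n ↦ w.obj i) (hφ n _)
  have hπm (n z i) : (ψ.hom.app n (πm.app n z)).obj i = π (z.obj i) :=
    congrArg (fun w : (nerve N).obj n ↦ w.obj i) (hψ n _)
  have hKm : K.preimage lm = chains (fun σ : Set P ↦ ∀ z ∈ σ, l z ≠ q₀)
      (fun _ _ h h' z hz ↦ h' z (h hz)) := by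
    ext n z
    refine (hK n _).trans ?_
    constructor
    · rintro h _ ⟨i, rfl⟩
      exact hlm n z i ▸ h i
    · intro h i
      exact (hlm n z i).symm ▸ h _ ⟨i, rfl⟩
  have hDm : D.preimage πm = chains (fun σ : Set P ↦ ∃ k, k ∉ π '' σ)
      (fun _ _ h ⟨k, hk⟩ ↦ ⟨k, fun h' ↦ hk (Set.image_mono h h')⟩) := by
    ext n z
    refine (hD n _).trans ?_
    constructor
    · rintro ⟨k, hk⟩
      refine ⟨k, ?_⟩
      rintro ⟨_, ⟨i, rfl⟩, hi⟩
      exact hk i ((hπm n z i).trans hi)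
    · rintro ⟨k, hk⟩
      exact ⟨k, fun i hi ↦ hk ⟨_, ⟨i, rfl⟩, (hπm n z i).symm.trans hi⟩⟩
  { obj := nerve P
    l := lm
    π := πm
    κ := ofMono κ hκ ≫ ψ.inv
    j₁ := j₁m
    j₂ := j₂m
    V := chains _ hVs
    Y := chains _ hYs
    l_j₁ n x d := exQ fun i ↦ (hlm n _ i).trans (l_j₁ _)
    π_j₁ n x d := exN fun i ↦ (hπm n _ i).trans (π_j₁ _)
    l_j₂ n x d := exQ fun i ↦ (hlm n _ i).trans (l_j₂ _)
    π_j₂ n x d := exN fun i ↦ (hπm n _ i).trans (π_j₂ _)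
    κ_j₁ n x d hx := exN fun i ↦ (congrArg (fun w : (nerve N).obj n ↦ w.obj i) (hψ n _)).trans
      (κ_j₁ _ ((hK n x).1 hx i))
    κ_j₂ n x d hx := exN fun i ↦ (congrArg (fun w : (nerve N).obj n ↦ w.obj i) (hψ n _)).trans
      ((κ_j₂ _ ((hK n x).1 hx i)).trans (hi₀' n i).symm)
    j_tip n d := ex fun i ↦ by
      change j₁ ((φ.hom.app n (cst tip n)).obj i, (ψ.hom.app n d).obj i) =
        j₂ ((φ.hom.app n (cst tip n)).obj i, (ψ.hom.app n d).obj i)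
      rw [htip', j_tip]
    j_cst n d := ex fun i ↦ by
      change j₁ ((φ.hom.app n d).obj i, (ψ.hom.app n (cst i₀ n)).obj i) =
        j₂ ((φ.hom.app n d).obj i, (ψ.hom.app n (cst i₀ n)).obj i)
      rw [hi₀', j_cst]
    mem_V n z := by rintro _ ⟨i, rfl⟩; exact mem_V _
    mem_Y n z := by rintro _ ⟨i, rfl⟩; exact mem_Y _
    j₁_of_mem n z hz := ex fun i ↦ by
      change j₁ ((φ.hom.app n (lm.app n z)).obj i, (ψ.hom.app n (πm.app n z)).obj i) = _
      rw [hlm, hπm]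
      exact j₁_V _ (hz _ ⟨i, rfl⟩)
    j₂_of_mem n z hz := ex fun i ↦ by
      change j₂ ((φ.hom.app n (lm.app n z)).obj i, (ψ.hom.app n (πm.app n z)).obj i) = _
      rw [hlm, hπm]
      exact j₂_Y _ (hz _ ⟨i, rfl⟩)
    hasExt₁ := by
      rw [hKm, hDm]
      exact t₁.hasExt
    hasExt₂ := by
      rw [hKm, hDm]
      have : (⊤ : (nerve P).Subcomplex) = chains (fun _ ↦ True) t₂.hereditary' := by
        ext n z
        simp [mem_chains]
      rw [this]
      exact t₂.hasExt }

end Thickening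

end InfCat

namespace InfCat

open CartesianMonoidalCategory (lift fst snd)

/-! ### The two layers of the thickened poset -/

namespace Thick

variable {N Q : Type u} [LinearOrder N] [OrderBot N] [PartialOrder Q] [OrderTop Q]

lemma monotone_col : Monotone (col (N := N) (Q := Q)) := by
  intro z w h
  obtain ⟨h₁, h₂, -⟩ := le_iff.1 h
  unfold col
  split_ifs with hz hw
  · exact h₁
  · rw [hz] at h₂
    exact absurd (Bool.eq_true_of_true_le h₂) hw
  · exact bot_le
  · exact le_rfl

open Classical in
/-- The inclusion of the upper layer. -/
noncomputable def inUp (x : Q × N) : Thick N Q :=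
  ⟨(x.2, decide (x.1 = ⊤ ∨ x.2 ≠ ⊥), x.1), by simp +contextual, by simp +contextual⟩

open Classical in
/-- The inclusion of the lower layer. -/
noncomputable def inDown (x : Q × N) : Thick N Q :=
  ⟨(x.2, decide (x.1 = ⊤), x.1), by simp, by simp +contextual⟩

lemma monotone_inUp : Monotone (inUp (N := N) (Q := Q)) := by
  rintro ⟨q, k⟩ ⟨q', k'⟩ ⟨h, h'⟩
  refine le_iff.2 ⟨h', ?_, h⟩
  dsimp at h h'
  refine Bool.le_iff_imp.2 fun h₁ ↦ ?_
  simp only [lay, inUp, decide_eq_true_eq] at h₁ ⊢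
  obtain rfl | h₁ := h₁
  · exact Or.inl (top_le_iff.1 h)
  · exact Or.inr fun h₂ ↦ h₁ (le_bot_iff.1 (h₂ ▸ h'))

lemma monotone_inDown : Monotone (inDown (N := N) (Q := Q)) := by
  rintro ⟨q, k⟩ ⟨q', k'⟩ ⟨h, h'⟩
  refine le_iff.2 ⟨h', ?_, h⟩
  dsimp at h h'
  refine Bool.le_iff_imp.2 fun h₁ ↦ ?_
  simp only [lay, inDown, decide_eq_true_eq] at h₁ ⊢
  obtain rfl := h₁
  exact top_le_iff.1 h

lemma col_inUp (x : Q × N) (h : x.1 ≠ ⊤) : col (inUp x) = x.2 := by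
  obtain ⟨q, k⟩ := x
  by_cases hk : k = ⊥ <;> simp_all [col, inUp, lay, idx]

lemma col_inDown (x : Q × N) (h : x.1 ≠ ⊤) : col (inDown x) = ⊥ := by
  simp_all [col, inDown, lay]

lemma inUp_tip (k : N) : inUp ((⊤ : Q), k) = inDown (⊤, k) :=
  ext rfl (by simp [lay, inUp, inDown]) rfl

lemma inUp_bot (q : Q) : inUp (q, (⊥ : N)) = inDown (q, ⊥) :=
  ext rfl (by simp [lay, inUp, inDown]) rfl

lemma not_lower_inUp (x : Q × N) : ¬ Lower (inUp x) := by
  simp +contextual [Lower, inUp, lay, idx]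

lemma not_upper_inDown (x : Q × N) : ¬ Upper (inDown x) := by
  simp +contextual [Upper, inDown, lay, pos]

open Classical in
lemma inUp_of_not_lower (z : Thick N Q) (h : ¬ Lower z) : inUp (z.pos, z.idx) = z := by
  have h₁ := z.2.1
  have h₂ := z.2.2
  refine ext rfl ?_ rfl
  simp only [Lower, not_and, not_not] at h
  change z.pos = ⊤ → z.lay = true at h₁
  change z.idx = ⊥ → z.pos ≠ ⊤ → z.lay = false at h₂
  change decide (z.pos = ⊤ ∨ z.idx ≠ ⊥) = z.lay
  cases hl : z.lay <;> simp_all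
  tauto

open Classical in
lemma inDown_of_not_upper (z : Thick N Q) (h : ¬ Upper z) : inDown (z.pos, z.idx) = z := by
  have h₁ := z.2.1
  refine ext rfl ?_ rfl
  simp only [Upper, not_and, not_not] at h
  change z.pos = ⊤ → z.lay = true at h₁
  change decide (z.pos = ⊤) = z.lay
  cases hl : z.lay <;> simp_all

variable {L Δ : SSet.{u}} {K : L.Subcomplex} {D : Δ.Subcomplex} {tip : L _⦋0⦌} {i₀ : Δ _⦋0⦌}

/-- The thickening for spaces of cocones. -/
noncomputable def thickening (φ : L ≅ nerve Q) (ψ : Δ ≅ nerve N)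
    (hK : ∀ n x, x ∈ K.obj n ↔ ∀ i, (φ.hom.app n x).obj i ≠ ⊤)
    (hD : ∀ n x, x ∈ D.obj n ↔ ∃ k, ∀ i, (ψ.hom.app n x).obj i ≠ k)
    (htip : (φ.hom.app _ tip).obj 0 = ⊤) (hi₀ : (ψ.hom.app _ i₀).obj 0 = ⊥) :
    Thickening K D tip i₀ :=
  Thickening.ofPosets (P := Thick N Q) pos idx col inUp inDown (fun _ _ h ↦ (le_iff.1 h).2.2)
    (fun _ _ h ↦ (le_iff.1 h).1) monotone_col monotone_inUp monotone_inDown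
    (fun z ↦ ¬ Lower z) (fun z ↦ ¬ Upper z) ⊤ ⊥ (fun _ ↦ rfl) (fun _ ↦ rfl) (fun _ ↦ rfl)
    (fun _ ↦ rfl) col_inUp col_inDown inUp_tip inUp_bot not_lower_inUp not_upper_inDown
    inUp_of_not_lower inDown_of_not_upper toggle₁ toggle₂ φ ψ hK hD htip hi₀

/-- The thickening for spaces of cones. -/
noncomputable def thickeningDual (φ : L ≅ nerve Qᵒᵈ) (ψ : Δ ≅ nerve Nᵒᵈ)
    (hK : ∀ n x, x ∈ K.obj n ↔ ∀ i, (φ.hom.app n x).obj i ≠ OrderDual.toDual ⊤)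
    (hD : ∀ n x, x ∈ D.obj n ↔ ∃ k, ∀ i, (ψ.hom.app n x).obj i ≠ k)
    (htip : (φ.hom.app _ tip).obj 0 = OrderDual.toDual ⊤)
    (hi₀ : (ψ.hom.app _ i₀).obj 0 = OrderDual.toDual ⊥) :
    Thickening K D tip i₀ :=
  Thickening.ofPosets (P := (Thick N Q)ᵒᵈ) (Q := Qᵒᵈ) (N := Nᵒᵈ)
    (pos (N := N) (Q := Q)) (idx (N := N) (Q := Q)) (col (N := N) (Q := Q))
    (inUp (N := N) (Q := Q)) (inDown (N := N) (Q := Q))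
    (fun _ _ h ↦ (le_iff.1 h).2.2)
    (fun _ _ h ↦ (le_iff.1 h).1) (fun _ _ h ↦ monotone_col h)
    (fun _ _ h ↦ monotone_inUp (N := N) (Q := Q) h)
    (fun _ _ h ↦ monotone_inDown (N := N) (Q := Q) h)
    (fun z ↦ ¬ Lower (N := N) (Q := Q) z) (fun z ↦ ¬ Upper (N := N) (Q := Q) z) (OrderDual.toDual ⊤) (OrderDual.toDual ⊥)
    (fun _ ↦ rfl) (fun _ ↦ rfl) (fun _ ↦ rfl)
    (fun _ ↦ rfl) (col_inUp (N := N) (Q := Q)) (col_inDown (N := N) (Q := Q))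
    (inUp_tip (N := N) (Q := Q)) (inUp_bot (N := N) (Q := Q)) (not_lower_inUp (N := N) (Q := Q))
    (not_upper_inDown (N := N) (Q := Q)) (inUp_of_not_lower (N := N) (Q := Q))
    (inDown_of_not_upper (N := N) (Q := Q)) (toggle₁ (N := N) (Q := Q)).dual
    (toggle₂ (N := N) (Q := Q)).dual φ ψ hK hD htip hi₀

end Thick

/-! ### Standard simplices and the square as nerves of posets -/

section Instances

/-- The standard simplex as a nerve. -/
noncomputable def stdNerve (n : ℕ) {N : Type u} [PartialOrder N] (e : Fin (n + 1) ≃o N) :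
    (Δ[n] : SSet.{u}) ≅ nerve N :=
  NatIso.ofComponents (fun d ↦ Equiv.toIso (stdSimplex.objEquiv.trans
    { toFun f := (e.monotone.comp f.toOrderHom.monotone).functor
      invFun f := SimplexCategory.Hom.mk (e.symm.toOrderEmbedding.toOrderHom.comp f.toOrderHom)
      left_inv f := by aesop
      right_inv f := by
        apply nerve.ext_of_isThin
        funext i
        exact e.apply_symm_apply _ }))

lemma stdNerve_obj {n : ℕ} {N : Type u} [PartialOrder N] (e : Fin (n + 1) ≃o N)
    {d : SimplexCategoryᵒᵖ} (s : (Δ[n] : SSet.{u}).obj d) (i : Fin (d.unop.len + 1)) :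
    ((stdNerve n e).hom.app d s).obj i = e ((stdSimplex.objEquiv s).toOrderHom i) := rfl

/-- The square as a nerve. -/
noncomputable def squareNerve {Q : Type u} [PartialOrder Q] (e : Fin 2 × Fin 2 ≃o Q) :
    Square.{u} ≅ nerve Q :=
  NatIso.ofComponents (fun d ↦ Equiv.toIso
    { toFun f := Monotone.functor (f := fun i ↦ e ((stdSimplex.objEquiv f.1).toOrderHom i,
          (stdSimplex.objEquiv f.2).toOrderHom i)) (fun i j h ↦ e.monotone
            ⟨(stdSimplex.objEquiv f.1).toOrderHom.monotone h,
              (stdSimplex.objEquiv f.2).toOrderHom.monotone h⟩)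
      invFun f := ⟨stdSimplex.objEquiv.symm (SimplexCategory.Hom.mk
          (OrderHom.fst.comp (e.symm.toOrderEmbedding.toOrderHom.comp f.toOrderHom))),
        stdSimplex.objEquiv.symm (SimplexCategory.Hom.mk
          (OrderHom.snd.comp (e.symm.toOrderEmbedding.toOrderHom.comp f.toOrderHom)))⟩
      left_inv f := by
        refine Prod.ext ?_ ?_
        · apply stdSimplex.objEquiv.injective
          ext i
          exact congrArg (fun z : Fin 2 × Fin 2 ↦ (z.1 : ℕ)) (e.symm_apply_apply _)
        · apply stdSimplex.objEquiv.injective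
          ext i
          exact congrArg (fun z : Fin 2 × Fin 2 ↦ (z.2 : ℕ)) (e.symm_apply_apply _)
      right_inv f := by
        apply nerve.ext_of_isThin
        funext i
        exact e.apply_symm_apply _ })

lemma squareNerve_obj {Q : Type u} [PartialOrder Q] (e : Fin 2 × Fin 2 ≃o Q)
    {d : SimplexCategoryᵒᵖ} (s : Square.{u}.obj d) (i : Fin (d.unop.len + 1)) :
    ((squareNerve e).hom.app d s).obj i = e ((stdSimplex.objEquiv s.1).toOrderHom i,
      (stdSimplex.objEquiv s.2).toOrderHom i) := rfl

lemma mem_ofSimplex_vertex_iff {n : ℕ} (k : Fin (n + 1)) {d : SimplexCategoryᵒᵖ}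
    (s : (Δ[n] : SSet.{u}).obj d) :
    s ∈ (Subcomplex.ofSimplex (stdSimplex.obj₀Equiv.symm k : (Δ[n] : SSet.{u}) _⦋0⦌)).obj d ↔
      ∀ i, (stdSimplex.objEquiv s).toOrderHom i = k := by
  rw [Subcomplex.mem_ofSimplex_obj_iff]
  constructor
  · rintro ⟨f, rfl⟩ i
    rfl
  · intro h
    refine ⟨SimplexCategory.const _ _ 0, ?_⟩
    apply stdSimplex.objEquiv.injective
    ext i
    rw [h i]
    rfl

lemma mem_boundary_iff' {n : ℕ} {d : SimplexCategoryᵒᵖ} (s : (Δ[n] : SSet.{u}).obj d) :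
    s ∈ (∂Δ[n] : (Δ[n] : SSet.{u}).Subcomplex).obj d ↔
      ∃ k, ∀ i, (stdSimplex.objEquiv s).toOrderHom i ≠ k := by
  change ¬ Function.Surjective _ ↔ _
  simp only [Function.Surjective, not_forall, not_exists]
  rfl

end Instances

end InfCat

namespace InfCat

open CartesianMonoidalCategory (lift fst snd)

/-! ### Thickenings for arrows, spans and cospans -/

/-- The thickening for comma objects. -/
noncomputable def pointThickening (n : ℕ) :
    Thickening (Subcomplex.ofSimplex v0 : (Δ[1] : SSet.{u}).Subcomplex) (∂Δ[n + 1]) v1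
      (stdSimplex.obj₀Equiv.symm 0) :=
  Thick.thickening (N := ULift.{u} (Fin (n + 2))) (Q := ULift.{u} (Fin 2))
    (stdNerve 1 ULift.orderIso.symm) (stdNerve (n + 1) ULift.orderIso.symm)
    (fun d x ↦ by
      rw [mem_ofSimplex_vertex_iff]
      refine forall_congr' fun i ↦ ?_
      rw [stdNerve_obj]
      generalize (stdSimplex.objEquiv x).toOrderHom i = k
      change k = 0 ↔ (ULift.up k : ULift.{u} (Fin 2)) ≠ ULift.up 1
      simp only [ne_eq, ULift.up.injEq]
      lia)
    (fun d x ↦ by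
      rw [mem_boundary_iff']
      refine ⟨fun ⟨k, hk⟩ ↦ ⟨ULift.up k, fun i h ↦ hk i (congrArg ULift.down h)⟩,
        fun ⟨k, hk⟩ ↦ ⟨k.down, fun i h ↦ hk i (congrArg ULift.up h)⟩⟩)
    rfl rfl

lemma forall_or_forall_iff_bot {d : SimplexCategoryᵒᵖ} (x : Square.{u}.obj d) :
    ((∀ i, (stdSimplex.objEquiv x.2).toOrderHom i = 0) ∨
      (∀ i, (stdSimplex.objEquiv x.1).toOrderHom i = 0)) ↔
    ∀ i, ((squareNerve (Q := ULift.{u} (Fin 2 × Fin 2)) ULift.orderIso.symm).hom.app d x).obj i ≠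
      ⊤ := by
  have key (i) : ((squareNerve (Q := ULift.{u} (Fin 2 × Fin 2)) ULift.orderIso.symm).hom.app d
      x).obj i ≠ ⊤ ↔ ((stdSimplex.objEquiv x.2).toOrderHom i = 0 ∨
      (stdSimplex.objEquiv x.1).toOrderHom i = 0) := by
    rw [squareNerve_obj]
    generalize (stdSimplex.objEquiv x.1).toOrderHom i = k
    generalize (stdSimplex.objEquiv x.2).toOrderHom i = l
    change (ULift.up (k, l) : ULift.{u} (Fin 2 × Fin 2)) ≠ ULift.up (1, 1) ↔ _
    simp only [ne_eq, ULift.up.injEq, Prod.mk.injEq]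
    lia
  simp only [key]
  refine ⟨fun h i ↦ h.imp (fun h ↦ h i) (fun h ↦ h i), fun h ↦ ?_⟩
  -- A coordinate which vanishes at the last vertex vanishes on the whole chain.
  obtain h' | h' := h (Fin.last _)
  · exact Or.inl fun i ↦ Fin.le_zero_iff.1
      (h' ▸ (stdSimplex.objEquiv x.2).toOrderHom.monotone (Fin.le_last i))
  · exact Or.inr fun i ↦ Fin.le_zero_iff.1
      (h' ▸ (stdSimplex.objEquiv x.1).toOrderHom.monotone (Fin.le_last i))

lemma forall_or_forall_iff_top {d : SimplexCategoryᵒᵖ} (x : Square.{u}.obj d) :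
    ((∀ i, (stdSimplex.objEquiv x.2).toOrderHom i = 1) ∨
      (∀ i, (stdSimplex.objEquiv x.1).toOrderHom i = 1)) ↔
    ∀ i, ((squareNerve (Q := (ULift.{u} (Fin 2 × Fin 2))ᵒᵈᵒᵈ) (ULift.orderIso.symm.trans
      (OrderIso.dualDual _))).hom.app d x).obj i ≠ OrderDual.toDual ⊤ := by
  have key (i) : ((squareNerve (Q := (ULift.{u} (Fin 2 × Fin 2))ᵒᵈᵒᵈ) (ULift.orderIso.symm.trans
      (OrderIso.dualDual _))).hom.app d x).obj i ≠ OrderDual.toDual ⊤ ↔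
      ((stdSimplex.objEquiv x.2).toOrderHom i = 1 ∨
      (stdSimplex.objEquiv x.1).toOrderHom i = 1) := by
    rw [squareNerve_obj]
    generalize (stdSimplex.objEquiv x.1).toOrderHom i = k
    generalize (stdSimplex.objEquiv x.2).toOrderHom i = l
    change (ULift.up (k, l) : ULift.{u} (Fin 2 × Fin 2)) ≠ ULift.up (0, 0) ↔ _
    simp only [ne_eq, ULift.up.injEq, Prod.mk.injEq]
    lia
  simp only [key]
  refine ⟨fun h i ↦ h.imp (fun h ↦ h i) (fun h ↦ h i), fun h ↦ ?_⟩
  obtain h' | h' := h 0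
  · exact Or.inl fun i ↦ Fin.last_le_iff.1 (h'.ge.trans
      ((stdSimplex.objEquiv x.2).toOrderHom.monotone (Fin.zero_le i)))
  · exact Or.inr fun i ↦ Fin.last_le_iff.1 (h'.ge.trans
      ((stdSimplex.objEquiv x.1).toOrderHom.monotone (Fin.zero_le i)))

/-- The thickening for squares under a span. -/
noncomputable def spanThickening (n : ℕ) :
    Thickening span.{u} (∂Δ[n + 1]) (v1, v1) (stdSimplex.obj₀Equiv.symm 0) :=
  Thick.thickening (N := ULift.{u} (Fin (n + 2))) (Q := ULift.{u} (Fin 2 × Fin 2))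
    (squareNerve ULift.orderIso.symm) (stdNerve (n + 1) ULift.orderIso.symm)
    (fun d x ↦ by
      refine (Subcomplex.mem_unionProd_iff _ _ x).trans ?_
      rw [mem_ofSimplex_vertex_iff, mem_ofSimplex_vertex_iff]
      exact forall_or_forall_iff_bot x)
    (fun d x ↦ by
      rw [mem_boundary_iff']
      refine ⟨fun ⟨k, hk⟩ ↦ ⟨ULift.up k, fun i h ↦ hk i (congrArg ULift.down h)⟩,
        fun ⟨k, hk⟩ ↦ ⟨k.down, fun i h ↦ hk i (congrArg ULift.up h)⟩⟩)
    rfl rfl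

/-- The thickening for squares over a cospan. -/
noncomputable def cospanThickening (n : ℕ) :
    Thickening cospan.{u} (∂Δ[n + 1]) (v0, v0) (stdSimplex.obj₀Equiv.symm (Fin.last (n + 1))) :=
  Thick.thickeningDual (N := (ULift.{u} (Fin (n + 2)))ᵒᵈ) (Q := (ULift.{u} (Fin 2 × Fin 2))ᵒᵈ)
    (squareNerve (ULift.orderIso.symm.trans (OrderIso.dualDual _)))
    (stdNerve (n + 1) (ULift.orderIso.symm.trans (OrderIso.dualDual _)))
    (fun d x ↦ by
      refine (Subcomplex.mem_unionProd_iff _ _ x).trans ?_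
      rw [mem_ofSimplex_vertex_iff, mem_ofSimplex_vertex_iff]
      exact forall_or_forall_iff_top x)
    (fun d x ↦ by
      rw [mem_boundary_iff']
      refine ⟨fun ⟨k, hk⟩ ↦ ⟨ULift.up k, fun i h ↦ hk i (congrArg ULift.down h)⟩,
        fun ⟨k, hk⟩ ↦ ⟨k.down, fun i h ↦ hk i (congrArg ULift.up h)⟩⟩)
    rfl rfl

/-! ### Relatively initial and relatively terminal vertices -/

/-- The vertex `m` is initial (for `j = 0`) or terminal (for `j = last`) in its fibre, in the strong
sense that it is initial or terminal relative to `p`. -/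
def IsLoc (j : ∀ n : ℕ, Fin (n + 2)) {M B : SSet.{u}} (p : M ⟶ B) (m : M _⦋0⦌) : Prop :=
  ∀ (n : ℕ) (f : (∂Δ[n + 1] : SSet.{u}) ⟶ M) (b : Δ[n + 1] ⟶ B), f ≫ p = ∂Δ[n + 1].ι ≫ b →
    (∀ w : (∂Δ[n + 1] : SSet.{u}) _⦋0⦌, w.1 = stdSimplex.obj₀Equiv.symm (j n) → f.app _ w = m) →
    ∃ g : Δ[n + 1] ⟶ M, ∂Δ[n + 1].ι ≫ g = f ∧ g ≫ p = b

lemma yonedaEquiv_comp_apply {X Y : SSet.{u}} {n : ℕ} (f : Δ[n] ⟶ X) (g : X ⟶ Y) :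
    SSet.yonedaEquiv (f ≫ g) = g.app _ (SSet.yonedaEquiv f) := rfl

lemma yonedaEquiv_symm_vertex {X : SSet.{u}} (x : X _⦋0⦌) (v : (Δ[0] : SSet.{u}) _⦋0⦌) :
    (SSet.yonedaEquiv.symm x).app _ v = x := by
  obtain ⟨k, rfl⟩ := stdSimplex.obj₀Equiv.symm.surjective v
  obtain rfl : k = 0 := Subsingleton.elim (α := Fin 1) _ _
  exact map_const_self X x

/-! ### Lifting along monomorphisms, cell by cell -/

section Lift

variable {K L M B : SSet.{u}} (i : K ⟶ L) [Mono i] (p : M ⟶ B) (f : K ⟶ M) (b : L ⟶ B)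
  (s : L _⦋0⦌ → M _⦋0⦌)

open relativeCellComplexOfMono in
include s in
-- Induction over the relative skeleta of `i`. The lifts `s` of the vertices are fixed in advance,
-- so that the condition on a cell of positive dimension can refer to the lift of a particular
-- vertex of this cell.
theorem exists_lift_of_cells (w : f ≫ p = i ≫ b) (hs : ∀ v, p.app _ (s v) = b.app _ v)
    (hf : ∀ v, f.app _ v = s (i.app _ v))
    (hcell : ∀ (n : ℕ) (x : L _⦋n + 1⦌), x ∈ L.nonDegenerate _ → x ∉ Set.range (i.app _) →
      ∀ φ : (∂Δ[n + 1] : SSet.{u}) ⟶ M, φ ≫ p = ∂Δ[n + 1].ι ≫ SSet.yonedaEquiv.symm x ≫ b →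
      (∀ v, φ.app _ v = s ((SSet.yonedaEquiv.symm x).app _ v.1)) →
      ∃ g : Δ[n + 1] ⟶ M, ∂Δ[n + 1].ι ≫ g = φ ∧ g ≫ p = SSet.yonedaEquiv.symm x ≫ b) :
    ∃ g : L ⟶ M, i ≫ g = f ∧ g ≫ p = b ∧ ∀ v, g.app _ v = s v := by
  let Good (d : ℕ) (g : (skeletonOfMono i d : SSet) ⟶ M) : Prop :=
    g ≫ p = (skeletonOfMono i d).ι ≫ b ∧ ∀ v, g.app (op ⦋0⦌) v = s v.1
  have step (d : ℕ) (g : (skeletonOfMono i d : SSet) ⟶ M) (hg : Good d g) :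
      ∃ g' : (skeletonOfMono i (d + 1) : SSet) ⟶ M, Good (d + 1) g' ∧ r i d ≫ g' = g := by
    let tc (c : Cell i d) : (∂Δ[d] : SSet.{u}) ⟶ skeletonOfMono i d := c.ιSigmaBoundary ≫ t i d
    have htc (c : Cell i d) : tc c ≫ (skeletonOfMono i d).ι = ∂Δ[d].ι ≫ c.map := by
      simp only [tc, Category.assoc]
      rw [c.ι_t_ι_eq_ι_l_b_ι, c.ι_b_ι]
    have hc (c : Cell i d) : ∃ h : Δ[d] ⟶ M, ∂Δ[d].ι ≫ h = tc c ≫ g ∧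
        h ≫ p = c.map ≫ b ∧ ∀ v, h.app (op ⦋0⦌) v = s (c.map.app _ v) := by
      have htg v : (tc c ≫ g).app (op ⦋0⦌) v = s (c.map.app _ v.1) :=
        (hg.2 _).trans (congrArg s (congrArg (fun k : (∂Δ[d] : SSet.{u}) ⟶ L ↦ k.app _ v) (htc c)))
      obtain ⟨x, hx, hx'⟩ := c
      obtain _ | d := d
      · refine ⟨SSet.yonedaEquiv.symm (s x), ?_, ?_, ?_⟩
        · apply map_ext_app
          rintro n ⟨y, hy⟩
          rw [boundary_zero] at hy
          exact hy.elim
        · apply SSet.yonedaEquiv.injective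
          rw [yonedaEquiv_comp_apply, Equiv.apply_symm_apply, hs, yonedaEquiv_comp_apply,
            Equiv.apply_symm_apply]
        · intro v
          rw [yonedaEquiv_symm_vertex, yonedaEquiv_symm_vertex]
      · obtain ⟨h, hh, hh'⟩ := hcell d x hx hx' (tc ⟨x, hx, hx'⟩ ≫ g) (by
          rw [Category.assoc, hg.1, ← Category.assoc, htc, Category.assoc]) htg
        refine ⟨h, hh, hh', fun v ↦ ?_⟩
        have hv : v ∈ (boundary.{u} (d + 1)).obj (op ⦋0⦌) := by
          rw [boundary_obj_eq_univ 0 (d + 1)]; trivial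
        exact (congrArg (fun k : (∂Δ[d + 1] : SSet.{u}) ⟶ M ↦ k.app _ ⟨v, hv⟩) hh).trans
          (htg ⟨v, hv⟩)
    choose h h₁ h₂ h₃ using hc
    obtain ⟨g', hg'₁, hg'₂⟩ : ∃ g' : (skeletonOfMono i (d + 1) : SSet) ⟶ M,
        r i d ≫ g' = g ∧ relativeCellComplexOfMono.b i d ≫ g' = Limits.Sigma.desc h :=
      ⟨(isPushout i d).desc g (Limits.Sigma.desc h) (by
        apply Limits.Sigma.hom_ext
        intro c
        refine (Category.assoc _ _ _).symm.trans ((h₁ c).symm.trans ?_)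
        refine Eq.trans ?_ (Category.assoc _ _ _)
        refine Eq.trans ?_ (congrArg (fun k ↦ k ≫ Limits.Sigma.desc h) c.ι_l.symm)
        refine Eq.trans ?_ (Category.assoc _ _ _).symm
        rw [Limits.Sigma.ι_desc]), (isPushout i d).inl_desc _ _ _, (isPushout i d).inr_desc _ _ _⟩
    have hg'c (c : Cell i d) :
        Subcomplex.lift c.map c.range_map_le ≫ g' = h c := by
      have := congrArg (fun k ↦ c.ιSigmaStdSimplex ≫ k) hg'₂
      change c.ιSigmaStdSimplex ≫ relativeCellComplexOfMono.b i d ≫ g' =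
        c.ιSigmaStdSimplex ≫ Limits.Sigma.desc h at this
      rwa [Limits.Sigma.ι_desc, Limits.Sigma.ι_desc_assoc] at this
    refine ⟨g', ⟨?_, ?_⟩, hg'₁⟩
    · apply (isPushout i d).hom_ext
      · rw [← Category.assoc, hg'₁, hg.1]
        rfl
      · apply Limits.Sigma.hom_ext
        intro c
        rw [Limits.Sigma.ι_desc_assoc, Limits.Sigma.ι_desc_assoc, ← Category.assoc, hg'c, h₂]
        rfl
    · rintro ⟨v, hv⟩
      by_cases hv' : v ∈ (skeletonOfMono i d).obj (op ⦋0⦌)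
      · exact (congrArg (fun k : (skeletonOfMono i d : SSet) ⟶ M ↦ k.app _ ⟨v, hv'⟩) hg'₁).trans
          (hg.2 ⟨v, hv'⟩)
      · obtain rfl : d = 0 := by
          by_contra hd
          apply hv'
          rw [skeletonOfMono_obj_eq_top i (d := 0) (by lia)]
          trivial
        let c : Cell i 0 := ⟨v, by simp, fun h ↦ hv' (by rw [skeletonOfMono_zero]; exact h)⟩
        let v₀ : (Δ[0] : SSet.{u}) _⦋0⦌ := stdSimplex.obj₀Equiv.symm 0
        have e := congrArg (fun k : Δ[0] ⟶ M ↦ k.app _ v₀) (hg'c c)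
        have e' : c.map.app _ v₀ = v := yonedaEquiv_symm_vertex _ _
        refine Eq.trans ?_ (e.trans ((h₃ c _).trans (congrArg s e')))
        exact congrArg (fun w ↦ g'.app _ w) (Subtype.ext e'.symm)
  have hK : ∃ g : (skeletonOfMono i 0 : SSet) ⟶ M, Good 0 g ∧
      ∀ n x hx, g.app n ⟨i.app n x, hx⟩ = f.app n x := by
    let e : (skeletonOfMono i 0 : SSet) ⟶ K :=
      Subcomplex.homOfLE (skeletonOfMono_zero i).le ≫ inv (Subcomplex.toRange i)
    have he n x hx : e.app n ⟨i.app n x, hx⟩ = x :=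
      congrArg (fun k : K ⟶ K ↦ k.app n x) (IsIso.hom_inv_id (Subcomplex.toRange i))
    have hm n (x) (hx : x ∈ (skeletonOfMono i 0).obj n) : ∃ y, i.app n y = x := by
      rw [skeletonOfMono_zero] at hx
      exact hx
    refine ⟨e ≫ f, ⟨?_, ?_⟩, fun n x hx ↦ congrArg (fun y ↦ f.app n y) (he n x hx)⟩
    · apply map_ext_app
      rintro n ⟨x, hx⟩
      obtain ⟨y, rfl⟩ := hm _ x hx
      refine (congrArg (fun y ↦ p.app _ (f.app _ y)) (he _ y hx)).trans ?_
      exact congrArg (fun k : K ⟶ B ↦ k.app _ y) w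
    · rintro ⟨x, hx⟩
      obtain ⟨y, rfl⟩ := hm _ x hx
      exact (congrArg (fun y ↦ f.app _ y) (he _ y hx)).trans (hf y)
  obtain ⟨g₀, hg₀, hg₀'⟩ := hK
  choose F hF hF' using step
  let G (d : ℕ) : {g : (skeletonOfMono i d : SSet) ⟶ M // Good d g} :=
    Nat.rec ⟨g₀, hg₀⟩ (fun d g ↦ ⟨F d g.1 g.2, hF d g.1 g.2⟩) d
  have hG (d k : ℕ) (n x) (hx : x ∈ (skeletonOfMono i d).obj n) :
      (G (d + k)).1.app n ⟨x, (skeletonOfMono i).monotone (Nat.le_add_right d k) n hx⟩ =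
        (G d).1.app n ⟨x, hx⟩ := by
    induction k with
    | zero => rfl
    | succ k hk =>
      rw [← hk]
      exact congrArg (fun m : (skeletonOfMono i (d + k) : SSet) ⟶ M ↦
        m.app n ⟨x, (skeletonOfMono i).monotone (Nat.le_add_right d k) n hx⟩)
        (hF' (d + k) (G (d + k)).1 (G (d + k)).2)
  have hG' (d d' : ℕ) (n x) (hx : x ∈ (skeletonOfMono i d).obj n)
      (hx' : x ∈ (skeletonOfMono i d').obj n) :
      (G d).1.app n ⟨x, hx⟩ = (G d').1.app n ⟨x, hx'⟩ := by
    rw [← hG d d' n x hx, ← hG d' d n x hx']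
    have key (e e' : ℕ) (h : e = e') (he he') :
        (G e).1.app n ⟨x, he⟩ = (G e').1.app n ⟨x, he'⟩ := by
      subst h; rfl
    exact key _ _ (Nat.add_comm _ _) _ _
  have hmem (n : SimplexCategoryᵒᵖ) (x : L.obj n) :
      x ∈ (skeletonOfMono i (n.unop.len + 1)).obj n := by
    have := skeletonOfMono_obj_eq_top i (Nat.lt_succ_self n.unop.len)
    exact this.symm ▸ trivial
  -- Simplices of dimension `n` are present at stage `n + 1`, and by `hG'` all stages which contain
  -- a simplex give it the same value.
  let g : L ⟶ M :=
    { app n := TypeCat.ofHom fun x ↦ (G (n.unop.len + 1)).1.app n ⟨x, hmem n x⟩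
      naturality n m a := by
        ext x
        have hx := (skeletonOfMono i (n.unop.len + 1)).map a (hmem n x)
        refine (hG' _ (n.unop.len + 1) _ _ _ hx).trans ?_
        exact NatTrans.naturality_apply (G (n.unop.len + 1)).1 a ⟨x, hmem n x⟩ }
  have hg n x : g.app n x = (G (n.unop.len + 1)).1.app n ⟨x, hmem n x⟩ := rfl
  refine ⟨g, ?_, ?_, ?_⟩
  · apply map_ext_app
    intro n x
    have hx : i.app (op ⦋n⦌) x ∈ (skeletonOfMono i 0).obj _ := by
      rw [skeletonOfMono_zero]; exact ⟨x, rfl⟩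
    refine (hg _ _).trans ((hG' _ 0 _ _ _ hx).trans ?_)
    exact hg₀' _ x hx
  · apply map_ext_app
    intro n x
    exact congrArg (fun k : (skeletonOfMono i (n + 1) : SSet) ⟶ B ↦ k.app (op ⦋n⦌) ⟨x, hmem _ x⟩)
      (G (n + 1)).2.1
  · intro v
    exact (G 1).2.2 ⟨v, _⟩

end Lift

end InfCat

namespace InfCat

open CartesianMonoidalCategory (lift fst snd)

/-- The vertex `j` of a simplex. -/
def vtx {X : SSet.{u}} {n : ℕ} (x : X _⦋n⦌) (j : Fin (n + 1)) : X _⦋0⦌ :=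
  X.map (SimplexCategory.const ⦋0⦌ ⦋n⦌ j).op x

lemma yonedaEquiv_symm_app_vertex {X : SSet.{u}} {n : ℕ} (x : X _⦋n⦌) (j : Fin (n + 1)) :
    (SSet.yonedaEquiv.symm x).app _ (stdSimplex.obj₀Equiv.symm j) = vtx x j := rfl

lemma app_vtx {X Y : SSet.{u}} (f : X ⟶ Y) {n : ℕ} (x : X _⦋n⦌) (j : Fin (n + 1)) :
    f.app _ (vtx x j) = vtx (f.app _ x) j :=
  NatTrans.naturality_apply f _ x

section

variable {K L M B : SSet.{u}} (i : K ⟶ L) [Mono i] (p : M ⟶ B) (f : K ⟶ M) (b : L ⟶ B)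
  (j : ∀ n : ℕ, Fin (n + 2))

/-- Lifts exist along a monomorphism if the lifts of the vertices are initial (or terminal). -/
theorem exists_lift_of_isLoc (s : L _⦋0⦌ → M _⦋0⦌) (w : f ≫ p = i ≫ b)
    (hs : ∀ v, p.app _ (s v) = b.app _ v)
    (hf : ∀ v, f.app _ v = s (i.app _ v))
    (h : ∀ (n : ℕ) (x : L _⦋n + 1⦌), x ∉ Set.range (i.app _) → IsLoc j p (s (vtx x (j n)))) :
    ∃ g : L ⟶ M, i ≫ g = f ∧ g ≫ p = b ∧ ∀ v, g.app _ v = s v := by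
  refine exists_lift_of_cells i p f b s w hs hf fun n x _ hx φ hφ hφ' ↦ ?_
  refine h n x hx n φ _ hφ fun v hv ↦ ?_
  rw [hφ', hv, yonedaEquiv_symm_app_vertex]

/-- Lifts exist along a monomorphism which is bijective on vertices if the vertices of
each new simplex are initial (or terminal). -/
theorem exists_lift_of_isLoc' (w : f ≫ p = i ≫ b) (hi : Function.Surjective (i.app (op ⦋0⦌)))
    (h : ∀ (n : ℕ) (x : L _⦋n + 1⦌), x ∉ Set.range (i.app _) → ∃ v, i.app _ v = vtx x (j n) ∧
      IsLoc j p (f.app _ v)) :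
    ∃ g : L ⟶ M, i ≫ g = f ∧ g ≫ p = b := by
  choose t ht using hi
  have hinj := injective_of_mono (i.app (op ⦋0⦌))
  have ht' (v) : t (i.app _ v) = v := hinj (ht _)
  obtain ⟨g, h₁, h₂, -⟩ := exists_lift_of_isLoc i p f b j (fun v ↦ f.app _ (t v)) w
    (fun v ↦ by
      refine (congrArg (fun k : K ⟶ B ↦ k.app _ (t v)) w).trans ?_
      exact congrArg (fun u ↦ b.app _ u) (ht v))
    (fun v ↦ by rw [ht'])
    (fun n x hx ↦ by
      obtain ⟨v, hv, hv'⟩ := h _ x hx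
      rwa [← hv, ht'])
  exact ⟨g, h₁, h₂⟩

end

/-- The absolute notion of an initial vertex (for `j = 0`) or a terminal vertex (for `j = last`). -/
def IsAbsLoc (j : ∀ n : ℕ, Fin (n + 2)) {X : SSet.{u}} (v : X _⦋0⦌) : Prop :=
  ∀ (n : ℕ) (f : (∂Δ[n + 1] : SSet.{u}) ⟶ X),
    (∀ w : (∂Δ[n + 1] : SSet.{u}) _⦋0⦌,
      w.1 = stdSimplex.obj₀Equiv.symm (j n) → f.app _ w = v) →
    ∃ g : Δ[n + 1] ⟶ X, ∂Δ[n + 1].ι ≫ g = f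

lemma IsAbsLoc.isLoc {j : ∀ n : ℕ, Fin (n + 2)} {X : SSet.{u}} {v : X _⦋0⦌} (h : IsAbsLoc j v) :
    IsLoc j (SSet.const (stdSimplex.obj₀Equiv.symm 0) : X ⟶ Δ[0]) v := by
  intro n f b hb hf
  obtain ⟨g, hg⟩ := h n f hf
  refine ⟨g, hg, ?_⟩
  apply map_ext_app
  intro m x
  apply stdSimplex.objEquiv.injective
  ext i
  exact congrArg Fin.val (Subsingleton.elim (α := Fin 1) _ _)

/-! ### Evaluation of adjoint maps -/

section Curry

lemma evalAt_app_curry {K L X : SSet.{u}} (h : K ⊗ L ⟶ X) (k : K _⦋0⦌) {n : SimplexCategoryᵒᵖ}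
    (l : L.obj n) : (evalAt k X).app n ((MonoidalClosed.curry h).app n l) = h.app n (cst k n, l) := by
  have : MonoidalClosed.curry h ≫ evalAt k X = lift (SSet.const k) (𝟙 _) ≫ h := by
    have e : MonoidalClosed.curry h ≫ lift (SSet.const k) (𝟙 _) =
        lift (SSet.const k) (𝟙 _) ≫ K ◁ MonoidalClosed.curry h :=
      map_ext_app fun n x ↦ Prod.ext rfl rfl
    rw [evalAt, ← Category.assoc, e, Category.assoc, MonoidalClosed.whiskerLeft_curry_ihom_ev_app]
  exact congrArg (fun g : L ⟶ X ↦ g.app n l) this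

lemma curry_restrict {K K' L X : SSet.{u}} (i : K' ⟶ K) (h : K ⊗ L ⟶ X) :
    MonoidalClosed.curry h ≫ restrict i X = MonoidalClosed.curry (i ▷ L ≫ h) := by
  rw [restrict, MonoidalClosed.curry_pre_app]

lemma curry_fst_app {K L X : SSet.{u}} (p : K ⟶ X) {n : SimplexCategoryᵒᵖ} (l : L.obj n) :
    (MonoidalClosed.curry (fst K L ≫ p)).app n l = cst (vertex p) n := by
  have e : MonoidalClosed.curry (fst K L ≫ p) =
      (SSet.const (stdSimplex.obj₀Equiv.symm 0) : L ⟶ Δ[0]) ≫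
        MonoidalClosed.curry (fst K Δ[0] ≫ p) := by
    rw [← MonoidalClosed.curry_natural_left]
    congr 1
  rw [e]
  refine (app_cst (MonoidalClosed.curry (fst K Δ[0] ≫ p)) _ _).trans ?_
  rw [curry_app]
  rfl

lemma mem_ofSimplex_iff {X : SSet.{u}} (v : X _⦋0⦌) {n : SimplexCategoryᵒᵖ} (x : X.obj n) :
    x ∈ (Subcomplex.ofSimplex v).obj n ↔ x = cst v n := by
  rw [Subcomplex.mem_ofSimplex_obj_iff]
  constructor
  · rintro ⟨f, rfl⟩
    rw [Subsingleton.elim f (SimplexCategory.const n.unop ⦋0⦌ 0)]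
    rfl
  · rintro rfl
    exact ⟨_, rfl⟩

lemma mem_boundary_vertex {n : ℕ} (k : (Δ[n + 1] : SSet.{u}) _⦋0⦌) :
    k ∈ (boundary.{u} (n + 1)).obj (op ⦋0⦌) := by
  rw [boundary_obj_eq_univ 0 (n + 1)]
  trivial

/-- If two families of maps agree at a vertex then their adjoints agree there. -/
lemma curry_app_eq {K L X : SSet.{u}} {h h' : K ⊗ L ⟶ X} {l : L _⦋0⦌}
    (H : ∀ n k, h.app n (k, cst l n) = h'.app n (k, cst l n)) :
    (MonoidalClosed.curry h).app _ l = (MonoidalClosed.curry h').app _ l := by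
  rw [curry_app, curry_app]
  congr 1
  exact map_ext_app fun n k ↦ H _ k

lemma app_eq_of_curry_app_eq {K L X : SSet.{u}} {h : K ⊗ L ⟶ X} {l : L _⦋0⦌} {p : K ⟶ X}
    (H : (MonoidalClosed.curry h).app _ l = vertex p) (n : SimplexCategoryᵒᵖ) (k : K.obj n) :
    h.app n (k, cst l n) = p.app n k := by
  rw [curry_app] at H
  exact congrArg (fun g : K ⟶ X ↦ g.app n k) (vertex_injective H)

end Curry

/-! ### Initial vertices of fibres are relatively initial -/

/-- The space of arrows `b ⟶ G a`. -/
noncomputable def arrows {A B : SSet.{u}} (G : A ⟶ B) : (A ⊗ Fun Δ[1] B).Subcomplex where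
  obj n := {z | (evalAt v1 B).app n z.2 = G.app n z.1}
  map := by
    rintro m n f ⟨a, e⟩ h₁
    dsimp at h₁
    change (evalAt v1 B).app n ((Fun Δ[1] B).map f e) = G.app n (A.map f a)
    rw [NatTrans.naturality_apply, NatTrans.naturality_apply, h₁]

/-- The source of an arrow. -/
noncomputable def arrowsSrc {A B : SSet.{u}} (G : A ⟶ B) : (arrows G : SSet) ⟶ B :=
  (arrows G).ι ≫ snd _ _ ≫ evalAt v0 B

lemma comma_le_arrows {A B : SSet.{u}} (G : A ⟶ B) (b : B _⦋0⦌) : comma G b ≤ arrows G :=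
  fun _ _ h ↦ h.2

/-- Initiality in `comma G b` only concerns arrows with the fixed source `b`. A boundary of arrows
with varying sources is transported to the source `b` of its vertex `0`, filled there, and
transported back by `pointThickening`. The transport does not move the targets, so that they keep
coming from `A`. -/
theorem isLoc_of_isInitialVertex_comma {A B : SSet.{u}} [Quasicategory B] (G : A ⟶ B) (b : B _⦋0⦌)
    (s : (comma G b : SSet) _⦋0⦌) (hs : IsInitialVertex s) :
    IsLoc (fun _ ↦ 0) (arrowsSrc G) ⟨s.1, comma_le_arrows G b _ s.2⟩ := by
  intro n f σ₀ hσ₀ hf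
  have hf₁ (m) (d) : (evalAt v1 B).app m (f.app m d).1.2 = G.app m (f.app m d).1.1 := (f.app m d).2
  let e : (∂Δ[n + 1] : SSet.{u}) ⟶ Fun Δ[1] B := f ≫ (arrows G).ι ≫ snd _ _
  let τ : Δ[1] ⊗ (∂Δ[n + 1] : SSet.{u}) ⟶ B := MonoidalClosed.uncurry e
  have hτ : MonoidalClosed.curry τ = e := MonoidalClosed.curry_uncurry e
  have hτe (k m d) : τ.app m (cst k m, d) = (evalAt k B).app m (e.app m d) := by
    rw [← hτ, evalAt_app_curry]
  have hσ₀' (m d) : (evalAt v0 B).app m (e.app m d) = σ₀.app m d.1 :=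
    congrArg (fun k : (∂Δ[n + 1] : SSet.{u}) ⟶ B ↦ k.app m d) hσ₀
  let i₀ : (Δ[n + 1] : SSet.{u}) _⦋0⦌ := stdSimplex.obj₀Equiv.symm 0
  let w₀ : (∂Δ[n + 1] : SSet.{u}) _⦋0⦌ := ⟨i₀, mem_boundary_vertex _⟩
  have hb : σ₀.app _ i₀ = b := by
    refine (hσ₀' _ w₀).symm.trans ?_
    change (evalAt v0 B).app _ (f.app _ w₀).1.2 = b
    rw [hf w₀ rfl]
    exact ((mem_ofSimplex_iff _ _).1 s.2.1).trans (map_const_self B b)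
  obtain ⟨τ', h₁, h₂, h₃, h₄⟩ := (pointThickening n).exists_extension
    (snd (Subcomplex.ofSimplex v0 : SSet) _ ≫ σ₀) τ (by
      apply map_ext_app
      rintro m ⟨⟨k, hk⟩, d⟩
      obtain rfl := (mem_ofSimplex_iff _ _).1 hk
      exact (hτe v0 _ d).trans (hσ₀' _ d))
  have hx₀ (m) : σ₀.app m (cst i₀ m) = cst b m := by rw [app_cst, hb]
  -- The transported boundary: all sources are now `b`, while the targets are the original ones.
  let F : (∂Δ[n + 1] : SSet.{u}) ⟶ comma G b :=
    Subcomplex.lift (lift (f ≫ (arrows G).ι ≫ fst _ _) (MonoidalClosed.curry τ')) (by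
      rintro m _ ⟨d, rfl⟩
      refine ⟨?_, ?_⟩
      · refine (mem_ofSimplex_iff _ _).2 ((evalAt_app_curry τ' v0 d).trans ?_)
        exact (h₁ m ⟨cst v0 m, (mem_ofSimplex_iff _ _).2 rfl⟩ d).trans (hx₀ m)
      · refine (evalAt_app_curry τ' v1 d).trans ((h₃ m d).trans ((hτe v1 m d).trans ?_))
        exact hf₁ m d)
  obtain ⟨g, hg⟩ := hs n F (by
    intro w hw
    obtain rfl : w = w₀ := Subtype.ext hw
    have hfw := hf w₀ rfl
    refine Subtype.ext (Prod.ext (congrArg (fun z : (arrows G : SSet) _⦋0⦌ ↦ z.1.1) hfw) ?_)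
    refine Eq.trans ?_ (congrArg (fun z : (arrows G : SSet) _⦋0⦌ ↦ z.1.2) hfw)
    refine Eq.trans (curry_app_eq (h' := τ) fun m k ↦ ?_)
      (congrArg (fun k : (∂Δ[n + 1] : SSet.{u}) ⟶ Fun Δ[1] B ↦ k.app _ w₀) hτ)
    exact h₂ m k ((boundary (n + 1)).map _ w₀.2))
  let Ω : Δ[1] ⊗ Δ[n + 1] ⟶ B := MonoidalClosed.uncurry (g ≫ (comma G b).ι ≫ snd _ _)
  have hΩ : MonoidalClosed.curry Ω = g ≫ (comma G b).ι ≫ snd _ _ := MonoidalClosed.curry_uncurry _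
  have hΩe (k m d) : Ω.app m (cst k m, d) = (evalAt k B).app m (g.app m d).1.2 := by
    rw [← evalAt_app_curry, hΩ]
    rfl
  have hgF (m) (d : (∂Δ[n + 1] : SSet.{u}).obj m) : g.app m d.1 = F.app m d :=
    congrArg (fun k : (∂Δ[n + 1] : SSet.{u}) ⟶ comma G b ↦ k.app m d) hg
  obtain ⟨τ'', h₅, h₆, h₇⟩ := h₄ Ω (by
      apply MonoidalClosed.curry_injective
      rw [MonoidalClosed.curry_natural_left, hΩ]
      apply map_ext_app
      intro m d
      exact congrArg (fun z : (comma G b : SSet).obj _ ↦ z.1.2) (hgF _ d)) (by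
      rintro m ⟨k, hk⟩ d
      obtain rfl := (mem_ofSimplex_iff _ _).1 hk
      refine (hΩe v0 m d).trans (Eq.trans ?_ (hx₀ m).symm)
      exact (mem_ofSimplex_iff _ _).1 (g.app m d).2.1)
  refine ⟨Subcomplex.lift (lift (g ≫ (comma G b).ι ≫ fst _ _) (MonoidalClosed.curry τ'')) ?_, ?_, ?_⟩
  · rintro m _ ⟨d, rfl⟩
    refine (evalAt_app_curry τ'' v1 d).trans ((h₇ m d).trans ((hΩe v1 m d).trans ?_))
    exact (g.app m d).2.2
  · apply map_ext_app
    intro m d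
    refine Subtype.ext (Prod.ext ?_ ?_)
    · exact congrArg (fun z : (comma G b : SSet).obj _ ↦ z.1.1) (hgF _ d)
    · refine Eq.trans ?_ (congrArg (fun k : (∂Δ[n + 1] : SSet.{u}) ⟶ Fun Δ[1] B ↦ k.app _ d) hτ)
      rw [← h₅, MonoidalClosed.curry_natural_left]
      rfl
  · apply map_ext_app
    intro m d
    refine (evalAt_app_curry τ'' v0 d).trans ?_
    exact congrArg (fun k : (Subcomplex.ofSimplex v0 : SSet) ⊗ Δ[n + 1] ⟶ B ↦
      k.app _ (⟨cst v0 _, (mem_ofSimplex_iff _ _).2 rfl⟩, d)) h₆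

/-- The hypothesis compares `x` only with extensions of its own restriction to `K`. The thickening
moves a boundary of extensions with varying restrictions into this fibre and moves a filler back. -/
theorem isLoc_of_extVertex {L B : SSet.{u}} [Quasicategory B] {K : L.Subcomplex} {tip : L _⦋0⦌}
    {j : ∀ n : ℕ, Fin (n + 2)}
    (T : ∀ n, Thickening K (∂Δ[n + 1]) tip (stdSimplex.obj₀Equiv.symm (j n)))
    (x : L ⟶ B) (hx : IsAbsLoc j (extVertex K x)) : IsLoc j (restrict K.ι B) (vertex x) := by
  intro n f σ₀ hσ₀ hf
  obtain ⟨τ, rfl⟩ : ∃ τ, f = MonoidalClosed.curry τ :=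
    ⟨_, (MonoidalClosed.curry_uncurry f).symm⟩
  obtain ⟨σ, rfl⟩ : ∃ σ, σ₀ = MonoidalClosed.curry σ :=
    ⟨_, (MonoidalClosed.curry_uncurry σ₀).symm⟩
  have hc : K.ι ▷ (∂Δ[n + 1] : SSet.{u}) ≫ τ = (K : SSet) ◁ ∂Δ[n + 1].ι ≫ σ := by
    rw [curry_restrict, ← MonoidalClosed.curry_natural_left] at hσ₀
    exact MonoidalClosed.curry_injective hσ₀
  let i₀ : (Δ[n + 1] : SSet.{u}) _⦋0⦌ := stdSimplex.obj₀Equiv.symm (j n)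
  let w₀ : (∂Δ[n + 1] : SSet.{u}) _⦋0⦌ := ⟨i₀, mem_boundary_vertex _⟩
  have hw (m) : cst i₀ m ∈ (boundary.{u} (n + 1)).obj m := (boundary (n + 1)).map _ w₀.2
  have hτ₀ (m k) : τ.app m (k, ⟨cst i₀ m, hw m⟩) = x.app m k :=
    app_eq_of_curry_app_eq (hf w₀ rfl) m k
  obtain ⟨τ', h₁, h₂, -, h₄⟩ := (T n).exists_extension σ τ hc
  have hσx (m k) : σ.app m (k, cst i₀ m) = x.app m k.1 := by
    refine Eq.trans ?_ (hτ₀ m k.1)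
    exact congrArg (fun g : (K : SSet) ⊗ (∂Δ[n + 1] : SSet.{u}) ⟶ B ↦
      g.app m (k, ⟨cst i₀ m, hw m⟩)) hc.symm
  have hτ' : K.ι ▷ (∂Δ[n + 1] : SSet.{u}) ≫ τ' = fst _ _ ≫ K.ι ≫ x := by
    apply map_ext_app
    rintro m ⟨k, d⟩
    exact (h₁ _ k d).trans (hσx _ k)
  obtain ⟨g, hg⟩ := hx n (Subcomplex.lift (MonoidalClosed.curry τ') (by
      rintro m _ ⟨d, rfl⟩
      refine (mem_ofSimplex_iff _ _).2 ?_
      refine (congrArg (fun k : (∂Δ[n + 1] : SSet.{u}) ⟶ Fun K B ↦ k.app m d)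
        (curry_restrict K.ι τ')).trans ?_
      rw [hτ', curry_fst_app])) (by
    intro w hw'
    obtain rfl : w = w₀ := Subtype.ext hw'
    refine Subtype.ext (Eq.trans ?_ (hf w₀ rfl))
    exact curry_app_eq fun m k ↦ h₂ m k (hw m))
  obtain ⟨Ω, hΩ⟩ : ∃ Ω, g ≫ (fiber (restrict K.ι B) (vertex (K.ι ≫ x))).ι =
      MonoidalClosed.curry Ω := ⟨_, (MonoidalClosed.curry_uncurry _).symm⟩
  obtain ⟨τ'', h₅, h₆, -⟩ := h₄ Ω (by
      apply MonoidalClosed.curry_injective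
      rw [MonoidalClosed.curry_natural_left, ← hΩ, ← Category.assoc, hg]
      rfl) (by
      intro m k d
      rw [hσx]
      have : MonoidalClosed.curry (K.ι ▷ Δ[n + 1] ≫ Ω) = MonoidalClosed.curry (fst _ _ ≫ K.ι ≫ x) := by
        rw [← curry_restrict, ← hΩ]
        apply map_ext_app
        intro m d
        refine Eq.trans ?_ (curry_fst_app (K.ι ≫ x) d).symm
        exact (mem_ofSimplex_iff _ _).1 (g.app _ d).2
      exact congrArg (fun g : (K : SSet) ⊗ Δ[n + 1] ⟶ B ↦ g.app m (k, d))
        (MonoidalClosed.curry_injective this))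
  refine ⟨MonoidalClosed.curry τ'', ?_, ?_⟩
  · rw [← MonoidalClosed.curry_natural_left, h₅]
  · rw [curry_restrict, h₆]

theorem IsPushout.isLoc {B : SSet.{u}} [Quasicategory B] {σ : Square ⟶ B} (h : IsPushout σ) :
    IsLoc (fun _ ↦ 0) (restrict span.ι B) (vertex σ) :=
  isLoc_of_extVertex spanThickening σ h

theorem IsPullback.isLoc {B : SSet.{u}} [Quasicategory B] {σ : Square ⟶ B} (h : IsPullback σ) :
    IsLoc (fun n ↦ Fin.last (n + 1)) (restrict cospan.ι B) (vertex σ) :=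
  isLoc_of_extVertex cospanThickening σ h

end InfCat

namespace InfCat

open CartesianMonoidalCategory (lift fst snd)

/-! ### Morphism sets of homotopy categories and relative initial vertices -/

lemma exists_boundary_map {X : SSet.{u}} {n : ℕ} (y : Fin (n + 2) → ((Δ[n] : SSet.{u}) ⟶ X))
    (H : ∀ i j d (z z' : (Δ[n] : SSet.{u}).obj d), (stdSimplex.δ i).app d z = (stdSimplex.δ j).app d z' →
      (y i).app d z = (y j).app d z') :
    ∃ f : (∂Δ[n + 1] : SSet.{u}) ⟶ X, ∀ i d z hz, f.app d ⟨(stdSimplex.δ i).app d z, hz⟩ =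
      (y i).app d z := by
  have h (d) (x : (∂Δ[n + 1] : SSet.{u}).obj d) : ∃ i z, (stdSimplex.δ i).app d z = x.1 := by
    obtain ⟨x, hx⟩ := x
    induction d with | _ d
    induction d using SimplexCategory.rec with | _ d
    rw [boundary_eq_iSup] at hx
    simp only [Subfunctor.iSup_obj, Set.mem_iUnion, stdSimplex.face_singleton_compl] at hx
    obtain ⟨i, hi⟩ := hx
    obtain ⟨f, hf⟩ := (Subcomplex.mem_ofSimplex_obj_iff _ _).1 hi
    exact ⟨i, SSet.stdSimplex.objEquiv.symm f, hf⟩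
  choose i z hz using h
  refine ⟨⟨fun d ↦ ↾fun x ↦ (y (i d x)).app d (z d x), ?_⟩, fun k d w hw ↦ ?_⟩
  · intro d d' f
    ext x
    refine Eq.trans ?_ (NatTrans.naturality_apply (y (i d x)) f (z d x))
    refine H _ _ _ _ _ ?_
    rw [NatTrans.naturality_apply, hz, hz]
    rfl
  · exact H _ _ _ _ _ (hz _ _)

lemma vtx_zero {X : SSet.{u}} (s : X _⦋1⦌) : vtx s 0 = X.δ 1 s := by
  rw [vtx, ← SimplexCategory.δ_one_eq_const]; rfl

lemma vtx_one {X : SSet.{u}} (s : X _⦋1⦌) : vtx s 1 = X.δ 0 s := by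
  rw [vtx, ← SimplexCategory.δ_zero_eq_const]; rfl

lemma exists_boundary_map₁ {X : SSet.{u}} (x : Fin 2 → X _⦋0⦌) :
    ∃ f : (∂Δ[1] : SSet.{u}) ⟶ X, ∀ i w, w.1 = stdSimplex.obj₀Equiv.symm i → f.app _ w = x i := by
  -- The face of `Δ[1]` opposite to the vertex `i` is the other vertex, which accounts for `rev`.
  obtain ⟨f, hf⟩ := exists_boundary_map (n := 0) (fun i ↦ SSet.yonedaEquiv.symm (x i.rev)) (by
    intro i j d z z' h
    have : i = j := by
      have h' : i.succAbove ((stdSimplex.objEquiv z).toOrderHom 0) =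
          j.succAbove ((stdSimplex.objEquiv z').toOrderHom 0) :=
        congrArg (fun k : (Δ[1] : SSet.{u}).obj d ↦ (stdSimplex.objEquiv k).toOrderHom 0) h
      generalize (stdSimplex.objEquiv z).toOrderHom 0 = a at h'
      generalize (stdSimplex.objEquiv z').toOrderHom 0 = b at h'
      revert h'
      fin_cases a; fin_cases b; fin_cases i <;> fin_cases j <;> decide
    subst this
    have : z = z' := by
      apply stdSimplex.objEquiv.injective
      ext k : 3
      exact Subsingleton.elim (α := Fin 1) _ _
    rw [this])
  refine ⟨f, fun i w hw ↦ ?_⟩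
  have hw' : w.1 = (stdSimplex.δ i.rev).app _ (stdSimplex.obj₀Equiv.symm 0) := by
    rw [hw]
    refine SSet.stdSimplex.ext _ _ fun k ↦ ?_
    change i = i.rev.succAbove 0
    fin_cases i <;> rfl
  refine Eq.trans ?_ ((hf i.rev _ (stdSimplex.obj₀Equiv.symm 0) (hw' ▸ w.2)).trans ?_)
  · congr 1
    exact Subtype.ext hw'
  · rw [yonedaEquiv_symm_app_vertex, Fin.rev_rev, vtx]
    exact map_const_self X _

lemma eq_cst_of_forall {n : ℕ} {d : SimplexCategoryᵒᵖ} (z : (Δ[n] : SSet.{u}).obj d) (a : Fin (n + 1))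
    (h : ∀ i, (stdSimplex.objEquiv z).toOrderHom i = a) : z = cst (stdSimplex.obj₀Equiv.symm a) d := by
  rw [← mem_ofSimplex_iff, mem_ofSimplex_vertex_iff]
  exact h

lemma exists_boundary_map₂ {X : SSet.{u}} (x : Fin 3 → X _⦋0⦌) (e : Fin 3 → X _⦋1⦌)
    (h : ∀ i a, vtx (e i) a = x (i.succAbove a)) :
    ∃ f : (∂Δ[2] : SSet.{u}) ⟶ X, (∀ i, (boundary.ι i) ≫ f = SSet.yonedaEquiv.symm (e i)) ∧
      ∀ k w, w.1 = stdSimplex.obj₀Equiv.symm k → f.app _ w = x k := by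
  obtain ⟨f, hf⟩ := exists_boundary_map (n := 1) (fun i ↦ SSet.yonedaEquiv.symm (e i)) (by
    intro i j d z z' H
    have H' (k) : i.succAbove ((stdSimplex.objEquiv z).toOrderHom k) =
        j.succAbove ((stdSimplex.objEquiv z').toOrderHom k) :=
      congrArg (fun w : (Δ[2] : SSet.{u}).obj d ↦ (stdSimplex.objEquiv w).toOrderHom k) H
    by_cases hij : i = j
    · subst hij
      have : z = z' := by
        apply stdSimplex.objEquiv.injective
        ext k : 3
        exact Fin.succAbove_right_injective (H' k)
      rw [this]
    -- Two different edges of the triangle meet in one vertex only, so compatibility is the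
    -- hypothesis on the end points.
    · have key (i j : Fin 3) (hij : i ≠ j) : ∃ a b : Fin 2, i.succAbove a = j.succAbove b ∧
          ∀ a' b', i.succAbove a' = j.succAbove b' → a' = a ∧ b' = b := by
        revert i j; decide
      obtain ⟨a, b, hab, hu⟩ := key i j hij
      rw [eq_cst_of_forall z a fun k ↦ (hu _ _ (H' k)).1, eq_cst_of_forall z' b fun k ↦ (hu _ _ (H' k)).2,
        app_cst, app_cst, yonedaEquiv_symm_app_vertex, yonedaEquiv_symm_app_vertex, h, h, hab])
  refine ⟨f, fun i ↦ ?_, fun k w hw ↦ ?_⟩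
  · apply map_ext_app
    intro n z
    refine Eq.trans (congrArg (f.app _) (Subtype.ext ?_)) (hf i _ z ?_)
    · exact congrArg (fun g : (Δ[1] : SSet.{u}) ⟶ Δ[2] ↦ g.app _ z) (boundary.ι_ι i)
    · rw [← boundary.ι_ι]
      exact ((boundary.ι i).app _ z).2
  · have key (k : Fin 3) : ∃ i : Fin 3, ∃ a : Fin 2, i.succAbove a = k := by
      revert k; decide
    obtain ⟨i, a, rfl⟩ := key k
    have hw' : w.1 = (stdSimplex.δ i).app _ (stdSimplex.obj₀Equiv.symm a) := hw
    refine Eq.trans (congrArg (f.app _) (Subtype.ext hw')) ((hf i _ _ (hw' ▸ w.2)).trans ?_)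
    rw [yonedaEquiv_symm_app_vertex, h]

section

variable {M B : SSet.{u}} {p : M ⟶ B}

/-- The lifting property in dimension one, which gives surjectivity on morphism sets; its analogue
in dimension two below gives injectivity. -/
lemma IsLoc.exists_edge' {j : ∀ n : ℕ, Fin (n + 2)} {m : Fin 2 → M _⦋0⦌} (h : IsLoc j p (m (j 0)))
    (s : B _⦋1⦌) (hs : ∀ i, vtx s i = p.app _ (m i)) :
    ∃ t : M _⦋1⦌, p.app _ t = s ∧ ∀ i, vtx t i = m i := by
  obtain ⟨f, hf⟩ := exists_boundary_map₁ m
  obtain ⟨g, h₁, h₂⟩ := h 0 f (SSet.yonedaEquiv.symm s) (by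
    apply map_ext_app
    intro n x
    obtain ⟨k, hk⟩ := (mem_boundary_iff' _).1 x.2
    have hx : x.1 = cst (stdSimplex.obj₀Equiv.symm k.rev) _ := by
      refine eq_cst_of_forall _ _ fun i ↦ ?_
      have := hk i
      generalize (stdSimplex.objEquiv x.1).toOrderHom i = a at this
      revert this
      fin_cases a <;> fin_cases k <;> simp
    have hw : stdSimplex.obj₀Equiv.symm k.rev ∈ (boundary.{u} 1).obj _ := mem_boundary_vertex _
    have hx' : x = cst (X := (∂Δ[1] : SSet.{u})) ⟨_, hw⟩ _ := Subtype.ext hx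
    refine Eq.trans (congrArg (fun y ↦ (f ≫ p).app _ y) hx') ?_
    refine Eq.trans ?_ (congrArg (fun y ↦ (SSet.yonedaEquiv.symm s).app _ y) hx).symm
    refine (app_cst (f ≫ p) _ _).trans (Eq.trans ?_ (app_cst (SSet.yonedaEquiv.symm s) _ _).symm)
    rw [yonedaEquiv_symm_app_vertex, hs]
    refine congrArg (fun v ↦ cst (p.app _ v) _) ?_
    exact hf _ _ rfl) (fun w hw ↦ hf _ w hw)
  refine ⟨SSet.yonedaEquiv g, ?_, fun i ↦ ?_⟩
  · rw [← yonedaEquiv_comp_apply, h₂, Equiv.apply_symm_apply]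
  · rw [← yonedaEquiv_symm_app_vertex, Equiv.symm_apply_apply]
    have hw : stdSimplex.obj₀Equiv.symm i ∈ (boundary.{u} 1).obj _ := mem_boundary_vertex _
    refine Eq.trans ?_ (hf i ⟨_, hw⟩ rfl)
    exact congrArg (fun k : (∂Δ[1] : SSet.{u}) ⟶ M ↦ k.app _ ⟨_, hw⟩) h₁

lemma IsLoc.exists_triangle' {j : ∀ n : ℕ, Fin (n + 2)} {m : Fin 3 → M _⦋0⦌}
    (h : IsLoc j p (m (j 1))) (e : Fin 3 → M _⦋1⦌) (he : ∀ i a, vtx (e i) a = m (i.succAbove a))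
    (r : B _⦋2⦌) (hr : ∀ i, B.δ i r = p.app _ (e i)) : ∃ t : M _⦋2⦌, ∀ i, M.δ i t = e i := by
  obtain ⟨f, hf, hf'⟩ := exists_boundary_map₂ m e he
  obtain ⟨g, h₁, h₂⟩ := h 1 f (SSet.yonedaEquiv.symm r) (by
    refine boundary.hom_ext fun i ↦ SSet.yonedaEquiv.injective ?_
    rw [← Category.assoc, hf, yonedaEquiv_comp_apply, Equiv.apply_symm_apply, ← Category.assoc,
      boundary.ι_ι, stdSimplex.yonedaEquiv_δ_comp, Equiv.apply_symm_apply, hr]) (fun w hw ↦ hf' _ w hw)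
  refine ⟨SSet.yonedaEquiv g, fun i ↦ ?_⟩
  rw [← stdSimplex.yonedaEquiv_δ_comp, ← boundary.ι_ι, Category.assoc, h₁, hf, Equiv.apply_symm_apply]

end

end InfCat

namespace InfCat

open CartesianMonoidalCategory (lift fst snd)

/-! ### Edges, triangles and squares in the complex of arrows -/

/-- The map of (products of) standard simplices given by a monotone map of two variables. -/
def stdProd {a b c : ℕ} (f : Fin (a + 1) → Fin (b + 1) → Fin (c + 1))
    (hf : ∀ i i' j j', i ≤ i' → j ≤ j' → f i j ≤ f i' j') : (Δ[a] ⊗ Δ[b] : SSet.{u}) ⟶ Δ[c] where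
  app d := ↾fun x ↦ stdSimplex.objEquiv.symm (SimplexCategory.Hom.mk
    ⟨fun i ↦ f ((stdSimplex.objEquiv x.1).toOrderHom i) ((stdSimplex.objEquiv x.2).toOrderHom i),
      fun _ _ h ↦ hf _ _ _ _ ((stdSimplex.objEquiv x.1).toOrderHom.monotone h)
        ((stdSimplex.objEquiv x.2).toOrderHom.monotone h)⟩)
  naturality _ _ _ := rfl

/-- The edge of `X` given by a vertex of `Fun(Δ[1], X)`. -/
noncomputable def edgeOf {X : SSet.{u}} (v : (Fun Δ[1] X) _⦋0⦌) : X _⦋1⦌ :=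
  ((ihom.ev Δ[1]).app X).app _ (stdSimplex.objEquiv.symm (𝟙 ⦋1⦌), (Fun Δ[1] X).σ 0 v)

lemma ev_app_curry {K L X : SSet.{u}} (h : K ⊗ L ⟶ X) {n : SimplexCategoryᵒᵖ} (k : K.obj n)
    (l : L.obj n) : ((ihom.ev K).app X).app n (k, (MonoidalClosed.curry h).app n l) =
      h.app n (k, l) :=
  congrArg (fun g : K ⊗ L ⟶ X ↦ g.app n (k, l)) (MonoidalClosed.whiskerLeft_curry_ihom_ev_app (A := K) (g := h))

section

variable {X : SSet.{u}}

lemma edgeOf_vertex (p : Δ[1] ⟶ X) : edgeOf (vertex p) = SSet.yonedaEquiv p := by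
  rw [edgeOf, vertex_eq_sx, σ_sx, sx]
  exact ev_app_curry _ _ _

lemma edgeOf_injective {v w : (Fun Δ[1] X) _⦋0⦌} (h : edgeOf v = edgeOf w) : v = w := by
  obtain ⟨p, rfl⟩ := vertex_surjective v
  obtain ⟨q, rfl⟩ := vertex_surjective w
  rw [edgeOf_vertex, edgeOf_vertex] at h
  rw [SSet.yonedaEquiv.injective h]

lemma δ_one_edgeOf (v : (Fun Δ[1] X) _⦋0⦌) : X.δ 1 (edgeOf v) = (evalAt v0 X).app _ v := by
  obtain ⟨p, rfl⟩ := vertex_surjective v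
  rw [edgeOf_vertex, evalAt_vertex, ← vtx_zero, ← yonedaEquiv_symm_app_vertex,
    Equiv.symm_apply_apply]

lemma δ_zero_edgeOf (v : (Fun Δ[1] X) _⦋0⦌) : X.δ 0 (edgeOf v) = (evalAt v1 X).app _ v := by
  obtain ⟨p, rfl⟩ := vertex_surjective v
  rw [edgeOf_vertex, evalAt_vertex, ← vtx_one, ← yonedaEquiv_symm_app_vertex,
    Equiv.symm_apply_apply]

lemma edgeOf_post {Y : SSet.{u}} (F : X ⟶ Y) (v : (Fun Δ[1] X) _⦋0⦌) :
    edgeOf (((ihom Δ[1]).map F).app _ v) = F.app _ (edgeOf v) := by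
  obtain ⟨p, rfl⟩ := vertex_surjective v
  rw [post_vertex, edgeOf_vertex, edgeOf_vertex, yonedaEquiv_comp_apply]

lemma arr_congr {s s' : X _⦋1⦌} (h : s = s') {x y : X _⦋0⦌} (h₀ : X.δ 1 s = x) (h₁ : X.δ 0 s = y) :
    arr s h₀ h₁ = arr s' (h ▸ h₀) (h ▸ h₁) := by
  subst h; rfl

/-- An edge of the complex of arrows is a square, and both composites are the class of its diagonal.
-/
lemma arr_natural (s : (Fun Δ[1] X) _⦋1⦌) {a b : (Fun Δ[1] X) _⦋0⦌} (ha : (Fun Δ[1] X).δ 1 s = a)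
    (hb : (Fun Δ[1] X).δ 0 s = b) {x y z w : X _⦋0⦌} (a₀ : X.δ 1 (edgeOf a) = x)
    (a₁ : X.δ 0 (edgeOf a) = y) (b₀ : X.δ 1 (edgeOf b) = z) (b₁ : X.δ 0 (edgeOf b) = w)
    (c₀ : X.δ 1 ((evalAt v0 X).app _ s) = x) (c₁ : X.δ 0 ((evalAt v0 X).app _ s) = z)
    (d₀ : X.δ 1 ((evalAt v1 X).app _ s) = y) (d₁ : X.δ 0 ((evalAt v1 X).app _ s) = w) :
    arr (edgeOf a) a₀ a₁ ≫ arr ((evalAt v1 X).app _ s) d₀ d₁ =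
      arr ((evalAt v0 X).app _ s) c₀ c₁ ≫ arr (edgeOf b) b₀ b₁ := by
  obtain ⟨H, rfl⟩ := sx_surjective s
  have ea : edgeOf a = SSet.yonedaEquiv (ι₀ ≫ H) := by
    rw [← ha, curry_app_δ₁, edgeOf_vertex]
  have eb : edgeOf b = SSet.yonedaEquiv (ι₁ ≫ H) := by
    rw [← hb, curry_app_δ₀, edgeOf_vertex]
  have e₀ : (evalAt v0 X).app _ (sx H) = SSet.yonedaEquiv (lift (SSet.const v0) (𝟙 _) ≫ H) :=
    sx_evalAt _ _
  have e₁ : (evalAt v1 X).app _ (sx H) = SSet.yonedaEquiv (lift (SSet.const v1) (𝟙 _) ≫ H) :=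
    sx_evalAt _ _
  have h (i : Fin 3) (t : Δ[2] ⟶ Δ[1] ⊗ Δ[1]) (k : Δ[1] ⟶ Δ[1] ⊗ Δ[1])
      (ht : stdSimplex.δ i ≫ t = k) : X.δ i (SSet.yonedaEquiv (t ≫ H)) =
        SSet.yonedaEquiv (k ≫ H) := by
    rw [← stdSimplex.yonedaEquiv_δ_comp, ← Category.assoc, ht]
  have l₀ := h 0 _ _ δ_zero_lowerTriangle
  have l₁ := h 1 _ _ δ_one_lowerTriangle
  have l₂ := h 2 _ _ δ_two_lowerTriangle
  have r₀ := h 0 _ _ δ_zero_upperTriangle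
  have r₁ := h 1 _ _ δ_one_upperTriangle
  have r₂ := h 2 _ _ δ_two_upperTriangle
  refine (arr_comp (c := SSet.yonedaEquiv (lift (𝟙 Δ[1]) (𝟙 Δ[1]) ≫ H)) (hc₀ := ?_) (hc₁ := ?_)
    (SSet.yonedaEquiv (lowerTriangle ≫ H)) (l₂.trans ea.symm) (l₀.trans e₁.symm) l₁).trans
    (arr_comp (SSet.yonedaEquiv (upperTriangle ≫ H)) (r₂.trans e₀.symm)
      (r₀.trans eb.symm) r₁).symm
  · rw [← l₁, ← a₀, ea, ← l₂]
    exact (δδ _ (i := 1) (j := 1) le_rfl).symm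
  · rw [← l₁, ← d₁, e₁, ← l₀]
    exact δδ _ (i := 0) (j := 0) le_rfl

/-- The map from the square to the triangle which contracts a side. -/
def collapse : (Δ[1] ⊗ Δ[1] : SSet.{u}) ⟶ Δ[2] :=
  stdProd (fun i j ↦ if i = 0 then 0 else if j = 0 then 1 else 2) (by decide)

lemma ι₀_collapse : ι₀ ≫ collapse.{u} = stdSimplex.δ 2 := by
  refine hom_std_ext fun n x i ↦ ?_
  change (if x i = 0 then (0 : Fin 3) else 1) = Fin.succAbove 2 (x i)
  generalize x i = t
  fin_cases t <;> rfl

lemma ι₁_collapse : ι₁ ≫ collapse.{u} = stdSimplex.δ 1 := by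
  refine hom_std_ext fun n x i ↦ ?_
  change (if x i = 0 then (0 : Fin 3) else 2) = Fin.succAbove 1 (x i)
  generalize x i = t
  fin_cases t <;> rfl

lemma lift_v0_collapse : lift (SSet.const v0) (𝟙 _) ≫ collapse.{u} =
    stdSimplex.σ 0 ≫ stdSimplex.δ 1 ≫ stdSimplex.δ 1 := by
  refine hom_std_ext fun n x i ↦ ?_
  change 0 = Fin.succAbove 1 (Fin.succAbove 1 (Fin.predAbove 0 (x i)))
  generalize x i = t
  fin_cases t <;> rfl

lemma lift_v1_collapse : lift (SSet.const v1) (𝟙 _) ≫ collapse.{u} = stdSimplex.δ 0 := by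
  refine hom_std_ext fun n x i ↦ ?_
  change (if x i = 0 then (1 : Fin 3) else 2) = Fin.succAbove 0 (x i)
  generalize x i = t
  fin_cases t <;> rfl

/-- The degenerate square with the faces of a triangle. -/
lemma exists_square_of_triangle (r : X _⦋2⦌) {a b : (Fun Δ[1] X) _⦋0⦌} (ha : edgeOf a = X.δ 2 r)
    (hb : edgeOf b = X.δ 1 r) : ∃ s : (Fun Δ[1] X) _⦋1⦌, (Fun Δ[1] X).δ 1 s = a ∧
      (Fun Δ[1] X).δ 0 s = b ∧ (evalAt v0 X).app _ s = X.σ 0 (X.δ 1 (X.δ 1 r)) ∧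
      (evalAt v1 X).app _ s = X.δ 0 r := by
  refine ⟨sx (collapse ≫ SSet.yonedaEquiv.symm r), ?_, ?_, ?_, ?_⟩
  · apply edgeOf_injective
    rw [ha, curry_app_δ₁, edgeOf_vertex, ← Category.assoc, ι₀_collapse,
      stdSimplex.yonedaEquiv_δ_comp, Equiv.apply_symm_apply]
  · apply edgeOf_injective
    rw [hb, curry_app_δ₀, edgeOf_vertex, ← Category.assoc, ι₁_collapse,
      stdSimplex.yonedaEquiv_δ_comp, Equiv.apply_symm_apply]
  · refine (sx_evalAt _ _).trans ?_
    rw [← Category.assoc, lift_v0_collapse, Category.assoc, Category.assoc,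
      stdSimplex.yonedaEquiv_σ_comp, stdSimplex.yonedaEquiv_δ_comp, stdSimplex.yonedaEquiv_δ_comp,
      Equiv.apply_symm_apply]
  · refine (sx_evalAt _ _).trans ?_
    rw [← Category.assoc, lift_v1_collapse, stdSimplex.yonedaEquiv_δ_comp, Equiv.apply_symm_apply]

end

section

variable {M B : SSet.{u}} {p : M ⟶ B}

lemma IsLoc.exists_edge {v w : M _⦋0⦌} (h : IsLoc (fun _ ↦ 0) p v) (s : B _⦋1⦌)
    (h₀ : B.δ 1 s = p.app _ v) (h₁ : B.δ 0 s = p.app _ w) :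
    ∃ t : M _⦋1⦌, p.app _ t = s ∧ M.δ 1 t = v ∧ M.δ 0 t = w := by
  obtain ⟨t, ht, ht'⟩ := IsLoc.exists_edge' (m := ![v, w]) h s (fun i ↦ by
    fin_cases i
    · exact (vtx_zero s).trans h₀
    · exact (vtx_one s).trans h₁)
  exact ⟨t, ht, (vtx_zero t).symm.trans (ht' 0), (vtx_one t).symm.trans (ht' 1)⟩

variable [Quasicategory B]

/-- An equality in the base is a triangle with a degenerate last side. Its boundary lifts by means
of `s`, `t` and the degenerate edge at `w`, and the lifting property provides a lift of the
triangle, that is, the equality upstairs. -/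
lemma arr_eq_of_isLoc {j : ∀ n : ℕ, Fin (n + 2)} {v w : M _⦋0⦌} (h : IsLoc j p (![v, w, w] (j 1)))
    {s t : M _⦋1⦌} (hs₀ : M.δ 1 s = v) (hs₁ : M.δ 0 s = w) (ht₀ : M.δ 1 t = v) (ht₁ : M.δ 0 t = w)
    {b c : B _⦋0⦌} {e e'} {f f'} (H : arr (p.app _ s) (x := b) (y := c) e e' =
      arr (p.app _ t) f f') : arr s hs₀ hs₁ = arr t ht₀ ht₁ := by
  have hσ₀ : M.δ 1 (M.σ 0 w) = w := SSet.δ_comp_σ_succ_apply (S := M) 0 w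
  have hσ₁ : M.δ 0 (M.σ 0 w) = w := SSet.δ_comp_σ_self_apply (S := M) 0 w
  have hc : p.app _ w = c := by rw [← hs₁, ← app_δ]; exact e'
  have hσ : arr (p.app _ (M.σ 0 w)) (x := c) (y := c) (by rw [app_δ, hσ₀, hc])
      (by rw [app_δ, hσ₁, hc]) = 𝟙 _ := by
    rw [← push_arr p hc hc _ hσ₀ hσ₁, arr_id, push_id]
  rw [← Category.comp_id (arr (p.app _ s) e e'), ← hσ, arr_comp_iff] at H
  obtain ⟨r, h₂, h₀, h₁⟩ := H
  obtain ⟨q, hq⟩ := h.exists_triangle' (m := ![v, w, w]) ![M.σ 0 w, t, s] (by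
    intro i a
    fin_cases i <;> fin_cases a
    · exact (vtx_zero _).trans hσ₀
    · exact (vtx_one _).trans hσ₁
    · exact (vtx_zero _).trans ht₀
    · exact (vtx_one _).trans ht₁
    · exact (vtx_zero _).trans hs₀
    · exact (vtx_one _).trans hs₁) r (by
    intro i
    fin_cases i
    · exact h₀
    · exact h₁
    · exact h₂)
  have := arr_comp (ha₀ := hs₀) (ha₁ := hs₁) (hb₀ := hσ₀) (hb₁ := hσ₁) (hc₀ := ht₀) (hc₁ := ht₁)
    q (hq 2) (hq 0) (hq 1)
  rwa [arr_id, Category.comp_id] at this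

variable [Quasicategory M]

/-- Either the source is relatively initial or the target is relatively terminal. The two cases
differ only in which vertex of an edge and of the triangle `v, w, w` is singled out by `j 0` and `j
1`. -/
lemma push_bijective_of_isLoc {j : ∀ n : ℕ, Fin (n + 2)} {v w : M _⦋0⦌}
    (h : (j 0 = 0 ∧ j 1 = 0 ∧ IsLoc j p v) ∨ (j 0 = Fin.last 1 ∧ j 1 = Fin.last 2 ∧ IsLoc j p w))
    {b c : B _⦋0⦌} (hb : p.app _ v = b) (hc : p.app _ w = c) :
    Function.Bijective (push p hb hc) := by
  have h0 : IsLoc j p (![v, w] (j 0)) := by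
    obtain ⟨e, -, h⟩ | ⟨e, -, h⟩ := h <;> rw [e] <;> exact h
  have h1 : IsLoc j p (![v, w, w] (j 1)) := by
    obtain ⟨-, e, h⟩ | ⟨-, e, h⟩ := h <;> rw [e] <;> exact h
  constructor
  · intro f g hfg
    obtain ⟨s, hs₀, hs₁, rfl⟩ := arr_surjective f
    obtain ⟨t, ht₀, ht₁, rfl⟩ := arr_surjective g
    rw [push_arr, push_arr] at hfg
    exact arr_eq_of_isLoc h1 _ _ _ _ hfg
  · intro f
    obtain ⟨s, hs₀, hs₁, rfl⟩ := arr_surjective f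
    obtain ⟨t, ht, ht'⟩ := h0.exists_edge' (m := ![v, w]) s (fun i ↦ by
      fin_cases i
      · exact (vtx_zero s).trans (hs₀.trans hb.symm)
      · exact (vtx_one s).trans (hs₁.trans hc.symm))
    refine ⟨arr t ((vtx_zero t).symm.trans (ht' 0)) ((vtx_one t).symm.trans (ht' 1)), ?_⟩
    rw [push_arr]
    exact arr_congr ht _ _

lemma IsLoc.push_bijective {v w : M _⦋0⦌} (h : IsLoc (fun _ ↦ 0) p v)
    {b c : B _⦋0⦌} (hb : p.app _ v = b) (hc : p.app _ w = c) :
    Function.Bijective (push p hb hc) :=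
  push_bijective_of_isLoc (Or.inl ⟨rfl, rfl, h⟩) hb hc

lemma IsLoc.push_bijective_last {v w : M _⦋0⦌} (h : IsLoc (fun n ↦ Fin.last (n + 1)) p w)
    {b c : B _⦋0⦌} (hb : p.app _ v = b) (hc : p.app _ w = c) :
    Function.Bijective (push p hb hc) :=
  push_bijective_of_isLoc (Or.inr ⟨rfl, rfl, h⟩) hb hc

end

section

variable {A B : SSet.{u}} (G : A ⟶ B)

/-- The class of an arrow `b ⟶ G a`. -/
noncomputable def arrowHom (s : (arrows G : SSet) _⦋0⦌) {b : B _⦋0⦌} (hs : (arrowsSrc G).app _ s = b) :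
    Ho.mk b ⟶ Ho.mk (G.app _ s.1.1) :=
  arr (edgeOf s.1.2) ((δ_one_edgeOf _).trans hs) ((δ_zero_edgeOf _).trans s.2)

lemma arrowHom_surjective [Quasicategory B] {b : B _⦋0⦌} {a : A _⦋0⦌}
    (v : Ho.mk b ⟶ Ho.mk (G.app _ a)) : ∃ (p : Δ[1] ⟶ B) (h : (evalAt v1 B).app _ (vertex p) = G.app _ a)
    (hb : (arrowsSrc G).app _ (⟨(a, vertex p), h⟩ : (arrows G : SSet) _⦋0⦌) = b),
      arrowHom G ⟨(a, vertex p), h⟩ hb = v := by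
  obtain ⟨s, h₀, h₁, rfl⟩ := arr_surjective v
  have he : edgeOf (vertex (SSet.yonedaEquiv.symm s)) = s := by
    rw [edgeOf_vertex, Equiv.apply_symm_apply]
  refine ⟨SSet.yonedaEquiv.symm s, ?_, ?_, ?_⟩
  · rw [← δ_zero_edgeOf, he, h₁]
  · have := δ_one_edgeOf (vertex (SSet.yonedaEquiv.symm s))
    rw [he, h₀] at this
    exact this.symm
  · exact arr_congr he _ _

/-- A relatively initial arrow is a universal arrow on homotopy categories. Existence comes from
lifting the degenerate edge at `b` to the space of arrows; any solution gives another such lift with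
the same end points, and these lifts agree in the homotopy category. -/
theorem IsLoc.existsUnique [Quasicategory A] [Quasicategory B] {s : (arrows G : SSet) _⦋0⦌}
    (h : IsLoc (fun _ ↦ 0) (arrowsSrc G) s) {b : B _⦋0⦌} (hs : (arrowsSrc G).app _ s = b)
    {a : A _⦋0⦌} (v : Ho.mk b ⟶ Ho.mk (G.app _ a)) :
    ∃! x : Ho.mk s.1.1 ⟶ Ho.mk a, arrowHom G s hs ≫ push G rfl rfl x = v := by
  obtain ⟨q, hq, hb, rfl⟩ := arrowHom_surjective G v
  have hσ₀ : B.δ 1 (B.σ 0 b) = b := SSet.δ_comp_σ_succ_apply (S := B) 0 b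
  have hσ₁ : B.δ 0 (B.σ 0 b) = b := SSet.δ_comp_σ_self_apply (S := B) 0 b
  let t₁ : (arrows G : SSet) _⦋0⦌ := ⟨(a, vertex q), hq⟩
  obtain ⟨t, ht, ht₀, ht₁⟩ := h.exists_edge (w := t₁) (B.σ 0 b) (hσ₀.trans hs.symm) (hσ₁.trans hb.symm)
  have hA (t : (arrows G : SSet) _⦋1⦌) (ht₀ : (arrows G : SSet).δ 1 t = s)
      (ht₁ : (arrows G : SSet).δ 0 t = t₁) : A.δ 1 t.1.1 = s.1.1 ∧ A.δ 0 t.1.1 = a ∧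
      (Fun Δ[1] B).δ 1 t.1.2 = s.1.2 ∧ (Fun Δ[1] B).δ 0 t.1.2 = vertex q :=
    ⟨congrArg (fun z : (arrows G : SSet) _⦋0⦌ ↦ z.1.1) ht₀,
      congrArg (fun z : (arrows G : SSet) _⦋0⦌ ↦ z.1.1) ht₁,
      congrArg (fun z : (arrows G : SSet) _⦋0⦌ ↦ z.1.2) ht₀,
      congrArg (fun z : (arrows G : SSet) _⦋0⦌ ↦ z.1.2) ht₁⟩
  obtain ⟨a₀, a₁, b₀, b₁⟩ := hA t ht₀ ht₁
  refine ⟨arr t.1.1 a₀ a₁, ?_, fun y hy ↦ ?_⟩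
  · dsimp only
    rw [push_arr, arr_congr (show G.app _ t.1.1 = (evalAt v1 B).app _ t.1.2 from t.2.symm)]
    have ht' : (evalAt v0 B).app _ t.1.2 = B.σ 0 b := ht
    refine (arr_natural t.1.2 b₀ b₁ ((δ_one_edgeOf _).trans hs) ((δ_zero_edgeOf _).trans s.2)
      ((δ_one_edgeOf _).trans hb) ((δ_zero_edgeOf _).trans hq) (by rw [ht', hσ₀]) (by rw [ht', hσ₁])
      _ _).trans ?_
    rw [arr_congr ht', arr_id, Category.id_comp]
    rfl
  · obtain ⟨y, hy₀, hy₁, rfl⟩ := arr_surjective y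
    rw [push_arr] at hy
    obtain ⟨r, hr₂, hr₀, hr₁⟩ := arr_comp_iff.1 hy
    -- The triangle which witnesses the equation, seen as a square with a degenerate side, is an
    -- edge in the space of arrows over the degenerate edge at `b`.
    obtain ⟨w, hw₁, hw₀, hwe₀, hwe₁⟩ := exists_square_of_triangle r hr₂.symm hr₁.symm
    have hwb : (evalAt v0 B).app _ w = B.σ 0 b := by
      rw [hwe₀, hr₁, δ_one_edgeOf]
      exact congrArg (B.σ 0) hb
    let t' : (arrows G : SSet) _⦋1⦌ := ⟨(y, w), hwe₁.trans hr₀⟩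
    have ht'₀ : (arrows G : SSet).δ 1 t' = s := Subtype.ext (Prod.ext hy₀ hw₁)
    have ht'₁ : (arrows G : SSet).δ 0 t' = t₁ := Subtype.ext (Prod.ext hy₁ hw₀)
    have key := arr_eq_of_isLoc (p := arrowsSrc G) (j := fun _ ↦ 0) (v := s) (w := t₁) h (b := b)
      (c := b) ht'₀ ht'₁ ht₀ ht₁
      (e := by rw [show (arrowsSrc G).app _ t' = _ from hwb, hσ₀])
      (e' := by rw [show (arrowsSrc G).app _ t' = _ from hwb, hσ₁])
      (f := by rw [ht, hσ₀]) (f' := by rw [ht, hσ₁])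
      ((arr_congr (hwb : (arrowsSrc G).app _ t' = _) _ _).trans (arr_congr ht _ _).symm)
    have := congrArg (push ((arrows G).ι ≫ fst _ _) (y := s.1.1) (y' := a) rfl rfl) key
    exact (push_arr _ _ _ t' ht'₀ ht'₁).symm.trans (this.trans (push_arr _ _ _ t ht₀ ht₁))

end

end InfCat

namespace InfCat

open CartesianMonoidalCategory (lift fst snd)

/-! ### Families of universal arrows -/

section

variable {K M B X : SSet.{u}}

lemma mem_range_whiskerLeft {L L' : SSet.{u}} (i : L ⟶ L') {n : SimplexCategoryᵒᵖ} (x : (K ⊗ L').obj n)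
    (h : x.2 ∈ Set.range (i.app n)) : x ∈ Set.range ((K ◁ i).app n) := by
  obtain ⟨y, hy⟩ := h
  exact ⟨(x.1, y), Prod.ext rfl hy⟩

lemma vtx_std {m n : ℕ} (x : (Δ[m] : SSet.{u}) _⦋n⦌) (j : Fin (n + 1)) :
    vtx x j = stdSimplex.obj₀Equiv.symm (x j) := by
  refine SSet.stdSimplex.ext _ _ fun i ↦ ?_
  rfl

lemma vtx_zero_of_notMem_boundary {m n : ℕ} (x : (Δ[m] : SSet.{u}) _⦋n⦌)
    (h : x ∉ (boundary.{u} m).obj _) : vtx x 0 = stdSimplex.obj₀Equiv.symm 0 := by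
  rw [vtx_std]
  congr 1
  rw [mem_boundary_iff'] at h
  push Not at h
  obtain ⟨i, hi⟩ := h 0
  exact Fin.le_zero_iff.1 (hi ▸ (stdSimplex.objEquiv x).toOrderHom.monotone (Fin.zero_le i))

lemma vtx_last_of_notMem_boundary {m n : ℕ} (x : (Δ[m] : SSet.{u}) _⦋n⦌)
    (h : x ∉ (boundary.{u} m).obj _) : vtx x (Fin.last n) = stdSimplex.obj₀Equiv.symm (Fin.last m) := by
  rw [vtx_std]
  congr 1
  rw [mem_boundary_iff'] at h
  push Not at h
  obtain ⟨i, hi⟩ := h (Fin.last m)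
  exact Fin.last_le_iff.1 (hi ▸ (stdSimplex.objEquiv x).toOrderHom.monotone (Fin.le_last i))

lemma mono_whiskerLeft {L L' : SSet.{u}} (i : L ⟶ L') [Mono i] : Mono (K ◁ i) := by
  have (m : SimplexCategoryᵒᵖ) : Mono ((K ◁ i).app m) := by
    rw [mono_iff_injective]
    intro x y h
    have h₁ : x.1 = y.1 := congrArg (fun z : (K ⊗ L').obj m ↦ z.1) h
    have h₂ : i.app m x.2 = i.app m y.2 := congrArg (fun z : (K ⊗ L').obj m ↦ z.2) h
    exact Prod.ext h₁ (injective_of_mono (i.app m) h₂)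
  exact NatTrans.mono_of_mono_app _

/-- Pointwise relative initial vertices are relative initial. -/
theorem IsLoc.fun {p : M ⟶ B} (s : K ⟶ M) (h : ∀ k, IsLoc (fun _ ↦ 0) p (s.app _ k)) :
    IsLoc (fun _ ↦ 0) ((ihom K).map p) (vertex s) := by
  intro n f b hb hf
  obtain ⟨τ, rfl⟩ : ∃ τ, f = MonoidalClosed.curry τ := ⟨_, (MonoidalClosed.curry_uncurry f).symm⟩
  obtain ⟨σ, rfl⟩ : ∃ σ, b = MonoidalClosed.curry σ := ⟨_, (MonoidalClosed.curry_uncurry b).symm⟩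
  rw [← MonoidalClosed.curry_natural_left, ← MonoidalClosed.curry_natural_right] at hb
  have hτ (k : K _⦋0⦌) (w : (∂Δ[n + 1] : SSet.{u}) _⦋0⦌) (hw : w.1 = stdSimplex.obj₀Equiv.symm 0) :
      τ.app _ (k, w) = s.app _ k := by
    refine Eq.trans ?_ (app_eq_of_curry_app_eq (hf w hw) _ k)
    exact congrArg (fun u ↦ τ.app _ (k, u)) (map_const_self _ w).symm
  have := mono_whiskerLeft (K := K) (∂Δ[n + 1].ι : (∂Δ[n + 1] : SSet.{u}) ⟶ _)
  obtain ⟨g, h₁, h₂⟩ := exists_lift_of_isLoc' (K ◁ ∂Δ[n + 1].ι) p τ σ (fun _ ↦ 0)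
    (MonoidalClosed.curry_injective hb) (fun x ↦ by
      exact mem_range_whiskerLeft _ _ ⟨⟨_, mem_boundary_vertex x.2⟩, rfl⟩) (fun m x hx ↦ by
      have hx' : x.2 ∉ (boundary.{u} (n + 1)).obj _ :=
        fun h ↦ hx (mem_range_whiskerLeft _ _ ⟨⟨_, h⟩, rfl⟩)
      -- A simplex outside of `K ⊗ ∂Δ[n + 1]` starts over the vertex `0`, where the map is given by
      -- `s`.
      refine ⟨(vtx (X := K) x.1 0, ⟨stdSimplex.obj₀Equiv.symm 0, mem_boundary_vertex _⟩), ?_, ?_⟩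
      · exact Prod.ext rfl (vtx_zero_of_notMem_boundary (x.2 : (Δ[n + 1] : SSet.{u}) _⦋m + 1⦌) hx').symm
      · refine Eq.mpr (congrArg (IsLoc (fun _ ↦ 0) p) (hτ _ ⟨_, mem_boundary_vertex _⟩ rfl)) (h _))
  exact ⟨MonoidalClosed.curry g, by rw [← MonoidalClosed.curry_natural_left, h₁],
    by rw [← MonoidalClosed.curry_natural_right, h₂]⟩

/-- The natural transformation given by a family of arrows. -/
noncomputable def arrF (W : K ⟶ Fun Δ[1] X) : K ⊗ Δ[1] ⟶ X :=
  lift (snd _ _) (fst _ _) ≫ MonoidalClosed.uncurry W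

/-- The family of arrows given by a natural transformation. -/
noncomputable def famOf (V : K ⊗ Δ[1] ⟶ X) : K ⟶ Fun Δ[1] X :=
  MonoidalClosed.curry (lift (snd _ _) (fst _ _) ≫ V)

lemma arrF_famOf (V : K ⊗ Δ[1] ⟶ X) : arrF (famOf V) = V := by
  rw [arrF, famOf, MonoidalClosed.uncurry_curry, ← Category.assoc]
  exact map_ext_app fun n x ↦ rfl

lemma famOf_arrF (W : K ⟶ Fun Δ[1] X) : famOf (arrF W) = W := by
  rw [arrF, famOf, ← Category.assoc]
  refine Eq.trans (congrArg _ ?_) (MonoidalClosed.curry_uncurry W)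
  exact map_ext_app fun n x ↦ rfl

lemma arrF_app (W : K ⟶ Fun Δ[1] X) {n : SimplexCategoryᵒᵖ} (k : K.obj n) (v : (Δ[1] : SSet.{u}) _⦋0⦌) :
    (arrF W).app n (k, cst v n) = (evalAt v X).app n (W.app n k) := by
  conv_rhs => rw [← famOf_arrF W, famOf]
  rw [evalAt_app_curry]
  rfl

lemma ι₀_arrF (W : K ⟶ Fun Δ[1] X) : ι₀ ≫ arrF W = W ≫ evalAt v0 X :=
  map_ext_app fun _ k ↦ arrF_app W k v0

lemma ι₁_arrF (W : K ⟶ Fun Δ[1] X) : ι₁ ≫ arrF W = W ≫ evalAt v1 X :=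
  map_ext_app fun _ k ↦ arrF_app W k v1

lemma famOf_evalAt_zero (V : K ⊗ Δ[1] ⟶ X) : famOf V ≫ evalAt v0 X = ι₀ ≫ V := by
  rw [← ι₀_arrF, arrF_famOf]

lemma famOf_evalAt_one (V : K ⊗ Δ[1] ⟶ X) : famOf V ≫ evalAt v1 X = ι₁ ≫ V := by
  rw [← ι₁_arrF, arrF_famOf]

lemma famOf_comp {L : SSet.{u}} (i : L ⟶ K) (V : K ⊗ Δ[1] ⟶ X) : i ≫ famOf V = famOf (i ▷ _ ≫ V) := by
  rw [famOf, famOf, ← MonoidalClosed.curry_natural_left]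
  rfl

lemma arrF_comp {L : SSet.{u}} (i : L ⟶ K) (W : K ⟶ Fun Δ[1] X) : arrF (i ≫ W) = i ▷ _ ≫ arrF W := by
  conv_lhs => rw [← famOf_arrF W, famOf_comp, arrF_famOf]

lemma edgeOf_famOf (V : K ⊗ Δ[1] ⟶ X) (k : K _⦋0⦌) : edgeOf ((famOf V).app _ k) =
    V.app _ (K.σ 0 k, stdSimplex.objEquiv.symm (𝟙 ⦋1⦌)) := by
  rw [famOf, curry_app, edgeOf_vertex]
  have h : K.map (SimplexCategory.const ⦋1⦌ ⦋0⦌ 0).op k = K.σ 0 k :=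
    congrArg (fun f : ⦋1⦌ ⟶ ⦋0⦌ ↦ K.map f.op k) (Subsingleton.elim _ _)
  exact congrArg (fun x ↦ V.app (op ⦋1⦌) (x, stdSimplex.objEquiv.symm (𝟙 ⦋1⦌))) h

/-- With the variables reordered, `W` is a square of transformations, to which `square_comm`
applies. -/
lemma fam_natural [Quasicategory X] (W : K ⊗ Δ[1] ⟶ Fun Δ[1] X) {U V : K ⟶ Fun Δ[1] X}
    (hU : ι₀ ≫ W = U) (hV : ι₁ ≫ W = V) {p q r t : K ⟶ X}
    (a₀ : ι₀ ≫ arrF U = p) (a₁ : ι₁ ≫ arrF U = q)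
    (b₀ : ι₀ ≫ arrF V = r) (b₁ : ι₁ ≫ arrF V = t)
    (c₀ : ι₀ ≫ W ≫ evalAt v0 X = p) (c₁ : ι₁ ≫ W ≫ evalAt v0 X = r)
    (d₀ : ι₀ ≫ W ≫ evalAt v1 X = q) (d₁ : ι₁ ≫ W ≫ evalAt v1 X = t) :
    cls (arrF U) a₀ a₁ ≫ cls (W ≫ evalAt v1 X) d₀ d₁ =
      cls (W ≫ evalAt v0 X) c₀ c₁ ≫ cls (arrF V) b₀ b₁ := by
  let S : K ⊗ (Δ[1] ⊗ Δ[1]) ⟶ X :=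
    lift (snd _ _ ≫ fst _ _) (lift (fst _ _) (snd _ _ ≫ snd _ _)) ≫ MonoidalClosed.uncurry W
  have hS (n) (k : K _⦋n⦌) (x y : (Δ[1] : SSet.{u}) _⦋n⦌) : S.app _ (k, (x, y)) =
      (MonoidalClosed.uncurry W).app _ (x, (k, y)) := rfl
  have hW (v) (n) (z : (K ⊗ Δ[1] : SSet.{u}) _⦋n⦌) : (MonoidalClosed.uncurry W).app _ (cst v _, z) =
      (evalAt v X).app _ (W.app _ z) := by
    conv_rhs => rw [← MonoidalClosed.curry_uncurry W]
    exact (evalAt_app_curry _ _ _).symm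
  refine square_comm S ?_ ?_ ?_ ?_ a₀ a₁ b₀ b₁ c₀ c₁ d₀ d₁
  · rw [← hU, arrF, MonoidalClosed.uncurry_natural_left]
    rfl
  · rw [← hV, arrF, MonoidalClosed.uncurry_natural_left]
    rfl
  · exact map_ext_app fun n z ↦ (hS _ _ _ _).trans (hW v0 n z)
  · exact map_ext_app fun n z ↦ (hS _ _ _ _).trans (hW v1 n z)

/-- The degenerate squares with the faces of a family of triangles. -/
lemma exists_family_of_triangle (S : K ⊗ Δ[2] ⟶ X) : ∃ W : K ⊗ Δ[1] ⟶ Fun Δ[1] X,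
    arrF (ι₀ ≫ W) = K ◁ stdSimplex.δ 2 ≫ S ∧ arrF (ι₁ ≫ W) = K ◁ stdSimplex.δ 1 ≫ S ∧
      W ≫ evalAt v0 X = fst _ _ ≫ ι₀ ≫ K ◁ stdSimplex.δ 1 ≫ S ∧
      W ≫ evalAt v1 X = K ◁ stdSimplex.δ 0 ≫ S := by
  let V : (K ⊗ Δ[1]) ⊗ Δ[1] ⟶ X :=
    lift (fst _ _ ≫ fst _ _) (lift (snd _ _) (fst _ _ ≫ snd _ _) ≫ collapse) ≫ S
  refine ⟨famOf V, ?_, ?_, ?_, ?_⟩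
  · rw [famOf_comp, arrF_famOf, ← ι₀_collapse]
    exact map_ext_app fun n x ↦ rfl
  · rw [famOf_comp, arrF_famOf, ← ι₁_collapse]
    exact map_ext_app fun n x ↦ rfl
  · have : fst _ _ ≫ ι₀ ≫ K ◁ stdSimplex.δ 1 ≫ S = K ◁ (stdSimplex.σ 0 ≫ stdSimplex.δ 1 ≫
        stdSimplex.δ 1) ≫ S := by
      rw [stdSimplex.δ_one_eq_const]
      exact map_ext_app fun n x ↦ rfl
    rw [famOf_evalAt_zero, this, ← lift_v0_collapse]
    exact map_ext_app fun n x ↦ rfl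
  · rw [famOf_evalAt_one, ← lift_v1_collapse]
    exact map_ext_app fun n x ↦ rfl

lemma cls_congr {H H' : K ⊗ Δ[1] ⟶ X} (h : H = H') {p q : K ⟶ X} (h₀ : ι₀ ≫ H = p) (h₁ : ι₁ ≫ H = q) :
    cls H h₀ h₁ = cls H' (h ▸ h₀) (h ▸ h₁) := by
  subst h; rfl

end

section

variable {K A B : SSet.{u}} (G : A ⟶ B)

lemma arrowsSrc_eq : arrowsSrc G = (arrows G).ι ≫ snd _ _ ≫ evalAt v0 B := rfl

lemma arrows_condition : (arrows G).ι ≫ snd _ _ ≫ evalAt v1 B = (arrows G).ι ≫ fst _ _ ≫ G :=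
  map_ext_app fun _ z ↦ z.2

/-- The map to the space of arrows which is given by a family of arrows. -/
noncomputable def toArrows (a : K ⟶ A) (W : K ⟶ Fun Δ[1] B) (h : W ≫ evalAt v1 B = a ≫ G) :
    K ⟶ arrows G :=
  Subcomplex.lift (lift a W) (by
    rintro n _ ⟨k, rfl⟩
    exact congrArg (fun g : K ⟶ B ↦ g.app n k) h)

variable [Quasicategory A] [Quasicategory B]

/-- The argument of `IsLoc.existsUnique` inside functor complexes: by `IsLoc.fun` a family of
universal arrows is itself universal. -/
theorem IsLoc.existsUnique_family (s : K ⟶ arrows G) (h : ∀ k, IsLoc (fun _ ↦ 0) (arrowsSrc G) (s.app _ k))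
    {b : K ⟶ B} {a : K ⟶ A} (hb : s ≫ arrowsSrc G = b) (ha : s ≫ (arrows G).ι ≫ fst _ _ = a)
    {a' : K ⟶ A} (v : Ho.mk (vertex b) ⟶ Ho.mk (vertex (a' ≫ G))) :
    ∃! x : Ho.mk (vertex a) ⟶ Ho.mk (vertex a'),
      cls (arrF (s ≫ (arrows G).ι ≫ snd _ _)) (p := b) (q := a ≫ G)
        (by rw [ι₀_arrF, ← hb, arrowsSrc_eq]; simp only [Category.assoc])
        (by rw [ι₁_arrF, ← ha]; simp only [Category.assoc, arrows_condition]) ≫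
      push ((ihom K).map G) (post_vertex _ _) (post_vertex _ _) x = v := by
  obtain ⟨V, hV₀, hV₁, rfl⟩ := cls_surjective v
  have hl := IsLoc.fun s h
  let t : K ⟶ arrows G := toArrows G a' (famOf V) (by rw [famOf_evalAt_one, hV₁])
  have ht : t ≫ arrowsSrc G = b := (famOf_evalAt_zero V).trans hV₀
  obtain ⟨w, hw, hw₀, hw₁⟩ := hl.exists_edge (w := vertex t) (sx (fst K Δ[1] ≫ b)) (by
    rw [curry_app_δ₁, post_vertex, hb]; rfl) (by
    rw [curry_app_δ₀, post_vertex, ht]; rfl)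
  obtain ⟨W, rfl⟩ := sx_surjective w
  rw [sx_post] at hw
  replace hw := sx_injective hw
  rw [curry_app_δ₁] at hw₀
  rw [curry_app_δ₀] at hw₁
  replace hw₀ := vertex_injective hw₀
  replace hw₁ := vertex_injective hw₁
  have comm (W : K ⊗ Δ[1] ⟶ arrows G) : (W ≫ (arrows G).ι ≫ snd _ _) ≫ evalAt v1 B =
      (W ≫ (arrows G).ι ≫ fst _ _) ≫ G := by
    simp only [Category.assoc, arrows_condition]
  have e₀ (W : K ⊗ Δ[1] ⟶ arrows G) (hw₀ : ι₀ ≫ W = s) : ι₀ ≫ W ≫ (arrows G).ι ≫ fst _ _ = a := by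
    rw [← Category.assoc, hw₀, ha]
  have e₁ (W : K ⊗ Δ[1] ⟶ arrows G) (hw₁ : ι₁ ≫ W = t) : ι₁ ≫ W ≫ (arrows G).ι ≫ fst _ _ = a' := by
    rw [← Category.assoc, hw₁]; rfl
  refine ⟨cls (W ≫ (arrows G).ι ≫ fst _ _) (e₀ _ hw₀) (e₁ _ hw₁), ?_, fun y hy ↦ ?_⟩
  · dsimp only
    rw [push_post_cls G _ _ _ rfl rfl, cls_congr (comm W).symm]
    have hw' : (W ≫ (arrows G).ι ≫ snd _ _) ≫ evalAt v0 B = fst _ _ ≫ b := hw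
    refine (fam_natural (W ≫ (arrows G).ι ≫ snd _ _) (U := s ≫ (arrows G).ι ≫ snd _ _)
      (V := famOf V) (r := b) (t := a' ≫ G) ?_ ?_ _ _ ?_ ?_ (by rw [hw']; rfl) (by rw [hw']; rfl) _ _).trans ?_
    · rw [← hw₀]; rfl
    · rw [← Category.assoc, hw₁]; rfl
    · rw [arrF_famOf, hV₀]
    · rw [arrF_famOf, hV₁]
    · rw [cls_congr hw', cls_fst, Category.id_comp, cls_congr (arrF_famOf V)]
  · obtain ⟨y, hy₀, hy₁, rfl⟩ := cls_surjective y
    rw [push_post_cls G _ _ _ rfl rfl, cls_comp_iff] at hy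
    obtain ⟨S, hS₂, hS₀, hS₁⟩ := hy
    obtain ⟨W', hW₀, hW₁, hWs, hWt⟩ := exists_family_of_triangle S
    rw [hS₂] at hW₀
    rw [hS₁] at hW₁ hWs
    rw [hS₀] at hWt
    let T : K ⊗ Δ[1] ⟶ arrows G := toArrows G y W' hWt
    have hT₀ : ι₀ ≫ T = s := by
      have h1 : ι₀ ≫ W' = s ≫ (arrows G).ι ≫ snd _ _ := by
        rw [← famOf_arrF (ι₀ ≫ W'), hW₀, famOf_arrF]
      have h2 : ι₀ ≫ y = s ≫ (arrows G).ι ≫ fst _ _ := hy₀.trans ha.symm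
      exact map_ext_app fun n x ↦ Subtype.ext (Prod.ext
        (congrArg (fun g : K ⟶ A ↦ g.app _ x) h2)
        (congrArg (fun g : K ⟶ Fun Δ[1] B ↦ g.app _ x) h1))
    have hT₁ : ι₁ ≫ T = t := by
      have h1 : ι₁ ≫ W' = famOf V := by
        rw [← famOf_arrF (ι₁ ≫ W'), hW₁]
      exact map_ext_app fun n x ↦ Subtype.ext (Prod.ext
        (congrArg (fun g : K ⟶ A ↦ g.app _ x) hy₁)
        (congrArg (fun g : K ⟶ Fun Δ[1] B ↦ g.app _ x) h1))
    have hTb : T ≫ arrowsSrc G = fst _ _ ≫ b := by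
      rw [hV₀] at hWs
      exact hWs
    have f₀ : ι₀ ≫ fst _ _ ≫ b = b := rfl
    have f₁ : ι₁ ≫ fst _ _ ≫ b = b := rfl
    have key := arr_eq_of_isLoc (p := (ihom K).map (arrowsSrc G)) (j := fun _ ↦ 0) (v := vertex s)
      (w := vertex t) hl (s := sx T) (t := sx W) (b := vertex b) (c := vertex b)
      (by rw [curry_app_δ₁, hT₀]) (by rw [curry_app_δ₀, hT₁])
      (by rw [curry_app_δ₁, hw₀]) (by rw [curry_app_δ₀, hw₁])
      (e := by rw [sx_post, curry_app_δ₁, hTb, f₀])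
      (e' := by rw [sx_post, curry_app_δ₀, hTb, f₁])
      (f := by rw [sx_post, curry_app_δ₁, hw, f₀])
      (f' := by rw [sx_post, curry_app_δ₀, hw, f₁])
      (arr_congr (by rw [sx_post, sx_post, hw, hTb]) _ _)
    have := congrArg (push ((ihom K).map ((arrows G).ι ≫ fst _ _)) (y := vertex a) (y' := vertex a')
      (by rw [post_vertex, ha]) (by rw [post_vertex]; rfl)) key
    have h₁ := push_post_cls ((arrows G).ι ≫ fst _ _) T hT₀ hT₁ ha (show t ≫ _ = a' from rfl)
      (by rw [post_vertex, ha]) (by rw [post_vertex]; rfl)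
    have h₂ := push_post_cls ((arrows G).ι ≫ fst _ _) W hw₀ hw₁ ha (show t ≫ _ = a' from rfl)
      (by rw [post_vertex, ha]) (by rw [post_vertex]; rfl)
    exact h₁.symm.trans (this.trans h₂)

end

end InfCat

namespace InfCat

open CartesianMonoidalCategory (lift fst snd)

/-! ### Squares -/

section

variable {K X : SSet.{u}}

/-- Kan extension by initial or terminal objects. A simplex of `K ⊗ Δ[n + 1]` which lies neither
over `K'` nor over the boundary has its distinguished vertex at a place where the value is initial
or terminal, so it imposes no obstruction to the extension. -/
lemma isLoc_evalAt_aux {j : ∀ n : ℕ, Fin (n + 2)} (K' : K.Subcomplex) (τ : K ⟶ X)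
    (hj : ∀ (m n : ℕ) (x : (Δ[m + 1] : SSet.{u}) _⦋n + 1⦌), x ∉ (boundary.{u} (m + 1)).obj _ →
      vtx x (j n) = stdSimplex.obj₀Equiv.symm (j m))
    (h : ∀ (n : ℕ) (x : K _⦋n + 1⦌), x ∉ K'.obj _ → IsAbsLoc j (τ.app _ (vtx x (j n)))) :
    IsLoc j (restrict K'.ι X) (vertex τ) := by
  intro n f b hb hf
  obtain ⟨F, rfl⟩ : ∃ F, f = MonoidalClosed.curry F := ⟨_, (MonoidalClosed.curry_uncurry f).symm⟩
  obtain ⟨σ, rfl⟩ : ∃ σ, b = MonoidalClosed.curry σ := ⟨_, (MonoidalClosed.curry_uncurry b).symm⟩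
  rw [← MonoidalClosed.curry_natural_left, curry_restrict] at hb
  replace hb := MonoidalClosed.curry_injective hb
  have hF (k : K _⦋0⦌) (w : (∂Δ[n + 1] : SSet.{u}) _⦋0⦌) (hw : w.1 = stdSimplex.obj₀Equiv.symm (j n)) :
      F.app _ (k, w) = τ.app _ k := by
    refine Eq.trans ?_ (app_eq_of_curry_app_eq (hf w hw) _ k)
    exact congrArg (fun u ↦ F.app _ (k, u)) (map_const_self _ w).symm
  let U : (K ⊗ (Δ[n + 1] : SSet.{u})).Subcomplex := (⊤ : K.Subcomplex).prod (boundary (n + 1))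
  let V : (K ⊗ (Δ[n + 1] : SSet.{u})).Subcomplex := K'.prod ⊤
  obtain ⟨G, hG₁, hG₂⟩ := exists_glue (A := U) (B := V) (Y := X)
    (Subcomplex.lift (U.ι ≫ snd _ _) (by rintro _ _ ⟨x, rfl⟩; exact x.2.2) |>
      (fun q ↦ lift (U.ι ≫ fst _ _) q ≫ F))
    (Subcomplex.lift (V.ι ≫ fst _ _) (by rintro _ _ ⟨x, rfl⟩; exact x.2.1) |>
      (fun q ↦ lift q (V.ι ≫ snd _ _) ≫ σ)) (by
    intro m x hA hB
    exact congrArg (fun g : (K' : SSet) ⊗ (∂Δ[n + 1] : SSet.{u}) ⟶ X ↦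
      g.app m (⟨x.1, hB.1⟩, ⟨x.2, hA.2⟩)) hb)
  obtain ⟨g, h₁, -⟩ := exists_lift_of_isLoc' (U ⊔ V).ι
    (SSet.const (stdSimplex.obj₀Equiv.symm 0) : X ⟶ Δ[0]) G
    (SSet.const (stdSimplex.obj₀Equiv.symm 0)) j rfl (fun x ↦ by
      exact ⟨⟨x, Or.inl ⟨trivial, mem_boundary_vertex _⟩⟩, rfl⟩) (fun m x hx ↦ by
      have hx₁ : x.1 ∉ K'.obj _ := fun h ↦ hx ⟨⟨x, Or.inr ⟨h, trivial⟩⟩, rfl⟩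
      have hx₂ : x.2 ∉ (boundary.{u} (n + 1)).obj _ := fun h ↦ hx ⟨⟨x, Or.inl ⟨trivial, h⟩⟩, rfl⟩
      have hv : vtx x (j m) = (vtx (X := K) x.1 (j m), stdSimplex.obj₀Equiv.symm (j n)) :=
        Prod.ext rfl (hj _ _ _ hx₂)
      have hU : (vtx (X := K) x.1 (j m), stdSimplex.obj₀Equiv.symm (j n)) ∈ U.obj (op ⦋0⦌) :=
        ⟨trivial, mem_boundary_vertex _⟩
      refine ⟨⟨_, Or.inl hU⟩, hv.symm, ?_⟩
      refine Eq.mpr (congrArg (IsLoc j _) ((hG₁ _ _ hU).trans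
        (hF _ ⟨_, mem_boundary_vertex _⟩ rfl))) (h _ _ hx₁).isLoc)
  refine ⟨MonoidalClosed.curry g, ?_, ?_⟩
  · rw [← MonoidalClosed.curry_natural_left]
    congr 1
    apply map_ext_app
    intro m x
    exact (congrArg (fun k : ((U ⊔ V : Subcomplex _) : SSet) ⟶ X ↦
      k.app _ ⟨(x.1, x.2.1), Or.inl ⟨trivial, x.2.2⟩⟩) h₁).trans (hG₁ _ _ ⟨trivial, x.2.2⟩)
  · rw [curry_restrict]
    congr 1
    apply map_ext_app
    intro m x
    exact (congrArg (fun k : ((U ⊔ V : Subcomplex _) : SSet) ⟶ X ↦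
      k.app _ ⟨(x.1.1, x.2), Or.inr ⟨x.1.2, trivial⟩⟩) h₁).trans (hG₂ _ _ ⟨x.1.2, trivial⟩)

theorem isLoc_restrict (K' : K.Subcomplex) (τ : K ⟶ X)
    (h : ∀ (n : ℕ) (x : K _⦋n + 1⦌), x ∉ K'.obj _ → IsInitialVertex (τ.app _ (vtx x 0))) :
    IsLoc (fun _ ↦ 0) (restrict K'.ι X) (vertex τ) :=
  isLoc_evalAt_aux K' τ (fun _ _ x hx ↦ vtx_zero_of_notMem_boundary x hx) h

theorem isLoc_restrict_last (K' : K.Subcomplex) (τ : K ⟶ X)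
    (h : ∀ (n : ℕ) (x : K _⦋n + 1⦌), x ∉ K'.obj _ → IsTerminalVertex (τ.app _ (vtx x (Fin.last _)))) :
    IsLoc (fun n ↦ Fin.last (n + 1)) (restrict K'.ι X) (vertex τ) :=
  isLoc_evalAt_aux K' τ (fun _ _ x hx ↦ vtx_last_of_notMem_boundary x hx) h

lemma IsLoc.comp_inverse {j : ∀ n : ℕ, Fin (n + 2)} {M B B' : SSet.{u}} {p : M ⟶ B} {m : M _⦋0⦌}
    (h : IsLoc j p m) (q : B ⟶ B') (r : B' ⟶ B) (hqr : q ≫ r = 𝟙 _) (hrq : r ≫ q = 𝟙 _) :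
    IsLoc j (p ≫ q) m := by
  intro n f b hb hf
  obtain ⟨g, h₁, h₂⟩ := h n f (b ≫ r) (by
    rw [← Category.assoc, ← hb, Category.assoc, Category.assoc, hqr, Category.comp_id]) hf
  exact ⟨g, h₁, by rw [← Category.assoc, h₂, Category.assoc, hrq, Category.comp_id]⟩

lemma restrict_comp {L M : SSet.{u}} (i : K ⟶ L) (j : L ⟶ M) :
    restrict j X ≫ restrict i X = restrict (i ≫ j) X := by
  simp [restrict, MonoidalClosed.pre_map]

lemma restrict_id : restrict (𝟙 K) X = 𝟙 _ := by
  simp [restrict]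

lemma constFun_evalAt (k : K _⦋0⦌) : constFun K X ≫ evalAt k X = 𝟙 X :=
  map_ext_app fun _ x ↦ (evalAt_app_curry (snd K X) k x).trans rfl

lemma restrict_evalAt {L : SSet.{u}} (i : K ⟶ L) (k : K _⦋0⦌) :
    restrict i X ≫ evalAt k X = evalAt (i.app _ k) X := by
  have h₁ : restrict i X ≫ lift (SSet.const k) (𝟙 (Fun K X)) =
      lift (SSet.const k) (𝟙 (Fun L X)) ≫ K ◁ restrict i X := map_ext_app fun n x ↦ Prod.ext rfl rfl
  have h₂ : lift (SSet.const k) (𝟙 (Fun L X)) ≫ i ▷ Fun L X = lift (SSet.const (i.app _ k)) (𝟙 _) :=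
    map_ext_app fun n x ↦ Prod.ext (app_cst i k _) rfl
  rw [evalAt, evalAt, ← Category.assoc, h₁, Category.assoc, restrict,
    MonoidalClosed.id_tensor_pre_app_comp_ev, ← Category.assoc, h₂]

lemma restrict_ofSimplex_constFun (k : K _⦋0⦌) :
    evalAt (K := (Subcomplex.ofSimplex k : SSet)) ⟨k, Subcomplex.mem_ofSimplex_obj k⟩ X ≫
      constFun _ X = 𝟙 _ := by
  apply map_ext_app
  intro n x
  obtain ⟨H, rfl⟩ := sx_surjective x
  refine (congrArg ((constFun _ X).app _) (sx_evalAt _ H)).trans ((constFun_simplex _).trans ?_)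
  change _ = sx H
  congr 1
  rw [Equiv.symm_apply_apply, ← Category.assoc]
  convert Category.id_comp H
  apply map_ext_app
  rintro m ⟨⟨y, hy⟩, d⟩
  obtain rfl := (mem_ofSimplex_iff _ _).1 hy
  rfl

theorem isLoc_evalAt (k : K _⦋0⦌) (τ : K ⟶ X)
    (h : ∀ (n : ℕ) (x : K _⦋n + 1⦌), x ≠ cst k _ → IsInitialVertex (τ.app _ (vtx x 0))) :
    IsLoc (fun _ ↦ 0) (evalAt k X) (vertex τ) := by
  have := (isLoc_restrict (Subcomplex.ofSimplex k) τ (fun n x hx ↦ h n x fun hx' ↦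
    hx ((mem_ofSimplex_iff _ _).2 hx'))).comp_inverse _ _ (restrict_ofSimplex_constFun k)
      (constFun_evalAt _)
  exact (restrict_evalAt (Subcomplex.ofSimplex k).ι
    (⟨k, Subcomplex.mem_ofSimplex_obj k⟩ : (Subcomplex.ofSimplex k : SSet) _⦋0⦌)) ▸ this

theorem isLoc_evalAt_last (k : K _⦋0⦌) (τ : K ⟶ X)
    (h : ∀ (n : ℕ) (x : K _⦋n + 1⦌), x ≠ cst k _ → IsTerminalVertex (τ.app _ (vtx x (Fin.last _)))) :
    IsLoc (fun n ↦ Fin.last (n + 1)) (evalAt k X) (vertex τ) := by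
  have := (isLoc_restrict_last (Subcomplex.ofSimplex k) τ (fun n x hx ↦ h n x fun hx' ↦
    hx ((mem_ofSimplex_iff _ _).2 hx'))).comp_inverse _ _ (restrict_ofSimplex_constFun k)
      (constFun_evalAt _)
  exact (restrict_evalAt (Subcomplex.ofSimplex k).ι
    (⟨k, Subcomplex.mem_ofSimplex_obj k⟩ : (Subcomplex.ofSimplex k : SSet) _⦋0⦌)) ▸ this

end

/-! ### Spans, cospans and evaluation of squares at a corner -/

section Square

/-- The vertices of the square. -/
abbrev s00 : (Square.{u}) _⦋0⦌ := (v0, v0)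
/-- The vertices of the square. -/
abbrev s01 : (Square.{u}) _⦋0⦌ := (v0, v1)
/-- The vertices of the square. -/
abbrev s10 : (Square.{u}) _⦋0⦌ := (v1, v0)
/-- The vertices of the square. -/
abbrev s11 : (Square.{u}) _⦋0⦌ := (v1, v1)

lemma cst_or_vtx_last {n : ℕ} (x : (Δ[1] : SSet.{u}) _⦋n⦌) :
    x = cst v0 _ ∨ vtx x (Fin.last _) = v1 := by
  by_cases h : (stdSimplex.objEquiv x).toOrderHom (Fin.last _) = 0
  · refine Or.inl (eq_cst_of_forall _ _ fun i ↦ Fin.le_zero_iff.1 (h ▸ ?_))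
    exact (stdSimplex.objEquiv x).toOrderHom.monotone (Fin.le_last i)
  · refine Or.inr ?_
    rw [vtx_std]
    congr 1
    exact Fin.eq_one_of_ne_zero _ h

lemma cst_or_vtx_zero {n : ℕ} (x : (Δ[1] : SSet.{u}) _⦋n⦌) :
    x = cst v1 _ ∨ vtx x 0 = v0 := by
  by_cases h : (stdSimplex.objEquiv x).toOrderHom 0 = 0
  · refine Or.inr ?_
    rw [vtx_std]
    congr 1
  · refine Or.inl (eq_cst_of_forall _ _ fun i ↦ ?_)
    have h1 : (1 : Fin 2) ≤ (stdSimplex.objEquiv x).toOrderHom i := by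
      rw [← Fin.eq_one_of_ne_zero _ h]
      exact (stdSimplex.objEquiv x).toOrderHom.monotone (Fin.zero_le i)
    exact le_antisymm (Fin.le_last _) h1

lemma vtx_cst {X : SSet.{u}} (v : X _⦋0⦌) {n : ℕ} (i : Fin (n + 1)) : vtx (cst v (op ⦋n⦌)) i = v := by
  rw [vtx, cst]
  refine (Functor.map_comp_apply X _ _ v).symm.trans ?_
  exact map_const_self X v

lemma mem_span_iff {n : SimplexCategoryᵒᵖ} (x : (Square.{u}).obj n) :
    x ∈ span.obj n ↔ x.1 = cst v0 n ∨ x.2 = cst v0 n := by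
  rw [← mem_ofSimplex_iff, ← mem_ofSimplex_iff]
  change (_ ∨ _) ↔ _
  constructor
  · rintro (⟨-, h⟩ | ⟨h, -⟩)
    exacts [Or.inr h, Or.inl h]
  · rintro (h | h)
    exacts [Or.inr ⟨h, trivial⟩, Or.inl ⟨trivial, h⟩]

lemma mem_cospan_iff {n : SimplexCategoryᵒᵖ} (x : (Square.{u}).obj n) :
    x ∈ cospan.obj n ↔ x.1 = cst v1 n ∨ x.2 = cst v1 n := by
  rw [← mem_ofSimplex_iff, ← mem_ofSimplex_iff]
  change (_ ∨ _) ↔ _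
  constructor
  · rintro (⟨-, h⟩ | ⟨h, -⟩)
    exacts [Or.inr h, Or.inl h]
  · rintro (h | h)
    exacts [Or.inr ⟨h, trivial⟩, Or.inl ⟨trivial, h⟩]

lemma cst_self {X : SSet.{u}} (v : X _⦋0⦌) : cst v (op ⦋0⦌) = v := map_const_self X v

/-- The vertex `(0,0)` of the span. -/
noncomputable abbrev spanTip : (span.{u} : SSet) _⦋0⦌ :=
  ⟨s00, (mem_span_iff _).2 (Or.inl (cst_self _).symm)⟩

/-- The vertex `(1,1)` of the cospan. -/
noncomputable abbrev cospanTip : (cospan.{u} : SSet) _⦋0⦌ :=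
  ⟨s11, (mem_cospan_iff _).2 (Or.inl (cst_self _).symm)⟩

variable {X : SSet.{u}}

/-- Apart from the degeneracies of the tip, every simplex of positive dimension of the span ends at
one of the two corners. Dually, in a cospan every such simplex starts at a corner. -/
lemma isLoc_spanTip (τ : (span : SSet) ⟶ X) (h : ∀ x : (span.{u} : SSet) _⦋0⦌, x.1 = s01 ∨ x.1 = s10 →
    IsTerminalVertex (τ.app _ x)) : IsLoc (fun n ↦ Fin.last (n + 1)) (evalAt spanTip X) (vertex τ) := by
  refine isLoc_evalAt_last _ _ fun n x hx ↦ h _ ?_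
  obtain ⟨⟨a, b⟩, hx'⟩ := x
  change (vtx (X := Δ[1]) a (Fin.last _), vtx (X := Δ[1]) b (Fin.last _)) = s01 ∨
    (vtx (X := Δ[1]) a (Fin.last _), vtx (X := Δ[1]) b (Fin.last _)) = s10
  obtain rfl | ha := cst_or_vtx_last a <;> obtain rfl | hb := cst_or_vtx_last b
  · exact (hx rfl).elim
  · exact Or.inl (by rw [hb, vtx_cst])
  · exact Or.inr (by rw [ha, vtx_cst])
  · obtain h | h := (mem_span_iff _).1 hx'
    · dsimp only at h
      rw [h, vtx_cst] at ha
      exact absurd (stdSimplex.obj₀Equiv.symm.injective ha) (by decide)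
    · dsimp only at h
      rw [h, vtx_cst] at hb
      exact absurd (stdSimplex.obj₀Equiv.symm.injective hb) (by decide)

lemma isLoc_cospanTip (τ : (cospan : SSet) ⟶ X) (h : ∀ x : (cospan.{u} : SSet) _⦋0⦌, x.1 = s01 ∨ x.1 = s10 →
    IsInitialVertex (τ.app _ x)) : IsLoc (fun _ ↦ 0) (evalAt cospanTip X) (vertex τ) := by
  refine isLoc_evalAt _ _ fun n x hx ↦ h _ ?_
  obtain ⟨⟨a, b⟩, hx'⟩ := x
  change (vtx (X := Δ[1]) a 0, vtx (X := Δ[1]) b 0) = s01 ∨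
    (vtx (X := Δ[1]) a 0, vtx (X := Δ[1]) b 0) = s10
  obtain rfl | ha := cst_or_vtx_zero a <;> obtain rfl | hb := cst_or_vtx_zero b
  · exact (hx rfl).elim
  · exact Or.inr (by rw [hb, vtx_cst])
  · exact Or.inl (by rw [ha, vtx_cst])
  · obtain h | h := (mem_cospan_iff _).1 hx'
    · dsimp only at h
      rw [h, vtx_cst] at ha
      exact absurd (stdSimplex.obj₀Equiv.symm.injective ha) (by decide)
    · dsimp only at h
      rw [h, vtx_cst] at hb
      exact absurd (stdSimplex.obj₀Equiv.symm.injective hb) (by decide)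

variable [Quasicategory X]

/-- Maps out of a pushout square to a square with terminal corners. -/
theorem IsPushout.push_bijective {σ τ : Square ⟶ X} (hσ : IsPushout σ)
    (h₁ : IsTerminalVertex (τ.app _ s01)) (h₂ : IsTerminalVertex (τ.app _ s10)) {x y : X _⦋0⦌}
    (hx : (evalAt s00 X).app _ (vertex σ) = x) (hy : (evalAt s00 X).app _ (vertex τ) = y) :
    Function.Bijective (push (evalAt s00 X) hx hy) := by
  -- Restriction to the span is bijective because `σ` is a pushout, and the subsequent evaluation at
  -- the tip of the span is bijective because the corners of `τ` are terminal.
  have hτ := isLoc_spanTip (span.ι ≫ τ) (by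
    rintro ⟨_, h⟩ (rfl | rfl)
    exacts [h₁, h₂])
  have e : restrict span.ι X ≫ evalAt spanTip X = evalAt s00 X := restrict_evalAt _ _
  have b₁ := hσ.isLoc.push_bijective (w := vertex τ) (restrict_vertex _ _) (restrict_vertex _ _)
  have b₂ := hτ.push_bijective_last (v := vertex (span.ι ≫ σ)) (b := x) (c := y)
    (by rw [evalAt_vertex, ← hx, evalAt_vertex]; rfl) (by rw [evalAt_vertex, ← hy, evalAt_vertex]; rfl)
  convert b₂.comp b₁ using 1
  ext f
  exact (push_congr e.symm _ _ _ _ f).trans (push_push _ _ _ _ _ _ f).symm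

/-- Maps to a pullback square from a square with initial corners. -/
theorem IsPullback.push_bijective {σ τ : Square ⟶ X} (hτ : IsPullback τ)
    (h₁ : IsInitialVertex (σ.app _ s01)) (h₂ : IsInitialVertex (σ.app _ s10)) {x y : X _⦋0⦌}
    (hx : (evalAt s11 X).app _ (vertex σ) = x) (hy : (evalAt s11 X).app _ (vertex τ) = y) :
    Function.Bijective (push (evalAt s11 X) hx hy) := by
  have hσ := isLoc_cospanTip (cospan.ι ≫ σ) (by
    rintro ⟨_, h⟩ (rfl | rfl)
    exacts [h₁, h₂])
  have e : restrict cospan.ι X ≫ evalAt cospanTip X = evalAt s11 X := restrict_evalAt _ _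
  have b₁ := hτ.isLoc.push_bijective_last (v := vertex σ) (restrict_vertex _ _) (restrict_vertex _ _)
  have b₂ := hσ.push_bijective (w := vertex (cospan.ι ≫ τ)) (b := x) (c := y)
    (by rw [evalAt_vertex, ← hx, evalAt_vertex]; rfl) (by rw [evalAt_vertex, ← hy, evalAt_vertex]; rfl)
  convert b₂.comp b₁ using 1
  ext f
  exact (push_congr e.symm _ _ _ _ f).trans (push_push _ _ _ _ _ _ f).symm

end Square

end InfCat

namespace InfCat

open CartesianMonoidalCategory (lift fst snd)

/-! ### Morphisms of arrows and of squares -/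

section

variable {X : SSet.{u}}

/-- The map from the square to the triangle which contracts the other side. -/
def collapse' : (Δ[1] ⊗ Δ[1] : SSet.{u}) ⟶ Δ[2] :=
  stdProd (fun i j ↦ if i = 1 then 2 else if j = 0 then 0 else 1) (by decide)

lemma ι₀_collapse' : ι₀ ≫ collapse'.{u} = stdSimplex.δ 1 := by
  refine hom_std_ext fun n x i ↦ ?_
  change (if x i = 1 then (2 : Fin 3) else 0) = Fin.succAbove 1 (x i)
  generalize x i = t
  fin_cases t <;> rfl

lemma ι₁_collapse' : ι₁ ≫ collapse'.{u} = stdSimplex.δ 0 := by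
  refine hom_std_ext fun n x i ↦ ?_
  change (if x i = 1 then (2 : Fin 3) else 1) = Fin.succAbove 0 (x i)
  generalize x i = t
  fin_cases t <;> rfl

lemma lift_v0_collapse' : lift (SSet.const v0) (𝟙 _) ≫ collapse'.{u} = stdSimplex.δ 2 := by
  refine hom_std_ext fun n x i ↦ ?_
  change (if x i = 0 then (0 : Fin 3) else 1) = Fin.succAbove 2 (x i)
  generalize x i = t
  fin_cases t <;> rfl

lemma lift_v1_collapse' : lift (SSet.const v1) (𝟙 _) ≫ collapse'.{u} =
    stdSimplex.σ 0 ≫ stdSimplex.δ 0 ≫ stdSimplex.δ 0 := by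
  refine hom_std_ext fun n x i ↦ ?_
  change 2 = Fin.succAbove 0 (Fin.succAbove 0 (Fin.predAbove 0 (x i)))
  generalize x i = t
  fin_cases t <;> rfl

lemma exists_square_of_triangle' (r : X _⦋2⦌) {a b : (Fun Δ[1] X) _⦋0⦌} (ha : edgeOf a = X.δ 1 r)
    (hb : edgeOf b = X.δ 0 r) : ∃ s : (Fun Δ[1] X) _⦋1⦌, (Fun Δ[1] X).δ 1 s = a ∧
      (Fun Δ[1] X).δ 0 s = b ∧ (evalAt v0 X).app _ s = X.δ 2 r ∧
      (evalAt v1 X).app _ s = X.σ 0 (X.δ 0 (X.δ 0 r)) := by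
  refine ⟨sx (collapse' ≫ SSet.yonedaEquiv.symm r), ?_, ?_, ?_, ?_⟩
  · apply edgeOf_injective
    rw [ha, curry_app_δ₁, edgeOf_vertex, ← Category.assoc, ι₀_collapse',
      stdSimplex.yonedaEquiv_δ_comp, Equiv.apply_symm_apply]
  · apply edgeOf_injective
    rw [hb, curry_app_δ₀, edgeOf_vertex, ← Category.assoc, ι₁_collapse',
      stdSimplex.yonedaEquiv_δ_comp, Equiv.apply_symm_apply]
  · refine (sx_evalAt _ _).trans ?_
    rw [← Category.assoc, lift_v0_collapse', stdSimplex.yonedaEquiv_δ_comp, Equiv.apply_symm_apply]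
  · refine (sx_evalAt _ _).trans ?_
    rw [← Category.assoc, lift_v1_collapse', Category.assoc, Category.assoc,
      stdSimplex.yonedaEquiv_σ_comp, stdSimplex.yonedaEquiv_δ_comp, stdSimplex.yonedaEquiv_δ_comp,
      Equiv.apply_symm_apply]

/-- The morphism given by a vertex of `Fun(Δ[1], X)`. -/
noncomputable def edgeHom (a : (Fun Δ[1] X) _⦋0⦌) {x y : X _⦋0⦌} (h₀ : (evalAt v0 X).app _ a = x)
    (h₁ : (evalAt v1 X).app _ a = y) : Ho.mk x ⟶ Ho.mk y :=
  arr (edgeOf a) ((δ_one_edgeOf a).trans h₀) ((δ_zero_edgeOf a).trans h₁)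

lemma edgeHom_surjective [Quasicategory X] {x y : X _⦋0⦌} (f : Ho.mk x ⟶ Ho.mk y) :
    ∃ (p : Δ[1] ⟶ X) (h₀ : (evalAt v0 X).app _ (vertex p) = x)
      (h₁ : (evalAt v1 X).app _ (vertex p) = y), edgeHom (vertex p) h₀ h₁ = f := by
  obtain ⟨s, h₀, h₁, rfl⟩ := arr_surjective f
  have he : edgeOf (vertex (SSet.yonedaEquiv.symm s)) = s := by
    rw [edgeOf_vertex, Equiv.apply_symm_apply]
  refine ⟨SSet.yonedaEquiv.symm s, ?_, ?_, arr_congr he _ _⟩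
  · rw [← δ_one_edgeOf, he, h₀]
  · rw [← δ_zero_edgeOf, he, h₁]

variable [Quasicategory X] {a b : (Fun Δ[1] X) _⦋0⦌} {x y x' y' : X _⦋0⦌}
    (a₀ : (evalAt v0 X).app _ a = x) (a₁ : (evalAt v1 X).app _ a = y)
    (b₀ : (evalAt v0 X).app _ b = x') (b₁ : (evalAt v1 X).app _ b = y')

lemma edgeHom_natural (φ : Ho.mk a ⟶ Ho.mk b) :
    edgeHom a a₀ a₁ ≫ push (evalAt v1 X) a₁ b₁ φ = push (evalAt v0 X) a₀ b₀ φ ≫ edgeHom b b₀ b₁ := by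
  obtain ⟨s, hs₀, hs₁, rfl⟩ := arr_surjective φ
  rw [push_arr, push_arr]
  exact arr_natural s hs₀ hs₁ _ _ _ _ _ _ _ _

/-- The diagonal of a commutative square in the homotopy category is an edge `c`. The triangles on
both sides of it are squares with one degenerate side, that is, morphisms of arrows from `a` to `c`
and from `c` to `b`; their composite is as required. -/
lemma exists_of_edgeHom_comm (f : Ho.mk x ⟶ Ho.mk x') (g : Ho.mk y ⟶ Ho.mk y')
    (h : edgeHom a a₀ a₁ ≫ g = f ≫ edgeHom b b₀ b₁) :
    ∃ φ : Ho.mk a ⟶ Ho.mk b, push (evalAt v0 X) a₀ b₀ φ = f ∧ push (evalAt v1 X) a₁ b₁ φ = g := by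
  obtain ⟨c, c₀, c₁, hc⟩ := edgeHom_surjective (edgeHom a a₀ a₁ ≫ g)
  have hc' := h.symm.trans hc.symm
  obtain ⟨f, f₀, f₁, rfl⟩ := arr_surjective f
  obtain ⟨g, g₀, g₁, rfl⟩ := arr_surjective g
  obtain ⟨r, hr₂, hr₀, hr₁⟩ := arr_comp_iff.1 hc.symm
  obtain ⟨t, ht₂, ht₀, ht₁⟩ := arr_comp_iff.1 hc'
  obtain ⟨s, hs₁, hs₀, hse₀, hse₁⟩ := exists_square_of_triangle r hr₂.symm hr₁.symm
  obtain ⟨s', hs'₁, hs'₀, hse'₀, hse'₁⟩ := exists_square_of_triangle' t ht₁.symm ht₀.symm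
  refine ⟨arr s hs₁ hs₀ ≫ arr s' hs'₁ hs'₀, ?_, ?_⟩
  · rw [push_comp _ a₀ c₀ b₀, push_arr, push_arr, arr_congr hse'₀, arr_congr ht₂]
    have : (evalAt v0 X).app _ s = X.σ 0 x := by
      rw [hse₀, hr₁, δ_one_edgeOf, c₀]
    rw [arr_congr this, arr_id, Category.id_comp]
  · rw [push_comp _ a₁ c₁ b₁, push_arr, push_arr, arr_congr hse₁, arr_congr hr₀]
    have : (evalAt v1 X).app _ s' = X.σ 0 y' := by
      rw [hse'₁, ht₀, δ_zero_edgeOf, b₁]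
    rw [arr_congr this, arr_id, Category.comp_id]

end

section

variable {K X : SSet.{u}}

/-- The morphism given by an edge of `K` and a map `K ⟶ X`. -/
noncomputable def edgeAt (e : Δ[1] ⟶ K) (σ : K ⟶ X) {x y : X _⦋0⦌}
    (h₀ : σ.app _ (e.app _ v0) = x) (h₁ : σ.app _ (e.app _ v1) = y) : Ho.mk x ⟶ Ho.mk y :=
  edgeHom (vertex (e ≫ σ)) ((evalAt_vertex _ _).trans h₀) ((evalAt_vertex _ _).trans h₁)

lemma edgeAt_natural [Quasicategory X] (e : Δ[1] ⟶ K) {s t : K _⦋0⦌} (hs : e.app _ v0 = s)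
    (ht : e.app _ v1 = t) {σ τ : K ⟶ X} (φ : Ho.mk (vertex σ) ⟶ Ho.mk (vertex τ)) {x y x' y' : X _⦋0⦌}
    (h₀ : (evalAt s X).app _ (vertex σ) = x) (h₁ : (evalAt t X).app _ (vertex σ) = y)
    (h₀' : (evalAt s X).app _ (vertex τ) = x') (h₁' : (evalAt t X).app _ (vertex τ) = y') (a₀ a₁ b₀ b₁) :
    edgeAt e σ a₀ a₁ ≫ push (evalAt t X) h₁ h₁' φ = push (evalAt s X) h₀ h₀' φ ≫ edgeAt e τ b₀ b₁ := by
  subst hs ht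
  have := edgeHom_natural ((evalAt_vertex (e ≫ σ) v0).trans a₀) ((evalAt_vertex (e ≫ σ) v1).trans a₁)
    ((evalAt_vertex (e ≫ τ) v0).trans b₀) ((evalAt_vertex (e ≫ τ) v1).trans b₁)
    (push (restrict e X) (restrict_vertex _ _) (restrict_vertex _ _) φ)
  rw [push_push, push_push, push_congr (restrict_evalAt e v0) _ _ h₀ h₀',
    push_congr (restrict_evalAt e v1) _ _ h₁ h₁'] at this
  exact this

lemma isLoc_restrict_mono {L : SSet.{u}} (i : L ⟶ K) [Mono i] (τ : K ⟶ X)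
    (h : ∀ (n : ℕ) (x : K _⦋n + 1⦌), x ∉ Set.range (i.app _) → IsInitialVertex (τ.app _ (vtx x 0))) :
    IsLoc (fun _ ↦ 0) (restrict i X) (vertex τ) := by
  have := (isLoc_restrict (Subcomplex.range i) τ (fun n x hx ↦ h n x hx)).comp_inverse
    (restrict (Subcomplex.toRange i) X) (restrict (inv (Subcomplex.toRange i)) X)
    (by rw [restrict_comp, IsIso.inv_hom_id, restrict_id])
    (by rw [restrict_comp, IsIso.hom_inv_id, restrict_id])
  rwa [restrict_comp, Subcomplex.toRange_ι] at this

end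

/-! ### Zero objects and null morphisms -/

section Null

instance : Quasicategory (Δ[0] : SSet.{u}) where
  hornFilling' n i f _ _ :=
    ⟨SSet.const (stdSimplex.obj₀Equiv.symm 0), map_ext_app fun m x ↦ by
      apply stdSimplex.objEquiv.injective
      ext k : 3
      exact Subsingleton.elim (α := Fin 1) _ _⟩

lemma subsingleton_hom_point (x y : (Δ[0] : SSet.{u}) _⦋0⦌) : Subsingleton (Ho.mk x ⟶ Ho.mk y) ∧
    Nonempty (Ho.mk x ⟶ Ho.mk y) := by
  have h (n : ℕ) (x y : (Δ[0] : SSet.{u}) _⦋n⦌) : x = y := by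
    apply stdSimplex.objEquiv.injective
    ext k : 3
    exact Subsingleton.elim (α := Fin 1) _ _
  refine ⟨⟨fun f g ↦ ?_⟩, ?_⟩
  · obtain ⟨s, hs₀, hs₁, rfl⟩ := arr_surjective f
    obtain ⟨t, ht₀, ht₁, rfl⟩ := arr_surjective g
    exact arr_congr (h _ _ _) _ _
  · obtain rfl := h _ x y
    exact ⟨𝟙 _⟩

variable {X : SSet.{u}} [Quasicategory X] {z : X _⦋0⦌}

lemma existsUnique_of_bijective {α β : Type*} [Subsingleton β] [Nonempty β] {f : α → β}
    (h : Function.Bijective f) : Nonempty (Unique α) := by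
  obtain ⟨a, -⟩ := h.2 (Classical.arbitrary β)
  exact ⟨⟨⟨a⟩, fun b ↦ h.1 (Subsingleton.elim _ _)⟩⟩

lemma IsInitialVertex.nonempty_unique (h : IsInitialVertex z) (x : X _⦋0⦌) :
    Nonempty (Unique (Ho.mk z ⟶ Ho.mk x)) := by
  obtain ⟨_, _⟩ := subsingleton_hom_point.{u} (stdSimplex.obj₀Equiv.symm 0) (stdSimplex.obj₀Equiv.symm 0)
  exact existsUnique_of_bijective (IsLoc.push_bijective (v := z) (w := x)
    (b := stdSimplex.obj₀Equiv.symm 0) (c := stdSimplex.obj₀Equiv.symm 0)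
    (IsAbsLoc.isLoc (j := fun _ ↦ 0) h) (map_const_self (Δ[0] : SSet.{u}) (stdSimplex.obj₀Equiv.symm 0))
    (map_const_self (Δ[0] : SSet.{u}) (stdSimplex.obj₀Equiv.symm 0)))

lemma IsTerminalVertex.nonempty_unique (h : IsTerminalVertex z) (x : X _⦋0⦌) :
    Nonempty (Unique (Ho.mk x ⟶ Ho.mk z)) := by
  obtain ⟨_, _⟩ := subsingleton_hom_point.{u} (stdSimplex.obj₀Equiv.symm 0) (stdSimplex.obj₀Equiv.symm 0)
  exact existsUnique_of_bijective (IsLoc.push_bijective_last (v := x) (w := z)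
    (b := stdSimplex.obj₀Equiv.symm 0) (c := stdSimplex.obj₀Equiv.symm 0)
    (IsAbsLoc.isLoc (j := fun n ↦ Fin.last (n + 1)) h) (map_const_self (Δ[0] : SSet.{u}) (stdSimplex.obj₀Equiv.symm 0))
    (map_const_self (Δ[0] : SSet.{u}) (stdSimplex.obj₀Equiv.symm 0)))

/-- Zero objects of quasicategories. -/
def IsZeroVertex (z : X _⦋0⦌) : Prop := IsInitialVertex z ∧ IsTerminalVertex z

lemma IsZeroVertex.isZero (h : IsZeroVertex z) : Limits.IsZero (Ho.mk z) where
  unique_to y := h.1.nonempty_unique y.as.as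
  unique_from y := h.2.nonempty_unique y.as.as

end Null

/-- A morphism is null if it factors over a zero object. -/
def IsNull {C : Type*} [Category* C] {x y : C} (f : x ⟶ y) : Prop :=
  ∃ (z : C) (_ : Limits.IsZero z) (g : x ⟶ z) (h : z ⟶ y), g ≫ h = f

section IsNull

variable {C : Type*} [Category* C] {w x y z : C}

lemma IsNull.comp_left {f : x ⟶ y} (hf : IsNull f) (g : w ⟶ x) : IsNull (g ≫ f) := by
  obtain ⟨z, hz, a, b, rfl⟩ := hf
  exact ⟨z, hz, g ≫ a, b, Category.assoc _ _ _⟩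

lemma IsNull.comp_right {f : x ⟶ y} (hf : IsNull f) (g : y ⟶ w) : IsNull (f ≫ g) := by
  obtain ⟨z, hz, a, b, rfl⟩ := hf
  exact ⟨z, hz, a, b ≫ g, (Category.assoc _ _ _).symm⟩

lemma IsNull.eq {f g : x ⟶ y} (hf : IsNull f) (hg : IsNull g) : f = g := by
  obtain ⟨z, hz, a, b, rfl⟩ := hf
  obtain ⟨z', hz', a', b', rfl⟩ := hg
  rw [hz.eq_of_tgt a (a' ≫ hz'.to_ z), Category.assoc, hz'.eq_of_src (hz'.to_ z ≫ b) b']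

lemma isNull_of_src (hx : Limits.IsZero x) (f : x ⟶ y) : IsNull f := ⟨x, hx, 𝟙 _, f, Category.id_comp _⟩

lemma isNull_of_tgt (hy : Limits.IsZero y) (f : x ⟶ y) : IsNull f := ⟨y, hy, f, 𝟙 _, Category.comp_id _⟩

end IsNull

/-! ### Lifting to the fibre of a morphism -/

section Kernel

variable {X : SSet.{u}} [Quasicategory X] {z : X _⦋0⦌}

lemma mono_of_retraction {K L : SSet.{u}} (i : K ⟶ L) (p : L ⟶ K) (h : i ≫ p = 𝟙 _) : Mono i :=
  (SplitMono.mk p h).mono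

/-- The comparison of maps from a square which is constant in one direction
to a pullback square and maps of arrows. -/
lemma exists_map_of_isPullback (hz : IsZeroVertex z) {σ : Square ⟶ X} (hσ : IsPullback σ)
    (i : Δ[1] ⟶ (cospan : SSet)) (pr : Square ⟶ Δ[1]) (hpr : i ≫ cospan.ι ≫ pr = 𝟙 _)
    (hi : ∀ (n : ℕ) (x : (cospan.{u} : SSet) _⦋n + 1⦌), x ∉ Set.range (i.app _) →
      pr.app _ (vtx x 0).1 = v1)
    {a : X _⦋0⦌} {x : Ho.mk a ⟶ Ho.mk (σ.app _ (i.app _ v0).1)}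
    (hx : IsNull (x ≫ edgeAt (i ≫ cospan.ι) σ rfl rfl)) :
    ∃ (e : Δ[1] ⟶ X) (h₀ : e.app _ v0 = a) (φ : Ho.mk (vertex (pr ≫ e)) ⟶ Ho.mk (vertex σ))
      (h : (evalAt (i.app _ v0).1 X).app _ (vertex (pr ≫ e)) = a),
      push (evalAt (i.app _ v0).1 X) h (evalAt_vertex _ _) φ = x := by
  obtain ⟨p, hp₀, hp₁, -⟩ := edgeHom_surjective (hz.isZero.from_ (Ho.mk a))
  have := mono_of_retraction i (cospan.ι ≫ pr) hpr
  let δ : Square ⟶ X := pr ≫ p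
  have hδ : i ≫ cospan.ι ≫ δ = p := by
    rw [← Category.assoc cospan.ι, ← Category.assoc, hpr, Category.id_comp]
  rw [evalAt_vertex] at hp₀ hp₁
  have hl : IsLoc (fun _ ↦ 0) (restrict i X) (vertex (cospan.ι ≫ δ)) := by
    refine isLoc_restrict_mono i _ fun n y hy ↦ ?_
    have : (cospan.ι ≫ δ).app _ (vtx y 0) = z := by
      refine Eq.trans ?_ hp₁
      exact congrArg (p.app _) (hi n y hy)
    rw [this]
    exact hz.1
  -- As its composite is null, `x` extends to a morphism from the arrow `a ⟶ z` to the given edge of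
  -- `σ`. It then extends to the cospans, because the source is initial off this edge, and to the
  -- squares, because `σ` is a pullback.
  obtain ⟨φ₂, hφ₂, -⟩ := exists_of_edgeHom_comm (a := vertex p) (b := vertex ((i ≫ cospan.ι) ≫ σ))
    ((evalAt_vertex p v0).trans hp₀) ((evalAt_vertex p v1).trans hp₁) (evalAt_vertex _ _)
    (evalAt_vertex _ _) x (hz.isZero.to_ _) (((isNull_of_src hz.isZero _).comp_left _).eq hx)
  obtain ⟨φ₁, hφ₁⟩ := (hl.push_bijective (w := vertex (cospan.ι ≫ σ)) (b := vertex p)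
    (c := vertex ((i ≫ cospan.ι) ≫ σ)) (by rw [restrict_vertex, hδ])
    (by rw [restrict_vertex, Category.assoc])).2 φ₂
  obtain ⟨φ, hφ⟩ := (hσ.isLoc.push_bijective_last (v := vertex δ) (restrict_vertex _ _)
    (restrict_vertex _ _)).2 φ₁
  have e₀ : (evalAt (i.app _ v0).1 X).app _ (vertex δ) = a := by
    rw [evalAt_vertex, ← hp₀, ← hδ]; rfl
  refine ⟨p, hp₀, φ, e₀, ?_⟩
  rw [← hφ₂, ← hφ₁, ← hφ, push_push, push_push]
  refine push_congr ?_ _ _ _ _ φ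
  rw [restrict_evalAt i v0]
  exact (restrict_evalAt cospan.ι (i.app _ v0)).symm

/-- The edges of the square. -/
noncomputable abbrev edgeT : (Δ[1] : SSet.{u}) ⟶ Square := ι₀
/-- The edges of the square. -/
noncomputable abbrev edgeB : (Δ[1] : SSet.{u}) ⟶ Square := ι₁
/-- The edges of the square. -/
noncomputable abbrev edgeL : (Δ[1] : SSet.{u}) ⟶ Square := lift (SSet.const v0) (𝟙 _)
/-- The edges of the square. -/
noncomputable abbrev edgeR : (Δ[1] : SSet.{u}) ⟶ Square := lift (SSet.const v1) (𝟙 _)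

/-- The source square is `a ⟶ z` in the second direction and constant in the first one. Its upper
edge is therefore an identity, and naturality of the upper edge is the required factorization. -/
theorem exists_kernel_lift (hz : IsZeroVertex z) {σ : Square ⟶ X} (hσ : IsPullback σ)
    (h₁ : σ.app _ s01 = z) {a : X _⦋0⦌} (x : Ho.mk a ⟶ Ho.mk (σ.app _ s10))
    (hx : IsNull (x ≫ edgeAt edgeR σ rfl rfl)) :
    ∃ r : Ho.mk a ⟶ Ho.mk (σ.app _ s00), r ≫ edgeAt edgeT σ rfl rfl = x := by
  obtain ⟨e, he, φ, h, rfl⟩ := exists_map_of_isPullback hz hσ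
    (Subcomplex.lift edgeR (by
      rintro n _ ⟨y, rfl⟩
      exact (mem_cospan_iff _).2 (Or.inl rfl))) (snd _ _) rfl (by
    rintro n ⟨⟨y, y'⟩, hy⟩ hn
    obtain rfl | h' := (mem_cospan_iff _).1 hy
    · exact (hn ⟨y', rfl⟩).elim
    · dsimp only at h'
      subst h'
      exact vtx_cst (v1 : (Δ[1] : SSet.{u}) _⦋0⦌) (n := n + 1) 0) hx
  have := edgeAt_natural edgeT (s := s00) (t := s10) rfl rfl φ (x := a) (y := a)
    ((evalAt_vertex _ _).trans he) h (evalAt_vertex _ _) (evalAt_vertex _ _) he he rfl rfl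
  refine ⟨_, this.symm.trans ?_⟩
  have hid : edgeAt edgeT (snd _ _ ≫ e) (x := a) (y := a) he he = 𝟙 _ := by
    refine Eq.trans (arr_congr (s' := X.σ 0 a) ?_ _ _) (arr_id _ _ _)
    rw [edgeOf_vertex, ← he]
    exact NatTrans.naturality_apply e (SimplexCategory.σ 0).op v0
  rw [hid, Category.id_comp]
  rfl

theorem exists_kernel_lift' (hz : IsZeroVertex z) {σ : Square ⟶ X} (hσ : IsPullback σ)
    (h₁ : σ.app _ s10 = z) {a : X _⦋0⦌} (x : Ho.mk a ⟶ Ho.mk (σ.app _ s01))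
    (hx : IsNull (x ≫ edgeAt edgeB σ rfl rfl)) :
    ∃ r : Ho.mk a ⟶ Ho.mk (σ.app _ s00), r ≫ edgeAt edgeL σ rfl rfl = x := by
  obtain ⟨e, he, φ, h, rfl⟩ := exists_map_of_isPullback hz hσ
    (Subcomplex.lift edgeB (by
      rintro n _ ⟨y, rfl⟩
      exact (mem_cospan_iff _).2 (Or.inr rfl))) (fst _ _) rfl (by
    rintro n ⟨⟨y, y'⟩, hy⟩ hn
    obtain h' | rfl := (mem_cospan_iff _).1 hy
    · dsimp only at h'
      subst h'
      exact vtx_cst (v1 : (Δ[1] : SSet.{u}) _⦋0⦌) (n := n + 1) 0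
    · exact (hn ⟨y, rfl⟩).elim) hx
  have := edgeAt_natural edgeL (s := s00) (t := s01) rfl rfl φ (x := a) (y := a)
    ((evalAt_vertex _ _).trans he) h (evalAt_vertex _ _) (evalAt_vertex _ _) he he rfl rfl
  refine ⟨_, this.symm.trans ?_⟩
  have hid : edgeAt edgeL (fst _ _ ≫ e) (x := a) (y := a) he he = 𝟙 _ := by
    refine Eq.trans (arr_congr (s' := X.σ 0 a) ?_ _ _) (arr_id _ _ _)
    rw [edgeOf_vertex, ← he]
    exact NatTrans.naturality_apply e (SimplexCategory.σ 0).op v0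
  rw [hid, Category.id_comp]
  rfl

end Kernel

end InfCat

namespace InfCat

open CartesianMonoidalCategory (lift fst snd)

/-! ### Maps with the lifting property against monomorphisms -/

/-- Lifts along `π` exist for all monomorphisms, within the vertices satisfying `P`, over the
vertices satisfying `Q`. -/
def IsTriv {X Y : SSet.{u}} (π : X ⟶ Y) (P : X _⦋0⦌ → Prop) (Q : Y _⦋0⦌ → Prop) : Prop :=
  ∀ (K L : SSet.{u}) (i : K ⟶ L) [Mono i] (f : K ⟶ X) (b : L ⟶ Y), f ≫ π = i ≫ b →
    (∀ v, P (f.app _ v)) → (∀ v, Q (b.app _ v)) →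
    ∃ g : L ⟶ X, i ≫ g = f ∧ g ≫ π = b ∧ ∀ v, P (g.app _ v)

section

variable {X Y Z : SSet.{u}} {π : X ⟶ Y} {P : X _⦋0⦌ → Prop} {Q : Y _⦋0⦌ → Prop}

/-- Vertices are lifted arbitrarily outside of `K`. All admissible lifts are relatively initial or
terminal, so the cells of positive dimension follow. -/
lemma isTriv_of_isLoc (j : ∀ n : ℕ, Fin (n + 2)) (hP : ∀ x, P x → IsLoc j π x)
    (hex : ∀ y, Q y → ∃ x, P x ∧ π.app _ x = y) : IsTriv π P Q := by
  intro K L i _ f b w hf hb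
  have key (v : L _⦋0⦌) : ∃ x, P x ∧ π.app _ x = b.app _ v ∧ ∀ k, i.app _ k = v → f.app _ k = x := by
    by_cases h : ∃ k, i.app _ k = v
    · obtain ⟨k, rfl⟩ := h
      refine ⟨f.app _ k, hf k, congrArg (fun g : K ⟶ Y ↦ g.app _ k) w, fun k' hk' ↦ ?_⟩
      rw [injective_of_mono (i.app _) hk']
    · obtain ⟨x, hx, hx'⟩ := hex _ (hb v)
      exact ⟨x, hx, hx', fun k hk ↦ (h ⟨k, hk⟩).elim⟩
  choose s hs₁ hs₂ hs₃ using key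
  obtain ⟨g, h₁, h₂, h₃⟩ := exists_lift_of_isLoc i π f b j s w hs₂ (fun k ↦ hs₃ _ k rfl)
    (fun n x _ ↦ hP _ (hs₁ _))
  exact ⟨g, h₁, h₂, fun v ↦ (h₃ v).symm ▸ hs₁ v⟩

lemma IsTriv.comp {π' : Y ⟶ Z} {R : Z _⦋0⦌ → Prop} (h : IsTriv π P Q) (h' : IsTriv π' Q R)
    (hPQ : ∀ x, P x → Q (π.app _ x)) : IsTriv (π ≫ π') P R := by
  intro K L i _ f b w hf hb
  obtain ⟨g, h₁, h₂, h₃⟩ := h' _ _ i (f ≫ π) b (by rw [Category.assoc, w]) (fun v ↦ hPQ _ (hf v)) hb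
  obtain ⟨g', h₁', h₂', h₃'⟩ := h _ _ i f g h₁.symm hf h₃
  exact ⟨g', h₁', by rw [← Category.assoc, h₂', h₂], h₃'⟩

lemma eq_v0_or_v1 (v : (Δ[1] : SSet.{u}) _⦋0⦌) : v = v0 ∨ v = v1 := by
  obtain ⟨i, rfl⟩ := stdSimplex.obj₀Equiv.symm.surjective v
  fin_cases i
  exacts [Or.inl rfl, Or.inr rfl]

lemma cst_v0_ne_cst_v1 (n : SimplexCategoryᵒᵖ) : cst (v0 : (Δ[1] : SSet.{u}) _⦋0⦌) n ≠ cst v1 n := by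
  intro h
  have := congrArg (fun x : (Δ[1] : SSet.{u}).obj n ↦ (stdSimplex.objEquiv x).toOrderHom 0) h
  exact absurd this (by change ¬ ((0 : Fin 2) = 1); decide)

/-- Lifts of homotopies with prescribed ends. -/
lemma IsTriv.lift_cylinder (h : IsTriv π P fun _ ↦ True) {K : SSet.{u}} (K' : K.Subcomplex)
    (a₀ a₁ : K ⟶ X) (g : (K' : SSet) ⊗ Δ[1] ⟶ X) (H : K ⊗ Δ[1] ⟶ Y)
    (hg₀ : ι₀ ≫ g = K'.ι ≫ a₀) (hg₁ : ι₁ ≫ g = K'.ι ≫ a₁) (hH₀ : ι₀ ≫ H = a₀ ≫ π)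
    (hH₁ : ι₁ ≫ H = a₁ ≫ π) (hH : K'.ι ▷ _ ≫ H = g ≫ π) (ha₀ : ∀ v, P (a₀.app _ v))
    (ha₁ : ∀ v, P (a₁.app _ v)) :
    ∃ G : K ⊗ Δ[1] ⟶ X, ι₀ ≫ G = a₀ ∧ ι₁ ≫ G = a₁ ∧ K'.ι ▷ _ ≫ G = g ∧ G ≫ π = H ∧
      ∀ v, P (G.app _ v) := by
  let A : (K ⊗ (Δ[1] : SSet.{u})).Subcomplex := (⊤ : K.Subcomplex).prod (Subcomplex.ofSimplex v0)
  let B : (K ⊗ (Δ[1] : SSet.{u})).Subcomplex := (⊤ : K.Subcomplex).prod (Subcomplex.ofSimplex v1)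
  let C : (K ⊗ (Δ[1] : SSet.{u})).Subcomplex := K'.prod ⊤
  have hA (m : SimplexCategoryᵒᵖ) (k : K.obj m) : (k, cst v0 m) ∈ A.obj m :=
    ⟨trivial, (mem_ofSimplex_iff _ _).2 rfl⟩
  have hB (m : SimplexCategoryᵒᵖ) (k : K.obj m) : (k, cst v1 m) ∈ B.obj m :=
    ⟨trivial, (mem_ofSimplex_iff _ _).2 rfl⟩
  obtain ⟨q, hq₁, hq₂⟩ := exists_glue (A := A) (B := B) (Y := X) (A.ι ≫ fst _ _ ≫ a₀)
    (B.ι ≫ fst _ _ ≫ a₁) (by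
    intro m x hxA hxB
    exact (cst_v0_ne_cst_v1 m (((mem_ofSimplex_iff _ _).1 hxA.2).symm.trans
      ((mem_ofSimplex_iff _ _).1 hxB.2))).elim)
  let gC : (C : SSet) ⟶ X := lift (Subcomplex.lift (C.ι ≫ fst _ _)
    (by rintro _ _ ⟨x, rfl⟩; exact x.2.1)) (C.ι ≫ snd _ _) ≫ g
  obtain ⟨r, hr₁, hr₂⟩ := exists_glue (A := A ⊔ B) (B := C) (Y := X) q gC (by
    rintro m ⟨k, e⟩ (hx | hx) hxC
    · obtain rfl := (mem_ofSimplex_iff _ _).1 hx.2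
      exact (hq₁ _ _ hx).trans
        (congrArg (fun k' : (K' : SSet) ⟶ X ↦ k'.app m ⟨k, hxC.1⟩) hg₀).symm
    · obtain rfl := (mem_ofSimplex_iff _ _).1 hx.2
      exact (hq₂ _ _ hx).trans
        (congrArg (fun k' : (K' : SSet) ⟶ X ↦ k'.app m ⟨k, hxC.1⟩) hg₁).symm)
  have hrA (m k) : r.app m ⟨(k, cst v0 m), Or.inl (Or.inl (hA m k))⟩ = a₀.app m k :=
    (hr₁ _ _ _).trans (hq₁ _ _ (hA m k))
  have hrB (m k) : r.app m ⟨(k, cst v1 m), Or.inl (Or.inr (hB m k))⟩ = a₁.app m k :=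
    (hr₁ _ _ _).trans (hq₂ _ _ (hB m k))
  obtain ⟨G, hG, hG', hGP⟩ := h _ _ (A ⊔ B ⊔ C).ι r H (by
    apply map_ext_app
    rintro m ⟨⟨k, e⟩, (hx | hx) | hx⟩
    · obtain rfl := (mem_ofSimplex_iff _ _).1 hx.2
      exact (congrArg (π.app _) (hrA _ k)).trans
        (congrArg (fun k' : K ⟶ Y ↦ k'.app _ k) hH₀).symm
    · obtain rfl := (mem_ofSimplex_iff _ _).1 hx.2
      exact (congrArg (π.app _) (hrB _ k)).trans
        (congrArg (fun k' : K ⟶ Y ↦ k'.app _ k) hH₁).symm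
    · exact (congrArg (π.app _) (hr₂ _ _ hx)).trans
        (congrArg (fun k' : (K' : SSet) ⊗ Δ[1] ⟶ Y ↦ k'.app _ (⟨k, hx.1⟩, e)) hH).symm) (by
    rintro ⟨⟨k, e⟩, hx⟩
    obtain rfl | rfl := eq_v0_or_v1 e
    · have := hrA (op ⦋0⦌) k
      refine (congrArg P (Eq.trans (congrArg (r.app _) (Subtype.ext ?_)) this)).mpr (ha₀ k)
      exact Prod.ext rfl (cst_self _).symm
    · have := hrB (op ⦋0⦌) k
      refine (congrArg P (Eq.trans (congrArg (r.app _) (Subtype.ext ?_)) this)).mpr (ha₁ k)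
      exact Prod.ext rfl (cst_self _).symm) (fun _ ↦ trivial)
  have hGr (m) (x) (hx) : G.app m x = r.app m ⟨x, hx⟩ :=
    congrArg (fun k : ((A ⊔ B ⊔ C : Subcomplex _) : SSet) ⟶ X ↦ k.app m ⟨x, hx⟩) hG
  refine ⟨G, ?_, ?_, ?_, hG', hGP⟩
  · exact map_ext_app fun m k ↦ (hGr _ (k, cst v0 _) _).trans (hrA _ k)
  · exact map_ext_app fun m k ↦ (hGr _ (k, cst v1 _) _).trans (hrB _ k)
  · apply map_ext_app
    rintro m ⟨k, e⟩
    have hx : (k.1, e) ∈ C.obj _ := ⟨k.2, trivial⟩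
    exact (hGr _ (k.1, e) (Or.inr hx)).trans (hr₂ _ _ hx)

end

/-! ### Families of cocones -/

section

variable {K L X : SSet.{u}} {p : K ⟶ X}

/-- A map to the space of cocones. -/
noncomputable def toCocones (t : L ⟶ X) (H : (K ⊗ L) ⊗ Δ[1] ⟶ X) (h₀ : ι₀ ≫ H = fst _ _ ≫ p)
    (h₁ : ι₁ ≫ H = snd _ _ ≫ t) : L ⟶ (comma (constFun K X) (vertex p) : SSet) :=
  Subcomplex.lift (lift t (MonoidalClosed.curry (MonoidalClosed.curry
    (lift (lift (fst _ _) (snd _ _ ≫ snd _ _)) (snd _ _ ≫ fst _ _) ≫ H)))) (by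
    rintro n _ ⟨l, rfl⟩
    have key (v : (Δ[1] : SSet.{u}) _⦋0⦌) (q : K ⊗ L ⟶ X)
        (hq : lift (𝟙 _) (SSet.const v) ≫ H = q) :
        (evalAt v _).app n ((MonoidalClosed.curry (MonoidalClosed.curry
          (lift (lift (fst _ _) (snd _ _ ≫ snd _ _)) (snd _ _ ≫ fst _ _) ≫ H))).app n l) =
        (MonoidalClosed.curry q).app n l := by
      rw [evalAt_app_curry, ← hq]
      have : lift (𝟙 _) (SSet.const v) ≫ H = K ◁ lift (SSet.const v) (𝟙 L) ≫
        (lift (lift (fst _ _) (snd _ _ ≫ snd _ _)) (snd _ _ ≫ fst _ _) ≫ H) :=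
          map_ext_app fun _ _ ↦ rfl
      rw [this, MonoidalClosed.curry_natural_left]
      rfl
    refine ⟨?_, ?_⟩
    · refine (mem_ofSimplex_iff _ _).2 ((key v0 _ h₀).trans (curry_fst_app p l))
    · refine (key v1 _ h₁).trans ?_
      change _ = (t ≫ constFun K X).app n l
      rw [constFun, ← MonoidalClosed.curry_natural_left]
      rfl)

lemma toCocones_comp {L' : SSet.{u}} (i : L' ⟶ L) (t : L ⟶ X) (H : (K ⊗ L) ⊗ Δ[1] ⟶ X) (h₀ : ι₀ ≫ H = fst _ _ ≫ p)
    (h₁ : ι₁ ≫ H = snd _ _ ≫ t) : i ≫ toCocones t H h₀ h₁ = toCocones (p := p) (i ≫ t) ((K ◁ i) ▷ _ ≫ H)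
      (by
        have : ι₀ ≫ (K ◁ i) ▷ Δ[1] ≫ H = K ◁ i ≫ ι₀ ≫ H := rfl
        rw [this, h₀]; rfl)
      (by
        have : ι₁ ≫ (K ◁ i) ▷ Δ[1] ≫ H = K ◁ i ≫ ι₁ ≫ H := rfl
        rw [this, h₁]; rfl) := by
  have : lift (lift (fst K (Δ[1] ⊗ L')) (snd _ _ ≫ snd _ _)) (snd _ _ ≫ fst _ _) ≫ (K ◁ i) ▷ Δ[1] ≫ H =
    (K ◁ (Δ[1] ◁ i)) ≫ lift (lift (fst _ _) (snd _ _ ≫ snd _ _)) (snd _ _ ≫ fst _ _) ≫ H :=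
      map_ext_app fun _ _ ↦ rfl
  refine map_ext_app fun n x ↦ Subtype.ext (Prod.ext rfl ?_)
  have e : i ≫ MonoidalClosed.curry (MonoidalClosed.curry
      (lift (lift (fst K (Δ[1] ⊗ L)) (snd _ _ ≫ snd _ _)) (snd _ _ ≫ fst _ _) ≫ H)) =
      MonoidalClosed.curry (MonoidalClosed.curry
      (lift (lift (fst K (Δ[1] ⊗ L')) (snd _ _ ≫ snd _ _)) (snd _ _ ≫ fst _ _) ≫
        (K ◁ i) ▷ Δ[1] ≫ H)) := by
    rw [this, MonoidalClosed.curry_natural_left, MonoidalClosed.curry_natural_left]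
  exact congrArg (fun k : L' ⟶ Fun Δ[1] (Fun K X) ↦ k.app _ x) e

lemma toCocones_injective {t t' : L ⟶ X} {H H' : (K ⊗ L) ⊗ Δ[1] ⟶ X} {h₀ h₁ h₀' h₁'}
    (h : toCocones (p := p) t H h₀ h₁ = toCocones t' H' h₀' h₁') : t = t' ∧ H = H' := by
  refine ⟨congrArg (fun k ↦ k ≫ (comma _ _).ι ≫ fst _ _) h, ?_⟩
  have h'' : MonoidalClosed.curry (MonoidalClosed.curry
      (lift (lift (fst K (Δ[1] ⊗ L)) (snd _ _ ≫ snd _ _)) (snd _ _ ≫ fst _ _) ≫ H)) =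
      MonoidalClosed.curry (MonoidalClosed.curry
      (lift (lift (fst K (Δ[1] ⊗ L)) (snd _ _ ≫ snd _ _)) (snd _ _ ≫ fst _ _) ≫ H')) :=
    congrArg (fun k ↦ k ≫ (comma _ _).ι ≫ snd _ _) h
  have h' := MonoidalClosed.curry_injective (MonoidalClosed.curry_injective h'')
  apply map_ext_app
  rintro n ⟨⟨k, l⟩, e⟩
  exact congrArg (fun g : K ⊗ (Δ[1] ⊗ L) ⟶ X ↦ g.app _ (k, (e, l))) h'

lemma toCocones_surjective (F : L ⟶ (comma (constFun K X) (vertex p) : SSet)) :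
    ∃ (t : L ⟶ X) (H : (K ⊗ L) ⊗ Δ[1] ⟶ X) (h₀ : _) (h₁ : _), F = toCocones t H h₀ h₁ := by
  let M := MonoidalClosed.uncurry (MonoidalClosed.uncurry (F ≫ (comma _ _).ι ≫ snd _ _))
  have hM : MonoidalClosed.curry (MonoidalClosed.curry M) = F ≫ (comma _ _).ι ≫ snd _ _ := by
    simp [M]
  let t := F ≫ (comma _ _).ι ≫ fst _ _
  have key (v : (Δ[1] : SSet.{u}) _⦋0⦌) (q : K ⊗ L ⟶ X)
      (hq : ∀ n (l : L.obj n), (evalAt v _).app n (F.app n l).1.2 = (MonoidalClosed.curry q).app n l) :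
      K ◁ lift (SSet.const v) (𝟙 L) ≫ M = q := by
    apply MonoidalClosed.curry_injective
    rw [MonoidalClosed.curry_natural_left]
    apply map_ext_app
    intro n l
    refine Eq.trans ?_ (hq _ l)
    refine (evalAt_app_curry (MonoidalClosed.curry M) v l).symm.trans ?_
    rw [hM]
    rfl
  refine ⟨t, lift (fst _ _ ≫ fst _ _) (lift (snd _ _) (fst _ _ ≫ snd _ _)) ≫ M, ?_, ?_, ?_⟩
  · refine Eq.trans ?_ (key v0 _ ?_)
    · exact map_ext_app fun _ _ ↦ rfl
    · intro n l
      rw [curry_fst_app]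
      exact (mem_ofSimplex_iff _ _).1 (F.app n l).2.1
  · refine Eq.trans ?_ (key v1 _ ?_)
    · exact map_ext_app fun _ _ ↦ rfl
    · intro n l
      have ht : t ≫ constFun K X = MonoidalClosed.curry (snd K L ≫ t) := by
        rw [constFun, ← MonoidalClosed.curry_natural_left]
        rfl
      exact (F.app n l).2.2.trans (congrArg (fun k : L ⟶ Fun K X ↦ k.app n l) ht)
  · refine map_ext_app fun n x ↦ Subtype.ext (Prod.ext rfl ?_)
    exact congrArg (fun k : L ⟶ Fun Δ[1] (Fun K X) ↦ k.app _ x) hM.symm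

lemma toCocones_app_eq_iff (c : Cocone p) (t : L ⟶ X) (H : (K ⊗ L) ⊗ Δ[1] ⟶ X) (h₀ : ι₀ ≫ H = fst _ _ ≫ p)
    (h₁ : ι₁ ≫ H = snd _ _ ≫ t) (w : L _⦋0⦌) : (toCocones t H h₀ h₁).app _ w = c.toComma ↔
      t.app _ w = c.pt ∧ ∀ m k e, H.app m ((k, cst w m), e) = c.hom.app m (k, e) := by
  have e₂ : ((toCocones t H h₀ h₁).app _ w).1.2 =
      vertex (MonoidalClosed.curry (lift (lift (fst K Δ[1]) (SSet.const w)) (snd _ _) ≫ H)) := by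
    refine (curry_app _ w).trans (congrArg vertex ?_)
    rw [← MonoidalClosed.curry_natural_left]
    rfl
  constructor
  · intro h
    refine ⟨congrArg (fun z ↦ z.1.1) h, fun m k e ↦ ?_⟩
    have := MonoidalClosed.curry_injective (vertex_injective (e₂.symm.trans (congrArg (fun z ↦ z.1.2) h)))
    exact congrArg (fun g : K ⊗ Δ[1] ⟶ X ↦ g.app m (k, e)) this
  · rintro ⟨h, h'⟩
    refine Subtype.ext (Prod.ext h (e₂.trans (congrArg vertex (congrArg MonoidalClosed.curry ?_))))
    exact map_ext_app fun _ _ ↦ h' _ _ _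

/-- The definition, with a boundary in the space of cocones rewritten as a family of tips `t` and a
transformation `H`. In this form lifts along monomorphisms can be applied to the two pieces
separately. -/
lemma Cocone.isColimit_iff (c : Cocone p) : c.IsColimit ↔
    ∀ (n : ℕ) (t : (∂Δ[n + 1] : SSet.{u}) ⟶ X) (H : (K ⊗ (∂Δ[n + 1] : SSet.{u})) ⊗ Δ[1] ⟶ X),
      ι₀ ≫ H = fst _ _ ≫ p → ι₁ ≫ H = snd _ _ ≫ t →
      (∀ w : (∂Δ[n + 1] : SSet.{u}) _⦋0⦌, w.1 = stdSimplex.obj₀Equiv.symm 0 →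
        t.app _ w = c.pt ∧ ∀ m k e, H.app m ((k, cst w m), e) = c.hom.app m (k, e)) →
      ∃ (t' : Δ[n + 1] ⟶ X) (H' : (K ⊗ Δ[n + 1]) ⊗ Δ[1] ⟶ X), ∂Δ[n + 1].ι ≫ t' = t ∧
        (K ◁ ∂Δ[n + 1].ι) ▷ _ ≫ H' = H ∧ ι₀ ≫ H' = fst _ _ ≫ p ∧ ι₁ ≫ H' = snd _ _ ≫ t' := by
  constructor
  · intro hc n t H h₀ h₁ hw
    obtain ⟨g, hg⟩ := hc n (toCocones t H h₀ h₁) (fun w hw' ↦ (toCocones_app_eq_iff _ _ _ _ _ _).2 (hw w hw'))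
    obtain ⟨t', H', h₀', h₁', rfl⟩ := toCocones_surjective g
    rw [toCocones_comp] at hg
    obtain ⟨rfl, rfl⟩ := toCocones_injective hg
    exact ⟨t', H', rfl, rfl, h₀', h₁'⟩
  · intro hc n F hF
    obtain ⟨t, H, h₀, h₁, rfl⟩ := toCocones_surjective F
    obtain ⟨t', H', rfl, rfl, h₀', h₁'⟩ := hc n t H h₀ h₁
      (fun w hw ↦ (toCocones_app_eq_iff _ _ _ _ _ _).1 (hF w hw))
    exact ⟨toCocones t' H' h₀' h₁', toCocones_comp _ _ _ _ _⟩

end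

/-- Colimit cocones are transferred along maps with the lifting property
against monomorphisms. -/
theorem isColimit_transfer {K M X X' : SSet.{u}} {π : M ⟶ X} {π' : M ⟶ X'} {P : M _⦋0⦌ → Prop}
    (hπ : IsTriv π P fun _ ↦ True) (hπ' : IsTriv π' P fun _ ↦ True) (C : K ⊗ Δ[1] ⟶ M)
    (hC : ∀ v, P (C.app _ v)) (κ : M _⦋0⦌) (hκ : P κ) (hCκ : ι₁ ≫ C = SSet.const κ)
    {p : K ⟶ X} (c : Cocone p) (hp : c.hom = C ≫ π) (hpt : c.pt = π.app _ κ)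
    {p' : K ⟶ X'} (c' : Cocone p') (hp' : c'.hom = C ≫ π') (hpt' : c'.pt = π'.app _ κ)
    (hc : c.IsColimit) : c'.IsColimit := by
  rw [Cocone.isColimit_iff] at hc ⊢
  intro n t H h₀ h₁ hw
  let q : K ⟶ M := ι₀ ≫ C
  have hq : q ≫ π = p := by rw [← c.ι₀_hom, hp]; rfl
  have hq' : q ≫ π' = p' := by rw [← c'.ι₀_hom, hp']; rfl
  let w₀ : (∂Δ[n + 1] : SSet.{u}) _⦋0⦌ := ⟨stdSimplex.obj₀Equiv.symm 0, mem_boundary_vertex _⟩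
  have : Mono (SSet.const w₀ : Δ[0] ⟶ (∂Δ[n + 1] : SSet.{u})) :=
    mono_of_retraction _ (SSet.const (stdSimplex.obj₀Equiv.symm 0)) (map_ext_app fun m x ↦ by
      apply stdSimplex.objEquiv.injective
      ext k : 3
      exact Subsingleton.elim (α := Fin 1) _ _)
  -- The boundary of cocones is first lifted from `X'` to `M`: the tips here, with value `κ` at the
  -- vertex `0`, and then the transformations.
  obtain ⟨τ, hτ, hτπ, hτP⟩ := hπ' _ _ (SSet.const w₀ : Δ[0] ⟶ (∂Δ[n + 1] : SSet.{u})) (SSet.const κ) t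
    (map_ext_app fun m x ↦ by
      refine (app_cst π' κ _).trans (Eq.trans ?_ (app_cst t w₀ _).symm)
      rw [(hw w₀ rfl).1, hpt'])
    (fun v ↦ (map_const_self M κ).symm ▸ hκ) (fun _ ↦ trivial)
  have hτw : τ.app _ w₀ = κ := by
    have := congrArg (fun k : (Δ[0] : SSet.{u}) ⟶ M ↦ k.app _ (stdSimplex.obj₀Equiv.symm 0)) hτ
    refine Eq.trans ?_ (this.trans (map_const_self M κ))
    exact congrArg (τ.app _) (map_const_self _ w₀).symm
  let K' : (K ⊗ (∂Δ[n + 1] : SSet.{u})).Subcomplex := (⊤ : K.Subcomplex).prod (Subcomplex.ofSimplex w₀)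
  have hK' (m : SimplexCategoryᵒᵖ) (x : (K ⊗ (∂Δ[n + 1] : SSet.{u})).obj m) (hx : x ∈ K'.obj m) :
    x = (x.1, cst w₀ m) := Prod.ext rfl ((mem_ofSimplex_iff _ _).1 hx.2)
  obtain ⟨G, hG₀, hG₁, hG, hGπ, hGP⟩ := hπ'.lift_cylinder K' (fst _ _ ≫ q) (snd _ _ ≫ τ)
    ((K'.ι ≫ fst _ _) ▷ _ ≫ C) H rfl (by
      apply map_ext_app
      rintro m ⟨x, hx⟩
      refine (congrArg (fun k : K ⟶ M ↦ k.app _ x.1) hCκ).trans ?_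
      change cst κ _ = τ.app _ x.2
      rw [(mem_ofSimplex_iff _ _).1 hx.2, app_cst, hτw])
    (by rw [h₀, Category.assoc, hq']) (by rw [h₁, Category.assoc, hτπ]) (by
      apply map_ext_app
      rintro m ⟨⟨x, hx⟩, e⟩
      change H.app _ (x, e) = (C ≫ π').app _ (x.1, e)
      rw [hK' _ _ hx, (hw w₀ rfl).2, hp']) (fun v ↦ hC _) (fun v ↦ hτP _)
  -- Its image in `X` can be filled since `c` is a colimit.
  obtain ⟨t', H', ht', hH', h₀', h₁'⟩ := hc n (τ ≫ π) (G ≫ π)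
    (by rw [← Category.assoc, hG₀, Category.assoc, hq])
    (by rw [← Category.assoc, hG₁, Category.assoc]) (fun w hw' ↦ by
      obtain rfl : w = w₀ := Subtype.ext hw'
      refine ⟨(congrArg (π.app _) hτw).trans hpt.symm, fun m k e ↦ ?_⟩
      rw [hp]
      refine congrArg (π.app m) ?_
      exact congrArg (fun g : (K' : SSet) ⊗ Δ[1] ⟶ M ↦ g.app m (⟨(k, cst w₀ m),
        ⟨trivial, (mem_ofSimplex_iff _ _).2 rfl⟩⟩, e)) hG)
  -- The filler is lifted back to `M` along `π`, relative to the boundary, and its image under `π'`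
  -- is the filler in `X'`.
  obtain ⟨τ', hτ', hτπ', hτP'⟩ := hπ _ _ ∂Δ[n + 1].ι τ t' ht'.symm hτP (fun _ ↦ trivial)
  let K'' : (K ⊗ (Δ[n + 1] : SSet.{u})).Subcomplex := (⊤ : K.Subcomplex).prod (boundary (n + 1))
  let j : (K'' : SSet) ⟶ K ⊗ (∂Δ[n + 1] : SSet.{u}) := lift (K''.ι ≫ fst _ _)
    (Subcomplex.lift (K''.ι ≫ snd _ _) (by rintro _ _ ⟨x, rfl⟩; exact x.2.2))
  have hj : j ≫ K ◁ ∂Δ[n + 1].ι = K''.ι := rfl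
  obtain ⟨G', hG₀', hG₁', hG', hGπ', -⟩ := hπ.lift_cylinder K'' (fst _ _ ≫ q) (snd _ _ ≫ τ')
    (j ▷ _ ≫ G) H' (by
      have : ι₀ ≫ j ▷ _ ≫ G = j ≫ ι₀ ≫ G := rfl
      rw [this, hG₀]; rfl) (by
      have : ι₁ ≫ j ▷ _ ≫ G = j ≫ ι₁ ≫ G := rfl
      rw [this, hG₁, ← hτ']; rfl)
    (by rw [h₀', Category.assoc, hq]) (by rw [h₁', Category.assoc, hτπ']) (by
      rw [Category.assoc, ← hH', ← hj]; rfl) (fun v ↦ hC _) (fun v ↦ hτP' _)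
  refine ⟨τ' ≫ π', G' ≫ π', ?_, ?_, ?_, ?_⟩
  · rw [← Category.assoc, hτ', hτπ]
  · rw [← hGπ]
    apply map_ext_app
    rintro m ⟨⟨k, d⟩, e⟩
    refine congrArg (π'.app _) ?_
    exact congrArg (fun g : (K'' : SSet) ⊗ Δ[1] ⟶ M ↦ g.app _ (⟨(k, d.1), ⟨trivial, d.2⟩⟩, e)) hG'
  · rw [← Category.assoc, hG₀', Category.assoc, hq']
  · rw [← Category.assoc, hG₁', Category.assoc]

end InfCat

namespace InfCat

open CartesianMonoidalCategory (lift fst snd)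

/-! ### Suspension squares -/

/-- A square in a stable quasicategory which exhibits its last vertex as the suspension of its first
vertex. -/
structure IsSuspensionSquare {X : SSet.{u}} (σ : Square ⟶ X) : Prop where
  isPushout : IsPushout σ
  isPullback : IsPullback σ
  isZero₀₁ : IsZeroVertex (σ.app _ s01)
  isZero₁₀ : IsZeroVertex (σ.app _ s10)

/-- The vertices of `Fun(Δ[1] × Δ[1], X)` given by suspension squares. -/
def IsSuspension {X : SSet.{u}} (x : (Fun Square X) _⦋0⦌) : Prop :=
  ∃ σ, x = vertex σ ∧ IsSuspensionSquare σ

section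

variable {X : SSet.{u}} [Quasicategory X]

lemma IsZeroVertex.exists_edge_from {z : X _⦋0⦌} (hz : IsZeroVertex z) (x : X _⦋0⦌) :
    ∃ e : Δ[1] ⟶ X, e.app _ v0 = z ∧ e.app _ v1 = x := by
  obtain ⟨p, h₀, h₁, -⟩ := edgeHom_surjective (hz.1.nonempty_unique x).some.default
  exact ⟨p, (evalAt_vertex _ _).symm.trans h₀, (evalAt_vertex _ _).symm.trans h₁⟩

lemma IsZeroVertex.exists_edge_to {z : X _⦋0⦌} (hz : IsZeroVertex z) (x : X _⦋0⦌) :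
    ∃ e : Δ[1] ⟶ X, e.app _ v0 = x ∧ e.app _ v1 = z := by
  obtain ⟨p, h₀, h₁, -⟩ := edgeHom_surjective (hz.2.nonempty_unique x).some.default
  exact ⟨p, (evalAt_vertex _ _).symm.trans h₀, (evalAt_vertex _ _).symm.trans h₁⟩

lemma IsStable.exists_suspension (h : IsStable X) (τ : (span : SSet) ⟶ X)
    (hτ : ∀ x : (span.{u} : SSet) _⦋0⦌, x.1 = s01 ∨ x.1 = s10 → IsZeroVertex (τ.app _ x)) :
    ∃ σ, IsSuspensionSquare σ ∧ span.ι ≫ σ = τ := by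
  obtain ⟨σ, rfl, hσ'⟩ := h.exists_pushout τ
  exact ⟨σ, ⟨hσ', (h.isPushout_iff σ).1 hσ',
    hτ ⟨s01, (mem_span_iff _).2 (Or.inl (cst_self _).symm)⟩ (Or.inl rfl),
    hτ ⟨s10, (mem_span_iff _).2 (Or.inr (cst_self _).symm)⟩ (Or.inr rfl)⟩, rfl⟩

lemma IsStable.exists_suspension' (h : IsStable X) (τ : (cospan : SSet) ⟶ X)
    (hτ : ∀ x : (cospan.{u} : SSet) _⦋0⦌, x.1 = s01 ∨ x.1 = s10 → IsZeroVertex (τ.app _ x)) :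
    ∃ σ, IsSuspensionSquare σ ∧ cospan.ι ≫ σ = τ := by
  obtain ⟨σ, rfl, hσ'⟩ := h.exists_pullback τ
  exact ⟨σ, ⟨(h.isPushout_iff σ).2 hσ', hσ',
    hτ ⟨s01, (mem_cospan_iff _).2 (Or.inr (cst_self _).symm)⟩ (Or.inl rfl),
    hτ ⟨s10, (mem_cospan_iff _).2 (Or.inl (cst_self _).symm)⟩ (Or.inr rfl)⟩, rfl⟩

lemma IsStable.exists_span (h : IsStable X) (x : X _⦋0⦌) : ∃ τ : (span : SSet) ⟶ X,
    (∀ x : (span.{u} : SSet) _⦋0⦌, x.1 = s01 ∨ x.1 = s10 → IsZeroVertex (τ.app _ x)) ∧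
      τ.app _ spanTip = x := by
  obtain ⟨z, hz⟩ := h.exists_zero
  obtain ⟨e, he₀, he₁⟩ := IsZeroVertex.exists_edge_to hz x
  -- The supremum is `0` at the first corner only, so both legs of the span become the chosen edge
  -- to the zero object.
  let m : Square ⟶ (Δ[1] : SSet.{u}) := stdProd (fun i j ↦ i ⊔ j)
    (fun i i' j j' h h' ↦ sup_le_sup h h')
  have hm₀ : m.app _ s00 = v0 := stdSimplex.obj₀Equiv.injective rfl
  have hm₁ : m.app _ s01 = v1 := stdSimplex.obj₀Equiv.injective rfl
  have hm₂ : m.app _ s10 = v1 := stdSimplex.obj₀Equiv.injective rfl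
  refine ⟨span.ι ≫ m ≫ e, ?_, (congrArg (e.app _) hm₀).trans he₀⟩
  rintro ⟨x, _⟩ (rfl | rfl)
  · have : e.app _ (m.app _ s01) = z := (congrArg (e.app _) hm₁).trans he₁
    exact (congrArg IsZeroVertex this).mpr hz
  · have : e.app _ (m.app _ s10) = z := (congrArg (e.app _) hm₂).trans he₁
    exact (congrArg IsZeroVertex this).mpr hz

lemma IsStable.exists_cospan (h : IsStable X) (x : X _⦋0⦌) : ∃ τ : (cospan : SSet) ⟶ X,
    (∀ x : (cospan.{u} : SSet) _⦋0⦌, x.1 = s01 ∨ x.1 = s10 → IsZeroVertex (τ.app _ x)) ∧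
      τ.app _ cospanTip = x := by
  obtain ⟨z, hz⟩ := h.exists_zero
  obtain ⟨e, he₀, he₁⟩ := IsZeroVertex.exists_edge_from hz x
  let m : Square ⟶ (Δ[1] : SSet.{u}) := stdProd (fun i j ↦ i ⊓ j)
    (fun i i' j j' h h' ↦ inf_le_inf h h')
  have hm₀ : m.app _ s11 = v1 := stdSimplex.obj₀Equiv.injective rfl
  have hm₁ : m.app _ s01 = v0 := stdSimplex.obj₀Equiv.injective rfl
  have hm₂ : m.app _ s10 = v0 := stdSimplex.obj₀Equiv.injective rfl
  refine ⟨cospan.ι ≫ m ≫ e, ?_, (congrArg (e.app _) hm₀).trans he₁⟩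
  rintro ⟨x, _⟩ (rfl | rfl)
  · have : e.app _ (m.app _ s01) = z := (congrArg (e.app _) hm₁).trans he₀
    exact (congrArg IsZeroVertex this).mpr hz
  · have : e.app _ (m.app _ s10) = z := (congrArg (e.app _) hm₂).trans he₀
    exact (congrArg IsZeroVertex this).mpr hz

lemma IsStable.exists_suspensionSquare (h : IsStable X) (x : X _⦋0⦌) :
    ∃ σ, IsSuspensionSquare σ ∧ σ.app _ s00 = x := by
  obtain ⟨τ, hτ, hτ'⟩ := h.exists_span x
  obtain ⟨σ, hσ, rfl⟩ := h.exists_suspension τ hτ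
  exact ⟨σ, hσ, hτ'⟩

lemma IsStable.exists_suspensionSquare' (h : IsStable X) (x : X _⦋0⦌) :
    ∃ σ, IsSuspensionSquare σ ∧ σ.app _ s11 = x := by
  obtain ⟨τ, hτ, hτ'⟩ := h.exists_cospan x
  obtain ⟨σ, hσ, rfl⟩ := h.exists_suspension' τ hτ
  exact ⟨σ, hσ, hτ'⟩

/-- An object extends to a span with zero corners because these are terminal, and spans extend to
squares by pushouts, both without obstructions relative to monomorphisms. Together with the dual
`IsStable.isTriv_evalAt_s11` this replaces the assertion that suspension is an equivalence. -/
lemma IsStable.isTriv_evalAt_s00 (h : IsStable X) :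
    IsTriv (evalAt s00 X) IsSuspension fun _ ↦ True := by
  have e : restrict span.ι X ≫ evalAt spanTip X = evalAt s00 X := restrict_evalAt _ _
  rw [← e]
  let Q (y : (Fun (span : SSet) X) _⦋0⦌) : Prop := ∃ τ : (span : SSet) ⟶ X, y = vertex τ ∧
    ∀ x : (span.{u} : SSet) _⦋0⦌, x.1 = s01 ∨ x.1 = s10 → IsZeroVertex (τ.app _ x)
  have h₁ : IsTriv (restrict span.ι X) IsSuspension Q := by
    refine isTriv_of_isLoc (fun _ ↦ 0) ?_ ?_
    · rintro _ ⟨σ, rfl, hσ⟩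
      exact hσ.isPushout.isLoc
    · rintro _ ⟨τ, rfl, hτ⟩
      obtain ⟨σ, hσ, rfl⟩ := h.exists_suspension τ hτ
      exact ⟨vertex σ, ⟨σ, rfl, hσ⟩, restrict_vertex _ _⟩
  have h₂ : IsTriv (evalAt spanTip X) Q fun _ ↦ True := by
    refine isTriv_of_isLoc (fun n ↦ Fin.last (n + 1)) ?_ ?_
    · rintro _ ⟨τ, rfl, hτ⟩
      exact isLoc_spanTip _ fun x hx ↦ (hτ x hx).2
    · intro y _
      obtain ⟨τ, hτ, rfl⟩ := h.exists_span y
      exact ⟨vertex τ, ⟨τ, rfl, hτ⟩, evalAt_vertex _ _⟩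
  refine h₁.comp h₂ ?_
  rintro _ ⟨σ, rfl, hσ⟩
  refine ⟨span.ι ≫ σ, restrict_vertex _ _, ?_⟩
  rintro ⟨x, _⟩ (rfl | rfl)
  exacts [hσ.isZero₀₁, hσ.isZero₁₀]

lemma IsStable.isTriv_evalAt_s11 (h : IsStable X) :
    IsTriv (evalAt s11 X) IsSuspension fun _ ↦ True := by
  have e : restrict cospan.ι X ≫ evalAt cospanTip X = evalAt s11 X := restrict_evalAt _ _
  rw [← e]
  let Q (y : (Fun (cospan : SSet) X) _⦋0⦌) : Prop := ∃ τ : (cospan : SSet) ⟶ X, y = vertex τ ∧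
    ∀ x : (cospan.{u} : SSet) _⦋0⦌, x.1 = s01 ∨ x.1 = s10 → IsZeroVertex (τ.app _ x)
  have h₁ : IsTriv (restrict cospan.ι X) IsSuspension Q := by
    refine isTriv_of_isLoc (fun n ↦ Fin.last (n + 1)) ?_ ?_
    · rintro _ ⟨σ, rfl, hσ⟩
      exact hσ.isPullback.isLoc
    · rintro _ ⟨τ, rfl, hτ⟩
      obtain ⟨σ, hσ, rfl⟩ := h.exists_suspension' τ hτ
      exact ⟨vertex σ, ⟨σ, rfl, hσ⟩, restrict_vertex _ _⟩
  have h₂ : IsTriv (evalAt cospanTip X) Q fun _ ↦ True := by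
    refine isTriv_of_isLoc (fun _ ↦ 0) ?_ ?_
    · rintro _ ⟨τ, rfl, hτ⟩
      exact isLoc_cospanTip _ fun x hx ↦ (hτ x hx).1
    · intro y _
      obtain ⟨τ, hτ, rfl⟩ := h.exists_cospan y
      exact ⟨vertex τ, ⟨τ, rfl, hτ⟩, evalAt_vertex _ _⟩
  refine h₁.comp h₂ ?_
  rintro _ ⟨σ, rfl, hσ⟩
  refine ⟨cospan.ι ≫ σ, restrict_vertex _ _, ?_⟩
  rintro ⟨x, _⟩ (rfl | rfl)
  exacts [hσ.isZero₀₁, hσ.isZero₁₀]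

/-- If the suspension of a morphism is weakly compact, then so is the morphism. -/
theorem IsStable.isWeaklyCompact_of_suspension (h : IsStable X) {α β : Square ⟶ X}
    (hα : IsSuspensionSquare α) (hβ : IsSuspensionSquare β)
    (θ : Ho.mk (vertex α) ⟶ Ho.mk (vertex β)) {x x' y y' : X _⦋0⦌}
    (hx : (evalAt s00 X).app _ (vertex α) = x) (hx' : (evalAt s00 X).app _ (vertex β) = x')
    (hy : (evalAt s11 X).app _ (vertex α) = y) (hy' : (evalAt s11 X).app _ (vertex β) = y')
    (hθ : IsWeaklyCompact (push (evalAt s11 X) hy hy' θ)) :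
    IsWeaklyCompact (push (evalAt s00 X) hx hx' θ) := by
  intro I hI p c hc b
  obtain ⟨σ, hσ, hσc⟩ := h.exists_suspensionSquare c.pt
  have hκ : (evalAt s00 X).app _ (vertex σ) = c.pt := (evalAt_vertex _ _).trans hσc
  have : Mono (ι₁ : I ⟶ I ⊗ Δ[1]) := mono_of_retraction _ (fst _ _) rfl
  -- Suspension squares are chosen coherently over the whole colimit cocone, with the constant value
  -- `σ` over its tip.
  obtain ⟨C, hC₁, hC, hCP⟩ := h.isTriv_evalAt_s00 _ _ (ι₁ : I ⟶ I ⊗ Δ[1]) (SSet.const (vertex σ)) c.hom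
    (by
      rw [c.ι₁_hom]
      exact map_ext_app fun m k ↦ (app_cst _ _ _).trans (congrArg (fun v ↦ cst v _) hκ))
    (fun v ↦ (map_const_self _ (vertex σ)).symm ▸ ⟨σ, rfl, hσ⟩) (fun _ ↦ trivial)
  have hq : (ι₀ ≫ C) ≫ evalAt s00 X = p := by rw [Category.assoc, hC, c.ι₀_hom]
  let c' : Cocone ((ι₀ ≫ C) ≫ evalAt s11 X) :=
    { pt := (evalAt s11 X).app _ (vertex σ)
      hom := C ≫ evalAt s11 X
      ι₀_hom := rfl
      ι₁_hom := by
        rw [← Category.assoc, hC₁]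
        exact map_ext_app fun m k ↦ app_cst _ _ _ }
  -- Suspension preserves colimits: the last vertices of the squares again form a colimit cocone.
  have hc' : c'.IsColimit := isColimit_transfer h.isTriv_evalAt_s00 h.isTriv_evalAt_s11 C hCP
    (vertex σ) ⟨σ, rfl, hσ⟩ hC₁ c hC.symm hκ.symm c' rfl rfl hc
  obtain ⟨b', rfl⟩ := (hβ.isPushout.push_bijective hσ.isZero₀₁.2 hσ.isZero₁₀.2 hx' hκ).2 b
  obtain ⟨i, a, ha⟩ := hθ I hI _ c' hc' (push (evalAt s11 X) hy' rfl b')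
  obtain ⟨ρ, hρ, hρ'⟩ : IsSuspension ((ι₀ ≫ C).app _ i) := hCP _
  have hρi : (evalAt s11 X).app _ (vertex ρ) = ((ι₀ ≫ C) ≫ evalAt s11 X).app _ i :=
    congrArg ((evalAt s11 X).app _) hρ.symm
  have hρi' : (evalAt s00 X).app _ (vertex ρ) = p.app _ i :=
    (congrArg ((evalAt s00 X).app _) hρ.symm).trans
      (congrArg (fun k : I ⟶ X ↦ k.app _ i) hq)
  obtain ⟨a', rfl⟩ := (hρ'.isPullback.push_bijective hα.isZero₀₁.1 hα.isZero₁₀.1 hy hρi).2 a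
  let d : Cocone (ι₀ ≫ C) := ⟨vertex σ, C, rfl, hC₁⟩
  let s := C.app _ (I.σ 0 i, stdSimplex.objEquiv.symm (𝟙 ⦋1⦌))
  let l : Ho.mk (vertex ρ) ⟶ Ho.mk (vertex σ) := arr s ((d.leg i).src_eq.trans hρ) (d.leg i).tgt_eq
  have hl₁ : push (evalAt s11 X) hρi rfl l = Ho.homMk (c'.leg i) := push_arr _ _ _ _ _ _
  have hl₀ : push (evalAt s00 X) hρi' hκ l = Ho.homMk (c.leg i) :=
    (push_arr _ _ _ _ _ _).trans (arr_congr (congrArg (fun k : I ⊗ Δ[1] ⟶ X ↦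
      k.app _ (I.σ 0 i, stdSimplex.objEquiv.symm (𝟙 ⦋1⦌))) hC) _ _)
  refine ⟨i, push (evalAt s00 X) hx hρi' a', ?_⟩
  rw [← hl₀, ← push_comp, ← push_comp]
  congr 1
  -- Morphisms of suspension squares are determined by their values at the last vertex, so the
  -- equation may be checked after suspension.
  apply (hσ.isPullback.push_bijective hα.isZero₀₁.1 hα.isZero₁₀.1 hy rfl).1
  rw [push_comp _ hy hρi rfl, push_comp _ hy hy' rfl, hl₁, ha]

end

end InfCat

namespace InfCat

open CartesianMonoidalCategory (lift fst snd)

/-! ### Cofibre squares and pasting -/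

section

variable {X : SSet.{u}}

lemma δ_yonedaEquiv_symm {n : ℕ} (r : X _⦋n + 1⦌) (i : Fin (n + 2)) :
    stdSimplex.δ i ≫ SSet.yonedaEquiv.symm r = SSet.yonedaEquiv.symm (X.δ i r) := by
  apply SSet.yonedaEquiv.injective
  rw [Equiv.apply_symm_apply]
  exact (NatTrans.naturality_apply (SSet.yonedaEquiv.symm r) (SimplexCategory.δ i).op _).trans
    (congrArg (X.δ i) (SSet.yonedaEquiv.apply_symm_apply r))

lemma arr_cst (x : X _⦋0⦌) (h₀ h₁) : arr (cst x (op ⦋1⦌)) (x := x) (y := x) h₀ h₁ = 𝟙 _ := by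
  have e : cst x (op ⦋1⦌) = X.σ 0 x := by
    have : SimplexCategory.const ⦋1⦌ ⦋0⦌ 0 = SimplexCategory.σ 0 := Subsingleton.elim _ _
    exact congrArg (fun k : ⦋1⦌ ⟶ ⦋0⦌ ↦ X.map k.op x) this
  exact (arr_congr e _ _).trans (arr_id _ _ _)

lemma edgeAt_congr {K K' : SSet.{u}} {e : Δ[1] ⟶ K} {σ : K ⟶ X} {e' : Δ[1] ⟶ K'} {σ' : K' ⟶ X}
    (h : e ≫ σ = e' ≫ σ') {x y : X _⦋0⦌} (h₀ h₁ h₀' h₁') :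
    edgeAt e σ (x := x) (y := y) h₀ h₁ = edgeAt e' σ' h₀' h₁' :=
  arr_congr (by rw [h]) _ _

/-- The two paths around a square agree. -/
lemma edgeAt_square [Quasicategory X] (σ : Square ⟶ X) {x y z w : X _⦋0⦌} (h₀₀ : σ.app _ s00 = x) (h₁₀ : σ.app _ s10 = y)
    (h₀₁ : σ.app _ s01 = z) (h₁₁ : σ.app _ s11 = w) :
    edgeAt edgeT σ h₀₀ h₁₀ ≫ edgeAt edgeR σ h₁₀ h₁₁ = edgeAt edgeL σ h₀₀ h₀₁ ≫ edgeAt edgeB σ h₀₁ h₁₁ := by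
  have hc : X.δ 1 (SSet.yonedaEquiv (lift (𝟙 (Δ[1] : SSet.{u})) (𝟙 _) ≫ σ)) = x := by
    rw [← edgeOf_vertex, δ_one_edgeOf, evalAt_vertex]
    exact h₀₀
  have hd : X.δ 0 (SSet.yonedaEquiv (lift (𝟙 (Δ[1] : SSet.{u})) (𝟙 _) ≫ σ)) = w := by
    rw [← edgeOf_vertex, δ_zero_edgeOf, evalAt_vertex]
    exact h₁₁
  have key (i : Fin 3) (t : Δ[2] ⟶ Square) (e : Δ[1] ⟶ Square) (h : stdSimplex.δ i ≫ t = e) :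
      X.δ i (SSet.yonedaEquiv (t ≫ σ)) = SSet.yonedaEquiv (e ≫ σ) := by
    rw [← h]
    exact (NatTrans.naturality_apply (t ≫ σ) (SimplexCategory.δ i).op _).symm
  refine (arr_comp (hc₀ := hc) (hc₁ := hd) (SSet.yonedaEquiv (lowerTriangle ≫ σ)) ?_ ?_ ?_).trans
    (arr_comp (hc₀ := hc) (hc₁ := hd) (SSet.yonedaEquiv (upperTriangle ≫ σ)) ?_ ?_ ?_).symm
  · exact (key _ _ _ δ_two_lowerTriangle).trans (edgeOf_vertex _).symm
  · exact (key _ _ _ δ_zero_lowerTriangle).trans (edgeOf_vertex _).symm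
  · exact key _ _ _ δ_one_lowerTriangle
  · exact (key _ _ _ δ_two_upperTriangle).trans (edgeOf_vertex _).symm
  · exact (key _ _ _ δ_zero_upperTriangle).trans (edgeOf_vertex _).symm
  · exact key _ _ _ δ_one_upperTriangle

variable [Quasicategory X]

lemma exists_triangle_to {z : X _⦋0⦌} (hz : IsZeroVertex z) (p : Δ[1] ⟶ X) :
    ∃ r : Δ[2] ⟶ X, stdSimplex.δ 2 ≫ r = p ∧ r.app _ (stdSimplex.obj₀Equiv.symm 2) = z := by
  obtain ⟨e, he₀, he₁⟩ := IsZeroVertex.exists_edge_to hz (p.app _ v1)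
  have h (q : Δ[1] ⟶ X) : X.δ 1 (SSet.yonedaEquiv q) = q.app _ v0 ∧
      X.δ 0 (SSet.yonedaEquiv q) = q.app _ v1 := by
    rw [← edgeOf_vertex, δ_one_edgeOf, evalAt_vertex, δ_zero_edgeOf, evalAt_vertex]
    exact ⟨rfl, rfl⟩
  obtain ⟨r, hr₂, hr₀⟩ := exists_triangle (s := SSet.yonedaEquiv p) (t := SSet.yonedaEquiv e)
    ((h p).2.trans (he₀.symm.trans (h e).1.symm))
  refine ⟨SSet.yonedaEquiv.symm r, ?_, ?_⟩
  · rw [δ_yonedaEquiv_symm, hr₂, Equiv.symm_apply_apply]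
  · rw [yonedaEquiv_symm_app_vertex]
    have : vtx r 2 = X.δ 0 (X.δ 0 r) := by
      rw [← vtx_one]
      refine (Eq.trans ?_ (Functor.map_comp_apply X (SimplexCategory.δ 0).op _ r))
      rw [vtx]
      congr 2
    rw [this, hr₀, (h e).2, he₁]

/-- The cofibre square of a morphism. -/
lemma IsStable.exists_cofiber (h : IsStable X) {b c : X _⦋0⦌} (f : Ho.mk b ⟶ Ho.mk c) :
    ∃ σ : Square ⟶ X, IsPushout σ ∧ IsPullback σ ∧ IsZeroVertex (σ.app _ s01) ∧
      ∃ (h₀ : σ.app _ s00 = b) (h₁ : σ.app _ s10 = c), edgeAt edgeT σ h₀ h₁ = f := by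
  obtain ⟨z, hz⟩ := h.exists_zero
  obtain ⟨p, h₀, h₁, hf⟩ := edgeHom_surjective f
  obtain ⟨r, hr, hr'⟩ := exists_triangle_to hz p
  -- The side `j = 1` is collapsed to the vertex `2`, which goes to the zero object; only the
  -- restriction of this square to the span is used.
  let m : Square ⟶ (Δ[2] : SSet.{u}) := stdProd (fun i j ↦ if j = 0 then i.castSucc else 2) (by decide)
  have hm : edgeT ≫ m = stdSimplex.δ 2 := by
    refine hom_std_ext fun n x i ↦ ?_
    change Fin.castSucc (x i) = Fin.succAbove 2 (x i)
    generalize x i = t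
    fin_cases t <;> rfl
  obtain ⟨σ, hσ, hσ'⟩ := h.exists_pushout (span.ι ≫ m ≫ r)
  have hv (v : (span : SSet.{u}) _⦋0⦌) : σ.app _ v.1 = r.app _ (m.app _ v.1) :=
    congrArg (fun k : (span : SSet.{u}) ⟶ X ↦ k.app _ v) hσ
  have e : edgeT ≫ σ = p := by
    rw [← hr, ← hm]
    have : edgeT = Subcomplex.lift edgeT (by
      rintro n _ ⟨y, rfl⟩
      exact (mem_span_iff _).2 (Or.inr rfl)) ≫ span.ι := rfl
    rw [this, Category.assoc, hσ]
    rfl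
  have h₀' : σ.app _ s00 = b := by
    rw [← h₀, evalAt_vertex, ← e]; rfl
  have h₁' : σ.app _ s10 = c := by
    rw [← h₁, evalAt_vertex, ← e]; rfl
  refine ⟨σ, hσ', (h.isPushout_iff σ).1 hσ', ?_, h₀', h₁', ?_⟩
  · have := hv ⟨s01, (mem_span_iff _).2 (Or.inl (cst_self _).symm)⟩
    rw [show m.app _ s01 = stdSimplex.obj₀Equiv.symm 2 from stdSimplex.obj₀Equiv.injective rfl, hr'] at this
    exact (congrArg IsZeroVertex this).mpr hz
  · rw [← hf]
    exact arr_congr (by rw [e]) _ _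

/-- The cofibre square of a given edge, reflected at the diagonal. -/
lemma IsStable.exists_cofiber' (h : IsStable X) (p : Δ[1] ⟶ X) :
    ∃ σ : Square ⟶ X, IsPushout σ ∧ IsPullback σ ∧ IsZeroVertex (σ.app _ s10) ∧ edgeL ≫ σ = p := by
  obtain ⟨z, hz⟩ := h.exists_zero
  obtain ⟨r, hr, hr'⟩ := exists_triangle_to hz p
  let m : Square ⟶ (Δ[2] : SSet.{u}) := stdProd (fun i j ↦ if i = 0 then j.castSucc else 2) (by decide)
  have hm : edgeL ≫ m = stdSimplex.δ 2 := by
    refine hom_std_ext fun n x i ↦ ?_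
    change Fin.castSucc (x i) = Fin.succAbove 2 (x i)
    generalize x i = t
    fin_cases t <;> rfl
  obtain ⟨σ, hσ, hσ'⟩ := h.exists_pushout (span.ι ≫ m ≫ r)
  have hv (v : (span : SSet.{u}) _⦋0⦌) : σ.app _ v.1 = r.app _ (m.app _ v.1) :=
    congrArg (fun k : (span : SSet.{u}) ⟶ X ↦ k.app _ v) hσ
  refine ⟨σ, hσ', (h.isPushout_iff σ).1 hσ', ?_, ?_⟩
  · have := hv ⟨s10, (mem_span_iff _).2 (Or.inr (cst_self _).symm)⟩
    rw [show m.app _ s10 = stdSimplex.obj₀Equiv.symm 2 from stdSimplex.obj₀Equiv.injective rfl, hr'] at this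
    exact (congrArg IsZeroVertex this).mpr hz
  · rw [← hr, ← hm]
    have : edgeL = Subcomplex.lift edgeL (by
      rintro n _ ⟨y, rfl⟩
      exact (mem_span_iff _).2 (Or.inl rfl)) ≫ span.ι := rfl
    rw [this, Category.assoc, hσ]
    rfl

/-- Squares with a common side are composable edges in the complex of arrows, and an inner horn
filler there is a rectangle. -/
lemma exists_rectangle (σ τ : Square ⟶ X) (h : edgeR ≫ σ = edgeL ≫ τ) :
    ∃ S : Δ[2] ⊗ Δ[1] ⟶ X, stdSimplex.δ 2 ▷ _ ≫ S = σ ∧ stdSimplex.δ 0 ▷ _ ≫ S = τ := by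
  have hδ : (Fun Δ[1] X).δ 0 (SSet.yonedaEquiv (famOf σ)) =
      (Fun Δ[1] X).δ 1 (SSet.yonedaEquiv (famOf τ)) := by
    have e : (stdSimplex.δ 0 : Δ[0] ⟶ Δ[1]) ≫ famOf σ = (stdSimplex.δ 1 : Δ[0] ⟶ Δ[1]) ≫ famOf τ := by
      rw [famOf_comp, famOf_comp]
      have e₁ : (stdSimplex.δ 0 : (Δ[0] : SSet.{u}) ⟶ Δ[1]) ▷ Δ[1] = snd _ _ ≫ edgeR :=
        map_ext_app fun n x ↦ Prod.ext (by
          refine (eq_cst_of_forall _ 1 fun i ↦ ?_)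
          have : (stdSimplex.objEquiv x.1).toOrderHom i = 0 := Subsingleton.elim (α := Fin 1) _ _
          change Fin.succAbove 0 ((stdSimplex.objEquiv x.1).toOrderHom i) = 1
          rw [this]
          rfl) rfl
      have e₂ : (stdSimplex.δ 1 : (Δ[0] : SSet.{u}) ⟶ Δ[1]) ▷ Δ[1] = snd _ _ ≫ edgeL :=
        map_ext_app fun n x ↦ Prod.ext (by
          refine (eq_cst_of_forall _ 0 fun i ↦ ?_)
          have : (stdSimplex.objEquiv x.1).toOrderHom i = 0 := Subsingleton.elim (α := Fin 1) _ _
          change Fin.succAbove 1 ((stdSimplex.objEquiv x.1).toOrderHom i) = 0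
          rw [this]
          rfl) rfl
      rw [e₁, e₂, Category.assoc, Category.assoc, h]
    refine (NatTrans.naturality_apply (famOf σ) (SimplexCategory.δ 0).op _).symm.trans
      (Eq.trans ?_ (NatTrans.naturality_apply (famOf τ) (SimplexCategory.δ 1).op _))
    exact congrArg (fun k : Δ[0] ⟶ Fun Δ[1] X ↦ SSet.yonedaEquiv k) e
  obtain ⟨r, hr₂, hr₀⟩ := exists_triangle hδ
  have key (i : Fin 3) (ρ : Square ⟶ X) (hi : (Fun Δ[1] X).δ i r = SSet.yonedaEquiv (famOf ρ)) :
      stdSimplex.δ i ▷ _ ≫ arrF (SSet.yonedaEquiv.symm r) = ρ := by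
    rw [← arrF_comp, δ_yonedaEquiv_symm, hi, Equiv.symm_apply_apply, arrF_famOf]
  exact ⟨_, key _ _ hr₂, key _ _ hr₀⟩

/-- The pasting of two squares, with the natural transformation to it from the first square. -/
lemma exists_pasting (σ τ : Square ⟶ X) (h : edgeR ≫ σ = edgeL ≫ τ) :
    ∃ (β : Square ⟶ X) (ψ : Ho.mk (vertex σ) ⟶ Ho.mk (vertex β))
      (h₀ : (evalAt s00 X).app _ (vertex β) = σ.app _ s00)
      (h₁ : (evalAt s11 X).app _ (vertex β) = τ.app _ s11) (h₂ : τ.app _ s01 = σ.app _ s11),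
      β.app _ s01 = σ.app _ s01 ∧ β.app _ s10 = τ.app _ s10 ∧
      push (evalAt s00 X) (evalAt_vertex _ _) h₀ ψ = 𝟙 _ ∧
      push (evalAt s11 X) (evalAt_vertex _ _) h₁ ψ = edgeAt edgeB τ h₂ rfl := by
  obtain ⟨S, hσ, hτ⟩ := exists_rectangle σ τ h
  -- The outer rectangle is the restriction of `S` to the face opposite to the vertex `1`. The map
  -- `collapse` fixes the left side and moves the right side from the vertex `1` to the vertex `2`.
  let H : Square ⊗ Δ[1] ⟶ X :=
    lift (lift (fst _ _ ≫ fst _ _) (snd _ _) ≫ collapse) (fst _ _ ≫ snd _ _) ≫ S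
  have H₀ : ι₀ ≫ H = σ := by
    rw [← hσ, ← ι₀_collapse]
    exact map_ext_app fun n x ↦ rfl
  have H₁ : ι₁ ≫ H = stdSimplex.δ 1 ▷ _ ≫ S := by
    rw [← ι₁_collapse]
    exact map_ext_app fun n x ↦ rfl
  have b₀₀ : (stdSimplex.δ 1 ▷ (Δ[1] : SSet.{u}) ≫ S).app _ s00 = σ.app _ s00 := by
    rw [← hσ]
    exact congrArg (S.app _) (Prod.ext (stdSimplex.obj₀Equiv.injective rfl) rfl)
  have b₀₁ : (stdSimplex.δ 1 ▷ (Δ[1] : SSet.{u}) ≫ S).app _ s01 = σ.app _ s01 := by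
    rw [← hσ]
    exact congrArg (S.app _) (Prod.ext (stdSimplex.obj₀Equiv.injective rfl) rfl)
  have b₁₀ : (stdSimplex.δ 1 ▷ (Δ[1] : SSet.{u}) ≫ S).app _ s10 = τ.app _ s10 := by
    rw [← hτ]
    exact congrArg (S.app _) (Prod.ext (stdSimplex.obj₀Equiv.injective rfl) rfl)
  have b₁₁ : (stdSimplex.δ 1 ▷ (Δ[1] : SSet.{u}) ≫ S).app _ s11 = τ.app _ s11 := by
    rw [← hτ]
    exact congrArg (S.app _) (Prod.ext (stdSimplex.obj₀Equiv.injective rfl) rfl)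
  refine ⟨_, cls H H₀ H₁, (evalAt_vertex _ _).trans b₀₀, (evalAt_vertex _ _).trans b₁₁,
    congrArg (fun k : Δ[1] ⟶ X ↦ k.app _ v1) h.symm, b₀₁, b₁₀, ?_, ?_⟩
  · rw [push_evalAt_cls]
    refine Eq.trans (arr_congr (s' := cst (σ.app _ s00) _) ?_ _ _) (arr_cst _ _ _)
    have : lift (SSet.const s00) (𝟙 Δ[1]) ≫ H = SSet.const (σ.app _ s00) := by
      rw [← hσ]
      have e : lift (SSet.const s00) (𝟙 Δ[1]) ≫ H =
          lift (lift (SSet.const v0) (𝟙 _) ≫ collapse) (SSet.const v0) ≫ S := map_ext_app fun _ _ ↦ rfl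
      rw [e]
      refine map_ext_app fun n x ↦ Eq.trans ?_ (app_cst S _ _)
      refine congrArg (S.app _) (Prod.ext (eq_cst_of_forall _ 0 fun i ↦ ?_) rfl)
      rfl
    rw [this]
    rfl
  · rw [push_evalAt_cls]
    refine arr_congr ?_ _ _
    have e : lift (SSet.const s11) (𝟙 Δ[1]) ≫ H =
        lift (lift (SSet.const v1) (𝟙 _) ≫ collapse) (SSet.const v1) ≫ S := map_ext_app fun _ _ ↦ rfl
    rw [e, lift_v1_collapse, edgeOf_vertex, ← hτ]
    rfl

end

end InfCat

namespace InfCat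

open CartesianMonoidalCategory (lift fst snd)

/-! ### The criterion for conservativity -/

section

variable {X : SSet.{u}} [Quasicategory X]

lemma IsNull.of_comp_eq {C : Type*} [Category* C] {a b c d e : C} {u : a ⟶ b} {v : b ⟶ c} {g : c ⟶ d}
    {t : d ⟶ c} {q : c ⟶ e} (h : (u ≫ v) ≫ g ≫ t = u ≫ v) (h' : IsNull (t ≫ q)) :
    IsNull (u ≫ v ≫ q) := by
  rw [← Category.assoc, ← h, Category.assoc, Category.assoc, Category.assoc]
  exact ((h'.comp_left _).comp_left _).comp_left _

lemma IsNull.comp_right_assoc {C : Type*} [Category* C] {a b c d : C} {u : a ⟶ b} {v : b ⟶ c}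
    (h : IsNull (u ≫ v)) (w : c ⟶ d) : IsNull (u ≫ v ≫ w) := by
  rw [← Category.assoc]
  exact h.comp_right w

/-- Suspension preserves null morphisms. -/
lemma IsSuspensionSquare.isNull (h : IsStable X) {α β : Square ⟶ X} (hα : IsSuspensionSquare α)
    (hβ : IsSuspensionSquare β) (θ : Ho.mk (vertex α) ⟶ Ho.mk (vertex β)) {x x' y y' : X _⦋0⦌}
    (hx : (evalAt s00 X).app _ (vertex α) = x) (hx' : (evalAt s00 X).app _ (vertex β) = x')
    (hy : (evalAt s11 X).app _ (vertex α) = y) (hy' : (evalAt s11 X).app _ (vertex β) = y')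
    (hθ : IsNull (push (evalAt s00 X) hx hx' θ)) : IsNull (push (evalAt s11 X) hy hy' θ) := by
  obtain ⟨z, hz⟩ := h.exists_zero
  have hz' : IsZeroVertex z := hz
  have hc (v : (Square : SSet.{u}) _⦋0⦌) : (SSet.const z : Square ⟶ X).app _ v = z := map_const_self X z
  have ht (v : (Square : SSet.{u}) _⦋0⦌) : IsZeroVertex ((SSet.const z : Square ⟶ X).app _ v) :=
    (congrArg IsZeroVertex (hc v)).mpr hz
  have he (v : (Square : SSet.{u}) _⦋0⦌) : (evalAt v X).app _ (vertex (SSet.const z)) = z :=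
    (evalAt_vertex _ _).trans (hc v)
  obtain ⟨a, -⟩ := (hα.isPushout.push_bijective (ht _).2 (ht _).2 hx (he _)).2
    (hz.2.nonempty_unique x).some.default
  obtain ⟨b, -⟩ := (hβ.isPullback.push_bijective (ht _).1 (ht _).1 (he _) hy').2
    (hz.1.nonempty_unique y').some.default
  -- A morphism of suspension squares is determined at the first vertex. There it is null, so that
  -- it factors over the constant square at a zero object.
  obtain rfl : θ = a ≫ b := by
    apply (hα.isPushout.push_bijective hβ.isZero₀₁.2 hβ.isZero₁₀.2 hx hx').1
    refine hθ.eq ⟨_, hz'.isZero, push (evalAt s00 X) hx (he _) a, push (evalAt s00 X) (he _) hx' b, ?_⟩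
    exact (push_comp _ _ _ _ _ _).symm
  exact ⟨_, hz'.isZero, push (evalAt s11 X) hy (he _) a, push (evalAt s11 X) (he _) hy' b,
    (push_comp _ _ _ _ _ _).symm⟩

lemma exists_kernel_lift'' {z : X _⦋0⦌} (hz : IsZeroVertex z) {σ : Square ⟶ X} (hσ : IsPullback σ)
    (h₁ : σ.app _ s10 = z) {x y w : X _⦋0⦌} (h₀₀ : σ.app _ s00 = x) (h₀₁ : σ.app _ s01 = y)
    (h₁₁ : σ.app _ s11 = w) {a : X _⦋0⦌} (f : Ho.mk a ⟶ Ho.mk y)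
    (hf : IsNull (f ≫ edgeAt edgeB σ h₀₁ h₁₁)) : ∃ r, r ≫ edgeAt edgeL σ h₀₀ h₀₁ = f := by
  subst h₀₀ h₀₁ h₁₁
  exact exists_kernel_lift' hz hσ h₁ f hf

/-- Weakly compact morphisms to the cofibre of a morphism which has a quasi-inverse with respect
to weakly compact morphisms lift to the target of the morphism. -/
lemma IsStable.exists_lift_of_isWeaklyCompact (h : IsStable X) {σ : Square ⟶ X} (hσ : IsPushout σ)
    (hσ' : IsPullback σ) (hz : IsZeroVertex (σ.app _ s01))
    (g : Ho.mk (σ.app _ s10) ⟶ Ho.mk (σ.app _ s00))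
    (hg : ∀ (a : X _⦋0⦌) (w : Ho.mk a ⟶ Ho.mk (σ.app _ s00)), IsWeaklyCompact w →
      w ≫ edgeAt edgeT σ rfl rfl ≫ g = w)
    {a : X _⦋0⦌} (w : Ho.mk a ⟶ Ho.mk (σ.app _ s11)) (hw : IsWeaklyCompact w) :
    ∃ v : Ho.mk a ⟶ Ho.mk (σ.app _ s10), v ≫ edgeAt edgeR σ rfl rfl = w := by
  -- `τ` is the cofibre square of the map from the target of the morphism to its cofibre. Its last
  -- vertex plays the role of the suspension of the source, with `β'` as the outer rectangle.
  obtain ⟨τ, hτ, hτ', hzτ, e⟩ := h.exists_cofiber' (edgeR ≫ σ)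
  obtain ⟨β', ψ', h₀', h₁', h₂', hβ₁', hβ₂', hψ₀', hψ₁'⟩ := exists_pasting σ τ e.symm
  have e₀ : τ.app _ s00 = σ.app _ s10 := congrArg (fun k : Δ[1] ⟶ X ↦ k.app _ v0) e
  suffices hN : IsNull (w ≫ edgeAt edgeB τ h₂' rfl) by
    obtain ⟨r, hr⟩ := exists_kernel_lift'' hzτ hτ' rfl e₀ h₂' rfl w hN
    exact ⟨r, (congrArg (r ≫ ·) (edgeAt_congr e.symm _ _ _ _)).trans hr⟩
  obtain ⟨α, hα, rfl⟩ := h.exists_suspensionSquare' a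
  -- A pushout square on the same first vertex, used in place of `β'`. The pasting law for pushouts
  -- is not needed, because the morphism from `σ` to `β'` factors over `β`.
  obtain ⟨β, hβ, hβB⟩ := h.exists_suspensionSquare (σ.app _ s00)
  have hβ₀ := (evalAt_vertex β s00).trans hβB
  have hzβ₁' : IsZeroVertex (β'.app _ s01) := (congrArg IsZeroVertex hβ₁').mpr hz
  have hzβ₂' : IsZeroVertex (β'.app _ s10) := (congrArg IsZeroVertex hβ₂').mpr hzτ
  obtain ⟨χ, rfl⟩ := (hσ'.push_bijective hα.isZero₀₁.1 hα.isZero₁₀.1 (evalAt_vertex _ _)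
    (evalAt_vertex _ _)).2 w
  obtain ⟨ψ, hψ⟩ := (hσ.push_bijective hβ.isZero₀₁.2 hβ.isZero₁₀.2 (evalAt_vertex _ _) hβ₀).2 (𝟙 _)
  have hψ₁ : ψ' = ψ ≫ ((hβ.isPushout.push_bijective hzβ₁'.2 hzβ₂'.2 hβ₀ h₀').2 (𝟙 _)).choose := by
    apply (hσ.push_bijective hzβ₁'.2 hzβ₂'.2 (evalAt_vertex _ _) h₀').1
    rw [hψ₀', push_comp _ _ hβ₀ _, hψ,
      ((hβ.isPushout.push_bijective hzβ₁'.2 hzβ₂'.2 hβ₀ h₀').2 (𝟙 _)).choose_spec, Category.id_comp]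
  suffices hN : IsNull (push (evalAt s11 X) (evalAt_vertex α s11) (evalAt_vertex β s11) (χ ≫ ψ)) by
    rw [push_comp _ _ (evalAt_vertex _ _) _] at hN
    refine (congrArg IsNull ?_).mp (hN.comp_right (push (evalAt s11 X) (evalAt_vertex β s11) h₁'
      ((hβ.isPushout.push_bijective hzβ₁'.2 hzβ₂'.2 hβ₀ h₀').2 (𝟙 _)).choose))
    refine (Category.assoc _ _ _).trans (congrArg (push _ _ _ χ ≫ ·) ?_)
    exact (push_comp _ _ _ _ _ _).symm.trans ((congrArg _ hψ₁.symm).trans hψ₁')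
  refine hα.isNull h hβ _ (evalAt_vertex _ _) hβ₀ _ _ ?_
  -- The value of `χ ≫ ψ` at the last vertex is `w` followed by a map, so it is weakly compact;
  -- hence so is its desuspension.
  have hwc : IsWeaklyCompact (push (evalAt s00 X) (evalAt_vertex _ _) hβ₀ (χ ≫ ψ)) := by
    refine h.isWeaklyCompact_of_suspension hα hβ _ _ _ (evalAt_vertex _ _) (evalAt_vertex _ _) ?_
    rw [push_comp _ _ (evalAt_vertex _ _) _]
    exact hw.comp_right _
  rw [push_comp _ _ (evalAt_vertex _ _) _, hψ, Category.comp_id] at hwc ⊢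
  -- The desuspension is unchanged by composition with the morphism and `g`. Its composite with the
  -- morphism alone factors over a zero corner of `α`.
  rw [← hg _ _ hwc]
  refine IsNull.comp_right_assoc ?_ _
  have := edgeAt_natural edgeT (s := s00) (t := s10) rfl rfl χ (evalAt_vertex _ _) (evalAt_vertex _ _)
    (evalAt_vertex _ _) (evalAt_vertex _ _) rfl rfl rfl rfl
  exact (congrArg IsNull this).mp <| (isNull_of_tgt hα.isZero₁₀.isZero _).comp_right _

/-- The criterion for conservativity in terms of the vanishing of objects without essential weakly
compact morphisms. -/
theorem IsStable.exists_right_inverse (h : IsStable X)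
    (hX : ∀ q : X _⦋0⦌, (∀ (a a' : X _⦋0⦌) (u : Ho.mk a' ⟶ Ho.mk a) (w : Ho.mk a ⟶ Ho.mk q),
      IsWeaklyCompact u → IsWeaklyCompact w → IsNull (u ≫ w)) → Limits.IsZero (Ho.mk q))
    {b c : X _⦋0⦌} (f : Ho.mk b ⟶ Ho.mk c) (g : Ho.mk c ⟶ Ho.mk b)
    (hfg : ∀ (a : X _⦋0⦌) (w : Ho.mk a ⟶ Ho.mk b), IsWeaklyCompact w → w ≫ f ≫ g = w)
    (hgf : ∀ (a : X _⦋0⦌) (w : Ho.mk a ⟶ Ho.mk c), IsWeaklyCompact w → w ≫ g ≫ f = w) :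
    ∃ r : Ho.mk c ⟶ Ho.mk b, r ≫ f = 𝟙 _ := by
  obtain ⟨σ, hσ, hσ', hz, rfl, rfl, rfl⟩ := h.exists_cofiber f
  refine exists_kernel_lift hz hσ' rfl (𝟙 _) (isNull_of_tgt (hX _ fun a a' u w hu hw ↦ ?_) _)
  -- The lift `v` is not known to be weakly compact, but `u ≫ v` is. This is why pairs of weakly
  -- compact morphisms appear in the criterion.
  obtain ⟨v, rfl⟩ := h.exists_lift_of_isWeaklyCompact hσ hσ' hz g hfg w hw
  refine IsNull.of_comp_eq (hgf _ (u ≫ v) (hu.comp_right v)) ?_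
  exact (congrArg IsNull (edgeAt_square σ rfl rfl rfl rfl)).mpr
    ((isNull_of_tgt hz.isZero _).comp_right _)

/-- The criterion gives `r` with `r ≫ f = 𝟙 _`. Since `f` is a quasi-inverse of `r`, the criterion
also applies to `r` and gives `s` with `s ≫ r = 𝟙 _`, whence `s = f`. -/
theorem IsStable.isIso_of_isIso_hausdorff (h : IsStable X)
    (hX : ∀ q : X _⦋0⦌, (∀ (a a' : X _⦋0⦌) (u : Ho.mk a' ⟶ Ho.mk a) (w : Ho.mk a ⟶ Ho.mk q),
      IsWeaklyCompact u → IsWeaklyCompact w → IsNull (u ≫ w)) → Limits.IsZero (Ho.mk q))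
    {b c : X _⦋0⦌} (f : Ho.mk b ⟶ Ho.mk c) (hf : IsIso ((toHausdorffCat X).map f)) : IsIso f := by
  obtain ⟨g : Ho.mk c ⟶ Ho.mk b, hg⟩ := HausdorffHom.mk_surjective (inv ((toHausdorffCat X).map f))
  have hfg : (toHausdorffCat X).map (f ≫ g) = (toHausdorffCat X).map (𝟙 _) := by
    rw [Functor.map_comp]
    exact (congrArg ((toHausdorffCat X).map f ≫ ·) hg).trans
      ((IsIso.hom_inv_id _).trans ((toHausdorffCat X).map_id _).symm)
  have hgf : (toHausdorffCat X).map (g ≫ f) = (toHausdorffCat X).map (𝟙 _) := by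
    rw [Functor.map_comp]
    exact (congrArg (· ≫ (toHausdorffCat X).map f) hg).trans
      ((IsIso.inv_hom_id _).trans ((toHausdorffCat X).map_id _).symm)
  have hfg' (a : X _⦋0⦌) (w : Ho.mk a ⟶ Ho.mk b) (hw : IsWeaklyCompact w) : w ≫ f ≫ g = w :=
    ((HausdorffHom.mk_eq_mk_iff _ _).1 hfg _ w hw).trans (Category.comp_id _)
  have hgf' (a : X _⦋0⦌) (w : Ho.mk a ⟶ Ho.mk c) (hw : IsWeaklyCompact w) : w ≫ g ≫ f = w :=
    ((HausdorffHom.mk_eq_mk_iff _ _).1 hgf _ w hw).trans (Category.comp_id _)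
  obtain ⟨r, hr⟩ := h.exists_right_inverse hX f g hfg' hgf'
  -- As `w ≫ f ≫ r` is weakly compact it may be followed by `f ≫ g`, and then `r ≫ f` cancels.
  have hfr (a : X _⦋0⦌) (w : Ho.mk a ⟶ Ho.mk b) (hw : IsWeaklyCompact w) : w ≫ f ≫ r = w := by
    rw [← hfg' a (w ≫ f ≫ r) (hw.comp_right _), Category.assoc, Category.assoc, ← Category.assoc r,
      hr, Category.id_comp, hfg' a w hw]
  obtain ⟨s, hs⟩ := h.exists_right_inverse hX r f (fun a w _ ↦ by rw [hr, Category.comp_id]) hfr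
  have hsf : s = f := by
    rw [← Category.comp_id s, ← hr, ← Category.assoc, hs, Category.id_comp]
  exact ⟨r, hsf ▸ hs, hr⟩

end

end InfCat

namespace InfCat

open CartesianMonoidalCategory (lift fst snd)

/-! ### Weak homotopy equivalences and connected components -/

/-- The discrete simplicial set on a type. -/
def discrete (S : Type u) : SSet.{u} := (Functor.const _).obj S

instance (S : Type u) : KanComplex (discrete S) := by
  rw [KanComplex.iff]
  intro n i f hf
  let c (k : ℕ) (s : S) : Δ[k] ⟶ discrete S := SSet.yonedaEquiv.symm s
  have hc {k : ℕ} (g : Δ[k] ⟶ discrete S) : ∃ s, c k s = g :=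
    ⟨SSet.yonedaEquiv g, SSet.yonedaEquiv.symm_apply_apply g⟩
  have hc' {k : ℕ} {s t : S} (h : c k s = c k t) : s = t := SSet.yonedaEquiv.symm.injective h
  have key (k : ℕ) (s : S) (a) : stdSimplex.δ a ≫ c (k + 1) s = c k s := δ_yonedaEquiv_symm _ _
  obtain ⟨j, hj⟩ := exists_ne i
  choose v hv using fun j hj ↦ hc (f j hj)
  refine ⟨c _ (v j hj), fun k hk ↦ ?_⟩
  rw [key, ← hv k hk]
  congr 1
  cases n with
  | zero =>
    have : j = k := by omega
    subst this
    rfl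
  | succ n =>
    rw [horn.isCompatible_iff] at hf
    have e {j k : Fin (n + 3)} {hj : j ≠ i} {hk : k ≠ i} (hjk : j < k) : v j hj = v k hk := by
      have := hf j k hj hk hjk
      rw [← hv j hj, ← hv k hk, key, key] at this
      exact hc' this
    obtain h | h | h := lt_trichotomy j k
    · exact e h
    · subst h; rfl
    · exact (e h).symm

section

variable {X Y : SSet.{u}} {S : Type u}

/-- The map to a discrete simplicial set which is given by a locally constant function. -/
def toDiscrete (φ : X _⦋0⦌ → S) (hφ : ∀ s : X _⦋1⦌, φ (X.δ 1 s) = φ (X.δ 0 s)) : X ⟶ discrete S where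
  app n := ↾fun x ↦ φ (vtx (n := n.unop.len) x 0)
  naturality m n f := by
    ext x
    change φ (vtx (n := n.unop.len) (X.map f x) 0) = φ (vtx (n := m.unop.len) x 0)
    have h₁ : vtx (n := n.unop.len) (X.map f x) 0 = vtx (n := m.unop.len) x (f.unop.toOrderHom 0) := by
      rw [vtx, vtx]
      refine (Functor.map_comp_apply X _ _ x).symm.trans ?_
      congr 2
    rw [h₁]
    have key (k : Fin (m.unop.len + 1)) :
        φ (vtx (n := m.unop.len) x 0) = φ (vtx (n := m.unop.len) x k) := by
      let g : ⦋1⦌ ⟶ m.unop := SimplexCategory.mkOfLe 0 k (Fin.zero_le k)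
      have := hφ (X.map g.op x)
      rw [← vtx_zero, ← vtx_one] at this
      convert this using 2
      · rw [vtx, vtx]
        refine Eq.trans ?_ (Functor.map_comp_apply X _ _ x)
        congr 2
      · rw [vtx, vtx]
        refine Eq.trans ?_ (Functor.map_comp_apply X _ _ x)
        congr 2
    exact (key _).symm

lemma toDiscrete_app (φ : X _⦋0⦌ → S) (hφ) (x : X _⦋0⦌) : (toDiscrete φ hφ).app _ x = φ x := by
  refine congrArg φ ?_
  exact map_const_self X x

lemma app_eq_of_discrete (F : X ⟶ discrete S) (s : X _⦋1⦌) : F.app _ (X.δ 1 s) = F.app _ (X.δ 0 s) :=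
  (app_δ F s 1).symm.trans (app_δ F s 0)

lemma eq_of_π₀_mk_eq {F G : X ⟶ discrete S} (h : π₀.mk (vertex F) = π₀.mk (vertex G)) (x : X _⦋0⦌) :
    F.app _ x = G.app _ x := by
  have := congrArg (π₀.lift (T := S) (fun v : (Fun X (discrete S)) _⦋0⦌ ↦ (evalAt x _).app _ v)
    (fun a b e ↦ by
      have := app_eq_of_discrete (evalAt x (discrete S)) e.edge
      rw [e.src_eq, e.tgt_eq] at this
      exact this)) h
  rw [← evalAt_vertex F, ← evalAt_vertex G]
  exact this

/-- Maps to a discrete Kan complex are the locally constant functions on vertices, and homotopic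
ones are equal. Weak equivalences of mapping anima are used only through this lemma and the next
one, that is, through connected components. -/
lemma IsWeakHomotopyEquiv.eq_of {f : X ⟶ Y} (hf : IsWeakHomotopyEquiv f) {φ ψ : Y _⦋0⦌ → S}
    (hφ : ∀ s : Y _⦋1⦌, φ (Y.δ 1 s) = φ (Y.δ 0 s)) (hψ : ∀ s : Y _⦋1⦌, ψ (Y.δ 1 s) = ψ (Y.δ 0 s))
    (h : ∀ x, φ (f.app _ x) = ψ (f.app _ x)) (y : Y _⦋0⦌) : φ y = ψ y := by
  have : π₀.mk (vertex (toDiscrete φ hφ)) = π₀.mk (vertex (toDiscrete ψ hψ)) := by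
    apply (hf (discrete S)).1
    rw [mapπ₀_mk, mapπ₀_mk, restrict_vertex, restrict_vertex]
    congr 2
    refine map_ext_app fun n x ↦ ?_
    change φ (vtx (f.app _ x) 0) = ψ (vtx (f.app _ x) 0)
    rw [← app_vtx]
    exact h _
  rw [← toDiscrete_app φ hφ, ← toDiscrete_app ψ hψ]
  exact eq_of_π₀_mk_eq this y

lemma IsWeakHomotopyEquiv.exists_of {f : X ⟶ Y} (hf : IsWeakHomotopyEquiv f) {φ : X _⦋0⦌ → S}
    (hφ : ∀ s : X _⦋1⦌, φ (X.δ 1 s) = φ (X.δ 0 s)) :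
    ∃ ψ : Y _⦋0⦌ → S, (∀ s : Y _⦋1⦌, ψ (Y.δ 1 s) = ψ (Y.δ 0 s)) ∧ ∀ x, ψ (f.app _ x) = φ x := by
  obtain ⟨v, hv⟩ := (hf (discrete S)).2 (π₀.mk (vertex (toDiscrete φ hφ)))
  obtain ⟨v, rfl⟩ := v.mk_surjective
  obtain ⟨F, rfl⟩ := vertex_surjective v
  rw [mapπ₀_mk, restrict_vertex] at hv
  refine ⟨fun y ↦ F.app _ y, app_eq_of_discrete F, fun x ↦ ?_⟩
  rw [← toDiscrete_app φ hφ]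
  exact eq_of_π₀_mk_eq hv x

end

end InfCat

namespace InfCat

open CartesianMonoidalCategory (lift fst snd)

/-! ### Vertices and edges of comma objects -/

section

variable {A B : SSet.{u}} {G : A ⟶ B} {x : B _⦋0⦌}

/-- The class of the morphism given by a vertex of a comma object. -/
noncomputable def commaHom (z : (comma G x : SSet) _⦋0⦌) {y : B _⦋0⦌} (h : G.app _ z.1.1 = y) :
    Ho.mk x ⟶ Ho.mk y :=
  edgeHom z.1.2 (((mem_ofSimplex_iff _ _).1 z.2.1).trans (cst_self _)) (z.2.2.trans h)

lemma commaHom_edge (s : (comma G x : SSet) _⦋1⦌) {y y' : B _⦋0⦌}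
    (h : G.app _ (A.δ 1 s.1.1) = y) (h' : G.app _ (A.δ 0 s.1.1) = y') :
    commaHom ((comma G x : SSet).δ 1 s) h ≫ arr (G.app _ s.1.1) ((app_δ _ _ _).trans h)
      ((app_δ _ _ _).trans h') = commaHom ((comma G x : SSet).δ 0 s) h' := by
  have e₀ : (evalAt v0 B).app _ s.1.2 = cst x _ := (mem_ofSimplex_iff _ _).1 s.2.1
  have e₁ : (evalAt v1 B).app _ s.1.2 = G.app _ s.1.1 := s.2.2
  have c₀ : B.δ 1 ((evalAt v0 B).app _ s.1.2) = x := by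
    rw [e₀, ← vtx_zero, vtx_cst]
  have c₁ : B.δ 0 ((evalAt v0 B).app _ s.1.2) = x := by
    rw [e₀, ← vtx_one, vtx_cst]
  have d₀ : B.δ 1 ((evalAt v1 B).app _ s.1.2) = y := by rw [e₁, app_δ, h]
  have d₁ : B.δ 0 ((evalAt v1 B).app _ s.1.2) = y' := by rw [e₁, app_δ, h']
  have key := arr_natural s.1.2 rfl rfl (x := x) (y := y) (z := x) (w := y')
    ((δ_one_edgeOf _).trans ((app_δ _ _ _).symm.trans c₀))
    ((δ_zero_edgeOf _).trans ((app_δ _ _ _).symm.trans d₀))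
    ((δ_one_edgeOf _).trans ((app_δ _ _ _).symm.trans c₁))
    ((δ_zero_edgeOf _).trans ((app_δ _ _ _).symm.trans d₁)) c₀ c₁ d₀ d₁
  refine Eq.trans ?_ (key.trans ?_)
  · exact congrArg (_ ≫ ·) (arr_congr e₁.symm _ _)
  · exact (congrArg (· ≫ _) ((arr_congr e₀ _ _).trans (arr_cst _ _ _))).trans (Category.id_comp _)

lemma exists_commaHom [Quasicategory B] (a : A _⦋0⦌) {y : B _⦋0⦌} (h : G.app _ a = y)
    (f : Ho.mk x ⟶ Ho.mk y) : ∃ (z : (comma G x : SSet) _⦋0⦌) (hz : z.1.1 = a),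
      commaHom z ((congrArg (G.app _) hz).trans h) = f := by
  obtain ⟨p, h₀, h₁, rfl⟩ := edgeHom_surjective f
  exact ⟨⟨(a, vertex p), (mem_ofSimplex_iff _ _).2 (h₀.trans (cst_self _).symm), h₁.trans h.symm⟩,
    rfl, rfl⟩

lemma exists_comma_edge [Quasicategory B] (z z' : (comma G x : SSet) _⦋0⦌) (t : A _⦋1⦌)
    (h₀ : A.δ 1 t = z.1.1) (h₁ : A.δ 0 t = z'.1.1) {y y' : B _⦋0⦌} (h : G.app _ z.1.1 = y)
    (h' : G.app _ z'.1.1 = y')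
    (w : commaHom z h ≫ arr (G.app _ t) (by rw [app_δ, h₀, h]) (by rw [app_δ, h₁, h']) = commaHom z' h') :
    ∃ s : (comma G x : SSet) _⦋1⦌, (comma G x : SSet).δ 1 s = z ∧ (comma G x : SSet).δ 0 s = z' := by
  obtain ⟨r, hr₂, hr₀, hr₁⟩ := arr_comp_iff.1 w
  obtain ⟨s, hs₁, hs₀, e₀, e₁⟩ := exists_square_of_triangle r hr₂.symm hr₁.symm
  have hx : B.δ 1 (B.δ 1 r) = x := by
    rw [hr₁, δ_one_edgeOf]
    exact ((mem_ofSimplex_iff _ _).1 z'.2.1).trans (cst_self _)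
  have hc : B.σ 0 x = cst x (op ⦋1⦌) := by
    have : SimplexCategory.const ⦋1⦌ ⦋0⦌ 0 = SimplexCategory.σ 0 := Subsingleton.elim _ _
    exact (congrArg (fun k : ⦋1⦌ ⟶ ⦋0⦌ ↦ B.map k.op x) this).symm
  refine ⟨⟨(t, s), (mem_ofSimplex_iff _ _).2 (e₀.trans ((congrArg (B.σ 0) hx).trans hc)), e₁.trans hr₀⟩,
    Subtype.ext (Prod.ext h₀ hs₁), Subtype.ext (Prod.ext h₁ hs₀)⟩

end

/-- A fully faithful functor is fully faithful on homotopy categories. -/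
theorem IsFullyFaithful.push_bijective {X Y : SSet.{u}} [Quasicategory X] [Quasicategory Y] {F : X ⟶ Y}
    (hF : IsFullyFaithful F) (x x' : X _⦋0⦌) :
    Function.Bijective (push F (x := x) (x' := x') rfl rfl) := by
  have hG (a : (Δ[0] : SSet.{u}) _⦋0⦌) : (SSet.const x' : Δ[0] ⟶ X).app _ a = x' := map_const_self X x'
  have hG' (a : (Δ[0] : SSet.{u}) _⦋0⦌) : ((SSet.const x' : Δ[0] ⟶ X) ≫ F).app _ a = F.app _ x' :=
    congrArg (F.app _) (hG a)
  have inv (s : (comma (SSet.const x' : Δ[0] ⟶ X) x : SSet) _⦋1⦌) :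
      commaHom ((comma (SSet.const x' : Δ[0] ⟶ X) x : SSet).δ 1 s) (hG _) =
        commaHom ((comma (SSet.const x' : Δ[0] ⟶ X) x : SSet).δ 0 s) (hG _) :=
    ((congrArg (_ ≫ ·) (arr_cst x' _ _)).trans (Category.comp_id _)).symm.trans
      (commaHom_edge s (hG _) (hG _))
  have inv' (s : (comma ((SSet.const x' : Δ[0] ⟶ X) ≫ F) (F.app _ x) : SSet) _⦋1⦌) :
      commaHom ((comma ((SSet.const x' : Δ[0] ⟶ X) ≫ F) (F.app _ x) : SSet).δ 1 s) (hG' _) =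
        commaHom ((comma ((SSet.const x' : Δ[0] ⟶ X) ≫ F) (F.app _ x) : SSet).δ 0 s) (hG' _) := by
    refine Eq.trans ?_ (commaHom_edge s (hG' _) (hG' _))
    refine (Category.comp_id _).symm.trans (congrArg (_ ≫ ·) ?_)
    exact ((arr_congr (app_cst F x' _) _ _).trans (arr_cst _ _ _)).symm
  have post (z : (comma (SSet.const x' : Δ[0] ⟶ X) x : SSet) _⦋0⦌) :
      commaHom ((commaPost (SSet.const x' : Δ[0] ⟶ X) F x).app _ z) (hG' _) =
        push F rfl rfl (commaHom z (hG _)) :=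
    Eq.trans (arr_congr (edgeOf_post F z.1.2) _ _) (push_arr _ _ _ _ _ _).symm
  let pt : (Δ[0] : SSet.{u}) _⦋0⦌ := stdSimplex.obj₀Equiv.symm 0
  constructor
  · intro w w' h
    -- The class of a morphism is a locally constant function on `Map(x, x')`, so it extends to the
    -- mapping anima of the images and depends only on the image of the morphism.
    obtain ⟨ψ, hψ, hψ'⟩ := (hF x x').exists_of (φ := fun z ↦ commaHom z (hG _)) inv
    obtain ⟨z, hz, rfl⟩ := exists_commaHom (G := (SSet.const x' : Δ[0] ⟶ X)) pt (hG _) w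
    obtain ⟨z', hz', rfl⟩ := exists_commaHom (G := (SSet.const x' : Δ[0] ⟶ X)) pt (hG _) w'
    rw [← hψ', ← hψ']
    have hpt (a : (Δ[0] : SSet.{u}) _⦋0⦌) : pt = a :=
      stdSimplex.obj₀Equiv.injective (Subsingleton.elim (α := Fin 1) _ _)
    obtain ⟨s, hs₁, hs₀⟩ := exists_comma_edge ((commaPost (SSet.const x' : Δ[0] ⟶ X) F x).app _ z)
      ((commaPost (SSet.const x' : Δ[0] ⟶ X) F x).app _ z') ((Δ[0] : SSet.{u}).σ 0 pt)
      ((SSet.δ_comp_σ_succ_apply (S := Δ[0]) 0 pt).trans (hpt _))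
      ((SSet.δ_comp_σ_self_apply (S := Δ[0]) 0 pt).trans (hpt _)) (hG' _) (hG' _) (by
        refine Eq.trans (congrArg (_ ≫ ·) ((arr_congr (app_cst F x' _) _ _).trans
          (arr_cst _ _ _))) ((Category.comp_id _).trans ?_)
        rw [post, post, h])
    have := hψ s
    rwa [hs₁, hs₀] at this
  · intro v
    obtain ⟨z, hz, rfl⟩ := exists_commaHom (G := (SSet.const x' : Δ[0] ⟶ X) ≫ F) (x := F.app _ x) pt (hG' _) v
    -- Lying in the image of the map of morphism sets is a locally constant condition which holds on
    -- the image of the weak equivalence.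
    have := (hF x x').eq_of (S := ULift.{u} Prop) (φ := fun _ ↦ ⟨True⟩)
      (ψ := fun z ↦ ⟨∃ w : Ho.mk x ⟶ Ho.mk x', push F rfl rfl w = commaHom z (hG' _)⟩)
      (fun _ ↦ rfl) (fun s ↦ by rw [inv' s]) (fun z ↦ by
        refine ULift.ext _ _ (eq_true ?_).symm
        exact ⟨_, (post z).symm⟩) z
    exact (congrArg ULift.down this).mp trivial

/-! ### Legs of cocones -/

section

variable {K X : SSet.{u}} {p : K ⟶ X}

/-- The class of a leg of a cocone. -/
noncomputable def Cocone.legHom (c : Cocone p) (k : K _⦋0⦌) : Ho.mk (p.app _ k) ⟶ Ho.mk c.pt :=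
  Ho.homMk (c.leg k)

lemma Cocone.legHom_natural [Quasicategory X] (c : Cocone p) (s : K _⦋1⦌) {k k' : K _⦋0⦌}
    (h : K.δ 1 s = k) (h' : K.δ 0 s = k') :
    arr (p.app _ s) ((app_δ _ _ _).trans (congrArg (p.app _) h)) ((app_δ _ _ _).trans
      (congrArg (p.app _) h')) ≫ c.legHom k' = c.legHom k := by
  subst h h'
  have e₀ : famOf c.hom ≫ evalAt v0 X = p := (famOf_evalAt_zero _).trans c.ι₀_hom
  have e₁ : famOf c.hom ≫ evalAt v1 X = SSet.const c.pt := (famOf_evalAt_one _).trans c.ι₁_hom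
  have e₀' : (evalAt v0 X).app _ ((famOf c.hom).app _ s) = p.app _ s :=
    congrArg (fun k : K ⟶ X ↦ k.app _ s) e₀
  have e₁' : (evalAt v1 X).app _ ((famOf c.hom).app _ s) = cst c.pt _ :=
    congrArg (fun k : K ⟶ X ↦ k.app _ s) e₁
  have key := arr_natural ((famOf c.hom).app _ s) (app_δ _ _ 1) (app_δ _ _ 0)
    (x := p.app _ (K.δ 1 s)) (y := c.pt) (z := p.app _ (K.δ 0 s)) (w := c.pt)
    ((congrArg _ (edgeOf_famOf _ _)).trans (c.leg _).src_eq)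
    ((congrArg _ (edgeOf_famOf _ _)).trans (c.leg _).tgt_eq)
    ((congrArg _ (edgeOf_famOf _ _)).trans (c.leg _).src_eq)
    ((congrArg _ (edgeOf_famOf _ _)).trans (c.leg _).tgt_eq)
    ((congrArg _ e₀').trans (app_δ _ _ _)) ((congrArg _ e₀').trans (app_δ _ _ _))
    ((congrArg _ e₁').trans ((vtx_zero _).symm.trans (vtx_cst _ _)))
    ((congrArg _ e₁').trans ((vtx_one _).symm.trans (vtx_cst _ _)))
  refine Eq.trans ?_ (key.symm.trans ?_)
  · exact congr (congrArg (· ≫ ·) (arr_congr e₀'.symm _ _)) (arr_congr (edgeOf_famOf _ _).symm _ _)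
  · refine Eq.trans (congrArg (_ ≫ ·) ((arr_congr e₁' _ _).trans (arr_cst _ _ _)))
      ((Category.comp_id _).trans ?_)
    exact arr_congr (edgeOf_famOf _ _) _ _

end

end InfCat

namespace InfCat

open CartesianMonoidalCategory (lift fst snd)

/-! ### Filtered systems -/

instance finite_sup {X : SSet.{u}} (A B : X.Subcomplex) [SSet.Finite A] [SSet.Finite B] :
    SSet.Finite (A ⊔ B : X.Subcomplex) := by
  have h : A ⊔ B = ⨆ b : Bool, cond b A B := sup_eq_iSup _ _
  rw [h, finite_iSup_iff]
  rintro (_ | _) <;> assumption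

instance finite_ofSimplex {X : SSet.{u}} {n : ℕ} (x : X _⦋n⦌) : SSet.Finite (Subcomplex.ofSimplex x) := by
  have h := Subcomplex.range_eq_ofSimplex (SSet.yonedaEquiv.symm x)
  rw [Equiv.apply_symm_apply] at h
  rw [← h]
  infer_instance

section

variable {I : SSet.{u}} (hI : IsCountableFiltered I)

include hI

lemma IsCountableFiltered.exists_targets (i j : I _⦋0⦌) :
    ∃ k, Nonempty (Ho.mk i ⟶ Ho.mk k) ∧ Nonempty (Ho.mk j ⟶ Ho.mk k) := by
  obtain ⟨K⟩ := hI.nonempty_cocone _ (Subcomplex.ofSimplex i ⊔ Subcomplex.ofSimplex j).ι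
  exact ⟨K.pt, ⟨K.legHom ⟨i, Or.inl (Subcomplex.mem_ofSimplex_obj _)⟩⟩,
    ⟨K.legHom ⟨j, Or.inr (Subcomplex.mem_ofSimplex_obj _)⟩⟩⟩

lemma IsCountableFiltered.exists_span {i j k : I _⦋0⦌} (f : Ho.mk i ⟶ Ho.mk j) (g : Ho.mk i ⟶ Ho.mk k) :
    ∃ (l : I _⦋0⦌) (f' : Ho.mk j ⟶ Ho.mk l) (g' : Ho.mk k ⟶ Ho.mk l), f ≫ f' = g ≫ g' := by
  have := hI.quasicategory
  obtain ⟨s, hs, hs', rfl⟩ := arr_surjective f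
  obtain ⟨t, ht, ht', rfl⟩ := arr_surjective g
  let L := Subcomplex.ofSimplex s ⊔ Subcomplex.ofSimplex t
  obtain ⟨K⟩ := hI.nonempty_cocone _ L.ι
  let s' : (L : SSet) _⦋1⦌ := ⟨s, Or.inl (Subcomplex.mem_ofSimplex_obj _)⟩
  let t' : (L : SSet) _⦋1⦌ := ⟨t, Or.inr (Subcomplex.mem_ofSimplex_obj _)⟩
  subst hs hs' ht'
  refine ⟨K.pt, K.legHom ((L : SSet).δ 0 s'), K.legHom ((L : SSet).δ 0 t'), ?_⟩
  refine (K.legHom_natural s' rfl rfl).trans (Eq.trans ?_ (K.legHom_natural t' (k := (L : SSet).δ 1 s')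
    (Subtype.ext ht) rfl).symm)
  rfl

lemma IsCountableFiltered.nonempty : Nonempty (I _⦋0⦌) := by
  have : SSet.Finite (⊥ : (Δ[0] : SSet.{u}).Subcomplex) := inferInstance
  obtain ⟨K⟩ := hI.nonempty_cocone _ ((Subcomplex.isInitialBot (X := (Δ[0] : SSet.{u}))).to I)
  exact ⟨K.pt⟩

end

/-! ### Compact objects -/

section

variable {I X : SSet.{u}} [Quasicategory X] {p : I ⟶ X} (c : Cocone p)

/-- The cocone on the natural transformation of a cocone. -/
noncomputable def Cocone.extend : Cocone c.hom where
  pt := c.pt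
  hom := lift (fst _ _ ≫ fst _ _) (lift (fst _ _ ≫ snd _ _) (snd _ _) ≫
    stdProd (fun i j ↦ i ⊔ j) (fun _ _ _ _ h h' ↦ sup_le_sup h h')) ≫ c.hom
  ι₀_hom := by
    have : ι₀ ≫ lift (fst _ _ ≫ fst _ _) (lift (fst _ _ ≫ snd _ _) (snd _ _) ≫
        stdProd (fun i j ↦ i ⊔ j) (fun _ _ _ _ h h' ↦ sup_le_sup h h')) = 𝟙 (I ⊗ Δ[1]) := by
      refine map_ext_app fun n x ↦ Prod.ext rfl (SSet.stdSimplex.ext _ _ fun i ↦ ?_)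
      exact sup_of_le_left (Fin.zero_le (show Fin 2 from _))
    rw [← Category.assoc, this, Category.id_comp]
  ι₁_hom := by
    have : ι₁ ≫ lift (fst _ _ ≫ fst _ _) (lift (fst _ _ ≫ snd _ _) (snd _ _) ≫
        stdProd (fun i j ↦ i ⊔ j) (fun _ _ _ _ h h' ↦ sup_le_sup h h')) =
        fst I Δ[1] ≫ ι₁ := by
      refine map_ext_app fun n x ↦ Prod.ext rfl (SSet.stdSimplex.ext _ _ fun i ↦ ?_)
      exact sup_of_le_right (Fin.le_last (show Fin 2 from _))
    rw [← Category.assoc, this, Category.assoc, c.ι₁_hom]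
    rfl

lemma Cocone.extend_legHom_v1 (i : I _⦋0⦌) (h : c.hom.app _ (i, v1) = c.pt) :
    c.extend.legHom (i, v1) = arr (cst c.pt _) ((vtx_zero _).symm.trans ((vtx_cst _ _).trans h.symm))
      ((vtx_one _).symm.trans (vtx_cst _ _)) := by
  refine arr_congr ?_ _ _
  have e : (lift (fst _ _ ≫ fst _ _) (lift (fst _ _ ≫ snd _ _) (snd _ _) ≫
      stdProd (fun i j ↦ i ⊔ j) (fun _ _ _ _ h h' ↦ sup_le_sup h h')) :
      (I ⊗ Δ[1]) ⊗ Δ[1] ⟶ I ⊗ Δ[1]).app (op ⦋1⦌)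
      ((I.σ 0 i, (Δ[1] : SSet.{u}).σ 0 v1), stdSimplex.objEquiv.symm (𝟙 ⦋1⦌)) =
      (I.σ 0 i, cst v1 _) := by
    refine Prod.ext rfl (SSet.stdSimplex.ext _ _ fun i ↦ ?_)
    exact sup_of_le_left (Fin.le_last (show Fin 2 from _))
  exact Eq.trans (congrArg (c.hom.app _) e) (congrArg (fun k : I ⟶ X ↦ k.app _ (I.σ 0 i)) c.ι₁_hom)

lemma Cocone.extend_legHom_v0 (i : I _⦋0⦌) (h : c.hom.app _ (i, v0) = p.app _ i) :
    c.extend.legHom (i, v0) = arr (c.leg i).edge ((c.leg i).src_eq.trans h.symm) (c.leg i).tgt_eq := by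
  refine arr_congr (congrArg (c.hom.app _) (Prod.ext rfl ?_)) _ _
  refine SSet.stdSimplex.ext _ _ fun i ↦ ?_
  exact sup_of_le_right (Fin.zero_le (show Fin 2 from _))

variable {c}

/-- Morphisms from a compact object to a colimit factor over a member of the system. -/
theorem IsCompactObject.exists_factorization {a : X _⦋0⦌} (ha : IsCompactObject a)
    (hI : IsCountableFiltered I) (hc : c.IsColimit) (v : Ho.mk a ⟶ Ho.mk c.pt) :
    ∃ (i : I _⦋0⦌) (w : Ho.mk a ⟶ Ho.mk (p.app _ i)), w ≫ c.legHom i = v := by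
  obtain ⟨i⟩ := hI.nonempty
  have h₁ (i : I _⦋0⦌) : c.hom.app _ (i, v1) = c.pt :=
    (congrArg (fun k : I ⟶ X ↦ k.app _ i) c.ι₁_hom).trans (map_const_self _ _)
  have h₀ (i : I _⦋0⦌) : c.hom.app _ (i, v0) = p.app _ i :=
    congrArg (fun k : I ⟶ X ↦ k.app _ i) c.ι₀_hom
  obtain ⟨z, hz, hv⟩ := exists_commaHom (G := c.hom) (i, v1) (h₁ i) v
  -- Consider the condition that the composite to the tip factors over a member of the system. It is
  -- locally constant on the comma object over `I ⊗ Δ[1]` and holds over `I ⊗ {0}`, hence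
  -- everywhere, in particular for `v` over `I ⊗ {1}`.
  have := (ha I hI p c hc).eq_of (S := ULift.{u} Prop) (φ := fun _ ↦ ⟨True⟩)
    (ψ := fun z ↦ ⟨∃ (i : I _⦋0⦌) (w : Ho.mk a ⟶ Ho.mk (p.app _ i)), w ≫ c.legHom i =
      commaHom z rfl ≫ c.extend.legHom _⟩) (fun _ ↦ rfl) (fun s ↦ by
      have h := commaHom_edge s rfl rfl
      have h' := c.extend.legHom_natural s.1.1 rfl rfl
      have : commaHom ((comma c.hom a : SSet).δ 1 s) rfl ≫ c.extend.legHom _ =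
          commaHom ((comma c.hom a : SSet).δ 0 s) rfl ≫ c.extend.legHom _ := by
        refine (congrArg (_ ≫ ·) h'.symm).trans ((Category.assoc _ _ _).symm.trans ?_)
        exact congrArg (· ≫ _) h
      rw [this]) (fun z ↦ by
      refine ULift.ext _ _ (eq_true ?_).symm
      refine ⟨z.1.1, commaHom z (congrArg (fun k : I ⟶ X ↦ k.app _ z.1.1) c.ι₀_hom), ?_⟩
      have e := c.extend_legHom_v0 z.1.1 (h₀ _)
      refine Eq.trans ?_ (congrArg (_ ≫ ·) e.symm)
      have key {y : X _⦋0⦌} (h : c.hom.app _ (z.1.1, v0) = y) (h' : X.δ 1 (c.leg z.1.1).edge = y) :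
          commaHom ((commaMap ι₀ c.hom a).app _ z) h ≫ arr (c.leg z.1.1).edge h' (c.leg z.1.1).tgt_eq =
          commaHom ((commaMap ι₀ c.hom a).app _ z) rfl ≫
            arr (c.leg z.1.1).edge (h'.trans h.symm) (c.leg z.1.1).tgt_eq := by
        subst h; rfl
      exact key (h₀ _) (c.leg z.1.1).src_eq) z
  obtain ⟨j, w, hw⟩ := (congrArg ULift.down this).mp trivial
  refine ⟨j, w, hw.trans ?_⟩
  obtain ⟨⟨a', e⟩, hz'⟩ := z
  obtain rfl : a' = (i, v1) := hz
  rw [← hv]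
  refine (congrArg (_ ≫ ·) (c.extend_legHom_v1 i (h₁ i))).trans ?_
  have key {y : X _⦋0⦌} (h : c.hom.app _ (i, v1) = y) (h₀ : X.δ 1 (cst y (op ⦋1⦌)) = c.hom.app _ (i, v1))
      (h₁ : X.δ 0 (cst y (op ⦋1⦌)) = y) (z : (comma c.hom a : SSet) _⦋0⦌) (hz : z.1.1 = (i, v1)) :
      commaHom z (congrArg (c.hom.app _) hz) ≫ arr (cst y _) h₀ h₁ =
        commaHom z ((congrArg (c.hom.app _) hz).trans h) := by
    subst h
    rw [arr_cst, Category.comp_id]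
  exact key (h₁ i) _ _ ⟨((i, v1), e), hz'⟩ rfl

/-- Two factorizations of a morphism from a compact object to a colimit agree after passage to some
member of the system. -/
theorem IsCompactObject.exists_eq {a : X _⦋0⦌} (ha : IsCompactObject a)
    (hI : IsCountableFiltered I) (hc : c.IsColimit) {i j : I _⦋0⦌} (x : Ho.mk a ⟶ Ho.mk (p.app _ i))
    (y : Ho.mk a ⟶ Ho.mk (p.app _ j)) (h : x ≫ c.legHom i = y ≫ c.legHom j) :
    ∃ (k : I _⦋0⦌) (f : Ho.mk i ⟶ Ho.mk k) (g : Ho.mk j ⟶ Ho.mk k),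
      x ≫ push p rfl rfl f = y ≫ push p rfl rfl g := by
  have := hI.quasicategory
  obtain ⟨pt, hom, rfl, hp⟩ := c
  let c : Cocone (ι₀ ≫ hom) := ⟨pt, hom, rfl, hp⟩
  change c.IsColimit at hc
  have h₁ (i : I _⦋0⦌) : hom.app _ (i, v1) = pt :=
    (congrArg (fun k : I ⟶ X ↦ k.app _ i) hp).trans (map_const_self _ _)
  -- The quotient is the colimit of the sets of morphisms to the members of the system; transitivity
  -- uses that `I` is filtered.
  let R : Setoid (Σ i : I _⦋0⦌, (Ho.mk a ⟶ Ho.mk ((ι₀ ≫ hom).app _ i))) :=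
    { r := fun s t ↦ ∃ (k : I _⦋0⦌) (f : Ho.mk s.1 ⟶ Ho.mk k) (g : Ho.mk t.1 ⟶ Ho.mk k),
        s.2 ≫ push (ι₀ ≫ hom) rfl rfl f = t.2 ≫ push (ι₀ ≫ hom) rfl rfl g
      iseqv := by
        refine ⟨fun s ↦ ⟨s.1, 𝟙 _, 𝟙 _, rfl⟩, ?_, ?_⟩
        · rintro s t ⟨k, f, g, h⟩
          exact ⟨k, g, f, h.symm⟩
        · rintro s t r ⟨k, f, g, h⟩ ⟨k', f', g', h'⟩
          obtain ⟨l, m, m', hm⟩ := hI.exists_span g f'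
          refine ⟨l, f ≫ m, g' ≫ m', ?_⟩
          rw [push_comp _ _ rfl, push_comp _ _ rfl, ← Category.assoc, h, ← Category.assoc, ← h',
            Category.assoc, Category.assoc, ← push_comp, ← push_comp, hm] }
  -- The class in this colimit is locally constant over `I ⊗ {0}`, so it extends to a locally
  -- constant function over `I ⊗ Δ[1]`.
  obtain ⟨ψ, hψ, hψ'⟩ := (ha I hI _ c hc).exists_of (S := Quotient R)
    (φ := fun z ↦ Quotient.mk R ⟨z.1.1, commaHom z rfl⟩) (fun s ↦ by
      refine Quotient.sound (s := R) ⟨_, arr s.1.1 rfl rfl, 𝟙 _, ?_⟩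
      refine (congrArg (_ ≫ ·) (push_arr _ _ _ _ _ _)).trans ((commaHom_edge s rfl rfl).trans ?_)
      exact (congrArg (_ ≫ ·) (push_id _ _)).trans (Category.comp_id _) |>.symm)
  -- A morphism over `(i, 0)` is joined by an edge to its composite with the leg over `(i, 1)`.
  have key₁ (z : (comma (ι₀ ≫ hom) a : SSet) _⦋0⦌) (z' : (comma hom a : SSet) _⦋0⦌)
      (hz : z'.1.1 = (z.1.1, v1)) (w : commaHom z rfl ≫ c.legHom _ =
        commaHom z' ((congrArg (hom.app _) hz).trans (h₁ _))) :
      ψ z' = ψ ((commaMap ι₀ hom a).app _ z) := by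
    have e₁ : (I ⊗ Δ[1]).δ 1 (I.σ 0 z.1.1, stdSimplex.objEquiv.symm (𝟙 ⦋1⦌)) = (z.1.1, v0) :=
      Prod.ext (SSet.δ_comp_σ_succ_apply (S := I) 0 _) (stdSimplex.obj₀Equiv.injective rfl)
    have e₀ : (I ⊗ Δ[1]).δ 0 (I.σ 0 z.1.1, stdSimplex.objEquiv.symm (𝟙 ⦋1⦌)) = (z.1.1, v1) :=
      Prod.ext (SSet.δ_comp_σ_self_apply (S := I) 0 _) (stdSimplex.obj₀Equiv.injective rfl)
    obtain ⟨s, hs₁, hs₀⟩ := exists_comma_edge ((commaMap ι₀ hom a).app _ z) z'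
      (I.σ 0 z.1.1, stdSimplex.objEquiv.symm (𝟙 ⦋1⦌)) e₁ (e₀.trans hz.symm) rfl ((congrArg (hom.app _) hz).trans (h₁ _)) w
    have := hψ s
    rw [hs₁, hs₀] at this
    exact this.symm
  have key₂ (z z' : (comma hom a : SSet) _⦋0⦌) {i k : I _⦋0⦌} (e : Ho.mk i ⟶ Ho.mk k)
      (hz : z.1.1 = (i, v1)) (hz' : z'.1.1 = (k, v1))
      (w : commaHom z ((congrArg (hom.app _) hz).trans (h₁ _)) =
        commaHom z' ((congrArg (hom.app _) hz').trans (h₁ _))) : ψ z = ψ z' := by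
    obtain ⟨t, ht, ht', rfl⟩ := arr_surjective e
    have e₁ : (I ⊗ Δ[1]).δ 1 (t, cst v1 _) = (i, v1) :=
      Prod.ext ht ((vtx_zero (cst (X := Δ[1]) v1 _)).symm.trans (vtx_cst _ _))
    have e₀ : (I ⊗ Δ[1]).δ 0 (t, cst v1 _) = (k, v1) :=
      Prod.ext ht' ((vtx_one (cst (X := Δ[1]) v1 _)).symm.trans (vtx_cst _ _))
    obtain ⟨s, hs₁, hs₀⟩ := exists_comma_edge z z' (t, cst v1 _) (e₁.trans hz.symm) (e₀.trans hz'.symm)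
      ((congrArg (hom.app _) hz).trans (h₁ _)) ((congrArg (hom.app _) hz').trans (h₁ _)) (by
      refine Eq.trans (congrArg (_ ≫ ·) ((arr_congr (congrArg (fun k : I ⟶ X ↦ k.app _ t) hp) _ _).trans
        (arr_cst _ _ _))) ((Category.comp_id _).trans w))
    have := hψ s
    rwa [hs₁, hs₀] at this
  obtain ⟨z, hz, rfl⟩ := exists_commaHom (G := ι₀ ≫ hom) i rfl x
  obtain ⟨z', hz', rfl⟩ := exists_commaHom (G := ι₀ ≫ hom) j rfl y
  subst hz hz'
  -- Over `I ⊗ {1}` the same morphism to the tip, placed over both indices, is joined through a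
  -- common target `k`.
  obtain ⟨k, ⟨f⟩, ⟨g⟩⟩ := hI.exists_targets z.1.1 z'.1.1
  obtain ⟨t, ht, ht'⟩ := exists_commaHom (G := hom) (z.1.1, v1) (h₁ _) (commaHom z rfl ≫ c.legHom _)
  obtain ⟨t₁, ht₁, ht₁'⟩ := exists_commaHom (G := hom) (z'.1.1, v1) (h₁ _) (commaHom z rfl ≫ c.legHom _)
  obtain ⟨t₂, ht₂, ht₂'⟩ := exists_commaHom (G := hom) (k, v1) (h₁ _) (commaHom z rfl ≫ c.legHom _)
  have e := (key₁ z t ht ht'.symm).symm.trans ((key₂ t t₂ f ht ht₂ (ht'.trans ht₂'.symm)).trans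
    ((key₂ t₁ t₂ g ht₁ ht₂ (ht₁'.trans ht₂'.symm)).symm.trans (key₁ z' t₁ ht₁ (h.symm.trans ht₁'.symm))))
  rw [hψ', hψ'] at e
  exact Quotient.exact (s := R) e

end

end InfCat

namespace InfCat

open CartesianMonoidalCategory (lift fst snd)

/-! ### Functors of homotopy categories -/

/-- The functor of homotopy categories which is induced by a map of simplicial sets. -/
abbrev hoMap {X Y : SSet.{u}} (F : X ⟶ Y) : Ho X ⥤ Ho Y :=
  Truncated.mapHomotopyCategory ((truncation 2).map F)

lemma hoMap_map {X Y : SSet.{u}} (F : X ⟶ Y) {x x' : X _⦋0⦌} (f : Ho.mk x ⟶ Ho.mk x') :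
    (hoMap F).map f = push F rfl rfl f :=
  ((Category.id_comp _).trans (Category.comp_id _)).symm

/-! ### Constant families -/

section

variable (K : SSet.{u}) {X Y : SSet.{u}} {x x' x'' : X _⦋0⦌}

/-- The morphism of constant families which is given by a morphism. -/
noncomputable def diag (f : Ho.mk x ⟶ Ho.mk x') :
    Ho.mk (vertex (SSet.const x : K ⟶ X)) ⟶ Ho.mk (vertex (SSet.const x' : K ⟶ X)) :=
  push (constFun K X) (constFun_app K x) (constFun_app K x') f

lemma diag_comp (f : Ho.mk x ⟶ Ho.mk x') (g : Ho.mk x' ⟶ Ho.mk x'') :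
    diag K (f ≫ g) = diag K f ≫ diag K g :=
  push_comp _ _ _ _ _ _

lemma diag_id : diag K (𝟙 (Ho.mk x)) = 𝟙 _ := push_id _ _

variable {K}

lemma const_comp (F : X ⟶ Y) (x : X _⦋0⦌) : (SSet.const x : K ⟶ X) ≫ F = SSet.const (F.app _ x) :=
  map_ext_app fun n _ ↦ app_cst F x (op ⦋n⦌)

lemma constFun_post (F : X ⟶ Y) : constFun K X ≫ (ihom K).map F = F ≫ constFun K Y := by
  refine map_ext_app fun n s ↦ ?_
  change ((ihom K).map F).app _ ((constFun K X).app _ s) = (constFun K Y).app _ (F.app _ s)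
  rw [constFun_simplex, constFun_simplex, sx_post, Category.assoc]
  congr 2
  rw [SSet.yonedaEquiv_symm_comp]

variable [Quasicategory X]

lemma push_post_diag (F : X ⟶ Y) (f : Ho.mk x ⟶ Ho.mk x') (e e') :
    push ((ihom K).map F) (y := vertex (SSet.const (F.app _ x))) (y' := vertex (SSet.const (F.app _ x')))
      e e' (diag K f) = diag K (push F rfl rfl f) := by
  refine (push_push _ _ _ _ _ _ _).trans (Eq.trans ?_ (push_push _ _ _ _ _ _ _).symm)
  exact push_congr (constFun_post F) _ _ _ _ _

lemma push_evalAt_diag (k : K _⦋0⦌) (f : Ho.mk x ⟶ Ho.mk x') (e e') :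
    push (evalAt k X) (y := x) (y' := x') e e' (diag K f) = f := by
  refine (push_push _ _ _ _ _ _ _).trans (Eq.trans ?_ (push_refl f))
  exact push_congr (constFun_evalAt k) _ _ _ _ _

end

/-! ### Cocones and classes of families of morphisms -/

section

variable {K X Y : SSet.{u}} {p : K ⟶ X}

/-- The class of the natural transformation of a cocone. -/
noncomputable def Cocone.toHom (c : Cocone p) :
    Ho.mk (vertex p) ⟶ Ho.mk (vertex (SSet.const c.pt : K ⟶ X)) :=
  cls c.hom c.ι₀_hom c.ι₁_hom

/-- The image of a cocone. -/
def Cocone.map (c : Cocone p) (F : X ⟶ Y) : Cocone (p ≫ F) where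
  pt := F.app _ c.pt
  hom := c.hom ≫ F
  ι₀_hom := by rw [← Category.assoc, c.ι₀_hom]
  ι₁_hom := by rw [← Category.assoc, c.ι₁_hom, const_comp]

/-- A cocone with the universal property of colimits in the homotopy category of families. -/
def Cocone.IsHoColimit (c : Cocone p) : Prop :=
  ∀ x : X _⦋0⦌, Function.Bijective fun f : Ho.mk c.pt ⟶ Ho.mk x ↦ c.toHom ≫ diag K f

variable [Quasicategory X]

lemma Cocone.push_evalAt_toHom (c : Cocone p) (k : K _⦋0⦌) (e e') :
    push (evalAt k X) (y := p.app _ k) (y' := c.pt) e e' c.toHom = c.legHom k := by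
  refine (push_evalAt_cls k _ _ _ _ _).trans (arr_congr ?_ _ _)
  have h : K.map (SimplexCategory.const ⦋1⦌ ⦋0⦌ 0).op k = K.σ 0 k :=
    congrArg (fun f : ⦋1⦌ ⟶ ⦋0⦌ ↦ K.map f.op k) (Subsingleton.elim _ _)
  exact congrArg (fun x ↦ c.hom.app (op ⦋1⦌) (x, stdSimplex.objEquiv.symm (𝟙 ⦋1⦌))) h

lemma Cocone.push_post_toHom (c : Cocone p) (F : X ⟶ Y) (e e') :
    push ((ihom K).map F) (y := vertex (p ≫ F)) (y' := vertex (SSet.const (F.app _ c.pt))) e e' c.toHom =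
      (c.map F).toHom :=
  push_post_cls _ _ _ _ rfl (const_comp _ _) _ _

lemma Cocone.map_legHom (c : Cocone p) (F : X ⟶ Y) (k : K _⦋0⦌) :
    (c.map F).legHom k = (hoMap F).map (c.legHom k) :=
  ((hoMap_map _ _).trans (push_arr _ _ _ _ (c.leg k).src_eq (c.leg k).tgt_eq)).symm

/-- A colimit cocone is a universal arrow from the diagram to the diagonal, so `IsLoc.existsUnique`
applies. This weak form of the universal property is all that is needed of the realized cocones. -/
lemma Cocone.isHoColimit (c : Cocone p) (hc : c.IsColimit) : c.IsHoColimit := by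
  intro x
  have key := (isLoc_of_isInitialVertex_comma _ _ _ hc).existsUnique (G := constFun K X)
    (b := vertex p) (((mem_ofSimplex_iff _ _).1 c.toComma.2.1).trans (cst_self _)) (a := x)
  have e (f : Ho.mk c.pt ⟶ Ho.mk x) : push (𝟙 (Fun K X)) rfl (constFun_app K x) (arrowHom (constFun K X)
      ⟨c.toComma.1, comma_le_arrows _ _ _ c.toComma.2⟩
      (((mem_ofSimplex_iff _ _).1 c.toComma.2.1).trans (cst_self _)) ≫
        push (constFun K X) rfl rfl f) = c.toHom ≫ diag K f := by
    refine (push_comp (𝟙 (Fun K X)) _ (constFun_app K c.pt) _ _ _).trans ?_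
    refine congr (congrArg (· ≫ ·) ?_) ?_
    · refine (push_arr _ _ _ _ _ _).trans (arr_congr
        (show edgeOf c.toComma.1.2 = sx c.hom from edgeOf_vertex _) _ _)
    · exact (push_push _ _ _ _ _ _ _)
  have hb : Function.Bijective (push (𝟙 (Fun K X)) (x := vertex p) rfl (constFun_app K x)) := by
    have {y : (Fun K X) _⦋0⦌} (h : (constFun K X).app _ x = y) :
        Function.Bijective (push (𝟙 (Fun K X)) (x := vertex p) rfl h) := by
      subst h
      exact (Function.bijective_iff_has_inverse.2 ⟨id, fun f ↦ push_refl f, fun f ↦ push_refl f⟩)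
    exact this _
  have := hb.comp ((Function.bijective_iff_existsUnique _).2 key)
  exact (congrArg Function.Bijective (funext e)).mp this

end

/-! ### Adjunctions -/

/-- The adjunction given by a natural family of universal arrows. -/
noncomputable def adjOfUniversal {C D : Type*} [Category* C] [Category* D] {L : C ⥤ D} {Y : D ⥤ C}
    (h : ∀ b, b ⟶ Y.obj (L.obj b)) (hn : ∀ {b b'} (f : b ⟶ b'), h b ≫ Y.map (L.map f) = f ≫ h b')
    (hu : ∀ b a (v : b ⟶ Y.obj a), ∃! x : L.obj b ⟶ a, h b ≫ Y.map x = v) : L ⊣ Y :=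
  Adjunction.mkOfHomEquiv
    { homEquiv := fun b a ↦ Equiv.ofBijective (fun x ↦ h b ≫ Y.map x)
        ((Function.bijective_iff_existsUnique _).2 (hu b a))
      homEquiv_naturality_left_symm := fun {b b' a} f g ↦ by
        rw [Equiv.symm_apply_eq]
        obtain ⟨g, rfl⟩ := (Equiv.ofBijective (fun x ↦ h b' ≫ Y.map x)
          ((Function.bijective_iff_existsUnique _).2 (hu b' a))).surjective g
        rw [Equiv.symm_apply_apply]
        simp [reassoc_of% hn]
      homEquiv_naturality_right := fun {b a a'} f g ↦ by simp }

section

variable {A B : SSet.{u}} {F : B ⟶ A} {G : A ⟶ B}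

/-- A unit transformation, as a family of arrows, all of which are universal. -/
structure UniversalUnit (F : B ⟶ A) (G : A ⟶ B) where
  /-- The family of arrows. -/
  fam : B ⟶ Fun Δ[1] B
  src : fam ≫ evalAt v0 B = 𝟙 B
  tgt : fam ≫ evalAt v1 B = F ≫ G
  isLoc (b : B _⦋0⦌) : IsLoc (fun _ ↦ 0) (arrowsSrc G) ((toArrows G F fam tgt).app _ b)

variable [Quasicategory A] [Quasicategory B]

lemma IsLeftAdjoint.nonempty_universalUnit (h : IsLeftAdjoint F G) : Nonempty (UniversalUnit F G) := by
  obtain ⟨h, h₀, h₁, hu⟩ := h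
  refine ⟨⟨famOf h, (famOf_evalAt_zero _).trans h₀, (famOf_evalAt_one _).trans h₁, fun b ↦ ?_⟩⟩
  have e : B.map (SimplexCategory.const ⦋1⦌ ⦋0⦌ 0).op b = B.σ 0 b :=
    congrArg (fun f : ⦋1⦌ ⟶ ⦋0⦌ ↦ B.map f.op b) (Subsingleton.elim _ _)
  have e' : vertex (lift (SSet.const b) (𝟙 _) ≫ h) = (famOf h).app _ b :=
    edgeOf_injective ((edgeOf_vertex _).trans (Eq.trans
      (congrArg (fun x ↦ h.app (op ⦋1⦌) (x, stdSimplex.objEquiv.symm (𝟙 ⦋1⦌))) e) (edgeOf_famOf _ _).symm))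
  have key (z z' : (arrows G : SSet) _⦋0⦌) (h : z = z') (hz : IsLoc (fun _ ↦ 0) (arrowsSrc G) z) :
      IsLoc (fun _ ↦ 0) (arrowsSrc G) z' := h ▸ hz
  exact key _ _ (Subtype.ext (show (unitComponent h h₀ h₁ b).1 =
    (F.app _ b, (famOf h).app _ b) from Prod.ext rfl e')) (isLoc_of_isInitialVertex_comma G b _ (hu b))

namespace UniversalUnit

variable (η : UniversalUnit F G)

/-- The unit of an adjunction, on homotopy categories. -/
noncomputable def hom (b : B _⦋0⦌) : Ho.mk b ⟶ Ho.mk (G.app _ (F.app _ b)) :=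
  edgeHom (η.fam.app _ b) (congrArg (fun k : B ⟶ B ↦ k.app _ b) η.src)
    (congrArg (fun k : B ⟶ B ↦ k.app _ b) η.tgt)

lemma existsUnique {b : B _⦋0⦌} {a : A _⦋0⦌} (v : Ho.mk b ⟶ Ho.mk (G.app _ a)) :
    ∃! x : Ho.mk (F.app _ b) ⟶ Ho.mk a, η.hom b ≫ push G rfl rfl x = v :=
  (η.isLoc b).existsUnique G (congrArg (fun k : B ⟶ B ↦ k.app _ b) η.src) v

lemma hom_natural {b b' : B _⦋0⦌} (f : Ho.mk b ⟶ Ho.mk b') :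
    η.hom b ≫ push G rfl rfl (push F rfl rfl f) = f ≫ η.hom b' := by
  have key := edgeHom_natural (congrArg (fun k : B ⟶ B ↦ k.app _ b) η.src)
    (congrArg (fun k : B ⟶ B ↦ k.app _ b) η.tgt) (congrArg (fun k : B ⟶ B ↦ k.app _ b') η.src)
    (congrArg (fun k : B ⟶ B ↦ k.app _ b') η.tgt) (push η.fam rfl rfl f)
  refine Eq.trans (congrArg (_ ≫ ·) ?_) (key.trans (congrArg (· ≫ _) ?_))
  · exact (push_push _ _ _ _ _ _ _).trans ((push_congr η.tgt.symm _ _ _ _ _).trans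
      (push_push _ _ _ _ _ _ _).symm)
  · exact (push_push _ _ _ _ _ _ _).trans ((push_congr η.src _ _ rfl rfl _).trans (push_refl f))

/-- The adjunction of homotopy categories. -/
noncomputable def adj : hoMap F ⊣ hoMap G :=
  adjOfUniversal (fun b ↦ η.hom b.1.as) (fun {b b'} f ↦ by
    refine Eq.trans (congrArg (_ ≫ ·) ?_) (η.hom_natural (b := b.1.as) (b' := b'.1.as) f)
    exact (congrArg (hoMap G).map (hoMap_map F f)).trans (hoMap_map G _)) (fun b a v ↦ by
    obtain ⟨x, hx, hx'⟩ := η.existsUnique (b := b.1.as) (a := a.1.as) v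
    exact ⟨x, (congrArg (_ ≫ ·) (hoMap_map G x)).trans hx,
      fun x' h ↦ hx' x' ((congrArg (_ ≫ ·) (hoMap_map G x').symm).trans h)⟩)

end UniversalUnit

end

end InfCat

namespace InfCat

open CartesianMonoidalCategory (lift fst snd)

/-! ### Left adjoints preserve colimits of families -/

section

variable {K X : SSet.{u}}

lemma edgeOf_app (U : K ⟶ Fun Δ[1] X) (k : K _⦋0⦌) :
    edgeOf (U.app _ k) = SSet.yonedaEquiv (lift (SSet.const k) (𝟙 _) ≫ arrF U) := by
  have h : K.map (SimplexCategory.const ⦋1⦌ ⦋0⦌ 0).op k = K.σ 0 k :=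
    congrArg (fun f : ⦋1⦌ ⟶ ⦋0⦌ ↦ K.map f.op k) (Subsingleton.elim _ _)
  have e := edgeOf_famOf (arrF U) k
  rw [famOf_arrF] at e
  exact e.trans (congrArg (fun x ↦ (arrF U).app (op ⦋1⦌) (x, stdSimplex.objEquiv.symm (𝟙 ⦋1⦌))) h.symm)

lemma cls_arrF_const (e : (Fun Δ[1] X) _⦋0⦌) {x y : X _⦋0⦌} (h₀ : (evalAt v0 X).app _ e = x)
    (h₁ : (evalAt v1 X).app _ e = y) (a₀ a₁) : cls (arrF (SSet.const e : K ⟶ Fun Δ[1] X))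
      (p := SSet.const x) (q := SSet.const y) a₀ a₁ = diag K (edgeHom e h₀ h₁) := by
  refine Eq.trans (cls_congr ?_ _ _) (push_constFun_arr _ _ _ _ _).symm
  have h : famOf (snd K Δ[1] ≫ SSet.yonedaEquiv.symm (edgeOf e)) = SSet.const e := by
    obtain ⟨p, rfl⟩ := vertex_surjective e
    rw [edgeOf_vertex, Equiv.symm_apply_apply]
    refine Eq.trans ?_ (map_ext_app fun n x ↦ curry_fst_app p x)
    refine congrArg MonoidalClosed.curry ?_
    rw [← Category.assoc]
    rfl
  rw [← h, arrF_famOf]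

end

section

variable {K A B : SSet.{u}} [Quasicategory A] [Quasicategory B] {F : B ⟶ A} {G : A ⟶ B}
  (η : UniversalUnit F G)

namespace UniversalUnit

/-- The class of the family of units at the members of a family. -/
noncomputable def famHom (p : K ⟶ B) : Ho.mk (vertex p) ⟶ Ho.mk (vertex ((p ≫ F) ≫ G)) :=
  cls (arrF (p ≫ η.fam)) (by rw [ι₀_arrF, Category.assoc, η.src, Category.comp_id])
    (by rw [ι₁_arrF, Category.assoc, Category.assoc, η.tgt])

lemma existsUnique_famHom (p : K ⟶ B) {a : K ⟶ A} {b : K ⟶ B} (hb : a ≫ G = b) (e e')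
    (v : Ho.mk (vertex p) ⟶ Ho.mk (vertex b)) : ∃! x : Ho.mk (vertex (p ≫ F)) ⟶ Ho.mk (vertex a),
      η.famHom p ≫ push ((ihom K).map G) (y := vertex ((p ≫ F) ≫ G)) (y' := vertex b) e e' x = v := by
  subst hb
  exact IsLoc.existsUnique_family G (p ≫ toArrows G F η.fam η.tgt) (fun k ↦ η.isLoc _) (b := p)
    (a := p ≫ F) (by
      refine (Category.assoc _ _ _).trans (Eq.trans (congrArg (p ≫ ·) ?_) (Category.comp_id _))
      exact Eq.trans rfl η.src) rfl v

lemma famHom_toHom {p : K ⟶ B} (c : Cocone p) (e e') :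
    η.famHom p ≫ push ((ihom K).map G) (y := vertex ((p ≫ F) ≫ G))
      (y' := vertex (SSet.const (G.app _ (F.app _ c.pt)))) e e' (c.map F).toHom =
      c.toHom ≫ diag K (η.hom c.pt) := by
  have h₁ : (c.hom ≫ η.fam) ≫ evalAt v1 B = (c.hom ≫ F) ≫ G := by
    rw [Category.assoc, η.tgt, Category.assoc]
  have h₀ : (c.hom ≫ η.fam) ≫ evalAt v0 B = c.hom := by rw [Category.assoc, η.src, Category.comp_id]
  have a₀ : ι₀ ≫ c.hom ≫ η.fam = p ≫ η.fam := by rw [← Category.assoc, c.ι₀_hom]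
  have a₁ : ι₁ ≫ c.hom ≫ η.fam = SSet.const (η.fam.app _ c.pt) := by
    rw [← Category.assoc, c.ι₁_hom, const_comp]
  have key := fam_natural (c.hom ≫ η.fam) a₀ a₁ (p := p) (q := (p ≫ F) ≫ G) (r := SSet.const c.pt)
    (t := SSet.const (G.app _ (F.app _ c.pt)))
    (by rw [ι₀_arrF, Category.assoc, η.src, Category.comp_id])
    (by rw [ι₁_arrF, Category.assoc, Category.assoc, η.tgt])
    (by rw [ι₀_arrF, const_comp]; exact congrArg SSet.const (congrArg (fun k : B ⟶ B ↦ k.app _ c.pt) η.src))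
    (by rw [ι₁_arrF, const_comp]; exact congrArg SSet.const (congrArg (fun k : B ⟶ B ↦ k.app _ c.pt) η.tgt))
    (by rw [h₀, c.ι₀_hom]) (by rw [h₀, c.ι₁_hom])
    (by rw [h₁, ← Category.assoc, ← Category.assoc, c.ι₀_hom])
    (by rw [h₁, ← Category.assoc, ← Category.assoc, c.ι₁_hom, const_comp, const_comp])
  refine Eq.trans (congrArg (_ ≫ ·) ?_) (key.trans ?_)
  · exact (push_post_cls _ _ _ _ rfl (const_comp _ _) _ _).trans (cls_congr h₁.symm _ _)
  · exact congr (congrArg (· ≫ ·) (cls_congr h₀ _ _)) (cls_arrF_const _ _ _ _ _)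

include η in
-- Universality of the units identifies maps from the new tip to `a` with maps `c.pt ⟶ G a`. In
-- families it identifies transformations from `p ≫ F` to the constant family `a` with those from
-- `p` to the constant family `G a`. By `famHom_toHom` both identifications are compatible with
-- composition with the cocones.
theorem isHoColimit_map {p : K ⟶ B} (c : Cocone p) (hc : c.IsHoColimit) : (c.map F).IsHoColimit := by
  intro a
  have hp : ((ihom K).map G).app _ (vertex (p ≫ F)) = vertex ((p ≫ F) ≫ G) := post_vertex _ _
  have hq (a : A _⦋0⦌) : ((ihom K).map G).app _ (vertex (SSet.const a)) =
      vertex (SSet.const (G.app _ a) : K ⟶ B) := (post_vertex _ _).trans (congrArg _ (const_comp _ _))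
  have h₁ := (Function.bijective_iff_existsUnique _).2 fun v ↦
    η.existsUnique_famHom p (const_comp G a) hp (hq a) v
  have h₂ := (Function.bijective_iff_existsUnique _).2 fun v ↦ η.existsUnique (b := c.pt) (a := a) v
  refine h₁.of_comp_iff' _ |>.1 ((congrArg Function.Bijective (funext fun r ↦ ?_)).mp
    ((hc (G.app _ a)).comp h₂))
  refine Eq.trans ?_ (congrArg (_ ≫ ·) (push_comp _ hp (hq _) (hq _) _ _)).symm
  refine Eq.trans ?_ (Category.assoc _ _ _)
  refine Eq.trans ?_ (congr (congrArg (· ≫ ·) (η.famHom_toHom c hp (hq _)))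
    (push_post_diag G r (hq _) (hq _))).symm
  exact (congrArg (_ ≫ ·) (diag_comp K _ _)).trans (Category.assoc _ _ _).symm

end UniversalUnit

end

/-! ### Shapes of the members of a system -/

/-- A universal arrow from an object to a functor. -/
def IsShape {C D : Type*} [Category* C] [Category* D] (L : C ⥤ D) {b : D} {x : C} (η : b ⟶ L.obj x) :
    Prop :=
  ∀ (z : C) (v : b ⟶ L.obj z), ∃! f : x ⟶ z, η ≫ L.map f = v

section

variable {C D : SSet.{u}} [Quasicategory C] [Quasicategory D] {R : C ⟶ D}

lemma IsLoc.isShape {s : (arrows R : SSet) _⦋0⦌} (h : IsLoc (fun _ ↦ 0) (arrowsSrc R) s) {b : D _⦋0⦌}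
    (hs : (arrowsSrc R).app _ s = b) :
    IsShape (hoMap R) (x := Ho.mk s.1.1) (arrowHom R s hs) := by
  intro z v
  obtain ⟨x, hx, hx'⟩ := h.existsUnique R hs (a := z.1.as) v
  exact ⟨x, (congrArg (_ ≫ ·) (hoMap_map R x)).trans hx,
    fun x' h ↦ hx' x' ((congrArg (_ ≫ ·) (hoMap_map R x').symm).trans h)⟩

lemma AdmitsShape.exists_isLoc {b : D _⦋0⦌} (h : AdmitsShape R b) : ∃ s : (arrows R : SSet) _⦋0⦌,
    (arrowsSrc R).app _ s = b ∧ IsLoc (fun _ ↦ 0) (arrowsSrc R) s := by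
  obtain ⟨s, hs⟩ := h
  exact ⟨⟨s.1, comma_le_arrows _ _ _ s.2⟩, ((mem_ofSimplex_iff _ _).1 s.2.1).trans (cst_self _),
    isLoc_of_isInitialVertex_comma R b s hs⟩

lemma AdmitsShape.exists_isShape {b : D _⦋0⦌} (h : AdmitsShape R b) : ∃ (x : C _⦋0⦌)
    (η : Ho.mk b ⟶ (hoMap R).obj (Ho.mk x)), IsShape (hoMap R) η := by
  obtain ⟨s, hs, h⟩ := h.exists_isLoc
  exact ⟨_, _, h.isShape hs⟩

/-- A cocone whose tip maps to the value of a functor lifts to the system of the shapes. -/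
theorem exists_shape_system (hR : ∀ b : D _⦋0⦌, AdmitsShape R b) {I : SSet.{u}} {p : I ⟶ D}
    (c : Cocone p) {y : C _⦋0⦌} (v : Ho.mk c.pt ⟶ Ho.mk (R.app _ y)) :
    ∃ (q : I ⟶ C) (Q : I ⊗ Δ[1] ⟶ C) (h₀ : ι₀ ≫ Q = q) (h₁ : ι₁ ≫ Q = SSet.const y)
      (u : Ho.mk (vertex p) ⟶ Ho.mk (vertex (q ≫ R))),
      (∀ i e e', IsShape (hoMap R) (x := Ho.mk (q.app _ i))
        (push (evalAt i D) (y := p.app _ i) (y' := R.app _ (q.app _ i)) e e' u)) ∧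
      u ≫ (Cocone.map ⟨y, Q, h₀, h₁⟩ R).toHom = c.toHom ≫ diag I v := by
  choose s hs hs' using fun b ↦ (hR b).exists_isLoc
  obtain ⟨e, he, hb, rfl⟩ := arrowHom_surjective R v
  let s₁ : (arrows R : SSet) _⦋0⦌ := ⟨(y, vertex e), he⟩
  have h₁ (i : I _⦋0⦌) : c.hom.app _ (i, v1) = c.pt :=
    (congrArg (fun k : I ⟶ D ↦ k.app _ i) c.ι₁_hom).trans (map_const_self _ _)
  have h₀ (i : I _⦋0⦌) : c.hom.app _ (i, v0) = p.app _ i :=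
    congrArg (fun k : I ⟶ D ↦ k.app _ i) c.ι₀_hom
  have hv : (v0 : (Δ[1] : SSet.{u}) _⦋0⦌) ≠ v1 := fun h ↦ Fin.zero_ne_one
    (stdSimplex.obj₀Equiv.symm.injective h)
  have := mono_of_retraction (ι₁ : I ⟶ I ⊗ Δ[1]) (fst _ _) rfl
  classical
  let s' : (I ⊗ Δ[1]) _⦋0⦌ → (arrows R : SSet) _⦋0⦌ := fun w ↦
    if w.2 = v1 then s₁ else s (c.hom.app _ w)
  have hs₁ (i : I _⦋0⦌) : s' (i, v1) = s₁ := if_pos rfl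
  have hs₀ (w : (I ⊗ Δ[1]) _⦋0⦌) (hw : w.2 = v0) : s' w = s (c.hom.app _ w) :=
    if_neg fun h ↦ hv (hw.symm.trans h)
  -- Over `I ⊗ {0}` the vertices are lifted by arrows to shapes, over `I ⊗ {1}` by the constant
  -- arrow `s₁`. Every simplex not in `I ⊗ {1}` starts at a relatively initial arrow, so nothing has
  -- to be assumed about `s₁`.
  obtain ⟨g, hg₁, hg, hg'⟩ := exists_lift_of_isLoc (ι₁ : I ⟶ I ⊗ Δ[1]) (arrowsSrc R) (SSet.const s₁) c.hom
    (fun _ ↦ 0) s' (by rw [const_comp, hb, c.ι₁_hom]) (by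
      rintro ⟨i, w⟩
      obtain rfl | rfl := eq_v0_or_v1 w
      · exact (congrArg _ (hs₀ _ rfl)).trans (hs _)
      · exact (congrArg _ (hs₁ i)).trans (hb.trans (h₁ i).symm)) (by
      intro i
      exact (map_const_self (arrows R : SSet) s₁).trans (hs₁ i).symm) (by
      intro n x hx
      refine (congrArg (IsLoc (fun _ ↦ 0) (arrowsSrc R)) (hs₀ _ ?_)).mpr (hs' _)
      refine (cst_or_vtx_zero x.2).resolve_left fun h ↦ hx ⟨x.1, Prod.ext rfl h.symm⟩)
  have hW : (g ≫ (arrows R).ι ≫ snd _ _) ≫ evalAt v1 D = (g ≫ (arrows R).ι ≫ fst _ _) ≫ R := by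
    simp only [Category.assoc, arrows_condition]
  have hW' : (g ≫ (arrows R).ι ≫ snd _ _) ≫ evalAt v0 D = c.hom := by
    rw [← hg, arrowsSrc_eq]
    simp only [Category.assoc]
  have hV : ι₁ ≫ g ≫ (arrows R).ι ≫ snd _ _ = SSet.const (vertex e) := by
    rw [← Category.assoc, hg₁, const_comp]
    rfl
  have hQ : ι₁ ≫ g ≫ (arrows R).ι ≫ fst _ _ = SSet.const y := by
    rw [← Category.assoc, hg₁, const_comp]
    rfl
  have a₀ : ι₀ ≫ arrF (ι₀ ≫ g ≫ (arrows R).ι ≫ snd _ _) = p := by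
    rw [ι₀_arrF, Category.assoc, hW', c.ι₀_hom]
  have a₁ : ι₁ ≫ arrF (ι₀ ≫ g ≫ (arrows R).ι ≫ snd _ _) = (ι₀ ≫ g ≫ (arrows R).ι ≫ fst _ _) ≫ R := by
    rw [ι₁_arrF, Category.assoc, hW]
    simp only [Category.assoc]
  refine ⟨ι₀ ≫ g ≫ (arrows R).ι ≫ fst _ _, g ≫ (arrows R).ι ≫ fst _ _, rfl, hQ, cls _ a₀ a₁, ?_, ?_⟩
  · intro i e e'
    have hi : g.app _ (i, v0) = s (p.app _ i) :=
      (hg' _).trans ((hs₀ _ rfl).trans (congrArg s (h₀ i)))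
    have := (hs' (p.app _ i)).isShape (hs _)
    have key (z z' : (arrows R : SSet) _⦋0⦌) (h : z = z') (h' : (arrowsSrc R).app _ z = p.app _ i) :
        IsShape (hoMap R) (x := Ho.mk z'.1.1) (arrowHom R z' (h ▸ h')) →
        IsShape (hoMap R) (x := Ho.mk z.1.1) (arrowHom R z h') := by
      subst h
      exact id
    refine (congrArg (IsShape (hoMap R)) ?_).mp (key _ _ hi ((congrArg _ hi).trans (hs _)) this)
    refine (arr_congr ?_ _ _).trans (push_evalAt_cls i _ _ _ _ _).symm
    refine Eq.trans ?_ (edgeOf_app _ i)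
    exact congrArg (fun w ↦ edgeOf (g.app _ w).1.2)
      (show (i, v0) = (ι₀ : I ⟶ I ⊗ Δ[1]).app _ i from Prod.ext rfl (cst_self _).symm)
  · refine Eq.trans (congrArg (_ ≫ ·) (cls_congr hW.symm _ _)) ((fam_natural _ rfl hV a₀ a₁
      ?_ ?_ ?_ ?_ ?_ ?_).trans (congr (congrArg (· ≫ ·) (cls_congr hW' _ _)) (cls_arrF_const _ hb he _ _)))
    · rw [ι₀_arrF, const_comp]
      exact congrArg SSet.const hb
    · rw [ι₁_arrF, const_comp]
      exact congrArg SSet.const he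
    · rw [hW', c.ι₀_hom]
    · rw [hW', c.ι₁_hom]
    · rw [hW]
      simp only [Category.assoc]
    · rw [hW, ← Category.assoc, hQ, const_comp]
      rfl

omit [Quasicategory D] in
lemma Cocone.map_toHom_diag {K : SSet.{u}} {q : K ⟶ C} {t k : Cocone q} (R : C ⟶ D)
    (d : Ho.mk t.pt ⟶ Ho.mk k.pt) (h : t.toHom ≫ diag K d = k.toHom) :
    (t.map R).toHom ≫ diag K ((hoMap R).map d) = (k.map R).toHom := by
  have hq : ((ihom K).map R).app _ (vertex q) = vertex (q ≫ R) := post_vertex _ _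
  have hx (x : C _⦋0⦌) : ((ihom K).map R).app _ (vertex (SSet.const x)) =
      vertex (SSet.const (R.app _ x) : K ⟶ D) := (post_vertex _ _).trans (congrArg _ (const_comp _ _))
  rw [← k.push_post_toHom R hq (hx _), ← h, push_comp _ _ (hx _), t.push_post_toHom]
  exact congrArg (_ ≫ ·) ((congrArg (diag K) (hoMap_map R d)).trans (push_post_diag R d _ _).symm)

lemma comp_comp_eq {C : Type*} [Category* C] {a b c d e : C} {f : a ⟶ b} {r : b ⟶ c} {k : c ⟶ d}
    {u : a ⟶ e} {s : e ⟶ c} {v : a ⟶ d} (h : f ≫ r = u ≫ s) (h' : u ≫ s ≫ k = v) : f ≫ r ≫ k = v := by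
  rw [← h', ← Category.assoc, h, Category.assoc]

/-- The map `d` comes from the universal property of the colimit `t`, and `r` from that of `c`. The
equation for `v` holds because both sides have the same composite with the cocone `c`. -/
lemma Cocone.exists_colimit_comparison (hC : HasCountableFilteredColimits C)
    {I : SSet.{u}} (hI : IsCountableFiltered I) {p : I ⟶ D} (c : Cocone p) (hc : c.IsHoColimit)
    {q : I ⟶ C} (k : Cocone q) (u : Ho.mk (vertex p) ⟶ Ho.mk (vertex (q ≫ R)))
    (v : Ho.mk c.pt ⟶ Ho.mk (R.app _ k.pt)) (hv : u ≫ (k.map R).toHom = c.toHom ≫ diag I v) :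
    ∃ (t : Cocone q) (d : Ho.mk t.pt ⟶ Ho.mk k.pt) (r : Ho.mk c.pt ⟶ Ho.mk (R.app _ t.pt)),
      t.IsColimit ∧ (∀ i, c.legHom i ≫ r =
        push (evalAt i D) (evalAt_vertex _ _) (evalAt_vertex _ _) u ≫ (hoMap R).map (t.legHom i)) ∧
      r ≫ (hoMap R).map d = v := by
  obtain ⟨t, ht⟩ := hC I hI q
  obtain ⟨d, hd⟩ := (t.isHoColimit ht k.pt).2 k.toHom
  obtain ⟨r, hr⟩ := (hc (R.app _ t.pt)).2 (u ≫ (t.map R).toHom)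
  refine ⟨t, d, r, ht, fun i ↦ ?_, (hc _).1 ?_⟩
  · have := congrArg (push (evalAt i D) (y := p.app _ i) (y' := R.app _ t.pt) (evalAt_vertex _ _)
      ((evalAt_vertex _ _).trans (map_const_self _ _))) hr
    refine Eq.trans ?_ (this.trans ?_)
    · refine Eq.trans ?_ (push_comp _ _ ((evalAt_vertex _ _).trans (map_const_self _ _)) _ _ _).symm
      exact (congr (congrArg (· ≫ ·) (c.push_evalAt_toHom i _ _)) (push_evalAt_diag i r _ _)).symm
    · refine (push_comp _ _ (evalAt_vertex _ _) _ _ _).trans (congrArg (_ ≫ ·) ?_)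
      exact ((t.map R).push_evalAt_toHom i _ _).trans (t.map_legHom R i)
  · exact (congrArg (_ ≫ ·) (diag_comp I _ _)).trans
      (comp_comp_eq hr ((congrArg (u ≫ ·) (Cocone.map_toHom_diag R d hd)).trans hv))

/-- A cocone whose tip maps to the value of a functor lifts to a colimit of a system of shapes. -/
theorem exists_shape_colimit (hR : ∀ b : D _⦋0⦌, AdmitsShape R b) (hC : HasCountableFilteredColimits C)
    {I : SSet.{u}} (hI : IsCountableFiltered I) {p : I ⟶ D} (c : Cocone p) (hc : c.IsHoColimit)
    {y : C _⦋0⦌} (v : Ho.mk c.pt ⟶ Ho.mk (R.app _ y)) :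
    ∃ (q : I ⟶ C) (t : Cocone q) (u : ∀ i, Ho.mk (p.app _ i) ⟶ Ho.mk (R.app _ (q.app _ i)))
      (d : Ho.mk t.pt ⟶ Ho.mk y) (r : Ho.mk c.pt ⟶ Ho.mk (R.app _ t.pt)), t.IsColimit ∧
      (∀ i, IsShape (hoMap R) (x := Ho.mk (q.app _ i)) (u i)) ∧
      (∀ i, c.legHom i ≫ r = u i ≫ (hoMap R).map (t.legHom i)) ∧ r ≫ (hoMap R).map d = v := by
  obtain ⟨q, Q, h₀, h₁, u, hu, hv⟩ := exists_shape_system hR c v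
  obtain ⟨t, d, r, ht, h, h'⟩ := Cocone.exists_colimit_comparison hC hI c hc ⟨y, Q, h₀, h₁⟩ u v hv
  exact ⟨q, t, fun i ↦ push (evalAt i D) (evalAt_vertex _ _) (evalAt_vertex _ _) u, d, r, ht,
    fun i ↦ hu _ _ _, h, h'⟩

end

end InfCat

namespace InfCat

/-! ### Shapes and weakly compact morphisms -/

section

variable {C D : Type*} [Category* C] [Category* D] {L : C ⥤ D} {Y : D ⥤ C} (adj : L ⊣ Y)
  [Y.Full] [Y.Faithful]

include adj

/-- The map `x ⟶ Y.obj b` which corresponds to the inverse counit shows that `η` is a split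
monomorphism. It is also an epimorphism: morphisms out of `L.obj x` are adjoint to morphisms out of
`x`, and those are detected by `η` because the counit is invertible. -/
lemma IsShape.isIso {b : D} {x : C} {η : b ⟶ L.obj x} (h : IsShape L η) : IsIso η := by
  have hc : IsIso adj.counit := inferInstance
  have epi {w : D} {g g' : L.obj x ⟶ w} (e : η ≫ g = η ≫ g') : g = g' := by
    refine (adj.homEquiv _ _).injective ((h _ (η ≫ L.map (adj.homEquiv _ _ g'))).unique ?_ rfl)
    rw [← cancel_mono (adj.counit.app w), Category.assoc, Category.assoc]
    have (g : L.obj x ⟶ w) : L.map (adj.homEquiv _ _ g) ≫ adj.counit.app w = g := by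
      simp [Adjunction.homEquiv_unit]
    rw [this, this, e]
  obtain ⟨f, hf, -⟩ := h (Y.obj b) (inv (adj.counit.app b))
  have hs : η ≫ L.map f ≫ adj.counit.app b = 𝟙 _ := by
    rw [← Category.assoc, hf, IsIso.inv_hom_id]
  refine ⟨_, hs, epi ?_⟩
  rw [← Category.assoc, hs, Category.id_comp, Category.comp_id]

lemma exists_isIso_unit (b : D) : ∃ j : b ⟶ L.obj (Y.obj b), IsIso j := by
  have hc : IsIso adj.counit := inferInstance
  exact ⟨inv (adj.counit.app b), inferInstance⟩

lemma IsNull.map_map {a b : D} {f : a ⟶ b} (h : IsNull f) : IsNull (L.map (Y.map f)) := by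
  have hc : IsIso adj.counit := inferInstance
  obtain ⟨z, hz, g, k, rfl⟩ := h
  refine ⟨L.obj (Y.obj z), hz.of_iso (asIso (adj.counit.app z)), L.map (Y.map g), L.map (Y.map k), ?_⟩
  simp

/-- By universality `b' ≫ r` is the image of a map `x ⟶ T`, whose restriction to `Y.obj z` factors
over some `q k`. Inverting `u k` moves the factorization to `p k`, and the monomorphism `r` can be
cancelled. -/
lemma IsShape.exists_factorization {b z w : D} {x T : C} {η : b ⟶ L.obj x} (hη : IsShape L η)
    (i : z ⟶ L.obj (Y.obj z)) (f : Y.obj z ⟶ x) (b' : L.obj x ⟶ w) {I : Type*} {p : I → D} {q : I → C}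
    {c : ∀ k, p k ⟶ w} {t : ∀ k, q k ⟶ T} {u : ∀ k, p k ⟶ L.obj (q k)} (hu : ∀ k, IsShape L (u k))
    {r : w ⟶ L.obj T} {d : T ⟶ Y.obj w} (hr : ∀ k, c k ≫ r = u k ≫ L.map (t k))
    (hd : IsIso (r ≫ L.map d)) (h : ∀ v : Y.obj z ⟶ T, ∃ (k : I) (a : Y.obj z ⟶ q k), a ≫ t k = v) :
    ∃ (k : I) (a : z ⟶ p k), a ≫ c k = (i ≫ L.map f) ≫ b' := by
  have : Mono r := mono_of_mono r (L.map d)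
  have := hη.isIso adj
  obtain ⟨x', hx', -⟩ := hη T (η ≫ b' ≫ r)
  replace hx' := (cancel_epi η).1 hx'
  obtain ⟨k, a, ha⟩ := h (f ≫ x')
  have := (hu k).isIso adj
  refine ⟨k, i ≫ L.map a ≫ inv (u k), (cancel_mono r).1 ?_⟩
  have e := congrArg L.map ha
  rw [Functor.map_comp, Functor.map_comp, hx'] at e
  simp only [Category.assoc, hr, IsIso.inv_hom_id_assoc, e]

/-- Here `x` is the shape of `b` with structure maps `c i` from representables, and `T` is the
colimit of the shapes `q k` of the realized system. Factoring `c i` over such a `q k` exhibits its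
realization as a composite of two morphisms in `W`; universality of shapes then transports nullity
back to the system itself. -/
lemma exists_null_factorization {W : MorphismProperty D}
    (hW : ∀ {a b c : D} {f : a ⟶ b} (_ : W f) (g : b ⟶ c), W (f ≫ g))
    (hWs : ∀ {b : D} {x : C} {η : b ⟶ L.obj x} (_ : IsShape L η) {z : D} (i : z ⟶ L.obj (Y.obj z))
      (f : Y.obj z ⟶ x), W (i ≫ L.map f)) {b : D}
    (hb : ∀ {a a' : D} (u : a' ⟶ a) (w : a ⟶ b), W u → W w → IsNull (u ≫ w))
    {o : D} (ho : Limits.IsZero o) {x T : C} {ε : b ⟶ L.obj x} (hε : IsShape L ε) {I : Type*} {p : I → D}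
    {q : I → C} {c : ∀ k, Y.obj (p k) ⟶ x} {t : ∀ k, q k ⟶ T} {u : ∀ k, L.obj (Y.obj (p k)) ⟶ L.obj (q k)}
    (hu : ∀ k, IsShape L (u k)) {r : L.obj x ⟶ L.obj T} {d : T ⟶ x}
    (hr : ∀ k, L.map (c k) ≫ r = u k ≫ L.map (t k)) (hd : r ≫ L.map d = 𝟙 _)
    (h : ∀ (i : I) (v : Y.obj (p i) ⟶ T), ∃ (k : I) (a : Y.obj (p i) ⟶ q k), a ≫ t k = v) (i : I) :
    ∃ (k : I) (g : p i ⟶ p k), IsNull g ∧ c i = Y.map g ≫ c k := by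
  have hc : IsIso adj.counit := inferInstance
  have := hε.isIso adj
  obtain ⟨x', hx', -⟩ := hε T (ε ≫ r)
  have hx'd : x' ≫ d = 𝟙 _ := by
    refine (hε _ ε).unique ?_ ?_
    · rw [Functor.map_comp, ← Category.assoc, hx', Category.assoc, hd, Category.comp_id]
    · rw [L.map_id, Category.comp_id]
  -- Since `d` has the section `x'`, each `c i` factors over `T`, hence over some `q k` by
  -- compactness.
  have hfac (i : I) : ∃ (k : I) (a : Y.obj (p i) ⟶ q k), c i = a ≫ t k ≫ d := by
    obtain ⟨k, a, ha⟩ := h i (c i ≫ x')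
    refine ⟨k, a, ?_⟩
    rw [← Category.assoc, ha, Category.assoc, hx'd, Category.comp_id]
  have hκ (k : I) : u k ≫ L.map (t k ≫ d) = L.map (c k) := by
    rw [Functor.map_comp, ← Category.assoc, ← hr k, Category.assoc, hd, Category.comp_id]
  let j (i : I) := inv (adj.counit.app (p i))
  have hL (i : I) : IsNull (L.map (c i)) := by
    obtain ⟨k, a, ha⟩ := hfac i
    have := (hu k).isIso adj
    have w₁ := hWs (hu k) (j i) a
    have w₂ := hWs hε (j k) (c k)
    have e : L.map (c i) = (adj.counit.app (p i) ≫ ((j i ≫ L.map a) ≫ inv (u k) ≫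
        adj.counit.app (p k)) ≫ (j k ≫ L.map (c k)) ≫ inv ε) ≫ ε := by
      rw [ha, Functor.map_comp, ← hκ k]
      simp [j]
    rw [e]
    exact ((hb _ _ (hW w₁ _) (hW w₂ _)).comp_left _).comp_right _
  obtain ⟨k, a, ha⟩ := hfac i
  obtain ⟨β, hβ, -⟩ := hu k (Y.obj (p k)) (𝟙 _)
  let n : p k ⟶ p k := ho.from_ _ ≫ ho.to_ _
  have hn : IsNull n := ⟨_, ho, _, _, rfl⟩
  -- Both sides have null realizations, and morphisms out of a shape are determined by their
  -- realizations.
  have hκ' : t k ≫ d = β ≫ Y.map n ≫ c k := by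
    refine (hu k _ _).unique rfl (IsNull.eq ?_ ?_)
    · rw [Functor.map_comp, Functor.map_comp]
      exact (((hn.map_map adj).comp_right _).comp_left _).comp_left _
    · rw [hκ]
      exact hL k
  obtain ⟨g, hg⟩ := Y.map_surjective (a ≫ β)
  refine ⟨k, g ≫ n, hn.comp_left g, ?_⟩
  rw [ha, hκ', Y.map_comp g n, hg]
  simp only [Category.assoc]

end

section

variable {C D : SSet.{u}} [Quasicategory C] [Quasicategory D] {R : C ⟶ D} {y : D ⟶ C}

lemma IsFullyFaithful.full (h : IsFullyFaithful y) : (hoMap y).Full :=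
  ⟨fun {a b} f ↦ by
    obtain ⟨g, hg⟩ := (h.push_bijective a.1.as b.1.as).2 f
    exact ⟨g, (hoMap_map y g).trans hg⟩⟩

lemma IsFullyFaithful.faithful (h : IsFullyFaithful y) : (hoMap y).Faithful :=
  ⟨fun {a b} f g e ↦ (h.push_bijective a.1.as b.1.as).1
    ((hoMap_map y f).symm.trans (e.trans (hoMap_map y g)))⟩

variable (adj : hoMap R ⊣ hoMap y) (hy : IsCountableIndCompletion y)
  (hR : ∀ b : D _⦋0⦌, AdmitsShape R b)

include adj hy hR in
/-- Morphisms from representables to shapes give weakly compact morphisms. -/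
theorem IsShape.isWeaklyCompact {b : Ho D} {x : Ho C} {η : b ⟶ (hoMap R).obj x}
    (hη : IsShape (hoMap R) η) {z : Ho D} (i : z ⟶ (hoMap R).obj ((hoMap y).obj z))
    (f : (hoMap y).obj z ⟶ x) : IsWeaklyCompact (i ≫ (hoMap R).map f) := by
  have := hy.fullyFaithful.full
  have := hy.fullyFaithful.faithful
  intro I hI p c hcol b'
  obtain ⟨j, hj⟩ := exists_isIso_unit adj (Ho.mk c.pt)
  obtain ⟨q, t, u, d, r, ht, hu, hr, hv⟩ := exists_shape_colimit hR hy.hasColimits hI c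
    (c.isHoColimit hcol) (y := y.app _ c.pt) j
  exact hη.exists_factorization adj i f b' (w := Ho.mk c.pt) (T := Ho.mk t.pt) hu hr
    ((congrArg (fun f : Ho.mk c.pt ⟶ _ ↦ IsIso f) hv).mpr hj)
    fun v ↦ (hy.compact z.1.as).exists_factorization hI ht v

include hy hR in
/-- An object whose composable pairs of weakly compact morphisms into it vanish is the colimit of
a system in which every transition map is eventually null. -/
theorem exists_null_system (η : UniversalUnit R y) {z : D _⦋0⦌}
    (hz : Limits.IsZero (Ho.mk z)) {b : D _⦋0⦌}
    (hb : ∀ (a a' : D _⦋0⦌) (u : Ho.mk a' ⟶ Ho.mk a) (w : Ho.mk a ⟶ Ho.mk b), IsWeaklyCompact u →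
      IsWeaklyCompact w → IsNull (u ≫ w)) : ∃ (I : SSet.{u}) (_ : IsCountableFiltered I) (p : I ⟶ D)
      (c : Cocone p), c.IsHoColimit ∧ Nonempty (Ho.mk b ≅ Ho.mk c.pt) ∧
        ∀ i, ∃ (m : I _⦋0⦌) (e : Ho.mk i ⟶ Ho.mk m), IsNull ((hoMap p).map e) := by
  have := hy.fullyFaithful.full
  have := hy.fullyFaithful.faithful
  obtain ⟨x, ε, hε⟩ := (hR b).exists_isShape
  obtain ⟨I, hI, p, c, hcol, rfl⟩ := hy.exists_system x
  have := hI.quasicategory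
  have hcR := η.isHoColimit_map c (c.isHoColimit hcol)
  refine ⟨I, hI, (p ≫ y) ≫ R, c.map R, hcR, ⟨@asIso _ _ _ _ ε (hε.isIso η.adj)⟩, fun i ↦ ?_⟩
  obtain ⟨q, t, u, d, r, ht, hu, hr, hv⟩ := exists_shape_colimit hR hy.hasColimits hI (c.map R)
    hcR (y := c.pt) (𝟙 _)
  obtain ⟨k, g, hg, hck⟩ := exists_null_factorization η.adj (W := fun _ _ f ↦ IsWeaklyCompact f)
    (fun hf g ↦ hf.comp_right g) (fun h _ i f ↦ h.isWeaklyCompact η.adj hy hR i f) (b := Ho.mk b)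
    (fun {a a'} u w hu hw ↦ hb a.1.as a'.1.as u w hu hw) hz hε (p := fun i ↦ Ho.mk (p.app _ i))
    (c := fun i ↦ c.legHom i) (T := Ho.mk t.pt) (t := fun i ↦ t.legHom i) hu (r := r) (d := d)
    (fun k ↦ (congrArg (· ≫ r) (c.map_legHom R k).symm).trans (hr k)) hv
    (fun i v ↦ (hy.compact (p.app _ i)).exists_factorization hI ht v) i
  -- The structure map at `i` equals a null map followed by the one at `k`. By compactness this
  -- equality already holds at some `m`, so the realized transition map from `i` to `m` is null.
  obtain ⟨m, f, f', hf⟩ := (hy.compact (p.app _ i)).exists_eq hI hcol (𝟙 _) ((hoMap y).map g)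
    ((Category.id_comp _).trans hck)
  refine ⟨m, f, ?_⟩
  have e : (hoMap ((p ≫ y) ≫ R)).map f = (hoMap R).map (push (p ≫ y) rfl rfl f) :=
    (hoMap_map _ _).trans ((push_push _ _ _ _ _ _ _).symm.trans (hoMap_map _ _).symm)
  have e' : push (p ≫ y) rfl rfl f = (hoMap y).map g ≫ push (p ≫ y) rfl rfl f' :=
    (Category.id_comp _).symm.trans hf
  refine (congrArg IsNull (e.trans ((congrArg _ e').trans ((hoMap R).map_comp _ _)))).mpr ?_
  exact (hg.map_map η.adj).comp_right _

end

end InfCat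

namespace InfCat

open CartesianMonoidalCategory (lift fst snd)

/-! ### Systems whose transition maps factor over an object without endomorphisms -/

lemma InnerFibration.exists_triangle {X Y : SSet.{u}} (π : X ⟶ Y) [InnerFibration π] {s t : X _⦋1⦌}
    (h : X.δ 0 s = X.δ 1 t) (r : Y _⦋2⦌) (hs : Y.δ 2 r = π.app _ s) (ht : Y.δ 0 r = π.app _ t) :
    ∃ r' : X _⦋2⦌, π.app _ r' = r ∧ X.δ 2 r' = s ∧ X.δ 0 r' = t := by
  have sq : stdSimplex.δ 0 ≫ SSet.yonedaEquiv.symm s = stdSimplex.δ 1 ≫ SSet.yonedaEquiv.symm t := by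
    rw [δ_yonedaEquiv_symm, δ_yonedaEquiv_symm, h]
  have hl : HasLiftingProperty (Λ[2, 1] : (Δ[2] : SSet.{u}).Subcomplex).ι π :=
    mem_innerFibrations π _ (horn_ι_mem_innerHornInclusions (n := 2) (i := 1) (by decide) (by decide))
  have comm : CommSq (horn₂₁.isPushout.desc _ _ sq) (Λ[2, 1] : (Δ[2] : SSet.{u}).Subcomplex).ι π
      (SSet.yonedaEquiv.symm r) := by
    refine ⟨horn₂₁.isPushout.hom_ext ?_ ?_⟩
    · rw [horn₂₁.isPushout.inl_desc_assoc, horn.ι_ι_assoc, δ_yonedaEquiv_symm, hs]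
      exact SSet.yonedaEquiv.injective (by simp)
    · rw [horn₂₁.isPushout.inr_desc_assoc, horn.ι_ι_assoc, δ_yonedaEquiv_symm, ht]
      exact SSet.yonedaEquiv.injective (by simp)
  have h₂ := comm.fac_left
  have e₂ := (horn.ι_ι_assoc (1 : Fin 3) 2 (by simp) comm.lift).symm
  have e₀ := (horn.ι_ι_assoc (1 : Fin 3) 0 (by simp) comm.lift).symm
  rw [h₂, horn₂₁.isPushout.inl_desc] at e₂
  rw [h₂, horn₂₁.isPushout.inr_desc] at e₀
  refine ⟨SSet.yonedaEquiv comm.lift, ?_, ?_, ?_⟩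
  · rw [← yonedaEquiv_comp_apply, comm.fac_right, Equiv.apply_symm_apply]
  · rw [← stdSimplex.yonedaEquiv_δ_comp, e₂, Equiv.apply_symm_apply]
  · rw [← stdSimplex.yonedaEquiv_δ_comp, e₀, Equiv.apply_symm_apply]

section

variable {A K X : SSet.{u}} {p : K ⟶ X}

/-- The restriction of a cocone along a map of simplicial sets. -/
def Cocone.pre (c : Cocone p) (j : A ⟶ K) {p' : A ⟶ X} (h : j ≫ p = p') : Cocone p' where
  pt := c.pt
  hom := j ▷ _ ≫ c.hom
  ι₀_hom := Eq.trans (b := j ≫ p) (map_ext_app fun _ x ↦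
    congrArg (fun k : K ⟶ X ↦ k.app _ (j.app _ x)) c.ι₀_hom) h
  ι₁_hom := map_ext_app fun _ x ↦ congrArg (fun k : K ⟶ X ↦ k.app _ (j.app _ x)) c.ι₁_hom

lemma Cocone.push_restrict_toHom (c : Cocone p) (j : A ⟶ K) {p' : A ⟶ X} (h : j ≫ p = p') (e e') :
    push (restrict j X) (y := vertex p') (y' := vertex (SSet.const c.pt)) e e' c.toHom =
      (c.pre j h).toHom :=
  push_restrict_cls _ _ _ _ h rfl _ _

variable [Quasicategory X]

/-- Evaluating `c` along `k` gives a square of transformations with one side constant at the tip of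
`c`. -/
lemma Cocone.cls_diag_legHom (c : Cocone p) (k : A ⊗ Δ[1] ⟶ K) {a : A ⟶ K} {m : K _⦋0⦌} (h₀ : ι₀ ≫ k = a)
    (h₁ : ι₁ ≫ k = SSet.const m) {p' : A ⟶ X} (h : a ≫ p = p') (e₀ e₁) :
    cls (k ≫ p) (p := p') (q := SSet.const (p.app _ m)) e₀ e₁ ≫ diag A (c.legHom m) =
      (c.pre a h).toHom := by
  have hA : A ◁ ι₀ ≫ (α_ A Δ[1] Δ[1]).inv ≫ k ▷ _ ≫ c.hom = k ≫ p :=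
    map_ext_app fun _ x ↦ congrArg (fun j : K ⟶ X ↦ j.app _ (k.app _ x)) c.ι₀_hom
  have hB : A ◁ ι₁ ≫ (α_ A Δ[1] Δ[1]).inv ≫ k ▷ _ ≫ c.hom = fst A Δ[1] ≫ SSet.const c.pt :=
    map_ext_app fun _ x ↦ congrArg (fun j : K ⟶ X ↦ j.app _ (k.app _ x)) c.ι₁_hom
  have hC : A ◁ lift (SSet.const v0) (𝟙 _) ≫ (α_ A Δ[1] Δ[1]).inv ≫ k ▷ _ ≫ c.hom = a ▷ _ ≫ c.hom :=
    map_ext_app fun _ x ↦ congrArg (fun j : A ⟶ K ↦ c.hom.app _ (j.app _ x.1, x.2)) h₀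
  have hD : A ◁ lift (SSet.const v1) (𝟙 _) ≫ (α_ A Δ[1] Δ[1]).inv ≫ k ▷ _ ≫ c.hom =
      arrF (SSet.const ((famOf c.hom).app _ m) : A ⟶ _) := by
    refine Eq.trans (b := (SSet.const m : A ⟶ K) ▷ _ ≫ c.hom) (map_ext_app fun _ x ↦
      congrArg (fun j : A ⟶ K ↦ c.hom.app _ (j.app _ x.1, x.2)) h₁) ?_
    rw [← const_comp, arrF_comp, arrF_famOf]
  have f₀ : (evalAt v0 X).app _ ((famOf c.hom).app _ m) = p.app _ m :=
    congrArg (fun k : K ⟶ X ↦ k.app _ m) ((famOf_evalAt_zero _).trans c.ι₀_hom)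
  have f₁ : (evalAt v1 X).app _ ((famOf c.hom).app _ m) = c.pt :=
    (congrArg (fun k : K ⟶ X ↦ k.app _ m) ((famOf_evalAt_one _).trans c.ι₁_hom)).trans
      (map_const_self _ _)
  have key := square_comm ((α_ A Δ[1] Δ[1]).inv ≫ k ▷ _ ≫ c.hom) (p₀₁ := SSet.const c.pt)
    (p₁₁ := SSet.const c.pt) hA hB hC hD e₀ e₁ (map_ext_app fun _ _ ↦ rfl) (map_ext_app fun _ _ ↦ rfl)
    (c.pre a h).ι₀_hom (c.pre a h).ι₁_hom (by rw [ι₀_arrF, const_comp, f₀]) (by rw [ι₁_arrF, const_comp, f₁])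
  refine Eq.trans (congrArg (_ ≫ ·) (Eq.trans ?_ (cls_arrF_const _ f₀ f₁ _ _).symm))
    (key.trans ((congrArg (_ ≫ ·) (cls_fst _ _ _)).trans (Category.comp_id _)))
  exact congrArg (diag A) (arr_congr (edgeOf_famOf _ _).symm _ _)

end

section

variable {A I X : SSet.{u}} [Quasicategory I] [Quasicategory X] {b : X _⦋0⦌} {G : I ⟶ X} {i : A ⟶ I}

/-- Whatever follows the factorization over `b` and returns to `b` is an endomorphism of `b`, hence
trivial. -/
lemma comp_comp_comp_eq {C : Type*} [Category* C] {a x y b : C} {g : a ⟶ x} {γ : a ⟶ b} {ε : b ⟶ x}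
    (h : g = γ ≫ ε) (hb : ∀ f : b ⟶ b, f = 𝟙 b) (l : x ⟶ y) (γ' : y ⟶ b) : (g ≫ l) ≫ γ' = γ := by
  rw [h, Category.assoc, Category.assoc, hb (ε ≫ l ≫ γ'), Category.comp_id]

/-- If the transition maps factor over an object without nontrivial endomorphisms, then the family
of morphisms to this object which is induced by a cocone does not change if the cocone is enlarged. -/
lemma Cocone.toHom_diag_eq_of_le (hb : ∀ f : Ho.mk b ⟶ Ho.mk b, f = 𝟙 _) (k : Cocone i)
    {m : I _⦋0⦌} (e : Ho.mk k.pt ⟶ Ho.mk m)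
    (γ : Ho.mk (G.app _ k.pt) ⟶ Ho.mk b) (ε : Ho.mk b ⟶ Ho.mk (G.app _ m))
    (he : push G rfl rfl e = γ ≫ ε) :
    ∃ s : I _⦋1⦌, ∀ (L : I.Subcomplex) (_ : Subcomplex.range k.hom ≤ L) (_ : s ∈ L.obj _)
      (l : Cocone L.ι) (a : A ⟶ L) (_ : a ≫ L.ι = i) (h : a ≫ L.ι ≫ G = i ≫ G)
      (γ' : Ho.mk (G.app _ l.pt) ⟶ Ho.mk b),
      (k.map G).toHom ≫ diag A γ = ((l.map G).pre a h).toHom ≫ diag A γ' := by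
  obtain ⟨s, h₀, h₁, rfl⟩ := arr_surjective e
  refine ⟨s, fun L hL hs l a ha h γ' ↦ ?_⟩
  let k' : A ⊗ Δ[1] ⟶ L := Subcomplex.lift k.hom hL
  let m₀ : (L : SSet) _⦋0⦌ := ⟨k.pt, h₀ ▸ ((L : SSet).δ 1 ⟨s, hs⟩).2⟩
  let m₁ : (L : SSet) _⦋0⦌ := ⟨m, h₁ ▸ ((L : SSet).δ 0 ⟨s, hs⟩).2⟩
  have a₀ : ι₀ ≫ k' = a := map_ext_app fun n x ↦ Subtype.ext
    (congrArg (fun j : A ⟶ I ↦ j.app _ x) (k.ι₀_hom.trans ha.symm))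
  have a₁ : ι₁ ≫ k' = SSet.const m₀ := map_ext_app fun n x ↦ Subtype.ext
    (congrArg (fun j : A ⟶ I ↦ j.app _ x) k.ι₁_hom)
  have key := (l.map G).cls_diag_legHom k' a₀ a₁ h (k.map G).ι₀_hom (k.map G).ι₁_hom
  have hl := (l.map G).legHom_natural (⟨s, hs⟩ : (L : SSet) _⦋1⦌) (k := m₀) (k' := m₁)
    (Subtype.ext h₀) (Subtype.ext h₁)
  refine Eq.trans ?_ (congrArg (· ≫ diag A γ') key)
  refine Eq.trans ?_ (Category.assoc _ _ _).symm
  refine congrArg ((k.map G).toHom ≫ ·) (Eq.trans (congrArg (diag A) ?_) (diag_comp A _ _))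
  -- The leg of `l` at the tip of `k` passes through the transition map `s`; followed by `γ'` it is
  -- therefore `γ`, whatever `γ'` is.
  refine (comp_comp_comp_eq he hb ((l.map G).legHom m₁) γ').symm.trans (congrArg (· ≫ γ') ?_)
  exact (congrArg (· ≫ _) (push_arr _ _ _ _ _ _)).trans hl

end

end InfCat

namespace InfCat

open CartesianMonoidalCategory (lift fst snd)

/-! ### Gluing a compatible sequence of homotopy classes -/

section

variable {A B X : SSet.{u}} [Quasicategory X]

instance restrict_innerFibration (i : A ⟶ B) [Mono i] : InnerFibration (restrict i X) :=
  inferInstanceAs (InnerFibration ((MonoidalClosed.pre i).app X))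

/-- A transformation in a given class can be chosen to extend a transformation on a subcomplex. -/
lemma exists_extension_of_cls (i : A ⟶ B) [Mono i] {p q : B ⟶ X} {p' q' : A ⟶ X} (hp : i ≫ p = p')
    (hq : i ≫ q = q') (φ : Ho.mk (vertex p) ⟶ Ho.mk (vertex q)) {H : A ⊗ Δ[1] ⟶ X} (h₀ : ι₀ ≫ H = p')
    (h₁ : ι₁ ≫ H = q') (e e')
    (hφ : push (restrict i X) (y := vertex p') (y' := vertex q') e e' φ = cls H h₀ h₁) :
    ∃ (H' : B ⊗ Δ[1] ⟶ X) (h₀' : ι₀ ≫ H' = p) (h₁' : ι₁ ≫ H' = q),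
      i ▷ _ ≫ H' = H ∧ cls H' h₀' h₁' = φ := by
  obtain ⟨H₀, a₀, a₁, rfl⟩ := cls_surjective φ
  rw [push_restrict_cls i H₀ a₀ a₁ hp hq] at hφ
  have hc : cls (i ▷ _ ≫ H₀) (p := p') (q := q') (vertex_injective (by
        rw [← hp, ← a₀]; rfl)) (vertex_injective (by rw [← hq, ← a₁]; rfl)) ≫
      cls (fst A Δ[1] ≫ q') (p := q') (q := q') (map_ext_app fun _ _ ↦ rfl)
        (map_ext_app fun _ _ ↦ rfl) = cls H h₀ h₁ := by
    rw [cls_fst, Category.comp_id]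
    exact hφ
  -- This triangle over `A`, with a degenerate side, identifies the restriction of `H₀` with `H`.
  -- Restriction is an inner fibration, so it lifts to a triangle over `B` on `H₀` and a degenerate
  -- edge; the remaining side is in the same class and extends `H` strictly.
  obtain ⟨S, s₂, s₀, s₁⟩ := cls_comp_iff.mp hc
  have hst : (Fun B X).δ 0 (sx H₀) = (Fun B X).δ 1 (sx (fst B Δ[1] ≫ q)) := by
    rw [curry_app_δ₀, curry_app_δ₁, a₁]
    exact congrArg vertex (map_ext_app fun _ _ ↦ rfl)
  obtain ⟨r, hr, r₂, r₀⟩ := InnerFibration.exists_triangle (restrict i X) hst (sx S)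
    (by rw [δ_sx, sx_restrict, s₂])
    (by
      rw [δ_sx, sx_restrict, s₀, ← hq]
      exact congrArg sx (map_ext_app fun _ _ ↦ rfl))
  obtain ⟨S', rfl⟩ := sx_surjective r
  rw [δ_sx] at r₂ r₀
  have e₂ := sx_injective r₂
  have e₀ := sx_injective r₀
  have b₀ : ι₀ ≫ B ◁ stdSimplex.δ 1 ≫ S' = p := by
    refine vertex_injective ?_
    rw [← curry_app_δ₁, ← δ_sx]
    refine (δδ (X := Fun B X) (sx S') (i := 1) (j := 1) le_rfl).symm.trans ?_
    exact (congrArg ((Fun B X).δ 1) ((δ_sx _ _).trans r₂)).trans ((curry_app_δ₁ _).trans (congrArg vertex a₀))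
  have b₁ : ι₁ ≫ B ◁ stdSimplex.δ 1 ≫ S' = q := by
    refine vertex_injective ?_
    rw [← curry_app_δ₀, ← δ_sx]
    refine (δδ (X := Fun B X) (sx S') (i := 0) (j := 0) le_rfl).trans ?_
    refine (congrArg ((Fun B X).δ 0) ((δ_sx _ _).trans r₀)).trans ((curry_app_δ₀ _).trans ?_)
    exact congrArg vertex (map_ext_app fun _ _ ↦ rfl)
  refine ⟨B ◁ stdSimplex.δ 1 ≫ S', b₀, b₁, sx_injective ?_, ?_⟩
  · rw [← s₁, ← δ_sx, ← hr, app_δ, δ_sx, sx_restrict]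
  · refine (cls_comp S' e₂ e₀ rfl (ha₀ := a₀) (ha₁ := a₁) (hb₀ := map_ext_app fun _ _ ↦ rfl)
      (hb₁ := map_ext_app fun _ _ ↦ rfl)).symm.trans ?_
    exact (congrArg (_ ≫ ·) (cls_fst q _ _)).trans (Category.comp_id _)

end

section

variable {I X : SSet.{u}} (J : ℕ → I.Subcomplex) (hJ : ∀ n, J n ≤ J (n + 1))
  (hJ' : ∀ (m : ℕ) (x : I _⦋m⦌), ∃ n, x ∈ (J n).obj _)

include hJ hJ' in
lemma exists_glue_sequence (T : ∀ n, (J n : SSet) ⊗ Δ[1] ⟶ X)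
    (hT : ∀ n, Subcomplex.homOfLE (hJ n) ▷ _ ≫ T (n + 1) = T n) :
    ∃ H : I ⊗ Δ[1] ⟶ X, ∀ n, (J n).ι ▷ _ ≫ H = T n := by
  have mono : Monotone J := monotone_nat_of_le_succ hJ
  have compat : ∀ {m n : ℕ} (_ : m ≤ n) {d : SimplexCategoryᵒᵖ} (x : I.obj d) (hm : x ∈ (J m).obj d)
      (hn : x ∈ (J n).obj d) (t : (Δ[1] : SSet.{u}).obj d),
      (T m).app d (⟨x, hm⟩, t) = (T n).app d (⟨x, hn⟩, t) := by
    intro m n hmn d x hm hn t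
    induction n, hmn using Nat.le_induction with
    | base => rfl
    | succ n hmn ih =>
      refine (ih (mono hmn _ hm)).trans ?_
      exact (congrArg (fun k : (J n : SSet) ⊗ Δ[1] ⟶ X ↦ k.app d (⟨x, mono hmn _ hm⟩, t)) (hT n)).symm
  have compat' : ∀ {m n : ℕ} {d : SimplexCategoryᵒᵖ} (x : I.obj d) (hm : x ∈ (J m).obj d)
      (hn : x ∈ (J n).obj d) (t : (Δ[1] : SSet.{u}).obj d),
      (T m).app d (⟨x, hm⟩, t) = (T n).app d (⟨x, hn⟩, t) := by
    intro m n d x hm hn t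
    rcases le_total m n with h | h
    · exact compat h x hm hn t
    · exact (compat h x hn hm t).symm
  have ex (d : SimplexCategoryᵒᵖ) (x : I.obj d) : ∃ n, x ∈ (J n).obj d := hJ' d.unop.len x
  choose N hN using ex
  refine ⟨{ app := fun d ↦ TypeCat.ofHom fun x : I.obj d × (Δ[1] : SSet.{u}).obj d ↦
              ((T (N d x.1)).app d (⟨x.1, hN d x.1⟩, x.2) : X.obj d)
            naturality := ?_ }, fun n ↦ map_ext_app fun m x ↦ compat' x.1.1 _ x.1.2 x.2⟩
  intro d d' f
  ext x
  let z : ((J (N d x.1) : SSet) ⊗ Δ[1]).obj d :=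
    show (J (N d x.1) : SSet).obj d × (Δ[1] : SSet.{u}).obj d from (⟨x.1, hN d x.1⟩, x.2)
  exact (compat' (I.map f x.1) _ ((J (N d x.1)).map f (hN d x.1)) _).trans
    (NatTrans.naturality_apply (T (N d x.1)) f z)

variable [Quasicategory X]

include hJ' in
/-- A compatible sequence of classes on an exhausting sequence of subcomplexes comes from
a transformation. -/
theorem exists_transformation_of_classes {p q : I ⟶ X} {p' q' : ∀ n, (J n : SSet) ⟶ X}
    (hp : ∀ n, (J n).ι ≫ p = p' n) (hq : ∀ n, (J n).ι ≫ q = q' n)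
    (φ : ∀ n, Ho.mk (vertex (p' n)) ⟶ Ho.mk (vertex (q' n)))
    (hφ : ∀ n e e', push (restrict (Subcomplex.homOfLE (hJ n)) X) e e' (φ (n + 1)) = φ n) :
    ∃ H : I ⊗ Δ[1] ⟶ X, ι₀ ≫ H = p ∧ ι₁ ≫ H = q := by
  have hp' n : Subcomplex.homOfLE (hJ n) ≫ p' (n + 1) = p' n := by
    rw [← hp, ← hp]; rfl
  have hq' n : Subcomplex.homOfLE (hJ n) ≫ q' (n + 1) = q' n := by
    rw [← hq, ← hq]; rfl
  -- Representatives are chosen inductively, each strictly extending the previous one. Only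
  -- existence of a transformation is claimed, so the ambiguity of the choices (a lim¹ phenomenon)
  -- does no harm.
  let State (n : ℕ) : Type u := { H : (J n : SSet) ⊗ Δ[1] ⟶ X // ∃ h₀ h₁, cls (p := p' n) (q := q' n) H h₀ h₁ = φ n }
  have base : Nonempty (State 0) := by
    obtain ⟨H, h₀, h₁, h⟩ := cls_surjective (φ 0)
    exact ⟨⟨H, h₀, h₁, h⟩⟩
  have step n (s : State n) : ∃ s' : State (n + 1), Subcomplex.homOfLE (hJ n) ▷ _ ≫ s'.1 = s.1 := by
    obtain ⟨H, h₀, h₁, h⟩ := s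
    obtain ⟨H', h₀', h₁', e, h'⟩ := exists_extension_of_cls (Subcomplex.homOfLE (hJ n)) (hp' n) (hq' n)
      (φ (n + 1)) h₀ h₁ ((restrict_vertex _ _).trans (congrArg vertex (hp' n)))
      ((restrict_vertex _ _).trans (congrArg vertex (hq' n))) ((hφ n _ _).trans h.symm)
    exact ⟨⟨H', h₀', h₁', h'⟩, e⟩
  choose next hnext using step
  let s (n : ℕ) : State n := Nat.rec (motive := State) base.some next n
  obtain ⟨H, hH⟩ := exists_glue_sequence J hJ hJ' (fun n ↦ (s n).1) fun n ↦ hnext n (s n)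
  refine ⟨H, map_ext_app fun m x ↦ ?_, map_ext_app fun m x ↦ ?_⟩
  · obtain ⟨n, hx⟩ := hJ' m x
    obtain ⟨h₀, -, -⟩ := (s n).2
    exact congrArg (fun k : (J n : SSet) ⟶ X ↦ k.app _ ⟨x, hx⟩)
      (((congrArg (ι₀ ≫ ·) (hH n)).trans h₀).trans (hp n).symm)
  · obtain ⟨n, hx⟩ := hJ' m x
    obtain ⟨-, h₁, -⟩ := (s n).2
    exact congrArg (fun k : (J n : SSet) ⟶ X ↦ k.app _ ⟨x, hx⟩)
      (((congrArg (ι₁ ≫ ·) (hH n)).trans h₁).trans (hq n).symm)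

end

/-- A countable simplicial set is exhausted by a sequence of finite subcomplexes. -/
lemma exists_exhaustion (I : SSet.{u}) (h : ∀ n, Countable (I.obj n)) (h' : Nonempty (I _⦋0⦌)) :
    ∃ J : ℕ → I.Subcomplex, (∀ n, J n ≤ J (n + 1)) ∧ (∀ n, SSet.Finite (J n : SSet)) ∧
      ∀ (m : ℕ) (x : I _⦋m⦌), ∃ n, x ∈ (J n).obj _ := by
  have (m : ℕ) : Countable (I _⦋m⦌) := h _
  have : Nonempty (Σ m : ℕ, I _⦋m⦌) := ⟨⟨0, h'.some⟩⟩
  obtain ⟨x, hx⟩ := exists_surjective_nat (Σ m : ℕ, I _⦋m⦌)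
  let J (n : ℕ) : I.Subcomplex := Nat.rec (motive := fun _ ↦ I.Subcomplex)
    (Subcomplex.ofSimplex (x 0).2) (fun n A ↦ A ⊔ Subcomplex.ofSimplex (x (n + 1)).2) n
  refine ⟨J, fun n ↦ le_sup_left, fun n ↦ ?_, fun m y ↦ ?_⟩
  · induction n with
    | zero => exact finite_ofSimplex _
    | succ n ih => exact @finite_sup _ (J n) _ ih (finite_ofSimplex _)
  · obtain ⟨n, hn⟩ := hx ⟨m, y⟩
    have key : Subcomplex.ofSimplex (x n).2 ≤ J n := by
      cases n with
      | zero => exact le_rfl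
      | succ n => exact le_sup_right
    rw [hn] at key
    exact ⟨n, key _ (Subcomplex.mem_ofSimplex_obj _)⟩

end InfCat

namespace InfCat

open CartesianMonoidalCategory (lift fst snd)

/-! ### Transformations to a constant system, from cocones on finite subcomplexes -/

section

variable {A A' I X : SSet.{u}} [Quasicategory X] {b : X _⦋0⦌} {G : I ⟶ X} {i : A ⟶ I}

/-- The transformation to a constant diagram which is given by a cocone and a morphism from
the image of its tip. -/
noncomputable def Cocone.homTo (k : Cocone i) (γ : Ho.mk (G.app _ k.pt) ⟶ Ho.mk b) :
    Ho.mk (vertex (i ≫ G)) ⟶ Ho.mk (vertex (SSet.const b : A ⟶ X)) :=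
  (k.map G).toHom ≫ diag A γ

lemma push_restrict_diag {x x' : X _⦋0⦌} (j : A' ⟶ A) (f : Ho.mk x ⟶ Ho.mk x') (e e') :
    push (restrict j X) (y := vertex (SSet.const x)) (y' := vertex (SSet.const x')) e e' (diag A f) =
      diag A' f := by
  have h : constFun A X ≫ restrict j X = constFun A' X := by
    dsimp only [constFun]
    rw [curry_restrict]
    rfl
  obtain ⟨s, h₀, h₁, rfl⟩ := arr_surjective f
  dsimp only [diag]
  rw [push_push]
  exact push_congr h _ _ _ _ _

lemma Cocone.push_restrict_homTo (k : Cocone i) (γ : Ho.mk (G.app _ k.pt) ⟶ Ho.mk b) (j : A' ⟶ A)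
    {i' : A' ⟶ I} (h : j ≫ i = i') (e e') :
    push (restrict j X) (y := vertex (i' ≫ G)) (y' := vertex (SSet.const b)) e e' (k.homTo γ) =
      (k.pre j h).homTo γ := by
  subst h
  refine (push_comp _ _ ((restrict_vertex _ _).trans (congrArg vertex (map_ext_app fun _ _ ↦ rfl))) _
    _ _).trans ?_
  exact congrArg₂ (· ≫ ·) ((k.map G).push_restrict_toHom j (map_ext_app fun _ _ ↦ rfl) _ _)
    (push_restrict_diag _ _ _ _)

variable [Quasicategory I] (hI : IsCountableFiltered I) (hb : ∀ f : Ho.mk b ⟶ Ho.mk b, f = 𝟙 _)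
  {m : I _⦋0⦌ → I _⦋0⦌} {e : ∀ i, Ho.mk i ⟶ Ho.mk (m i)} {γ : ∀ i, Ho.mk (G.app _ i) ⟶ Ho.mk b}
  {ε : ∀ i, Ho.mk b ⟶ Ho.mk (G.app _ (m i))} (he : ∀ i, push G rfl rfl (e i) = γ i ≫ ε i)

include hI hb he in
-- Both cocones and the transition edges at their tips lie in a finite subcomplex `L`, since `A` is
-- finite. A cocone on `L` enlarges both of them, and enlarging does not change the class.
lemma Cocone.homTo_eq [SSet.Finite A] (k₁ k₂ : Cocone i) :
    k₁.homTo (γ k₁.pt) = k₂.homTo (γ k₂.pt) := by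
  obtain ⟨s₁, h₁⟩ := k₁.toHom_diag_eq_of_le hb (e k₁.pt) (γ k₁.pt) (ε k₁.pt) (he k₁.pt)
  obtain ⟨s₂, h₂⟩ := k₂.toHom_diag_eq_of_le hb (e k₂.pt) (γ k₂.pt) (ε k₂.pt) (he k₂.pt)
  let L₁ := Subcomplex.range k₁.hom ⊔ Subcomplex.ofSimplex s₁
  let L₂ := Subcomplex.range k₂.hom ⊔ Subcomplex.ofSimplex s₂
  let L := L₁ ⊔ L₂
  obtain ⟨l⟩ := hI.nonempty_cocone L L.ι
  have hi : Subcomplex.range i ≤ L := by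
    refine le_trans ?_ ((le_sup_left : Subcomplex.range k₁.hom ≤ L₁).trans le_sup_left)
    rintro n _ ⟨x, rfl⟩
    exact ⟨_, congrArg (fun j : A ⟶ I ↦ j.app _ x) k₁.ι₀_hom⟩
  let a : A ⟶ L := Subcomplex.lift i hi
  refine (h₁ L (le_sup_left.trans le_sup_left) ?_ l a rfl rfl (γ l.pt)).trans
    (h₂ L (le_sup_left.trans le_sup_right) ?_ l a rfl rfl (γ l.pt)).symm
  · exact ((le_sup_right : _ ≤ L₁).trans (le_sup_left : _ ≤ L)) _ (Subcomplex.mem_ofSimplex_obj s₁)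
  · exact ((le_sup_right : _ ≤ L₂).trans (le_sup_right : _ ≤ L)) _ (Subcomplex.mem_ofSimplex_obj s₂)

end

/-- A countable filtered system whose transition maps eventually factor over an object without
nontrivial endomorphisms admits a transformation to the constant system on this object. -/
theorem exists_transformation_to_const {I X : SSet.{u}} [Quasicategory X] (hI : IsCountableFiltered I)
    {b : X _⦋0⦌} {G : I ⟶ X} (hb : ∀ f : Ho.mk b ⟶ Ho.mk b, f = 𝟙 _)
    (hG : ∀ i, ∃ (m : I _⦋0⦌) (e : Ho.mk i ⟶ Ho.mk m) (γ : Ho.mk (G.app _ i) ⟶ Ho.mk b)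
      (ε : Ho.mk b ⟶ Ho.mk (G.app _ m)), push G rfl rfl e = γ ≫ ε) :
    ∃ T : I ⊗ Δ[1] ⟶ X, ι₀ ≫ T = G ∧ ι₁ ≫ T = SSet.const b := by
  have := hI.quasicategory
  choose m e γ ε he using hG
  obtain ⟨J, hJ, hfin, hJ'⟩ := exists_exhaustion I hI.countable hI.nonempty
  let k (n : ℕ) : Cocone (J n).ι := (hI.nonempty_cocone (J n) (J n).ι).some
  refine exists_transformation_of_classes J hJ hJ' (p' := fun n ↦ (J n).ι ≫ G)
    (q' := fun n ↦ SSet.const b) (fun _ ↦ rfl) (fun _ ↦ map_ext_app fun _ _ ↦ rfl)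
    (fun n ↦ (k n).homTo (γ (k n).pt)) fun n e e' ↦ ?_
  -- The restricted class comes from the restricted cocone, which may be replaced by the cocone
  -- chosen at the stage `n`.
  refine ((k (n + 1)).push_restrict_homTo (γ (k (n + 1)).pt) (Subcomplex.homOfLE (hJ n))
    (i' := (J n).ι) rfl e e').trans ?_
  exact Cocone.homTo_eq hI hb he ((k (n + 1)).pre (Subcomplex.homOfLE (hJ n)) rfl) (k n)

end InfCat

namespace InfCat

open CartesianMonoidalCategory (lift fst snd)

/-! ### Systems over an object whose transition maps are null -/

section

variable {X Y : SSet.{u}} {f : X ⟶ Y} {y : Y _⦋0⦌}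

lemma mem_fiber_iff {n : SimplexCategoryᵒᵖ} (x : X.obj n) : x ∈ (fiber f y).obj n ↔ f.app n x = cst y n :=
  mem_ofSimplex_iff y (f.app n x)

lemma comp_fiber_ι {K : SSet.{u}} (g : K ⟶ (fiber f y : SSet)) : g ≫ (fiber f y).ι ≫ f = SSet.const y :=
  map_ext_app fun _ x ↦ (mem_fiber_iff _).1 (g.app _ x).2

/-- A map to a fibre. -/
def toFiber {K : SSet.{u}} (g : K ⟶ X) (h : g ≫ f = SSet.const y) : K ⟶ (fiber f y : SSet) :=
  Subcomplex.lift g (by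
    rintro n _ ⟨x, rfl⟩
    exact (mem_fiber_iff _).2 (congrArg (fun k : K ⟶ Y ↦ k.app n x) h))

lemma toFiber_ι {K : SSet.{u}} (g : K ⟶ X) (h : g ≫ f = SSet.const y) :
    toFiber g h ≫ (fiber f y).ι = g := rfl

instance quasicategory_fiber [InnerFibration f] : Quasicategory (fiber f y : SSet) where
  hornFilling' n i σ h₀ hn := by
    have hl : HasLiftingProperty (Λ[n + 2, i] : (Δ[n + 2] : SSet.{u}).Subcomplex).ι f :=
      mem_innerFibrations f _ (horn_ι_mem_innerHornInclusions h₀ hn)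
    have sq : CommSq (σ ≫ (fiber f y).ι) (Λ[n + 2, i] : (Δ[n + 2] : SSet.{u}).Subcomplex).ι f
        (SSet.const y) := ⟨(Category.assoc _ _ _).trans (comp_fiber_ι σ)⟩
    refine ⟨toFiber sq.lift sq.fac_right, (cancel_mono (fiber f y).ι).1 ?_⟩
    rw [Category.assoc, toFiber_ι, sq.fac_left]

lemma IsLoc.isInitialVertex_fiber {v : (fiber f y : SSet) _⦋0⦌} (h : IsLoc (fun _ ↦ 0) f v.1) :
    IsInitialVertex v := by
  intro n φ hφ
  obtain ⟨g, h₁, h₂⟩ := h n (φ ≫ (fiber f y).ι) (SSet.const y)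
    ((Category.assoc _ _ _).trans (comp_fiber_ι φ)) fun w hw ↦ congrArg Subtype.val (hφ w hw)
  refine ⟨toFiber g h₂, (cancel_mono (fiber f y).ι).1 ?_⟩
  rw [Category.assoc, toFiber_ι, h₁]

end

/-! ### Arrows to a fixed object -/

section

variable {D : SSet.{u}}

instance evalAt_innerFibration [Quasicategory D] (v : (Δ[1] : SSet.{u}) _⦋0⦌) :
    InnerFibration (evalAt v D) where
  mem := by
    let v' : (Subcomplex.ofSimplex v : SSet) _⦋0⦌ := ⟨v, Subcomplex.mem_ofSimplex_obj v⟩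
    have e : restrict (Subcomplex.ofSimplex v).ι D ≫ evalAt v' D = evalAt v D := restrict_evalAt _ v'
    have : IsIso (evalAt v' D) := ⟨constFun _ D, restrict_ofSimplex_constFun v, constFun_evalAt v'⟩
    exact e ▸ (innerFibrations.cancel_right_of_respectsIso _ _).2
      (mem_innerFibrations (restrict (Subcomplex.ofSimplex v).ι D))

/-- An arrow with initial source is initial among the arrows with the same target. -/
lemma isInitialVertex_fiber_evalAt [Quasicategory D] {F : D _⦋0⦌}
    (w : (fiber (evalAt v1 D) F : SSet) _⦋0⦌) (hw : IsInitialVertex ((evalAt v0 D).app _ w.1)) :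
    IsInitialVertex w := by
  refine IsLoc.isInitialVertex_fiber ?_
  obtain ⟨τ, hτ⟩ := vertex_surjective w.1
  rw [← hτ]
  refine isLoc_evalAt v1 τ fun n x hx ↦ ?_
  have h := (cst_or_vtx_zero x).resolve_left hx
  rw [h, ← evalAt_vertex, hτ]
  exact hw

/-- The map from the cone on an edge. -/
def coneMap₁ : (Δ[1] ⊗ Δ[1] : SSet.{u}) ⟶ Δ[2] :=
  stdProd (fun i j ↦ if i = 0 then j.castSucc else 2) (by decide)

/-- The map from the cone on a triangle. -/
def coneMap₂ : (Δ[1] ⊗ Δ[2] : SSet.{u}) ⟶ Δ[3] :=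
  stdProd (fun i j ↦ if i = 0 then j.castSucc else 3) (by decide)

/-- The subdivision of a square by its diagonal. -/
noncomputable def subdivide : (Δ[1] ⊗ Δ[2] : SSet.{u}) ⟶ Δ[1] ⊗ Δ[1] :=
  lift (fst _ _) (stdProd (fun i j ↦ if i = 0 then (if j = 2 then 1 else 0) else if j = 0 then 0 else 1)
    (by decide))

lemma δ_one_coneMap₂ : Δ[1] ◁ stdSimplex.δ 1 ≫ coneMap₂.{u} = coneMap₁ ≫ stdSimplex.δ 1 := by
  refine hom_std_ext fun n x i ↦ ?_
  change (if x.1 i = 0 then (Fin.succAbove 1 (x.2 i)).castSucc else (3 : Fin 4)) =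
    Fin.succAbove 1 (if x.1 i = 0 then (x.2 i).castSucc else 2)
  generalize x.1 i = s, x.2 i = t
  fin_cases s <;> fin_cases t <;> rfl

lemma δ_one_subdivide : Δ[1] ◁ stdSimplex.δ 1 ≫ subdivide.{u} = 𝟙 _ := by
  refine CartesianMonoidalCategory.hom_ext _ _ (map_ext_app fun _ _ ↦ rfl) (hom_std_ext fun n x i ↦ ?_)
  change (if x.1 i = 0 then (if Fin.succAbove (1 : Fin 3) (x.2 i) = 2 then (1 : Fin 2) else 0) else
    if Fin.succAbove (1 : Fin 3) (x.2 i) = 0 then 0 else 1) = x.2 i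
  generalize x.1 i = s, x.2 i = t
  fin_cases s <;> fin_cases t <;> rfl

lemma δ_zero_subdivide : Δ[1] ◁ stdSimplex.δ 0 ≫ subdivide.{u} = coneMap₁ ≫ upperTriangle := by
  refine CartesianMonoidalCategory.hom_ext _ _ (hom_std_ext fun n x i ↦ ?_) (hom_std_ext fun n x i ↦ ?_)
  · change x.1 i = Fin.predAbove (0 : Fin 2) (if x.1 i = 0 then (x.2 i).castSucc else (2 : Fin 3))
    generalize x.1 i = s, x.2 i = t
    fin_cases s <;> fin_cases t <;> rfl
  · change (if x.1 i = 0 then (if Fin.succAbove (0 : Fin 3) (x.2 i) = 2 then (1 : Fin 2) else 0) else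
      if Fin.succAbove (0 : Fin 3) (x.2 i) = 0 then 0 else 1) =
      Fin.predAbove (1 : Fin 2) (if x.1 i = 0 then (x.2 i).castSucc else (2 : Fin 3))
    generalize x.1 i = s, x.2 i = t
    fin_cases s <;> fin_cases t <;> rfl

lemma lift_v1_subdivide : lift (SSet.const v1) (𝟙 _) ≫ subdivide.{u} =
    stdSimplex.σ 1 ≫ lift (SSet.const v1) (𝟙 _) := by
  refine CartesianMonoidalCategory.hom_ext _ _ (map_ext_app fun _ _ ↦ rfl) (hom_std_ext fun n x i ↦ ?_)
  change (if x i = (0 : Fin 3) then (0 : Fin 2) else 1) = Fin.predAbove (1 : Fin 2) (x i)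
  generalize x i = t
  fin_cases t <;> rfl

lemma lift_v0_coneMap₂ : lift (SSet.const v0) (𝟙 _) ≫ coneMap₂.{u} = stdSimplex.δ 3 := by
  refine hom_std_ext fun n x i ↦ ?_
  change (x i).castSucc = Fin.succAbove (3 : Fin 4) (x i)
  generalize x i = t
  fin_cases t <;> rfl

lemma lift_v1_coneMap₂ : lift (SSet.const v1) (𝟙 _) ≫ coneMap₂.{u} =
    SSet.const (stdSimplex.obj₀Equiv.symm 3) :=
  hom_std_ext fun _ _ _ ↦ rfl

lemma vtx_δ {n : ℕ} (x : D _⦋n + 1⦌) (i : Fin (n + 2)) (j : Fin (n + 1)) :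
    vtx (D.δ i x) j = vtx x (i.succAbove j) :=
  (Functor.map_comp_apply D _ _ x).symm.trans (congrArg (fun k ↦ D.map k x) (Quiver.Hom.unop_inj
    (SimplexCategory.const_comp _ _ _)))

/-- If the upper edge of a square factors over an object and the right edge is constant, then the
square, seen as a morphism of arrows with the same target, factors over an arrow from this
object. -/
lemma exists_factorization_of_square [Quasicategory D] {F : D _⦋0⦌} (S : Δ[1] ⊗ Δ[1] ⟶ D)
    (hS : lift (SSet.const v1) (𝟙 _) ≫ S = SSet.const F) (r : D _⦋2⦌)
    (hr : D.δ 1 r = SSet.yonedaEquiv (lift (SSet.const v0) (𝟙 _) ≫ S)) :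
    ∃ a a' : (fiber (evalAt v1 D) F : SSet) _⦋2⦌, ((fiber (evalAt v1 D) F : SSet).δ 1 a).1 = sx S ∧
      (fiber (evalAt v1 D) F : SSet).δ 0 a = (fiber (evalAt v1 D) F : SSet).δ 1 a' ∧
      (evalAt v0 D).app _ (vtx a' 1).1 = vtx r 1 := by
  let T : D _⦋2⦌ := SSet.yonedaEquiv (upperTriangle ≫ S)
  have hT₂ : D.δ 2 T = D.δ 1 r := by
    rw [hr, ← stdSimplex.yonedaEquiv_δ_comp, ← Category.assoc, δ_two_upperTriangle]
  obtain ⟨f₀, h₂, h₀⟩ := exists_triangle (X := D) (s := D.δ 0 r) (t := D.δ 0 T) (by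
    refine (δδ (X := D) r (i := 0) (j := 0) le_rfl).symm.trans ?_
    rw [show (0 : Fin 2).succ = 1 from rfl, ← hT₂]
    exact δδ (X := D) T (i := 0) (j := 1) (by decide))
  -- The tetrahedron has the face `r` and the fourth vertex `F`, and its face on the long side of
  -- `r` is a triangle of the square. The triangle `a` below compares `S` with the cone on this
  -- side, and `a'` is the cone on `r`.
  obtain ⟨R, R₀, R₁, R₃⟩ := exists_tetrahedron₂ (X := D) (f₀ := f₀) (f₁ := T) (f₃ := r) hT₂ h₂ h₀
  have mem {n : ℕ} (H : Δ[1] ⊗ Δ[n] ⟶ D) (hH : lift (SSet.const v1) (𝟙 _) ≫ H = SSet.const F) :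
      sx H ∈ (fiber (evalAt v1 D) F).obj _ := by
    refine (mem_fiber_iff _).2 ((sx_evalAt _ _).trans ?_)
    rw [hH]
    rfl
  let a : (fiber (evalAt v1 D) F : SSet) _⦋2⦌ := ⟨sx (subdivide ≫ S), mem _ (by
    rw [← Category.assoc, lift_v1_subdivide, Category.assoc, hS]
    rfl)⟩
  let a' : (fiber (evalAt v1 D) F : SSet) _⦋2⦌ := ⟨sx (coneMap₂ ≫ SSet.yonedaEquiv.symm R), mem _ (by
    rw [← Category.assoc, lift_v1_coneMap₂, const_comp]
    refine congrArg SSet.const ((vtx_δ R 1 2).symm.trans (Eq.trans (congrArg (vtx · 2) R₁) ?_))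
    refine (congrArg (fun k : Δ[2] ⟶ D ↦ k.app _ (stdSimplex.obj₀Equiv.symm 2))
      (Equiv.symm_apply_apply SSet.yonedaEquiv (upperTriangle ≫ S))).trans ?_
    refine Eq.trans (congrArg (S.app _) (Prod.ext (stdSimplex.obj₀Equiv.injective rfl)
      (stdSimplex.obj₀Equiv.injective rfl)))
      ((congrArg (fun k : Δ[1] ⟶ D ↦ k.app _ v1) hS).trans (map_const_self _ _)))⟩
  refine ⟨a, a', ?_, Subtype.ext ?_, ?_⟩
  · refine (δ_sx _ _).trans ?_
    rw [← Category.assoc, δ_one_subdivide, Category.id_comp]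
  · refine (δ_sx _ _).trans (Eq.trans ?_ (δ_sx _ _).symm)
    rw [← Category.assoc, δ_zero_subdivide, ← Category.assoc, δ_one_coneMap₂, Category.assoc,
      Category.assoc, δ_yonedaEquiv_symm, R₁]
    exact congrArg (fun t ↦ sx (coneMap₁ ≫ t)) (Equiv.symm_apply_apply SSet.yonedaEquiv _).symm
  · refine (app_vtx (evalAt v0 D) a'.1 1).trans ?_
    rw [sx_evalAt, ← Category.assoc, lift_v0_coneMap₂, δ_yonedaEquiv_symm, R₃, Equiv.apply_symm_apply]

lemma exists_factorization_of_triangles (t t' : D _⦋2⦌) (h : D.δ 0 t = D.δ 1 t') {x y : D _⦋0⦌}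
    (h₀ : D.δ 1 (D.δ 1 t) = x) (h₁ : D.δ 0 (D.δ 1 t) = y) :
    ∃ (γ : Ho.mk x ⟶ Ho.mk (vtx t' 1)) (ε : Ho.mk (vtx t' 1) ⟶ Ho.mk y), arr (D.δ 1 t) h₀ h₁ = γ ≫ ε := by
  have e₁ : D.δ 0 (D.δ 2 t) = D.δ 1 (D.δ 2 t') :=
    (δδ t (i := 0) (j := 1) (by decide)).trans ((congrArg (D.δ 1) h).trans
      (δδ t' (i := 1) (j := 1) le_rfl).symm)
  have e₂ : D.δ 0 (D.δ 2 t') = vtx t' 1 := (vtx_one _).symm.trans (vtx_δ t' 2 1)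
  have e₃ : D.δ 1 (D.δ 0 t') = vtx t' 1 := (vtx_zero _).symm.trans (vtx_δ t' 0 0)
  have e₄ : D.δ 0 (D.δ 0 t) = y := (δδ t (i := 0) (j := 0) le_rfl).symm.trans h₁
  have e₅ : D.δ 0 (D.δ 0 t') = y := (δδ t' (i := 0) (j := 0) le_rfl).symm.trans
    ((congrArg (D.δ 0) h.symm).trans e₄)
  have e₆ : D.δ 1 (D.δ 2 t) = x := (δδ t (i := 1) (j := 1) le_rfl).trans h₀
  have e₇ : D.δ 1 (D.δ 0 t) = D.δ 1 (D.δ 2 t') := (congrArg (D.δ 1) h).trans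
    (δδ t' (i := 1) (j := 1) le_rfl).symm
  refine ⟨arr (D.δ 2 t) e₆ e₁ ≫ arr (D.δ 2 t') rfl e₂, arr (D.δ 0 t') e₃ e₅, ?_⟩
  refine (arr_comp t rfl rfl rfl (ha₀ := e₆) (ha₁ := e₁) (hb₀ := e₇) (hb₁ := e₄)).symm.trans ?_
  refine Eq.trans (congrArg (_ ≫ ·) ?_) (Category.assoc _ _ _).symm
  exact (arr_comp t' rfl rfl h.symm).symm

variable [Quasicategory D] {I : SSet.{u}} [Quasicategory I] {p : I ⟶ D} (c : Cocone p)

/-- A cocone, seen as a system of arrows to its tip. -/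
noncomputable def Cocone.toOver : I ⟶ (fiber (evalAt v1 D) c.pt : SSet) :=
  toFiber (famOf c.hom) ((famOf_evalAt_one _).trans c.ι₁_hom)

/-- This moves a factorization over `z` to the complex of arrows to the tip. The gain is that there
the intermediate arrow is initial when `z` is. -/
lemma Cocone.exists_factorization_toOver {z : D _⦋0⦌} {i m : I _⦋0⦌} (e : Ho.mk i ⟶ Ho.mk m)
    (f : Ho.mk (p.app _ i) ⟶ Ho.mk z) (g : Ho.mk z ⟶ Ho.mk (p.app _ m)) (h : push p rfl rfl e = f ≫ g) :
    ∃ (w : (fiber (evalAt v1 D) c.pt : SSet) _⦋0⦌) (_ : (evalAt v0 D).app _ w.1 = z)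
      (γ : Ho.mk (c.toOver.app _ i) ⟶ Ho.mk w) (ε : Ho.mk w ⟶ Ho.mk (c.toOver.app _ m)),
      push c.toOver rfl rfl e = γ ≫ ε := by
  obtain ⟨s, s₀, s₁, rfl⟩ := arr_surjective e
  obtain ⟨a, a₀, a₁, rfl⟩ := arr_surjective f
  obtain ⟨b, b₀, b₁, rfl⟩ := arr_surjective g
  rw [push_arr] at h
  obtain ⟨r, r₂, r₀, r₁⟩ := arr_comp_iff.1 h.symm
  obtain ⟨S, hS⟩ := sx_surjective ((famOf c.hom).app _ s)
  have hS₀ : SSet.yonedaEquiv (lift (SSet.const v0) (𝟙 _) ≫ S) = p.app _ s := by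
    rw [← sx_evalAt, hS]
    exact congrArg (fun k : I ⟶ D ↦ k.app _ s) ((famOf_evalAt_zero _).trans c.ι₀_hom)
  have hS₁ : lift (SSet.const v1) (𝟙 _) ≫ S = SSet.const c.pt := by
    refine SSet.yonedaEquiv.injective ?_
    rw [← sx_evalAt, hS]
    exact (mem_fiber_iff _).1 (c.toOver.app _ s).2
  obtain ⟨t, t', ht, htt, hv⟩ := exists_factorization_of_square S hS₁ r (r₁.trans hS₀.symm)
  have ht' : (fiber (evalAt v1 D) c.pt : SSet).δ 1 t = c.toOver.app _ s := Subtype.ext (ht.trans hS)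
  obtain ⟨γ, ε, key⟩ := exists_factorization_of_triangles t t' htt (x := c.toOver.app _ i)
    (y := c.toOver.app _ m) (by rw [ht', app_δ, s₀]) (by rw [ht', app_δ, s₁])
  refine ⟨vtx t' 1, hv.trans ?_, γ, ε, (push_arr _ _ _ _ _ _).trans ((arr_congr ht'.symm _ _).trans key)⟩
  rw [← a₁, ← r₂, ← vtx_one]
  exact (vtx_δ r 2 1).symm

end

end InfCat

namespace InfCat

/-! ### Vanishing of colimits of systems with null transition maps -/

section

variable {D I : SSet.{u}} [Quasicategory D] {p : I ⟶ D} {z : D _⦋0⦌}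

lemma IsNull.exists_factorization {C : Type*} [Category* C] {x y o : C} {f : x ⟶ y} (hf : IsNull f)
    (ho : Limits.IsZero o) : ∃ (a : x ⟶ o) (b : o ⟶ y), f = a ≫ b :=
  ⟨ho.from_ x, ho.to_ y, hf.eq ((isNull_of_src ho _).comp_left _)⟩

/-- If the transition maps of a countable filtered system are eventually null, then a cocone is
induced by a transformation to the constant system on a zero object. -/
theorem Cocone.exists_factorization_zero (hI : IsCountableFiltered I) (c : Cocone p)
    (hz : IsZeroVertex z)
    (h : ∀ i, ∃ (m : I _⦋0⦌) (e : Ho.mk i ⟶ Ho.mk m), IsNull ((hoMap p).map e)) :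
    ∃ (k : Ho.mk (vertex p) ⟶ Ho.mk (vertex (SSet.const z : I ⟶ D))) (v : Ho.mk z ⟶ Ho.mk c.pt),
      k ≫ diag I v = c.toHom := by
  have := hI.quasicategory
  have fac (i : I _⦋0⦌) : ∃ (m : I _⦋0⦌) (e : Ho.mk i ⟶ Ho.mk m)
      (w : (fiber (evalAt v1 D) c.pt : SSet) _⦋0⦌) (_ : (evalAt v0 D).app _ w.1 = z)
      (γ : Ho.mk (c.toOver.app _ i) ⟶ Ho.mk w) (ε : Ho.mk w ⟶ Ho.mk (c.toOver.app _ m)),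
      push c.toOver rfl rfl e = γ ≫ ε := by
    obtain ⟨m, e, he⟩ := h i
    obtain ⟨f, g, hfg⟩ := he.exists_factorization hz.isZero
    exact ⟨m, e, c.exists_factorization_toOver e f g ((hoMap_map p e).symm.trans hfg)⟩
  have ini (w : (fiber (evalAt v1 D) c.pt : SSet) _⦋0⦌) (hw : (evalAt v0 D).app _ w.1 = z) :
      IsInitialVertex w := isInitialVertex_fiber_evalAt w (hw ▸ hz.1)
  obtain ⟨-, -, b, hb, -⟩ := fac hI.nonempty.some
  -- The intermediate arrows `w` depend on `i`, but all have source `z` and are initial, so they are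
  -- replaced by the single arrow `b`, which has no nontrivial endomorphisms.
  obtain ⟨T, hT₀, hT₁⟩ := exists_transformation_to_const hI (b := b) (G := c.toOver)
    (fun f ↦ ((ini b hb).nonempty_unique b).some.instSubsingleton.elim _ _) fun i ↦ by
      obtain ⟨m, e, w, hw, γ, ε, he⟩ := fac i
      obtain ⟨α⟩ := (ini w hw).nonempty_unique b
      obtain ⟨β⟩ := (ini b hb).nonempty_unique w
      obtain ⟨δ⟩ := (ini w hw).nonempty_unique w
      refine ⟨m, e, γ ≫ α.default, β.default ≫ ε, he.trans ?_⟩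
      rw [Category.assoc, ← Category.assoc α.default,
        show α.default ≫ β.default = 𝟙 _ from (δ.uniq _).trans (δ.uniq _).symm, Category.id_comp]
  -- As a morphism of families of arrows with constant target, `T` says that the cocone factors over
  -- the constant system at the common source `z`.
  let W : I ⊗ Δ[1] ⟶ Fun Δ[1] D := T ≫ (fiber (evalAt v1 D) c.pt).ι
  have hU : ι₀ ≫ W = famOf c.hom := congrArg (· ≫ (fiber (evalAt v1 D) c.pt).ι) hT₀
  have hV : ι₁ ≫ W = SSet.const b.1 :=
    (congrArg (· ≫ (fiber (evalAt v1 D) c.pt).ι) hT₁).trans (const_comp _ _)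
  have hW : W ≫ evalAt v1 D = CartesianMonoidalCategory.fst I Δ[1] ≫ SSet.const c.pt :=
    (Category.assoc _ _ _).trans ((comp_fiber_ι T).trans (map_ext_app fun _ _ ↦ rfl))
  have hb₁ : (evalAt v1 D).app _ b.1 = c.pt := ((mem_fiber_iff _).1 b.2).trans (map_const_self _ _)
  have hc₀ : arrF (famOf c.hom) = c.hom := arrF_famOf c.hom
  have c₀ : ι₀ ≫ W ≫ evalAt v0 D = p :=
    (congrArg (· ≫ evalAt v0 D) hU).trans ((famOf_evalAt_zero c.hom).trans c.ι₀_hom)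
  have c₁ : ι₁ ≫ W ≫ evalAt v0 D = SSet.const z :=
    (congrArg (· ≫ evalAt v0 D) hV).trans ((const_comp _ _).trans (congrArg SSet.const hb))
  have b₀ : ι₀ ≫ arrF (SSet.const b.1 : I ⟶ Fun Δ[1] D) = SSet.const z :=
    (ι₀_arrF _).trans ((const_comp _ _).trans (congrArg SSet.const hb))
  have b₁ : ι₁ ≫ arrF (SSet.const b.1 : I ⟶ Fun Δ[1] D) = SSet.const c.pt :=
    (ι₁_arrF _).trans ((const_comp _ _).trans (congrArg SSet.const hb₁))
  have d₀ : ι₀ ≫ W ≫ evalAt v1 D = SSet.const c.pt := (congrArg (ι₀ ≫ ·) hW).trans rfl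
  have d₁ : ι₁ ≫ W ≫ evalAt v1 D = SSet.const c.pt := (congrArg (ι₁ ≫ ·) hW).trans rfl
  have key := fam_natural W hU hV (p := p) (q := SSet.const c.pt) (r := SSet.const z)
    (t := SSet.const c.pt) ((congrArg (ι₀ ≫ ·) hc₀).trans c.ι₀_hom)
    ((congrArg (ι₁ ≫ ·) hc₀).trans c.ι₁_hom) b₀ b₁ c₀ c₁ d₀ d₁
  refine ⟨cls (W ≫ evalAt v0 D) c₀ c₁, edgeHom b.1 hb hb₁, ?_⟩
  refine (congrArg (_ ≫ ·) (cls_arrF_const b.1 hb hb₁ b₀ b₁).symm).trans (key.symm.trans ?_)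
  refine (congr (congrArg (· ≫ ·) (cls_congr hc₀ _ _))
    ((cls_congr hW _ _).trans (cls_fst _ _ _))).trans (Category.comp_id _)

/-- By universality the transformation to the constant zero system comes from a map of tips, and
again by universality the identity of the tip factors over the zero object. -/
theorem Cocone.IsHoColimit.isZero_pt (hI : IsCountableFiltered I) {c : Cocone p} (hc : c.IsHoColimit)
    (hz : IsZeroVertex z)
    (h : ∀ i, ∃ (m : I _⦋0⦌) (e : Ho.mk i ⟶ Ho.mk m), IsNull ((hoMap p).map e)) :
    Limits.IsZero (Ho.mk c.pt) := by
  obtain ⟨k, v, hk⟩ := c.exists_factorization_zero hI hz h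
  obtain ⟨f, rfl⟩ := (hc z).2 k
  have hfv : f ≫ v = 𝟙 _ := by
    refine (hc c.pt).1 ?_
    change c.toHom ≫ diag I (f ≫ v) = c.toHom ≫ diag I (𝟙 _)
    rw [diag_comp, diag_id, Category.comp_id, ← Category.assoc]
    exact hk
  exact hz.isZero.of_iso ⟨f, v, hfv, hz.isZero.eq_of_src _ _⟩

end

theorem IsCompactlyAssembled.isZero_of_isNull {D : SSet.{u}} [Quasicategory D]
    (h : IsCompactlyAssembled D) {z : D _⦋0⦌} (hz : IsZeroVertex z) {b : D _⦋0⦌}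
    (hb : ∀ (a a' : D _⦋0⦌) (u : Ho.mk a' ⟶ Ho.mk a) (w : Ho.mk a ⟶ Ho.mk b),
      IsWeaklyCompact u → IsWeaklyCompact w → IsNull (u ≫ w)) : Limits.IsZero (Ho.mk b) := by
  obtain ⟨-, C, y, R, hy, hRy, hR⟩ := h
  have := hy.quasicategory
  obtain ⟨η⟩ := hRy.nonempty_universalUnit
  obtain ⟨I, hI, p, c, hc, ⟨i⟩, hp⟩ := exists_null_system hy hR η hz.isZero hb
  exact (hc.isZero_pt hI hz hp).of_iso i

end InfCat

theorem mainTheorem10 (D : SSet.{u}) [Quasicategory D] (hst : InfCat.IsStable D)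
    (hca : InfCat.IsCompactlyAssembled D) :
    ∀ ⦃B C : D _⦋0⦌⦄ (f : D.Edge B C),
      IsIso ((InfCat.toHausdorffCat D).map (InfCat.Ho.homMk f)) → InfCat.IsEquivalence f := by
  intro B C f hf
  obtain ⟨z, hz⟩ := hst.exists_zero
  exact hst.isIso_of_isIso_hausdorff (fun q hq ↦ hca.isZero_of_isNull hz hq) (InfCat.Ho.homMk f) hf
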